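/- **Setting.** Let $a>0$, $\operatorname{Re}\nu>0$, $\nu\ne1,2,\dots$, $\nu_0=\nu^2-\tfrac14$, $\mu_1=\tfrac12-\nu$, $\mu_2=\tfrac12+\nu$, $c_{10}c_{20}=(2\nu)^{-1}$, $c_{jk}=(-1)^kc_{j0}\big(\prod_{s=1}^k((2s+\mu_j)(2s+\mu_j-1)-\nu_0)\big)^{-1}$, and $$C_j(x,\lambda)=(x-a)^{\mu_j}\sum_{k\ge0}c_{jk}\lambda^k(x-a)^{2k}$$ (principal power, $\arg\in(-\pi,\pi]$). Let $W$ be the class of complex functions $q$ on $(0,\infty)$ such that, for some $T>a$, $q(x)|x-a|^{\min(0,1-2\operatorname{Re}\nu)}\in L(0,T)$ and $q\in L(T,\infty)$. For $q\in W$ let $s_j(x,\lambda)$, $j=1,2$, $0\le x\ne a$, solve $$s_j(x,\lambda)=C_j(x,\lambda)+\int_a^x\big(C_1(t,\lambda)C_2(x,\lambda)-C_1(x,\lambda)C_2(t,\lambda)\big)q(t)s_j(t,\lambda)\,dt .$$ Let $A=[a_{jk}]$ be a complex $2\times2$ matrix with $\det A\ne0$, $a_{12}=0$, such that the matrix $$[\xi_{jk}]=\frac1{2\sin\pi\nu}\begin{bmatrix}-a_{11}e^{2\pi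 i\nu}+a_{22}e^{-2\pi i\nu}&-i(a_{11}e^{\pi i\nu}-a_{22}e^{-\pi i\nu})\\-i(a_{11}e^{\pi i\nu}-a_{22}e^{-\pi i\nu})&a_{11}-a_{22}\end{bmatrix}$$ satisfies $|\xi_{jj}|>|\xi_{12}|>0$, $j=1,2$. Put $\sigma_j=s_j$ for $x<a$ and $\sigma_j=\sum_ka_{kj}s_k$ for $x>a$; primes denote $d/dx$, and $\langle y,z\rangle=yz'-y'z$. Let $\varphi(x,\lambda)=\sigma_1(0,\lambda)\sigma_2(x,\lambda)-\sigma_2(0,\lambda)\sigma_1(x,\lambda)$. For $\lambda=\rho^2$, $\operatorname{Im}\rho\ge0$, $\rho\ne0$, let $e(x,\rho)$ be the combination of $\sigma_1(x,\lambda),\sigma_2(x,\lambda)$ with $e(x,\rho)e^{-i\rho x}\to1$ as $x\to\infty$, and let $\Delta(\rho)=e(0,\rho)$, $\Phi(x,\lambda)=e(x,\rho)/\Delta(\rho)$, $M(\lambda)=\Phi'(0,\lambda)$ (for $\lambda>0$ these are functions on the two-sided cut, i.e. of $\rho$). Let $\eta(x)=1$ for $x<a$ and $\eta(x)=\det A$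 for $x>a$. Let $q,\tilde q\in W$; a tilde marks the objects built from $\tilde q$ with the same $a,\nu,c_{j0},A$, and $\widehat M=M-\tilde M$. Let $h>0$ be such that $\operatorname{Im}\rho<h$ for every zero $\rho$ ($\operatorname{Im}\rho\ge0$, $\rho\ne0$) of $\Delta$ or $\tilde\Delta$, and let $\widehat M(\lambda)=O(1)$ as $|\lambda|\to\infty$, $\lambda=\rho^2$, $\operatorname{Im}\rho\ge h$. Let $\gamma$ be the parabola that is the image of $\operatorname{Im}\rho=h$ under $\lambda=\rho^2$, oriented counterclockwise around its interior (which contains the positive half-axis), and let $J_\gamma$ be the set of $\lambda$ outside $\gamma$ and its interior. Put $$D(x,\lambda,\mu)=\frac1{\eta(x)}\frac{\langle\varphi(x,\lambda),\varphi(x,\mu)\rangle}{\lambda-\mu},\quad r(x,\lambda,\mu)=D(x,\lambda,\mu)\widehat M(\mu),\quad \tilde r(x,\lambda,\mu)=\tilde D(x,\lambda,\mu)\widehat M(\mu),$$ where $D,\tilde D$ are extended to $\lambda=\mu$ by their limits. **Theorem 5.** For every $x\ge0$, $x\ne a$, the following integrals exist as principal values $\lim_{R\to\infty}\int_{\gamma\cap\{|\mu|\le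 R\}}$, and 1. for all $\lambda\in\mathbb C$, $$\tilde\varphi(x,\lambda)=\varphi(x,\lambda)-\frac1{2\pi i}\int_\gamma\tilde r(x,\lambda,\mu)\varphi(x,\mu)\,d\mu;$$ 2. for all $\lambda\in\mathbb C$ and all $\mu=\theta^2$, $\operatorname{Im}\theta\ge0$, $\theta\ne0$, $\Delta(\theta)\tilde\Delta(\theta)\ne0$ (in particular all $\mu\in\gamma$), $$r(x,\lambda,\mu)-\tilde r(x,\lambda,\mu)-\frac1{2\pi i}\int_\gamma\tilde r(x,\lambda,\xi)r(x,\xi,\mu)\,d\xi=0;$$ 3. for all $\lambda\in J_\gamma$, $$\tilde\Phi(x,\lambda)=\Phi(x,\lambda)-\frac1{2\pi i}\frac1{\eta(x)}\int_\gamma\frac{\langle\tilde\Phi(x,\lambda),\tilde\varphi(x,\mu)\rangle}{\lambda-\mu}\widehat M(\mu)\varphi(x,\mu)\,d\mu.$$ -/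

import Mathlib

open Filter Topology MeasureTheory Asymptotics

noncomputable section

namespace BesselSL

/-- The fixed parameters of the boundary value problems: the position `a` of the singular point,
the number `ν` (the coefficient of the singularity is `ν² - 1/4`), the two leading coefficients
`c 0 = c₁₀`, `c 1 = c₂₀` of the model solutions, and the transition matrix `A`.
The indices `0, 1 : Fin 2` stand for the indices `1, 2` of the usual notation. -/
structure Params where
  a : ℝ
  ν : ℂ
  c : Fin 2 → ℂ
  A : Matrix (Fin 2) (Fin 2) ℂ

/-- Derivative in `x` on the half-line `x ≥ 0` (one-sided at `x = 0`). -/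
def dx (y : ℝ → ℂ) (x : ℝ) : ℂ := derivWithin y (Set.Ici 0) x

/-- `⟨y, z⟩ = y z' - y' z`. -/
def wronskian (y z : ℝ → ℂ) (x : ℝ) : ℂ := y x * dx z x - dx y x * z x

/-- `ν₀ = ν² - 1/4`. -/
def nuZero (P : Params) : ℂ := P.ν ^ 2 - 1 / 4

/-- The exponents `μ₁ = -ν + 1/2`, `μ₂ = ν + 1/2`. -/
def expo (P : Params) : Fin 2 → ℂ := ![-P.ν + 1 / 2, P.ν + 1 / 2]

/-- `c_{jk} = (-1)^k c_{j0} (∏_{s=1}^k ((2s+μ_j)(2s+μ_j-1) - ν₀))⁻¹`. -/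
def coeff (P : Params) (j : Fin 2) (k : ℕ) : ℂ :=
  (-1) ^ k * P.c j *
    (∏ s ∈ Finset.Icc 1 k,
      ((2 * (s : ℂ) + expo P j) * (2 * (s : ℂ) + expo P j - 1) - nuZero P))⁻¹

/-- `C_j(x, λ) = (x-a)^{μ_j} ∑_k c_{jk} (ρ (x-a))^{2k}`, `λ = ρ²`, with the principal power. -/
def modelSol (P : Params) (j : Fin 2) (x : ℝ) (lam : ℂ) : ℂ :=
  (((x - P.a : ℝ) : ℂ) ^ expo P j) *
    ∑' k : ℕ, coeff P j k * (lam * ((x - P.a : ℝ) : ℂ) ^ 2) ^ k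

/-- `g(x, t, λ) = C₁(t, λ) C₂(x, λ) - C₁(x, λ) C₂(t, λ)`. -/
def greenKernel (P : Params) (x t : ℝ) (lam : ℂ) : ℂ :=
  modelSol P 0 t lam * modelSol P 1 x lam - modelSol P 0 x lam * modelSol P 1 t lam

/-- The class `W` of potentials on `(0, ∞)`: `q |x-a|^{min(0, 1-2 Re ν)} ∈ L(0, T)` and
`q ∈ L(T, ∞)` for some `T > a`. -/
def ClassW (P : Params) (q : ℝ → ℂ) : Prop :=
  ∃ T : ℝ, P.a < T ∧
    IntegrableOn (fun x : ℝ => q x * ((|x - P.a| ^ min 0 (1 - 2 * P.ν.re) : ℝ) : ℂ))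
      (Set.Ioo 0 T) ∧
    IntegrableOn q (Set.Ioi T)

/-- `s` solves, on `[0, a) ∪ (a, ∞)`, the integral equation
`s(x) = C_j(x, λ) + ∫_a^x g(x, t, λ) q(t) s(t) dt`, the integral being convergent (the two
functions whose combinations make up the integrand are integrable between `a` and `x`). -/
def SolvesIntegralEq (P : Params) (q : ℝ → ℂ) (j : Fin 2) (lam : ℂ) (s : ℝ → ℂ) : Prop :=
  ∀ x : ℝ, 0 ≤ x → x ≠ P.a →
    (∀ k : Fin 2,
      IntervalIntegrable (fun t => modelSol P k t lam * (q t * s t)) volume P.a x) ∧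
    s x = modelSol P j x lam + ∫ t in P.a..x, greenKernel P x t lam * q t * s t

/-- The function `s_j(·, λ)`: the solution of the integral equation
(its values on `[0, a) ∪ (a, ∞)` are determined by the equation; no other value is used). -/
def sSol (P : Params) (q : ℝ → ℂ) (j : Fin 2) (lam : ℂ) : ℝ → ℂ :=
  Classical.epsilon (SolvesIntegralEq P q j lam)

/-- `σ_j = s_j` for `x < a` and `σ_j = ∑_k a_{kj} s_k` for `x > a`. -/
def sigma (P : Params) (q : ℝ → ℂ) (j : Fin 2) (lam : ℂ) (x : ℝ) : ℂ :=
  if x < P.a then sSol P q j lam x else ∑ k : Fin 2, P.A k j * sSol P q k lam x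

/-- `φ(x, λ) = σ₁(0, λ) σ₂(x, λ) - σ₂(0, λ) σ₁(x, λ)`: the solution satisfying the matching
conditions at `a` and `φ(0, λ) = 0`, `φ'(0, λ) = 1`. -/
def phi (P : Params) (q : ℝ → ℂ) (lam : ℂ) (x : ℝ) : ℂ :=
  sigma P q 0 lam 0 * sigma P q 1 lam x - sigma P q 1 lam 0 * sigma P q 0 lam x

/-- `B 0 σ₁(x, ρ²) + B 1 σ₂(x, ρ²)`, multiplied by `exp(-iρx)`, tends to `1` as `x → ∞`. -/
def IsJostCoeff (P : Params) (q : ℝ → ℂ) (ρ : ℂ) (B : Fin 2 → ℂ) : Prop :=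
  Tendsto
    (fun x : ℝ => (∑ k : Fin 2, B k * sigma P q k (ρ ^ 2) x) * Complex.exp (-Complex.I * ρ * x))
    atTop (𝓝 1)

/-- The coefficients `A₁(ρ), A₂(ρ)` of the Jost solution
(determined by the condition at infinity when `Im ρ ≥ 0`, `ρ ≠ 0`). -/
def jostCoeff (P : Params) (q : ℝ → ℂ) (ρ : ℂ) : Fin 2 → ℂ :=
  Classical.epsilon (IsJostCoeff P q ρ)

/-- The discontinuous Jost solution `e(x, ρ) = ∑_k A_k(ρ) σ_k(x, ρ²)`. -/
def jost (P : Params) (q : ℝ → ℂ) (ρ : ℂ) (x : ℝ) : ℂ :=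
  ∑ k : Fin 2, jostCoeff P q ρ k * sigma P q k (ρ ^ 2) x

/-- The characteristic function `Δ(ρ) = e(0, ρ)`. -/
def charFun (P : Params) (q : ℝ → ℂ) (ρ : ℂ) : ℂ := jost P q ρ 0

/-- The Weyl solution `Φ(x, λ) = e(x, ρ) / Δ(ρ)`, `λ = ρ²`, `Im ρ ≥ 0`, as a function of `ρ`. -/
def weylSol (P : Params) (q : ℝ → ℂ) (ρ : ℂ) (x : ℝ) : ℂ := jost P q ρ x / charFun P q ρ

/-- The Weyl function `M(λ) = Φ'(0, λ)`, `λ = ρ²`, `Im ρ ≥ 0`, as a function of `ρ`. -/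
def weylFun (P : Params) (q : ℝ → ℂ) (ρ : ℂ) : ℂ := dx (weylSol P q ρ) 0

/-- `M - M̃` as a function of `ρ`, where `λ = ρ²`, `Im ρ ≥ 0`. -/
def weylDiff (P : Params) (q qt : ℝ → ℂ) (ρ : ℂ) : ℂ := weylFun P q ρ - weylFun P qt ρ

/-- `η(x) = 1` for `x < a` and `η(x) = det A` for `x > a`. -/
def eta (P : Params) (x : ℝ) : ℂ := if x < P.a then 1 else P.A.det

/-- `D(x, λ, μ) = η(x)⁻¹ ⟨φ(x, λ), φ(x, μ)⟩ / (λ - μ)`, extended to `λ = μ` by its limit. -/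
def kernelD (P : Params) (q : ℝ → ℂ) (x : ℝ) (lam mu : ℂ) : ℂ :=
  (eta P x)⁻¹ *
    if lam = mu then deriv (fun l : ℂ => wronskian (phi P q l) (phi P q mu) x) mu
    else wronskian (phi P q lam) (phi P q mu) x / (lam - mu)

/-- `r(x, λ, μ) = D(x, λ, μ) (M(μ) - M̃(μ))` with `μ = θ²`, `Im θ ≥ 0`. -/
def kernelR (P : Params) (q qt : ℝ → ℂ) (x : ℝ) (lam θ : ℂ) : ℂ :=
  kernelD P q x lam (θ ^ 2) * weylDiff P q qt θ

/-- `r̃(x, λ, μ) = D̃(x, λ, μ) (M(μ) - M̃(μ))` with `μ = θ²`, `Im θ ≥ 0`. -/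
def kernelRt (P : Params) (q qt : ℝ → ℂ) (x : ℝ) (lam θ : ℂ) : ℂ :=
  kernelD P qt x lam (θ ^ 2) * weylDiff P q qt θ

/-- The matrix `[ξ_{jk}]`. -/
def xi (P : Params) : Matrix (Fin 2) (Fin 2) ℂ :=
  let w : ℂ := Real.pi * Complex.I * P.ν
  let o : ℂ := -Complex.I * (P.A 0 0 * Complex.exp w - P.A 1 1 * Complex.exp (-w))
  (1 / (2 * Complex.sin (Real.pi * P.ν))) •
    !![-P.A 0 0 * Complex.exp (2 * w) + P.A 1 1 * Complex.exp (-(2 * w)), o;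
       o, P.A 0 0 - P.A 1 1]

/-- `I` is the principal value of `∫_γ F dμ`, where `γ` is the image of the line `Im θ = h` under
`μ = θ²`, oriented counterclockwise around the interior of the parabola, that is, from
`Re θ = +∞` to `Re θ = -∞`. The integrand is given as a function of `θ`; the point
`μ = (s + ih)²` has `|μ| = s² + h²`, so cutting `γ` by `|μ| ≤ R` means `|s| ≤ S` with
`S² = R - h²`. The integrals over the cut contours are required to exist. -/
def HasPVIntegral (h : ℝ) (F : ℂ → ℂ) (I : ℂ) : Prop :=
  let G : ℝ → ℂ := fun s => F (s + h * Complex.I) * (2 * (s + h * Complex.I))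
  (∀ S : ℝ, IntervalIntegrable G volume S (-S)) ∧
    Tendsto (fun S : ℝ => ∫ s in S..(-S), G s) atTop (𝓝 I)

end BesselSL

end

open BesselSL

/-! Fix `x` and let `φ`, `S` be the solutions with data `(0, 1)` and `(1, 0)` at the origin, so that
`Φ = S + Mφ` and `φ'Φ - Φ'φ = η(x)`. For numbers `y₀, y₁` put `w(μ) = y₀ φ̃'(μ) - y₁ φ̃(μ)`. The
product `w (M - M̃) φ` stands under the integrals of the first and third assertions. It equals `X -
e`, where `X = y₀(φ̃'Φ - Φ̃'φ) - y₁(φ̃Φ - Φ̃φ)` is holomorphic wherever the two Weyl functions are,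
and `e` is entire in `μ`.

In the variable `μ = θ²` the contour is a horizontal line. On a high line `Im θ = H` the Cauchy
kernel `2θ/(λ - θ²)` is integrated against both parts. The part `X` tends to `η y₀` as `θ → ∞` above
the line, so closing the contour upwards gives `2πi η y₀`. The part `e` gives `2πi e(λ)`: after its
value at `λ` is split off, what remains is an even entire function of `θ` times `2θ`, and such an
odd integrand has zero integral over symmetric real segments. Geometrically, the parabola collapses
onto the two sides of the cut. The line is then lowered from `H` to `h`, where `M - M̃` is
holomorphic and bounded and `φ(x, θ²) = O(1/|θ|)`. Taking `(y₀, y₁)` to be the data of `φ̃` at `λ`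
gives the first equation (`PhiData.Paired.tendsto_phi`). The data of `Φ̃` give the third
(`PhiData.Paired.tendsto_weyl`), and the same splitting with a Wronskian form on each side gives the
second (`PhiData.Paired.tendsto_kernel`).

The analytic work is the behaviour of `X`, collected in `Setting.exists_mixed_bounds`. Since `φ̃'Φ -
Φ̃'φ = η + (φ̃' - φ')Φ + (Φ' - Φ̃')φ`, it must be shown that `φ` and `Φ` have the exact exponential
types `x` and `-x` in `Im θ`, and that replacing one potential by the other gains a negative power
of `|θ|`.

The model solutions and their Green kernel are controlled near the singular point by power series,
and further out by an energy estimate. Perturbed solutions come from Volterra equations that are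
contractions for suitable weights, uniformly in the spectral parameter. Near the origin `φ` is
obtained from its initial values, because the formula through `σ₁, σ₂` loses the exponential type.
The Jost solution is built from infinity, and dilation invariance of the model equation forces its
model coefficients to be exact multiples of `θ^{μ_j}` (`exists_mcoef_eq`).

Since `A` is triangular, its off-diagonal entry disturbs the continuation across the singular point
only by the relative order `|θ|^{-2 Re ν}`, which accounts for `gap`. The leading term of `Δ` is
governed by a nonzero multiple of `ξ₁₂`. Hence `1/Δ` is bounded at infinity in a sufficiently high
half-plane (`Setting.exists_charFun_bound`), and the estimates for the Jost solution pass to `Φ`. -/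

noncomputable section

namespace BesselSL

/-! ### Integrals over horizontal lines -/

/-- The integral of `f` over the segment `[-S + iH, S + iH]`. -/
def lineInt (f : ℂ → ℂ) (H S : ℝ) : ℂ := ∫ s in (-S)..S, f (s + H * Complex.I)

/-- Neighbourhoods of infinity in a subset of the plane. -/
def inftyIn (A : Set ℂ) : Filter ℂ := Bornology.cobounded ℂ ⊓ 𝓟 A

theorem eventually_inftyIn {A : Set ℂ} {p : ℂ → Prop} :
    (∀ᶠ z in inftyIn A, p z) ↔ ∃ R : ℝ, ∀ z ∈ A, R ≤ ‖z‖ → p z := by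
  unfold inftyIn
  rw [eventually_inf_principal, (Filter.hasBasis_cobounded_norm).eventually_iff]
  constructor
  · rintro ⟨R, -, h⟩
    exact ⟨R, fun z hz hR => h hR hz⟩
  · rintro ⟨R, h⟩
    exact ⟨R, trivial, fun z hR hz => h z hz hR⟩

theorem inftyIn_mono {A B : Set ℂ} (h : A ⊆ B) : inftyIn A ≤ inftyIn B :=
  inf_le_inf_left _ (principal_mono.2 h)

theorem tendsto_zero_inftyIn_iff {A : Set ℂ} {f : ℂ → ℂ} :
    Tendsto f (inftyIn A) (𝓝 0) ↔ ∀ ε > 0, ∃ R : ℝ, ∀ z ∈ A, R ≤ ‖z‖ → ‖f z‖ ≤ ε := by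
  rw [NormedAddGroup.tendsto_nhds_zero]
  constructor
  · intro h ε hε
    obtain ⟨R, hR⟩ := eventually_inftyIn.1 (h ε hε)
    exact ⟨R, fun z hz hzR => (hR z hz hzR).le⟩
  · intro h ε hε
    obtain ⟨R, hR⟩ := h (ε / 2) (by positivity)
    exact eventually_inftyIn.2 ⟨R, fun z hz hzR => (hR z hz hzR).trans_lt (by linarith)⟩

theorem norm_mem_inftyIn (A : Set ℂ) (R : ℝ) : ∀ᶠ z in inftyIn A, R ≤ ‖z‖ :=
  eventually_inftyIn.2 ⟨R, fun _ _ h => h⟩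

theorem mem_inftyIn (A : Set ℂ) : ∀ᶠ z in inftyIn A, z ∈ A :=
  eventually_inftyIn.2 ⟨0, fun _ h _ => h⟩

/-- Cauchy's theorem on the rectangle between the two lines: the horizontal sides differ by the
contribution of the vertical ones. -/
theorem lineInt_sub_lineInt {f : ℂ → ℂ} {h₁ h₂ S : ℝ} (h12 : h₁ ≤ h₂)
    (hf : ∀ z : ℂ, h₁ ≤ z.im → z.im ≤ h₂ → DifferentiableAt ℂ f z) :
    lineInt f h₁ S - lineInt f h₂ S =
      Complex.I * (∫ y in h₁..h₂, f ((-S : ℝ) + y * Complex.I)) -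
        Complex.I * ∫ y in h₁..h₂, f (S + y * Complex.I) := by
  have := Complex.integral_boundary_rect_eq_zero_of_differentiableOn f
    ((-S : ℝ) + h₁ * Complex.I) (S + h₂ * Complex.I) (by
      intro z hz
      rw [Complex.mem_reProdIm] at hz
      have h2 := hz.2
      simp only [Complex.add_im, Complex.ofReal_im, Complex.mul_im, Complex.ofReal_re,
        Complex.I_im, Complex.I_re, mul_one, mul_zero, add_zero, zero_add,
        Set.uIcc_of_le h12] at h2
      exact (hf z h2.1 h2.2).differentiableWithinAt)
  simp only [Complex.add_im, Complex.ofReal_im, Complex.mul_im, Complex.ofReal_re,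
    Complex.I_im, Complex.I_re, mul_one, mul_zero, add_zero, zero_add, Complex.add_re,
    Complex.mul_re, sub_zero, smul_eq_mul] at this
  unfold lineInt
  linear_combination this

theorem norm_sub_re_im_le (S y : ℝ) : |S| ≤ ‖(S : ℂ) + y * Complex.I‖ := by
  have := Complex.abs_re_le_norm ((S : ℂ) + y * Complex.I)
  simpa using this

theorem norm_im_le (S y : ℝ) : |y| ≤ ‖(S : ℂ) + y * Complex.I‖ := by
  have := Complex.abs_im_le_norm ((S : ℂ) + y * Complex.I)
  simpa using this

/-- The vertical sides have fixed length, so decay in the strip without any rate is enough to move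
the line. -/
theorem tendsto_lineInt_sub {f : ℂ → ℂ} {h₁ h₂ : ℝ} (h12 : h₁ ≤ h₂)
    (hf : ∀ z : ℂ, h₁ ≤ z.im → z.im ≤ h₂ → DifferentiableAt ℂ f z)
    (hlim : Tendsto f (inftyIn {z | h₁ ≤ z.im ∧ z.im ≤ h₂}) (𝓝 0)) :
    Tendsto (fun S => lineInt f h₁ S - lineInt f h₂ S) atTop (𝓝 0) := by
  rw [NormedAddGroup.tendsto_nhds_zero]
  intro ε hε
  -- The summand 1 keeps the denominator positive when the two lines coincide.
  obtain ⟨R, hR⟩ := tendsto_zero_inftyIn_iff.1 hlim (ε / (4 * (h₂ - h₁ + 1)))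
    (by have : 0 ≤ h₂ - h₁ := sub_nonneg.2 h12
        positivity)
  filter_upwards [eventually_ge_atTop R, eventually_ge_atTop 0] with S hS hS0
  rw [lineInt_sub_lineInt h12 hf]
  have key : ∀ T : ℝ, |T| = S → ‖∫ y in h₁..h₂, f (T + y * Complex.I)‖ ≤
      ε / (4 * (h₂ - h₁ + 1)) * |h₂ - h₁| := by
    intro T hT
    refine intervalIntegral.norm_integral_le_of_norm_le_const fun y hy => ?_
    rw [Set.uIoc_of_le h12] at hy
    refine hR _ ⟨?_, ?_⟩ ?_
    · simpa using hy.1.le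
    · simpa using hy.2
    · exact hS.trans (hT ▸ norm_sub_re_im_le T y)
  have k1 := key S (abs_of_nonneg hS0)
  have k2 := key (-S) (by rw [abs_neg, abs_of_nonneg hS0])
  have h0 : 0 ≤ h₂ - h₁ := sub_nonneg.2 h12
  rw [abs_of_nonneg h0] at k1 k2
  have h3 : ε / (4 * (h₂ - h₁ + 1)) * (h₂ - h₁) ≤ ε / 4 := by
    rw [div_mul_eq_mul_div, div_le_div_iff₀ (by positivity) (by positivity)]
    nlinarith
  refine (norm_sub_le _ _).trans_lt ?_
  rw [norm_mul, norm_mul, Complex.norm_I, one_mul, one_mul]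
  linarith

theorem lineInt_odd_zero {f : ℂ → ℂ} (hodd : ∀ z, f (-z) = -f z) (S : ℝ) :
    lineInt f 0 S = 0 := by
  have h1 : lineInt f 0 S = - lineInt f 0 S := by
    unfold lineInt
    rw [← intervalIntegral.integral_neg]
    have := intervalIntegral.integral_comp_neg (a := -S) (b := S)
      (fun s : ℝ => f (s + (0 : ℝ) * Complex.I))
    rw [neg_neg] at this
    rw [← this]
    refine intervalIntegral.integral_congr fun s _ => ?_
    simp [hodd]
  exact self_eq_neg.1 h1

/-- On the real line the symmetric integral of an odd function is zero, and decay in the strip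
carries this up to height `H`. It is applied to `g(θ²) · 2θ` with `g` entire, the form that every
entire function of `μ` takes after the substitution `μ = θ²`. -/
theorem tendsto_lineInt_odd {f : ℂ → ℂ} {H : ℝ} (hH : 0 ≤ H) (hf : Differentiable ℂ f)
    (hodd : ∀ z, f (-z) = -f z)
    (hlim : Tendsto f (inftyIn {z | 0 ≤ z.im ∧ z.im ≤ H}) (𝓝 0)) :
    Tendsto (fun S => lineInt f H S) atTop (𝓝 0) := by
  have := (tendsto_lineInt_sub hH (fun z _ _ => hf z) hlim).neg
  simpa [lineInt_odd_zero hodd] using this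

theorem lineInt_integrable {f : ℂ → ℂ} {H : ℝ} (S : ℝ)
    (hf : ∀ z : ℂ, z.im = H → DifferentiableAt ℂ f z) :
    IntervalIntegrable (fun s : ℝ => f (s + H * Complex.I)) volume (-S) S := by
  refine Continuous.intervalIntegrable ?_ _ _
  rw [continuous_iff_continuousAt]
  intro s
  have h1 : ContinuousAt f (s + H * Complex.I) := (hf _ (by simp)).continuousAt
  exact ContinuousAt.comp (f := fun s : ℝ => (s : ℂ) + H * Complex.I) h1 (by fun_prop)

/-- An antiderivative in `s` is `½ log(s² + H²) - i arctan(s/H)`. The logarithm is even and cancels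
between `-S` and `S`, so the limit depends on the cut being symmetric. -/
theorem tendsto_lineInt_inv {H : ℝ} (hH : 0 < H) :
    Tendsto (fun S => lineInt (fun z => z⁻¹) H S) atTop (𝓝 (-(Real.pi * Complex.I))) := by
  have h1 : ∀ S, lineInt (fun z => z⁻¹) H S = -(2 * Complex.I * (Real.arctan (S / H) : ℝ)) := by
    intro S
    have hpos : ∀ s : ℝ, 0 < s ^ 2 + H ^ 2 := fun s => by positivity
    have hder : ∀ s : ℝ, HasDerivAt
        (fun s : ℝ => (((1 / 2 * Real.log (s ^ 2 + H ^ 2) : ℝ) : ℂ) -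
          Complex.I * ((Real.arctan (s / H) : ℝ) : ℂ))) ((s + H * Complex.I : ℂ)⁻¹) s := by
      intro s
      have e1 : HasDerivAt (fun s : ℝ => 1 / 2 * Real.log (s ^ 2 + H ^ 2))
          (s / (s ^ 2 + H ^ 2)) s := by
        have := (((hasDerivAt_pow 2 s).add_const (H ^ 2)).log (hpos s).ne').const_mul (1 / 2)
        refine this.congr_deriv ?_
        norm_num
        ring
      have e2 : HasDerivAt (fun s : ℝ => Real.arctan (s / H)) (H / (s ^ 2 + H ^ 2)) s := by
        have := ((hasDerivAt_id s).div_const H).arctan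
        refine this.congr_deriv ?_
        field_simp
        simp only [id]
        ring
      have := e1.ofReal_comp.sub (e2.ofReal_comp.const_mul Complex.I)
      refine this.congr_deriv ?_
      have hne : (s + H * Complex.I : ℂ) ≠ 0 := by
        intro h0
        have := congrArg Complex.im h0
        simp at this
        exact hH.ne' this
      have hne2 : ((s : ℂ) ^ 2 + (H : ℂ) ^ 2) ≠ 0 := by exact_mod_cast (hpos s).ne'
      push_cast
      rw [inv_eq_one_div, eq_div_iff hne, ← mul_div_assoc, ← sub_div, div_mul_eq_mul_div,
        div_eq_iff hne2]
      linear_combination (-(H : ℂ) ^ 2) * Complex.I_sq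
    unfold lineInt
    rw [intervalIntegral.integral_eq_sub_of_hasDerivAt (fun s _ => hder s)]
    · rw [neg_div, Real.arctan_neg]
      push_cast
      rw [neg_sq]
      ring
    · have := lineInt_integrable (f := fun z => z⁻¹) (H := H) S (fun z hz => by
        refine differentiableAt_inv ?_
        rintro rfl
        simp at hz
        exact hH.ne hz)
      exact this
  simp_rw [h1]
  have h2 : Tendsto (fun S : ℝ => Real.arctan (S / H)) atTop (𝓝 (Real.pi / 2)) :=
    (Real.tendsto_arctan_atTop.mono_right nhdsWithin_le_nhds).comp
      (tendsto_id.atTop_div_const hH)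
  have h3 := ((Complex.continuous_ofReal.tendsto _).comp h2).const_mul (2 * Complex.I)
  have e : -(Real.pi * Complex.I) = -(2 * Complex.I * ((Real.pi / 2 : ℝ) : ℂ)) := by
    push_cast
    ring
  rw [e]
  exact h3.neg

/-- The segment is closed upwards by a rectangle of height `S`. Its other three sides have total
length `4S`, and `f = o(1/S)` on them. -/
theorem tendsto_lineInt_halfPlane_zero {f : ℂ → ℂ} {H : ℝ} (hH : 0 < H)
    (hf : ∀ z : ℂ, H ≤ z.im → DifferentiableAt ℂ f z)
    (hlim : Tendsto (fun z => z * f z) (inftyIn {z | H ≤ z.im}) (𝓝 0)) :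
    Tendsto (fun S => lineInt f H S) atTop (𝓝 0) := by
  rw [NormedAddGroup.tendsto_nhds_zero]
  intro ε hε
  -- The two vertical sides cost `ε/5` each and the top costs `2ε/5`, which leaves strict room below
  -- `ε`.
  obtain ⟨R, hR⟩ := tendsto_zero_inftyIn_iff.1 hlim (ε / 5) (by positivity)
  filter_upwards [eventually_ge_atTop R, eventually_gt_atTop 0] with S hS hS0
  have bd : ∀ z : ℂ, H ≤ z.im → S ≤ ‖z‖ → ‖f z‖ ≤ ε / 5 / S := by
    intro z hz hSz
    have := hR z hz (hS.trans hSz)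
    rw [norm_mul] at this
    rw [le_div_iff₀ hS0]
    nlinarith [norm_nonneg (f z)]
  have key : ∀ T : ℝ, |T| = S → ‖∫ y in H..(H + S), f (T + y * Complex.I)‖ ≤ ε / 5 := by
    intro T hT
    have : ‖∫ y in H..(H + S), f (T + y * Complex.I)‖ ≤ ε / 5 / S * |H + S - H| := by
      refine intervalIntegral.norm_integral_le_of_norm_le_const fun y hy => ?_
      rw [Set.uIoc_of_le (by linarith)] at hy
      exact bd _ (by simpa using hy.1.le) (hT ▸ norm_sub_re_im_le T y)
    rwa [add_sub_cancel_left, abs_of_pos hS0, div_mul_cancel₀ _ hS0.ne'] at this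
  have top : ‖lineInt f (H + S) S‖ ≤ 2 * (ε / 5) := by
    have : ‖lineInt f (H + S) S‖ ≤ ε / 5 / S * |S - -S| := by
      refine intervalIntegral.norm_integral_le_of_norm_le_const fun y _ => ?_
      refine bd _ (by simp [hS0.le]) ?_
      refine le_trans ?_ (norm_im_le y (H + S))
      rw [abs_of_pos (by linarith)]
      linarith
    rw [sub_neg_eq_add, abs_of_pos (by linarith)] at this
    calc _ ≤ _ := this
      _ = _ := by field_simp; ring
  have hrect := lineInt_sub_lineInt (f := f) (h₁ := H) (h₂ := H + S) (S := S) (by linarith)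
    (fun z hz _ => hf z hz)
  have k1 := key S (abs_of_pos hS0)
  have k2 := key (-S) (by rw [abs_neg, abs_of_pos hS0])
  have h4 : ‖lineInt f H S - lineInt f (H + S) S‖ ≤ ε / 5 + ε / 5 := by
    rw [hrect]
    refine (norm_sub_le _ _).trans ?_
    rw [norm_mul, norm_mul, Complex.norm_I, one_mul, one_mul]
    linarith
  have h5 := norm_add_le (lineInt f H S - lineInt f (H + S) S) (lineInt f (H + S) S)
  rw [sub_add_cancel] at h5
  linarith

theorem lineInt_add {f g : ℂ → ℂ} {H : ℝ} (S : ℝ)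
    (hf : ∀ z : ℂ, z.im = H → DifferentiableAt ℂ f z)
    (hg : ∀ z : ℂ, z.im = H → DifferentiableAt ℂ g z) :
    lineInt (fun z => f z + g z) H S = lineInt f H S + lineInt g H S :=
  intervalIntegral.integral_add (lineInt_integrable S hf) (lineInt_integrable S hg)

theorem lineInt_const_mul (c : ℂ) (f : ℂ → ℂ) (H S : ℝ) :
    lineInt (fun z => c * f z) H S = c * lineInt f H S :=
  intervalIntegral.integral_const_mul _ _

theorem lineInt_congr {f g : ℂ → ℂ} {H : ℝ} (S : ℝ) (h : ∀ z : ℂ, z.im = H → f z = g z) :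
    lineInt f H S = lineInt g H S :=
  intervalIntegral.integral_congr fun s _ => h _ (by simp)

theorem ne_zero_of_im_ge {H : ℝ} (hH : 0 < H) {z : ℂ} (hz : H ≤ z.im) : z ≠ 0 := by
  rintro rfl
  simp at hz
  linarith

/-- Subtracting `L/z` reduces to the case of limit zero; the subtracted term is integrated
explicitly. -/
theorem tendsto_lineInt_halfPlane {f : ℂ → ℂ} {H : ℝ} {L : ℂ} (hH : 0 < H)
    (hf : ∀ z : ℂ, H ≤ z.im → DifferentiableAt ℂ f z)
    (hlim : Tendsto (fun z => z * f z) (inftyIn {z | H ≤ z.im}) (𝓝 L)) :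
    Tendsto (fun S => lineInt f H S) atTop (𝓝 (-(Real.pi * Complex.I) * L)) := by
  have hinv : ∀ z : ℂ, H ≤ z.im → DifferentiableAt ℂ (fun z => L * z⁻¹) z := fun z hz =>
    (differentiableAt_inv (ne_zero_of_im_ge hH hz)).const_mul L
  have h0 : Tendsto (fun S => lineInt (fun z => f z - L * z⁻¹) H S) atTop (𝓝 0) := by
    refine tendsto_lineInt_halfPlane_zero hH (fun z hz => (hf z hz).sub (hinv z hz)) ?_
    have := hlim.sub_const L
    rw [sub_self] at this
    refine this.congr' ?_
    filter_upwards [mem_inftyIn {z : ℂ | H ≤ z.im}] with z hz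
    have := ne_zero_of_im_ge hH hz
    field_simp
  have h1 := h0.add ((tendsto_lineInt_inv hH).const_mul L)
  rw [zero_add, mul_comm] at h1
  refine h1.congr fun S => ?_
  have hadd := lineInt_add (f := fun z => f z - L * z⁻¹) (H := H) S
    (fun z hz => (hf z hz.ge).sub (hinv z hz.ge)) (fun z hz => hinv z hz.ge)
  rw [← lineInt_const_mul, ← hadd]
  exact lineInt_congr S fun z _ => by ring

/-- Both square roots of `l` have modulus less than `H`, so they lie below the line. This is how the
point `l` is kept inside the parabola of height `H`. -/
theorem sq_ne_of_im {H : ℝ} {l : ℂ} (hl : ‖l‖ < H ^ 2) (hH : 0 < H) {z : ℂ} (hz : H ≤ z.im) :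
    l - z ^ 2 ≠ 0 := by
  intro h0
  have h1 : l = z ^ 2 := sub_eq_zero.1 h0
  have h2 : z.im ≤ ‖z‖ := (le_abs_self _).trans (Complex.abs_im_le_norm z)
  rw [h1, norm_pow] at hl
  nlinarith

/-- `θ ↦ 2θ / (l - θ²)`: the Cauchy kernel in the variable `μ = θ²`. -/
def cker (l z : ℂ) : ℂ := 2 * z / (l - z ^ 2)

theorem tendsto_mul_cker (l : ℂ) (A : Set ℂ) :
    Tendsto (fun z => z * cker l z) (inftyIn A) (𝓝 (-2)) := by
  have h1 : Tendsto (fun z : ℂ => z⁻¹) (inftyIn A) (𝓝 0) :=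
    tendsto_inv₀_cobounded.mono_left inf_le_left
  have h2 : Tendsto (fun z : ℂ => 2 / (l * (z⁻¹) ^ 2 - 1)) (inftyIn A) (𝓝 (2 / (l * 0 ^ 2 - 1))) :=
    tendsto_const_nhds.div (((h1.pow 2).const_mul l).sub_const 1) (by norm_num)
  have h3 : (2 / (l * 0 ^ 2 - 1) : ℂ) = -2 := by norm_num
  rw [h3] at h2
  refine h2.congr' ?_
  filter_upwards [norm_mem_inftyIn A 1] with z hz
  have hz0 : z ≠ 0 := by
    rintro rfl
    simp at hz
    linarith
  unfold cker
  have : l - z ^ 2 = z ^ 2 * (l * (z⁻¹) ^ 2 - 1) := by field_simp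
  rw [this, ← mul_div_assoc]
  have e : z * (2 * z) = z ^ 2 * 2 := by ring
  rw [e, mul_div_mul_left _ _ (pow_ne_zero 2 hz0)]

theorem differentiableAt_cker {l z : ℂ} (h : l - z ^ 2 ≠ 0) : DifferentiableAt ℂ (cker l) z := by
  unfold cker
  exact DifferentiableAt.div (by fun_prop) (by fun_prop) h

theorem tendsto_lineInt_cker {H : ℝ} {l : ℂ} (hl : ‖l‖ < H ^ 2) (hH : 0 < H) :
    Tendsto (fun S => lineInt (cker l) H S) atTop (𝓝 (2 * Real.pi * Complex.I)) := by
  have := tendsto_lineInt_halfPlane hH (fun z hz => differentiableAt_cker (sq_ne_of_im hl hH hz))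
    (tendsto_mul_cker l _)
  convert this using 2
  ring

/-- The integral of the Cauchy kernel vanishes when the point is outside the parabola. -/
theorem tendsto_lineInt_cker_outside {h : ℝ} {r : ℂ} (hh : 0 ≤ h) (hr : h < r.im) :
    Tendsto (fun S => lineInt (cker (r ^ 2)) h S) atTop (𝓝 0) := by
  -- The poles are `r`, above the line of height `h`, and `-r`, below the real axis. The strip
  -- between is free of them, and the kernel is odd.
  have hne : ∀ z : ℂ, 0 ≤ z.im → z.im ≤ h → r ^ 2 - z ^ 2 ≠ 0 := by
    intro z hz0 hz h0
    have : (r - z) * (r + z) = 0 := by linear_combination h0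
    rcases mul_eq_zero.1 this with h1 | h1
    · have := congrArg Complex.im h1
      simp at this
      linarith
    · have := congrArg Complex.im h1
      simp at this
      linarith
  have hlim : Tendsto (cker (r ^ 2)) (inftyIn {z | 0 ≤ z.im ∧ z.im ≤ h}) (𝓝 0) := by
    have h1 : Tendsto (fun z : ℂ => z⁻¹) (inftyIn {z | 0 ≤ z.im ∧ z.im ≤ h}) (𝓝 0) :=
      tendsto_inv₀_cobounded.mono_left inf_le_left
    have h2 := h1.mul (tendsto_mul_cker (r ^ 2) {z | 0 ≤ z.im ∧ z.im ≤ h})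
    rw [zero_mul] at h2
    refine h2.congr' ?_
    filter_upwards [norm_mem_inftyIn _ 1] with z hz
    have hz0 : z ≠ 0 := by
      rintro rfl
      simp at hz
      linarith
    field_simp
  have := (tendsto_lineInt_sub hh (fun z h1 h2 => differentiableAt_cker (hne z h1 h2)) hlim).neg
  refine (by simpa using this : Tendsto _ _ _).congr fun S => ?_
  rw [lineInt_odd_zero (fun z => by unfold cker; ring), sub_zero]

section

/-! ### Integrals depending on a parameter -/

/-- For holomorphic integrands a majorant of the function suffices: Cauchy's estimate on small discs
turns it into a majorant of the derivative. -/
theorem differentiableOn_integral_of_dominated {U : Set ℂ} (hU : IsOpen U) {F : ℂ → ℝ → ℂ}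
    {b : ℝ → ℝ} {μ : Measure ℝ}
    (hm : ∀ l ∈ U, AEStronglyMeasurable (F l) μ)
    (hd : ∀ t, DifferentiableOn ℂ (fun l => F l t) U)
    (hb : ∀ l ∈ U, ∀ t, ‖F l t‖ ≤ b t) (hbi : Integrable b μ) :
    DifferentiableOn ℂ (fun l => ∫ t, F l t ∂μ) U := by
  intro l₀ hl₀
  obtain ⟨r, hr, hrU⟩ := Metric.isOpen_iff.1 hU l₀ hl₀
  have hr2 : 0 < r / 2 := by positivity
  have hr4 : 0 < r / 4 := by positivity
  have hsub : ∀ l ∈ Metric.ball l₀ (r / 2), Metric.closedBall l (r / 4) ⊆ U := by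
    intro l hl z hz
    refine hrU ?_
    rw [Metric.mem_ball] at hl ⊢
    rw [Metric.mem_closedBall] at hz
    have := dist_triangle z l l₀
    linarith
  have hbU : Metric.ball l₀ (r / 2) ⊆ U := fun l hl =>
    hsub l hl (Metric.mem_closedBall_self hr4.le)
  have hder : ∀ t, ∀ l ∈ Metric.ball l₀ (r / 2),
      HasDerivAt (fun l => F l t) (deriv (fun l => F l t) l) l := fun t l hl =>
    ((hd t).differentiableAt (hU.mem_nhds (hbU hl))).hasDerivAt
  have hmem : l₀ ∈ Metric.ball l₀ (r / 2) := Metric.mem_ball_self hr2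
  -- The derivative is the pointwise limit of difference quotients along one fixed sequence `u n →
  -- 0`, and each of these is measurable in `t`.
  have hF' : AEStronglyMeasurable (fun t => deriv (fun l => F l t) l₀) μ := by
    set u : ℕ → ℂ := fun n => ((r / 4 : ℝ) : ℂ) * ((1 / ((n : ℝ) + 1) : ℝ) : ℂ) with hu
    have hu1 : ∀ n : ℕ, 0 < 1 / ((n : ℝ) + 1) ∧ 1 / ((n : ℝ) + 1) ≤ 1 := fun n =>
      ⟨by positivity, by rw [div_le_one (by positivity)]; linarith [n.cast_nonneg (α := ℝ)]⟩
    have hu0 : ∀ n, u n ≠ 0 := fun n => by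
      simp only [hu, ne_eq, mul_eq_zero, not_or, Complex.ofReal_eq_zero]
      exact ⟨hr4.ne', (hu1 n).1.ne'⟩
    have hun : ∀ n, ‖u n‖ ≤ r / 4 := fun n => by
      rw [hu, norm_mul, Complex.norm_real, Complex.norm_real, Real.norm_of_nonneg hr4.le,
        Real.norm_of_nonneg (hu1 n).1.le]
      nlinarith [(hu1 n).2]
    have hulim : Tendsto u atTop (𝓝[≠] 0) := by
      rw [tendsto_nhdsWithin_iff]
      refine ⟨?_, Eventually.of_forall hu0⟩
      have h1 : Tendsto (fun n : ℕ => ((1 / ((n : ℝ) + 1) : ℝ) : ℂ)) atTop (𝓝 ((0 : ℝ) : ℂ)) :=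
        (Complex.continuous_ofReal.tendsto _).comp tendsto_one_div_add_atTop_nhds_zero_nat
      have h2 := h1.const_mul ((r / 4 : ℝ) : ℂ)
      rwa [Complex.ofReal_zero, mul_zero] at h2
    refine aestronglyMeasurable_of_tendsto_ae atTop
      (f := fun n t => (u n)⁻¹ • (F (l₀ + u n) t - F l₀ t)) (fun n => ?_) ?_
    · have hmn : l₀ + u n ∈ Metric.ball l₀ (r / 2) := ?_
      · exact AEStronglyMeasurable.const_smul ((hm _ (hbU hmn)).sub (hm _ hl₀)) (u n)⁻¹
      rw [Metric.mem_ball, dist_eq_norm, add_sub_cancel_left]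
      have := hun n
      linarith
    · refine Eventually.of_forall fun t => ?_
      have := (hasDerivAt_iff_tendsto_slope_zero.1 (hder t l₀ hmem)).comp hulim
      exact this
  have hbound : ∀ᵐ t ∂μ, ∀ l ∈ Metric.ball l₀ (r / 2),
      ‖deriv (fun l => F l t) l‖ ≤ b t / (r / 4) := by
    refine Eventually.of_forall fun t l hl => ?_
    refine Complex.norm_deriv_le_of_forall_mem_sphere_norm_le hr4 ?_ fun z hz =>
      hb z (hsub l hl (Metric.sphere_subset_closedBall hz)) t
    refine DifferentiableOn.diffContOnCl ((hd t).mono ?_)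
    exact (Metric.closure_ball_subset_closedBall).trans (hsub l hl)
  have hFint : Integrable (F l₀) μ :=
    hbi.mono' (hm _ hl₀) (Eventually.of_forall fun t => hb _ hl₀ t)
  have := (hasDerivAt_integral_of_dominated_loc_of_deriv_le (Metric.ball_mem_nhds l₀ hr2)
    (by filter_upwards [hU.mem_nhds hl₀] with l hl using hm l hl) hFint hF' hbound
    (hbi.div_const _) (Eventually.of_forall hder)).2
  exact this.differentiableAt.differentiableWithinAt

/-! ### Linear Volterra equations -/

/-- Successive approximations for `y(x) = f(x) + ∫ k(x, t) y(t) dt`. -/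
def volterraIter (k : ℝ → ℝ → ℂ) (f : ℝ → ℂ) : ℕ → ℝ → ℂ
  | 0 => f
  | n + 1 => fun x => ∫ t, k x t * volterraIter k f n t

/-- The Neumann series of `y(x) = f(x) + ∫ k(x, t) y(t) dt`. -/
def volterraSol (k : ℝ → ℝ → ℂ) (f : ℝ → ℂ) (x : ℝ) : ℂ := ∑' n, volterraIter k f n x

/-- On the set `I`, the nonnegative kernel `κ` is a contraction for the weight `p`. -/
structure Contracts (κ : ℝ → ℝ → ℝ) (I : Set ℝ) (p : ℝ → ℝ) : Prop where
  p_nonneg : ∀ x ∈ I, 0 ≤ p x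
  support : ∀ x ∈ I, ∀ t, t ∉ I → κ x t = 0
  integrable : ∀ x ∈ I, Integrable (fun t => κ x t * p t)
  le_half : ∀ x ∈ I, ∫ t, κ x t * p t ≤ p x / 2

variable {k : ℝ → ℝ → ℂ} {f : ℝ → ℂ} {κ : ℝ → ℝ → ℝ} {I : Set ℝ} {p : ℝ → ℝ} {F : ℝ}

theorem Contracts.kernel_zero (h : Contracts κ I p) (hk : ∀ x ∈ I, ∀ t, ‖k x t‖ ≤ κ x t)
    {x t : ℝ} (hx : x ∈ I) (ht : t ∉ I) : k x t = 0 := by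
  have := hk x hx t
  rw [h.support x hx t ht] at this
  exact norm_le_zero_iff.1 this

theorem Contracts.norm_mul_le (h : Contracts κ I p) (hk : ∀ x ∈ I, ∀ t, ‖k x t‖ ≤ κ x t)
    {y : ℝ → ℂ} {C : ℝ} (hy : ∀ t ∈ I, ‖y t‖ ≤ C * p t) {x : ℝ} (hx : x ∈ I) (t : ℝ) :
    ‖k x t * y t‖ ≤ C * (κ x t * p t) := by
  by_cases ht : t ∈ I
  · rw [norm_mul]
    calc ‖k x t‖ * ‖y t‖ ≤ κ x t * (C * p t) :=
          mul_le_mul (hk x hx t) (hy t ht) (norm_nonneg _) ((norm_nonneg _).trans (hk x hx t))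
      _ = _ := by ring
  · rw [h.kernel_zero hk hx ht, h.support x hx t ht]
    simp

theorem Contracts.norm_integral_le (h : Contracts κ I p) (hk : ∀ x ∈ I, ∀ t, ‖k x t‖ ≤ κ x t)
    {y : ℝ → ℂ} {C : ℝ} (hC : 0 ≤ C) (hy : ∀ t ∈ I, ‖y t‖ ≤ C * p t) {x : ℝ} (hx : x ∈ I) :
    ‖∫ t, k x t * y t‖ ≤ C * (p x / 2) := by
  refine (norm_integral_le_of_norm_le ((h.integrable x hx).const_mul C)
    (Eventually.of_forall (h.norm_mul_le hk hy hx))).trans ?_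
  rw [integral_const_mul]
  exact mul_le_mul_of_nonneg_left (h.le_half x hx) hC

/-- A solution of a Volterra equation which is bounded by some multiple of the weight is bounded
by twice the bound of the inhomogeneity. -/
theorem Contracts.norm_le (h : Contracts κ I p) (hk : ∀ x ∈ I, ∀ t, ‖k x t‖ ≤ κ x t)
    {y : ℝ → ℂ} {C : ℝ} (hF : 0 ≤ F) (hf : ∀ x ∈ I, ‖f x‖ ≤ F * p x)
    (hy : ∀ x ∈ I, ‖y x‖ ≤ C * p x) (heq : ∀ x ∈ I, y x = f x + ∫ t, k x t * y t) :
    ∀ x ∈ I, ‖y x‖ ≤ 2 * F * p x := by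
  -- Inserting a bound `C` into the equation improves it to `F + C/2`, and `2F` is the fixed point
  -- of this map. The a priori constant `C` therefore disappears in the limit.
  have step : ∀ n : ℕ, ∀ x ∈ I, ‖y x‖ ≤ (2 * F + max C 0 * (1 / 2) ^ n) * p x := by
    intro n
    induction n with
    | zero =>
      intro x hx
      refine (hy x hx).trans (mul_le_mul_of_nonneg_right ?_ (h.p_nonneg x hx))
      have := le_max_left C 0
      simp
      linarith
    | succ n ih =>
      intro x hx
      have h1 := h.norm_integral_le hk (by positivity) ih hx
      rw [heq x hx]
      calc _ ≤ ‖f x‖ + ‖∫ t, k x t * y t‖ := norm_add_le _ _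
        _ ≤ F * p x + (2 * F + max C 0 * (1 / 2) ^ n) * (p x / 2) := add_le_add (hf x hx) h1
        _ = _ := by ring
  intro x hx
  have hlim : Tendsto (fun n : ℕ => (2 * F + max C 0 * (1 / 2) ^ n) * p x) atTop
      (𝓝 ((2 * F + max C 0 * 0) * p x)) :=
    (((tendsto_pow_atTop_nhds_zero_of_lt_one (by norm_num) (by norm_num)).const_mul
      (max C 0)).const_add (2 * F)).mul_const (p x)
  rw [mul_zero, add_zero] at hlim
  exact ge_of_tendsto' hlim fun n => step n x hx

theorem stronglyMeasurable_volterraIter (hk : Measurable (Function.uncurry k))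
    (hf : Measurable f) (n : ℕ) : StronglyMeasurable (volterraIter k f n) := by
  induction n with
  | zero => exact hf.stronglyMeasurable
  | succ n ih =>
    refine StronglyMeasurable.integral_prod_right (f := fun x t => k x t * volterraIter k f n t) ?_
    exact hk.stronglyMeasurable.mul (ih.comp_measurable measurable_snd)

theorem Contracts.norm_iter_le (h : Contracts κ I p) (hk : ∀ x ∈ I, ∀ t, ‖k x t‖ ≤ κ x t)
    (hF : 0 ≤ F) (hf : ∀ x ∈ I, ‖f x‖ ≤ F * p x) (n : ℕ) :
    ∀ x ∈ I, ‖volterraIter k f n x‖ ≤ F * (1 / 2) ^ n * p x := by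
  induction n with
  | zero => simpa [volterraIter] using hf
  | succ n ih =>
    intro x hx
    refine (h.norm_integral_le hk (by positivity) ih hx).trans (le_of_eq ?_)
    ring

theorem Contracts.summable_iter (h : Contracts κ I p) (hk : ∀ x ∈ I, ∀ t, ‖k x t‖ ≤ κ x t)
    (hF : 0 ≤ F) (hf : ∀ x ∈ I, ‖f x‖ ≤ F * p x) {x : ℝ} (hx : x ∈ I) :
    Summable (fun n => volterraIter k f n x) := by
  refine Summable.of_norm_bounded (g := fun n : ℕ => F * p x * (1 / 2) ^ n)
    ((summable_geometric_of_lt_one (by norm_num) (by norm_num)).mul_left _) fun n => ?_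
  refine (h.norm_iter_le hk hF hf n x hx).trans (le_of_eq ?_)
  ring

theorem Contracts.norm_sol_le (h : Contracts κ I p) (hk : ∀ x ∈ I, ∀ t, ‖k x t‖ ≤ κ x t)
    (hF : 0 ≤ F) (hf : ∀ x ∈ I, ‖f x‖ ≤ F * p x) {x : ℝ} (hx : x ∈ I) :
    ‖volterraSol k f x‖ ≤ 2 * F * p x := by
  have h1 : HasSum (fun n : ℕ => F * p x * (1 / 2) ^ n) (F * p x * (1 - 1 / 2)⁻¹) :=
    (hasSum_geometric_of_lt_one (by norm_num) (by norm_num)).mul_left _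
  have := tsum_of_norm_bounded h1 (f := fun n => volterraIter k f n x) fun n => by
    refine (h.norm_iter_le hk hF hf n x hx).trans (le_of_eq ?_)
    ring
  refine this.trans (le_of_eq ?_)
  norm_num
  ring

/-- Convergence of the Neumann series is known only on `I`. A factor vanishing off `I` makes the
product a pointwise limit of measurable functions everywhere. -/
theorem Contracts.measurable_mul_sol (h : Contracts κ I p) (hk : ∀ x ∈ I, ∀ t, ‖k x t‖ ≤ κ x t)
    (hkm : Measurable (Function.uncurry k)) (hfm : Measurable f)
    (hF : 0 ≤ F) (hf : ∀ x ∈ I, ‖f x‖ ≤ F * p x) {g : ℝ → ℂ} (hg : Measurable g)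
    (hg0 : ∀ t, t ∉ I → g t = 0) : Measurable (fun t => g t * volterraSol k f t) := by
  refine measurable_of_tendsto_metrizable
    (f := fun (N : ℕ) t => g t * ∑ n ∈ Finset.range N, volterraIter k f n t) (fun N => ?_) ?_
  · exact hg.mul (Finset.measurable_sum _ fun n _ =>
      (stronglyMeasurable_volterraIter hkm hfm n).measurable)
  · rw [tendsto_pi_nhds]
    intro t
    by_cases ht : t ∈ I
    · exact ((h.summable_iter hk hF hf ht).hasSum.tendsto_sum_nat).const_mul _
    · simp [hg0 t ht]

/-- The recursion for the iterates is summed term by term; the geometric bounds make the sum of the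
integrals of the norms finite. -/
theorem Contracts.sol_eq (h : Contracts κ I p) (hk : ∀ x ∈ I, ∀ t, ‖k x t‖ ≤ κ x t)
    (hkm : Measurable (Function.uncurry k)) (hfm : Measurable f)
    (hF : 0 ≤ F) (hf : ∀ x ∈ I, ‖f x‖ ≤ F * p x) {x : ℝ} (hx : x ∈ I) :
    volterraSol k f x = f x + ∫ t, k x t * volterraSol k f t := by
  have hint : ∀ n, Integrable (fun t => k x t * volterraIter k f n t) := fun n =>
    ((h.integrable x hx).const_mul (F * (1 / 2) ^ n)).mono'
      ((hkm.comp (measurable_const.prodMk measurable_id)).mul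
        (stronglyMeasurable_volterraIter hkm hfm n).measurable).aestronglyMeasurable
      (Eventually.of_forall fun t => h.norm_mul_le hk (h.norm_iter_le hk hF hf n) hx t)
  have hsum : Summable (fun n => ∫ t, ‖k x t * volterraIter k f n t‖) := by
    refine Summable.of_nonneg_of_le (fun n => integral_nonneg fun t => norm_nonneg _) (fun n => ?_)
      ((summable_geometric_of_lt_one (r := 1 / 2) (by norm_num) (by norm_num)).mul_left
        (F * (p x / 2)))
    calc ∫ t, ‖k x t * volterraIter k f n t‖
        ≤ ∫ t, F * (1 / 2) ^ n * (κ x t * p t) :=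
          integral_mono (hint n).norm ((h.integrable x hx).const_mul _)
            (h.norm_mul_le hk (h.norm_iter_le hk hF hf n) hx)
      _ = F * (1 / 2) ^ n * ∫ t, κ x t * p t := integral_const_mul _ _
      _ ≤ F * (1 / 2) ^ n * (p x / 2) :=
          mul_le_mul_of_nonneg_left (h.le_half x hx) (by positivity)
      _ = _ := by ring
  have h1 := hasSum_integral_of_summable_integral_norm hint hsum
  have h2 : (fun t => ∑' n, k x t * volterraIter k f n t) =
      fun t => k x t * volterraSol k f t := by
    funext t
    exact tsum_mul_left
  rw [h2] at h1
  have h3 := (h.summable_iter hk hF hf hx).tsum_eq_zero_add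
  rw [volterraSol, h3, ← h1.tsum_eq]
  rfl

/-- One majorant `κ` serves for all parameters in `U`. Hence each iterate is holomorphic by
differentiation under the integral, and the series converges uniformly by the geometric bound. -/
theorem Contracts.differentiableOn_sol {U : Set ℂ} (hU : IsOpen U) {k : ℂ → ℝ → ℝ → ℂ}
    {f : ℂ → ℝ → ℂ} (h : Contracts κ I p) (hk : ∀ l ∈ U, ∀ x ∈ I, ∀ t, ‖k l x t‖ ≤ κ x t)
    (hkm : ∀ l ∈ U, Measurable (Function.uncurry (k l))) (hfm : ∀ l ∈ U, Measurable (f l))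
    (hF : 0 ≤ F) (hf : ∀ l ∈ U, ∀ x ∈ I, ‖f l x‖ ≤ F * p x)
    (hkd : ∀ x ∈ I, ∀ t, DifferentiableOn ℂ (fun l => k l x t) U)
    (hfd : ∀ x ∈ I, DifferentiableOn ℂ (fun l => f l x) U) {x : ℝ} (hx : x ∈ I) :
    DifferentiableOn ℂ (fun l => volterraSol (k l) (f l) x) U := by
  have iter : ∀ n, ∀ x ∈ I, DifferentiableOn ℂ (fun l => volterraIter (k l) (f l) n x) U := by
    intro n
    induction n with
    | zero => exact hfd
    | succ n ih =>
      intro x hx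
      refine differentiableOn_integral_of_dominated hU
        (F := fun l t => k l x t * volterraIter (k l) (f l) n t) (fun l hl => ?_) (fun t => ?_)
        (fun l hl t => h.norm_mul_le (hk l hl) (h.norm_iter_le (hk l hl) hF (hf l hl) n) hx t)
        ((h.integrable x hx).const_mul _)
      · exact (((hkm l hl).comp (measurable_const.prodMk measurable_id)).mul
          (stronglyMeasurable_volterraIter (hkm l hl) (hfm l hl) n).measurable).aestronglyMeasurable
      · by_cases ht : t ∈ I
        · exact (hkd x hx t).mul (ih t ht)
        · refine (differentiableOn_const (0 : ℂ)).congr fun l hl => ?_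
          rw [h.kernel_zero (hk l hl) hx ht, zero_mul]
  refine Complex.differentiableOn_tsum_of_summable_norm
    (u := fun n : ℕ => F * p x * (1 / 2) ^ n)
    ((summable_geometric_of_lt_one (by norm_num) (by norm_num)).mul_left _)
    (fun n => iter n x hx) hU fun n l hl => ?_
  refine (h.norm_iter_le (hk l hl) hF (hf l hl) n x hx).trans (le_of_eq ?_)
  ring

/-- No openness of `U` is required, so this reaches the boundary `Im ρ = 0`. That is needed for the
model Jost solution, where the points `ρ = ±1` are compared. -/
theorem Contracts.continuousOn_sol {U : Set ℂ} {k : ℂ → ℝ → ℝ → ℂ}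
    {f : ℂ → ℝ → ℂ} (h : Contracts κ I p) (hk : ∀ l ∈ U, ∀ x ∈ I, ∀ t, ‖k l x t‖ ≤ κ x t)
    (hkm : ∀ l ∈ U, Measurable (Function.uncurry (k l))) (hfm : ∀ l ∈ U, Measurable (f l))
    (hF : 0 ≤ F) (hf : ∀ l ∈ U, ∀ x ∈ I, ‖f l x‖ ≤ F * p x)
    (hkd : ∀ x ∈ I, ∀ t, ContinuousOn (fun l => k l x t) U)
    (hfd : ∀ x ∈ I, ContinuousOn (fun l => f l x) U) {x : ℝ} (hx : x ∈ I) :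
    ContinuousOn (fun l => volterraSol (k l) (f l) x) U := by
  have iter : ∀ n, ∀ x ∈ I, ContinuousOn (fun l => volterraIter (k l) (f l) n x) U := by
    intro n
    induction n with
    | zero => exact hfd
    | succ n ih =>
      intro x hx
      refine continuousOn_of_dominated
        (F := fun l t => k l x t * volterraIter (k l) (f l) n t)
        (bound := fun t => F * (1 / 2) ^ n * (κ x t * p t)) (fun l hl => ?_)
        (fun l hl => Eventually.of_forall fun t =>
          h.norm_mul_le (hk l hl) (h.norm_iter_le (hk l hl) hF (hf l hl) n) hx t)
        ((h.integrable x hx).const_mul _) (Eventually.of_forall fun t => ?_)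
      · exact (((hkm l hl).comp (measurable_const.prodMk measurable_id)).mul
          (stronglyMeasurable_volterraIter (hkm l hl) (hfm l hl) n).measurable).aestronglyMeasurable
      · by_cases ht : t ∈ I
        · exact (hkd x hx t).mul (ih t ht)
        · refine (continuousOn_const (c := (0 : ℂ))).congr fun l hl => ?_
          rw [h.kernel_zero (hk l hl) hx ht, zero_mul]
  refine continuousOn_tsum (u := fun n : ℕ => F * p x * (1 / 2) ^ n)
    (fun n => iter n x hx)
    ((summable_geometric_of_lt_one (by norm_num) (by norm_num)).mul_left _) fun n l hl => ?_
  refine (h.norm_iter_le (hk l hl) hF (hf l hl) n x hx).trans (le_of_eq ?_)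
  ring

end

/-! ### Entire power series -/

/-- `∑ b_k w^k` converges for all `w`. -/
def EntireCoeff (b : ℕ → ℂ) : Prop := ∀ w : ℂ, Summable (fun k => b k * w ^ k)

/-- Coefficients of the derivative of a power series. -/
def derivCoeff (b : ℕ → ℂ) (k : ℕ) : ℂ := (k + 1) * b (k + 1)

theorem EntireCoeff.differentiable_and_hasSum {b : ℕ → ℂ} (hb : EntireCoeff b) :
    Differentiable ℂ (fun w => ∑' k, b k * w ^ k) ∧
    ∀ w, HasSum (fun k => derivCoeff b k * w ^ k) (deriv (fun w => ∑' k, b k * w ^ k) w) := by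
  have bound : ∀ R : ℝ, ∀ k, ∀ w ∈ Metric.ball (0 : ℂ) R, ‖b k * w ^ k‖ ≤ ‖b k * (R : ℂ) ^ k‖ := by
    intro R k w hw
    rw [norm_mul, norm_mul, norm_pow, norm_pow]
    have : ‖w‖ < R := by simpa using hw
    have h2 : ‖w‖ ≤ ‖(R : ℂ)‖ := by
      rw [Complex.norm_real]
      exact this.le.trans (le_abs_self _)
    gcongr
  have hdk : ∀ k, Differentiable ℂ (fun w : ℂ => b k * w ^ k) := fun k => by fun_prop
  constructor
  · intro w
    have := Complex.differentiableOn_tsum_of_summable_norm (u := fun k =>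
      ‖b k * ((‖w‖ + 1 : ℝ) : ℂ) ^ k‖) (hb _).norm (F := fun k w => b k * w ^ k)
      (fun k => (hdk k).differentiableOn) Metric.isOpen_ball (bound (‖w‖ + 1))
    exact this.differentiableAt (Metric.isOpen_ball.mem_nhds (by simp))
  · intro w
    have := Complex.hasSum_deriv_of_summable_norm (u := fun k =>
      ‖b k * ((‖w‖ + 1 : ℝ) : ℂ) ^ k‖) (hb _).norm (F := fun k w => b k * w ^ k)
      (fun k => (hdk k).differentiableOn) Metric.isOpen_ball (bound (‖w‖ + 1))
      (z := w) (by simp)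
    rw [← hasSum_nat_add_iff' 1] at this
    have e : ∀ k : ℕ, deriv (fun w : ℂ => b k * w ^ k) w = b k * (k * w ^ (k - 1)) := by
      intro k
      rw [deriv_const_mul _ (by fun_prop)]
      simp
    simp only [e, Finset.range_one, Finset.sum_singleton] at this
    refine (by simpa using this : HasSum _ _).congr_fun fun k => ?_
    simp [derivCoeff]
    ring

theorem EntireCoeff.derivCoeff {b : ℕ → ℂ} (hb : EntireCoeff b) : EntireCoeff (derivCoeff b) :=
  fun w => (hb.differentiable_and_hasSum.2 w).summable

/-! ### The model solutions on the half-line -/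

/-- Standing assumptions on the parameters of the singularity. -/
structure Admissible (P : Params) : Prop where
  nu_re : 0 < P.ν.re
  nu_nat : ∀ n : ℕ, 1 ≤ n → P.ν ≠ n
  c_mul : P.c 0 * P.c 1 = (2 * P.ν)⁻¹

theorem Admissible.nu_ne {P : Params} (hP : Admissible P) : P.ν ≠ 0 := by
  intro h
  have := hP.nu_re
  rw [h] at this
  simp at this

theorem expo_zero (P : Params) : expo P 0 = -P.ν + 1 / 2 := rfl
theorem expo_one (P : Params) : expo P 1 = P.ν + 1 / 2 := rfl

theorem expo_add (P : Params) : expo P 0 + expo P 1 = 1 := by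
  rw [expo_zero, expo_one]
  ring

theorem expo_sub_sq (P : Params) (j : Fin 2) : (expo P j - 1 / 2) ^ 2 = P.ν ^ 2 := by
  fin_cases j
  · simp [expo_zero]
  · simp [expo_one]

theorem re_expo_zero (P : Params) : (expo P 0).re = 1 / 2 - P.ν.re := by
  rw [expo_zero]
  simp
  ring

theorem re_expo_one (P : Params) : (expo P 1).re = 1 / 2 + P.ν.re := by
  rw [expo_one]
  simp
  ring

/-- For the first exponent the quantity is `s - ν`, which is where `ν ≠ 1, 2, …` enters. For the
second it is `s + ν`, which has positive real part. -/
theorem Admissible.add_ne {P : Params} (hP : Admissible P) (j : Fin 2) (s : ℕ) (hs : 1 ≤ s) :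
    (s : ℂ) + (expo P j - 1 / 2) ≠ 0 := by
  fin_cases j
  · simp only [Fin.zero_eta, Fin.isValue, expo_zero]
    intro h
    apply hP.nu_nat s hs
    linear_combination -h
  · simp only [Fin.mk_one, Fin.isValue, expo_one]
    intro h
    have := congrArg Complex.re h
    simp at this
    linarith [hP.nu_re, s.cast_nonneg (α := ℝ)]

theorem coeff_zero (P : Params) (j : Fin 2) : coeff P j 0 = P.c j := by
  simp [coeff]

/-- Because `(μ_j - 1/2)² = ν²`, the factor `(2s + μ_j)(2s + μ_j - 1) - ν₀` equals `4s(s + μ_j -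
1/2)`. -/
theorem Admissible.coeff_succ {P : Params} (hP : Admissible P) (j : Fin 2) (k : ℕ) :
    4 * ((k : ℂ) + 1) * ((k : ℂ) + 1 + (expo P j - 1 / 2)) * coeff P j (k + 1) = -coeff P j k := by
  have h1 : ((k : ℂ) + 1) ≠ 0 := by exact_mod_cast k.succ_ne_zero
  have h2 := hP.add_ne j (k + 1) (by omega)
  push_cast at h2
  have h3 : (2 * ((k + 1 : ℕ) : ℂ) + expo P j) * (2 * ((k + 1 : ℕ) : ℂ) + expo P j - 1) -
      nuZero P = 4 * ((k : ℂ) + 1) * ((k : ℂ) + 1 + (expo P j - 1 / 2)) := by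
    unfold nuZero
    push_cast
    linear_combination expo_sub_sq P j
  unfold coeff
  rw [Finset.prod_Icc_succ_top (by omega), h3, mul_inv, pow_succ]
  have h4 : 4 * ((k : ℂ) + 1) * ((k : ℂ) + 1 + (expo P j - 1 / 2)) ≠ 0 :=
    mul_ne_zero (mul_ne_zero (by norm_num) h1) h2
  generalize 4 * ((k : ℂ) + 1) * ((k : ℂ) + 1 + (expo P j - 1 / 2)) = D at h4 ⊢
  field_simp

theorem Admissible.entireCoeff {P : Params} (hP : Admissible P) (j : Fin 2) :
    EntireCoeff (coeff P j) := by
  intro w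
  refine summable_of_ratio_norm_eventually_le (r := 1 / 2) (by norm_num) ?_
  obtain ⟨N, hN⟩ := exists_nat_ge (‖expo P j - 1 / 2‖ + ‖w‖)
  filter_upwards [eventually_ge_atTop N] with k hk
  have hkN : (N : ℝ) ≤ k := by exact_mod_cast hk
  have h1 := congrArg norm (hP.coeff_succ j k)
  rw [norm_neg, norm_mul, norm_mul, norm_mul] at h1
  have h2 : ‖(k : ℂ) + 1‖ = (k : ℝ) + 1 := by
    rw [show (k : ℂ) + 1 = ((k : ℝ) + 1 : ℝ) by push_cast; rfl, Complex.norm_real,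
      Real.norm_of_nonneg (by positivity)]
  have h3 : 1 ≤ ‖(k : ℂ) + 1 + (expo P j - 1 / 2)‖ := by
    have := norm_sub_le ((k : ℂ) + 1 + (expo P j - 1 / 2)) (expo P j - 1 / 2)
    rw [add_sub_cancel_right, h2] at this
    linarith [norm_nonneg w]
  rw [h2] at h1
  have h4 : ‖(4 : ℂ)‖ = 4 := by simp
  rw [h4] at h1
  rw [norm_mul, norm_mul, ← h1, pow_succ, norm_mul]
  have hw : ‖w‖ ≤ k := by linarith [norm_nonneg (expo P j - 1 / 2)]
  set A := ‖coeff P j (k + 1)‖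
  set B := ‖(k : ℂ) + 1 + (expo P j - 1 / 2)‖
  have hA : 0 ≤ A := norm_nonneg _
  have hwk : 0 ≤ ‖w ^ k‖ := norm_nonneg _
  have : ‖w‖ ≤ 1 / 2 * (4 * ((k : ℝ) + 1) * B) := by nlinarith [norm_nonneg w]
  calc A * (‖w ^ k‖ * ‖w‖) = (A * ‖w ^ k‖) * ‖w‖ := by ring
    _ ≤ (A * ‖w ^ k‖) * (1 / 2 * (4 * ((k : ℝ) + 1) * B)) := by gcongr
    _ = _ := by ring

/-- `H_j(w) = ∑ c_{jk} w^k`. -/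
def besSeries (P : Params) (j : Fin 2) (w : ℂ) : ℂ := ∑' k : ℕ, coeff P j k * w ^ k

theorem Admissible.differentiable_series {P : Params} (hP : Admissible P) (j : Fin 2) :
    Differentiable ℂ (besSeries P j) := (hP.entireCoeff j).differentiable_and_hasSum.1

theorem Admissible.deriv_series {P : Params} (hP : Admissible P) (j : Fin 2) :
    deriv (besSeries P j) = fun w => ∑' k, derivCoeff (coeff P j) k * w ^ k := by
  funext w
  exact ((hP.entireCoeff j).differentiable_and_hasSum.2 w).tsum_eq.symm

theorem Admissible.differentiable_deriv_series {P : Params} (hP : Admissible P) (j : Fin 2) :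
    Differentiable ℂ (deriv (besSeries P j)) := by
  rw [hP.deriv_series]
  exact (hP.entireCoeff j).derivCoeff.differentiable_and_hasSum.1

theorem besSeries_zero (P : Params) (j : Fin 2) : besSeries P j 0 = P.c j := by
  unfold besSeries
  rw [tsum_eq_single 0]
  · simp [coeff_zero]
  · intro k hk
    simp [hk]

/-- Comparing coefficients, this is the recursion `coeff_succ` read as a differential equation in `w
= λy²`. -/
theorem Admissible.series_ode {P : Params} (hP : Admissible P) (j : Fin 2) (w : ℂ) :
    4 * (w * deriv (deriv (besSeries P j)) w + (1 + (expo P j - 1 / 2)) * deriv (besSeries P j) w)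
      = -besSeries P j w := by
  have h1 : HasSum (fun k => derivCoeff (coeff P j) k * w ^ k) (deriv (besSeries P j) w) :=
    (hP.entireCoeff j).differentiable_and_hasSum.2 w
  have h2 : HasSum (fun k => derivCoeff (derivCoeff (coeff P j)) k * w ^ k)
      (deriv (deriv (besSeries P j)) w) := by
    rw [hP.deriv_series]
    exact (hP.entireCoeff j).derivCoeff.differentiable_and_hasSum.2 w
  have h3 : HasSum (fun k : ℕ => (k : ℂ) * derivCoeff (coeff P j) k * w ^ k)
      (w * deriv (deriv (besSeries P j)) w) := by
    rw [← hasSum_nat_add_iff' 1]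
    simp only [Finset.range_one, Finset.sum_singleton, Nat.cast_zero, zero_mul, sub_zero]
    refine (h2.mul_left w).congr_fun fun k => ?_
    simp only [derivCoeff]
    push_cast
    ring
  have h4 := (h3.add (h1.mul_left (1 + (expo P j - 1 / 2)))).mul_left 4
  have h5 : HasSum (fun k => -(coeff P j k * w ^ k)) (-besSeries P j w) :=
    ((hP.entireCoeff j) w).hasSum.neg
  refine h4.unique (h5.congr_fun fun k => ?_)
  have := hP.coeff_succ j k
  simp only [derivCoeff]
  linear_combination (w ^ k) * this

/-- The model solution `C_j(a + y, λ)` as a function of the distance `y` to the singular point. -/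
def bes (P : Params) (j : Fin 2) (lam : ℂ) (y : ℝ) : ℂ :=
  (y : ℂ) ^ expo P j * besSeries P j (lam * (y : ℂ) ^ 2)

/-- The derivative of `bes` in `y`. -/
def bes' (P : Params) (j : Fin 2) (lam : ℂ) (y : ℝ) : ℂ :=
  (y : ℂ) ^ (expo P j - 1) * (expo P j * besSeries P j (lam * (y : ℂ) ^ 2) +
    2 * (lam * (y : ℂ) ^ 2) * deriv (besSeries P j) (lam * (y : ℂ) ^ 2))

theorem modelSol_eq_bes (P : Params) (j : Fin 2) (x : ℝ) (lam : ℂ) :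
    modelSol P j x lam = bes P j lam (x - P.a) := rfl

theorem hasDerivAt_ofReal_cpow {y : ℝ} (hy : 0 < y) (μ : ℂ) :
    HasDerivAt (fun y : ℝ => (y : ℂ) ^ μ) (μ * (y : ℂ) ^ (μ - 1)) y := by
  have h : (y : ℂ) ∈ Complex.slitPlane := Complex.ofReal_mem_slitPlane.2 hy
  have := ((hasDerivAt_id (y : ℂ)).cpow_const (c := μ) h).comp_ofReal
  simpa using this

theorem cpow_sub_one' {y : ℝ} (hy : 0 < y) (μ : ℂ) : (y : ℂ) ^ (μ - 1) = (y : ℂ) ^ μ / y := by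
  rw [Complex.cpow_sub _ _ (by exact_mod_cast hy.ne'), Complex.cpow_one]

theorem hasDerivAt_comp_sq {f : ℂ → ℂ} (hf : Differentiable ℂ f) (lam : ℂ) (y : ℝ) :
    HasDerivAt (fun y : ℝ => f (lam * (y : ℂ) ^ 2))
      (deriv f (lam * (y : ℂ) ^ 2) * (2 * lam * y)) y := by
  have h1 : HasDerivAt (fun z : ℂ => lam * z ^ 2) (2 * lam * y) (y : ℂ) := by
    refine ((hasDerivAt_pow 2 (y : ℂ)).const_mul lam).congr_deriv ?_
    norm_num
    ring
  have h2 : HasDerivAt (fun z : ℂ => f (lam * z ^ 2))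
      (deriv f (lam * (y : ℂ) ^ 2) * (2 * lam * y)) (y : ℂ) :=
    HasDerivAt.comp (y : ℂ) (h₂ := f) (hf (lam * (y : ℂ) ^ 2)).hasDerivAt h1
  exact h2.comp_ofReal

theorem Admissible.hasDerivAt_bes {P : Params} (hP : Admissible P) (j : Fin 2) (lam : ℂ) {y : ℝ}
    (hy : 0 < y) : HasDerivAt (bes P j lam) (bes' P j lam y) y := by
  have h1 := (hasDerivAt_ofReal_cpow hy (expo P j)).mul
    (hasDerivAt_comp_sq (hP.differentiable_series j) lam y)
  refine h1.congr_deriv ?_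
  have hy' : (y : ℂ) ≠ 0 := by exact_mod_cast hy.ne'
  unfold bes'
  rw [cpow_sub_one' hy]
  field_simp

/-- This is the model equation. It follows from `series_ode` at `w = λy²` and from `(μ_j - 1/2)² =
ν²`. -/
theorem Admissible.hasDerivAt_bes' {P : Params} (hP : Admissible P) (j : Fin 2) (lam : ℂ) {y : ℝ}
    (hy : 0 < y) :
    HasDerivAt (bes' P j lam) ((nuZero P / (y : ℂ) ^ 2 - lam) * bes P j lam y) y := by
  have hG : Differentiable ℂ (fun w => expo P j * besSeries P j w +
      2 * w * deriv (besSeries P j) w) :=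
    ((hP.differentiable_series j).const_mul _).add
      ((differentiable_id.const_mul 2).mul (hP.differentiable_deriv_series j))
  have h1 := (hasDerivAt_ofReal_cpow hy (expo P j - 1)).mul (hasDerivAt_comp_sq hG lam y)
  refine h1.congr_deriv ?_
  have hy' : (y : ℂ) ≠ 0 := by exact_mod_cast hy.ne'
  have hd : ∀ w, deriv (fun w => expo P j * besSeries P j w + 2 * w * deriv (besSeries P j) w) w =
      expo P j * deriv (besSeries P j) w + (2 * deriv (besSeries P j) w +
        2 * w * deriv (deriv (besSeries P j)) w) := by
    intro w
    refine HasDerivAt.deriv ?_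
    have e1 := ((hP.differentiable_series j) w).hasDerivAt.const_mul (expo P j)
    have e2 := ((hasDerivAt_id w).const_mul 2).mul ((hP.differentiable_deriv_series j) w).hasDerivAt
    refine (e1.add e2).congr_deriv ?_
    simp
  rw [hd]
  have ode := hP.series_ode j (lam * (y : ℂ) ^ 2)
  unfold bes nuZero
  rw [cpow_sub_one' hy, cpow_sub_one' hy]
  have hsq := expo_sub_sq P j
  generalize deriv (deriv (besSeries P j)) (lam * (y : ℂ) ^ 2) = H2 at *
  generalize deriv (besSeries P j) (lam * (y : ℂ) ^ 2) = H1 at *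
  generalize besSeries P j (lam * (y : ℂ) ^ 2) = H0 at *
  generalize (y : ℂ) ^ expo P j = T at *
  field_simp
  linear_combination (4 * T * lam * (y : ℂ) ^ 2) * ode + 4 * H0 * T * hsq

/-- Since `μ₁ + μ₂ = 1`, the powers of `y` cancel and the Wronskian is an entire function of `w =
λy²` alone. Its derivative vanishes by `series_ode`, and its value at `w = 0` is `2ν c₁₀c₂₀ = 1`. -/
theorem Admissible.bes_wronskian {P : Params} (hP : Admissible P) (lam : ℂ) {y : ℝ} (hy : 0 < y) :
    bes P 0 lam y * bes' P 1 lam y - bes' P 0 lam y * bes P 1 lam y = 1 := by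
  set h : ℂ → ℂ := fun w => 2 * P.ν * (besSeries P 0 w * besSeries P 1 w) +
    2 * w * (besSeries P 0 w * deriv (besSeries P 1) w -
      deriv (besSeries P 0) w * besSeries P 1 w) with hh
  have hd : ∀ w, HasDerivAt h 0 w := by
    intro w
    have a0 := ((hP.differentiable_series 0) w).hasDerivAt
    have a1 := ((hP.differentiable_series 1) w).hasDerivAt
    have b0 := ((hP.differentiable_deriv_series 0) w).hasDerivAt
    have b1 := ((hP.differentiable_deriv_series 1) w).hasDerivAt
    have := ((a0.mul a1).const_mul (2 * P.ν)).add
      (((hasDerivAt_id w).const_mul 2).mul ((a0.mul b1).sub (b0.mul a1)))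
    refine this.congr_deriv ?_
    have o0 := hP.series_ode 0 w
    have o1 := hP.series_ode 1 w
    rw [expo_zero] at o0
    rw [expo_one] at o1
    simp only [id, Pi.mul_apply, Pi.sub_apply]
    linear_combination (besSeries P 0 w / 2) * o1 - (besSeries P 1 w / 2) * o0
  have hconst : ∀ w, h w = 1 := by
    intro w
    have h1 := is_const_of_deriv_eq_zero (fun w => (hd w).differentiableAt)
      (fun w => (hd w).deriv) w 0
    rw [h1, hh]
    simp only [besSeries_zero, hP.c_mul, mul_zero, zero_mul, add_zero]
    have := hP.nu_ne
    field_simp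
  have hy' : (y : ℂ) ≠ 0 := by exact_mod_cast hy.ne'
  have e1 : (y : ℂ) ^ expo P 0 * (y : ℂ) ^ expo P 1 = y := by
    rw [← Complex.cpow_add _ _ hy', expo_add, Complex.cpow_one]
  have h2 := hconst (lam * (y : ℂ) ^ 2)
  simp only [hh] at h2
  unfold bes bes'
  rw [cpow_sub_one' hy, cpow_sub_one' hy, expo_zero, expo_one] at *
  generalize deriv (besSeries P 0) (lam * (y : ℂ) ^ 2) = A1 at *
  generalize deriv (besSeries P 1) (lam * (y : ℂ) ^ 2) = B1 at *
  generalize besSeries P 0 (lam * (y : ℂ) ^ 2) = A at *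
  generalize besSeries P 1 (lam * (y : ℂ) ^ 2) = B at *
  generalize (y : ℂ) ^ (-P.ν + 1 / 2) = S at *
  generalize (y : ℂ) ^ (P.ν + 1 / 2) = T at *
  field_simp
  linear_combination 2 * (2 * P.ν * A * B +
    2 * (lam * (y : ℂ) ^ 2) * (A * B1 - A1 * B)) * e1 + 2 * y * h2

theorem norm_ofReal_cpow {y : ℝ} (hy : 0 < y) (μ : ℂ) : ‖(y : ℂ) ^ μ‖ = y ^ μ.re :=
  Complex.norm_cpow_eq_rpow_re_of_pos hy μ

/-- Bounds of the model solutions near the singular point. -/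
theorem Admissible.exists_near_bound {P : Params} (hP : Admissible P) (R : ℝ) :
    ∃ K : ℝ, 0 < K ∧ ∀ (j : Fin 2) (lam : ℂ) (y : ℝ), 0 < y → ‖lam‖ * y ^ 2 ≤ R →
      ‖bes P j lam y‖ ≤ K * y ^ (expo P j).re ∧ ‖bes' P j lam y‖ ≤ K * y ^ ((expo P j).re - 1) := by
  have hc : ∀ j, ∃ K, ∀ w ∈ Metric.closedBall (0 : ℂ) R, ‖besSeries P j w‖ ≤ K :=
    fun j => (isCompact_closedBall _ _).exists_bound_of_continuousOn
      (hP.differentiable_series j).continuous.continuousOn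
  have hc' : ∀ j, ∃ K, ∀ w ∈ Metric.closedBall (0 : ℂ) R, ‖expo P j * besSeries P j w +
      2 * w * deriv (besSeries P j) w‖ ≤ K :=
    fun j => (isCompact_closedBall _ _).exists_bound_of_continuousOn
      (by
        have h1 := (hP.differentiable_series j).continuous
        have h2 := (hP.differentiable_deriv_series j).continuous
        exact Continuous.continuousOn (by fun_prop))
  choose K hK using hc
  choose K' hK' using hc'
  refine ⟨|K 0| + |K 1| + |K' 0| + |K' 1| + 1, by positivity, fun j lam y hy hR => ?_⟩
  have hw : lam * (y : ℂ) ^ 2 ∈ Metric.closedBall (0 : ℂ) R := by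
    rw [mem_closedBall_zero_iff, norm_mul, norm_pow, Complex.norm_real,
      Real.norm_of_nonneg hy.le]
    exact hR
  have hj : K j ≤ |K 0| + |K 1| + |K' 0| + |K' 1| + 1 ∧
      K' j ≤ |K 0| + |K 1| + |K' 0| + |K' 1| + 1 := by
    have := le_abs_self (K 0)
    have := le_abs_self (K 1)
    have := le_abs_self (K' 0)
    have := le_abs_self (K' 1)
    have := abs_nonneg (K 0)
    have := abs_nonneg (K 1)
    have := abs_nonneg (K' 0)
    have := abs_nonneg (K' 1)
    fin_cases j <;> constructor <;> simp only [Fin.zero_eta, Fin.mk_one] <;> linarith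
  constructor
  · unfold bes
    rw [norm_mul, norm_ofReal_cpow hy, mul_comm]
    exact mul_le_mul_of_nonneg_right ((hK j _ hw).trans hj.1) (by positivity)
  · unfold bes'
    rw [norm_mul, norm_ofReal_cpow hy, mul_comm, Complex.sub_re, Complex.one_re]
    exact mul_le_mul_of_nonneg_right ((hK' j _ hw).trans hj.2) (by positivity)

theorem Admissible.differentiable_bes {P : Params} (hP : Admissible P) (j : Fin 2) (y : ℝ) :
    Differentiable ℂ (fun lam => bes P j lam y) := by
  have := hP.differentiable_series j
  unfold bes
  fun_prop

theorem Admissible.differentiable_bes' {P : Params} (hP : Admissible P) (j : Fin 2) (y : ℝ) :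
    Differentiable ℂ (fun lam => bes' P j lam y) := by
  have := hP.differentiable_series j
  have := hP.differentiable_deriv_series j
  unfold bes'
  fun_prop

theorem Admissible.measurable_bes {P : Params} (hP : Admissible P) (j : Fin 2) (lam : ℂ) :
    Measurable (bes P j lam) := by
  have := (hP.differentiable_series j).continuous.measurable
  unfold bes
  fun_prop

theorem Admissible.continuousOn_bes {P : Params} (hP : Admissible P) (j : Fin 2) (lam : ℂ) :
    ContinuousOn (bes P j lam) (Set.Ioi 0) := fun _ hy =>
  (hP.hasDerivAt_bes j lam hy).continuousAt.continuousWithinAt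

/-- The factor `exp(iπ μ_j)` picked up by the model solution on passing to the left of `a`. -/
def turn (P : Params) (j : Fin 2) : ℂ := Complex.exp (Real.pi * Complex.I * expo P j)

/-- The principal argument of a negative number is `π`, so the power contributes `exp(iπμ_j)`; the
series factor is even in `y`. -/
theorem bes_neg (P : Params) (j : Fin 2) (lam : ℂ) {y : ℝ} (hy : 0 < y) :
    bes P j lam (-y) = turn P j * bes P j lam y := by
  unfold bes turn
  have hy' : (y : ℂ) ≠ 0 := by exact_mod_cast hy.ne'
  have hny : ((-y : ℝ) : ℂ) ≠ 0 := by exact_mod_cast (neg_ne_zero.2 hy.ne')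
  have h1 : ((-y : ℝ) : ℂ) ^ expo P j =
      Complex.exp (Real.pi * Complex.I * expo P j) * (y : ℂ) ^ expo P j := by
    rw [Complex.cpow_def_of_ne_zero hny, Complex.cpow_def_of_ne_zero hy', ← Complex.exp_add]
    congr 1
    have : Complex.log ((-y : ℝ) : ℂ) = Complex.log (y : ℂ) + Real.pi * Complex.I := by
      rw [Complex.log, Complex.log]
      rw [Complex.arg_ofReal_of_neg (by linarith), Complex.arg_ofReal_of_nonneg hy.le]
      simp
    rw [this]
    ring
  rw [h1]
  push_cast
  rw [neg_sq]
  ring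

theorem turn_mul (P : Params) : turn P 0 * turn P 1 = -1 := by
  unfold turn
  rw [← Complex.exp_add, ← mul_add, expo_add, mul_one, Complex.exp_pi_mul_I]

/-! ### Growth of solutions of the model equation -/

/-- `Y` solves `Y'' = (ν₀/y² - λ) Y` on `(0, ∞)`, with `Y' = Y1`. -/
structure IsModel (P : Params) (lam : ℂ) (Y Y1 : ℝ → ℂ) : Prop where
  d0 : ∀ y : ℝ, 0 < y → HasDerivAt Y (Y1 y) y
  d1 : ∀ y : ℝ, 0 < y → HasDerivAt Y1 ((nuZero P / (y : ℂ) ^ 2 - lam) * Y y) y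

theorem Admissible.isModel {P : Params} (hP : Admissible P) (lam b0 b1 : ℂ) :
    IsModel P lam (fun y => b0 * bes P 0 lam y + b1 * bes P 1 lam y)
      (fun y => b0 * bes' P 0 lam y + b1 * bes' P 1 lam y) := by
  refine ⟨fun y hy => ?_, fun y hy => ?_⟩
  · exact ((hP.hasDerivAt_bes 0 lam hy).const_mul b0).add ((hP.hasDerivAt_bes 1 lam hy).const_mul b1)
  · refine (((hP.hasDerivAt_bes' 0 lam hy).const_mul b0).add
      ((hP.hasDerivAt_bes' 1 lam hy).const_mul b1)).congr_deriv ?_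
    ring

theorem hasDerivAt_normSq {U : ℝ → ℂ} {U' : ℂ} {y : ℝ} (h : HasDerivAt U U' y) :
    HasDerivAt (fun y => ‖U y‖ ^ 2) (2 * ((starRingEnd ℂ) (U y) * U').re) y := by
  have := h.norm_sq
  simpa [Complex.inner, mul_comm] using this

/-- A Gronwall argument, valid in both directions. The combinations `Y' ± iρY` diagonalise the
equation up to the term `ν₀Y/y²`, which is at most `|ν₀|/(|ρ|y²)` in terms of these combinations.
Its integral over `y ≥ 1/|ρ|` is bounded uniformly in `ρ`. -/
theorem IsModel.energy_bound {P : Params} {ρ : ℂ} (hρ : ρ ≠ 0) (him : 0 ≤ ρ.im) {Y Y1 : ℝ → ℂ}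
    (hY : IsModel P (ρ ^ 2) Y Y1) {r y : ℝ} (hr : 1 ≤ ‖ρ‖ * r) (hy : 1 ≤ ‖ρ‖ * y) :
    ‖Y1 y‖ ^ 2 + (‖ρ‖ * ‖Y y‖) ^ 2 ≤
      Real.exp (2 * ‖nuZero P‖) * Real.exp (2 * ρ.im * |y - r|) *
        (‖Y1 r‖ ^ 2 + (‖ρ‖ * ‖Y r‖) ^ 2) := by
  have hρ0 : 0 < ‖ρ‖ := norm_pos_iff.2 hρ
  set c := ‖nuZero P‖ / ‖ρ‖ with hc
  have hc0 : 0 ≤ c := by positivity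
  set U : ℝ → ℂ := fun y => Y1 y + Complex.I * ρ * Y y with hU
  set V : ℝ → ℂ := fun y => Y1 y - Complex.I * ρ * Y y with hV
  set N : ℝ → ℝ := fun y => ‖U y‖ ^ 2 + ‖V y‖ ^ 2 with hN
  have hNE : ∀ y, N y = 2 * (‖Y1 y‖ ^ 2 + (‖ρ‖ * ‖Y y‖) ^ 2) := by
    intro y
    have := parallelogram_law_with_norm ℝ (Y1 y) (Complex.I * ρ * Y y)
    rw [norm_mul, norm_mul, Complex.norm_I, one_mul] at this
    simp only [hN, hU, hV]
    nlinarith [this]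
  have hN0 : ∀ y, 0 ≤ N y := fun y => by positivity
  have hd : ∀ y, 0 < y → ∃ N', HasDerivAt N N' y ∧ |N'| ≤ (2 * ρ.im + 2 * c / y ^ 2) * N y := by
    intro y hy
    have dU : HasDerivAt U (Complex.I * ρ * U y + nuZero P / (y : ℂ) ^ 2 * Y y) y := by
      refine ((hY.d1 y hy).add ((hY.d0 y hy).const_mul (Complex.I * ρ))).congr_deriv ?_
      simp only [hU]
      linear_combination (-(ρ ^ 2) * Y y) * Complex.I_sq
    have dV : HasDerivAt V (-(Complex.I * ρ * V y) + nuZero P / (y : ℂ) ^ 2 * Y y) y := by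
      refine ((hY.d1 y hy).sub ((hY.d0 y hy).const_mul (Complex.I * ρ))).congr_deriv ?_
      simp only [hV]
      linear_combination (-(ρ ^ 2) * Y y) * Complex.I_sq
    refine ⟨_, (hasDerivAt_normSq dU).add (hasDerivAt_normSq dV), ?_⟩
    have hYUV : 2 * ‖ρ‖ * ‖Y y‖ ≤ ‖U y‖ + ‖V y‖ := by
      have e : U y - V y = 2 * (Complex.I * ρ * Y y) := by simp only [hU, hV]; ring
      have := norm_sub_le (U y) (V y)
      rw [e, norm_mul, norm_mul, norm_mul, Complex.norm_I] at this
      simp at this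
      linarith
    have e1 : ((starRingEnd ℂ) (U y) * (Complex.I * ρ * U y + nuZero P / (y : ℂ) ^ 2 * Y y)).re
        = -ρ.im * ‖U y‖ ^ 2 + ((starRingEnd ℂ) (U y) * (nuZero P / (y : ℂ) ^ 2 * Y y)).re := by
      rw [mul_add, Complex.add_re]
      congr 1
      rw [show (starRingEnd ℂ) (U y) * (Complex.I * ρ * U y) =
        (Complex.I * ρ) * ((starRingEnd ℂ) (U y) * U y) by ring, Complex.conj_mul',
        ← Complex.ofReal_pow, Complex.re_mul_ofReal]
      simp
    have e2 : ((starRingEnd ℂ) (V y) * (-(Complex.I * ρ * V y) + nuZero P / (y : ℂ) ^ 2 * Y y)).re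
        = ρ.im * ‖V y‖ ^ 2 + ((starRingEnd ℂ) (V y) * (nuZero P / (y : ℂ) ^ 2 * Y y)).re := by
      rw [mul_add, Complex.add_re]
      congr 1
      rw [show (starRingEnd ℂ) (V y) * -(Complex.I * ρ * V y) =
        (-(Complex.I * ρ)) * ((starRingEnd ℂ) (V y) * V y) by ring, Complex.conj_mul',
        ← Complex.ofReal_pow, Complex.re_mul_ofReal]
      simp
    have b : ∀ W : ℂ, |((starRingEnd ℂ) W * (nuZero P / (y : ℂ) ^ 2 * Y y)).re| ≤
        ‖W‖ * (‖nuZero P‖ / y ^ 2 * ‖Y y‖) := by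
      intro W
      refine (Complex.abs_re_le_norm _).trans (le_of_eq ?_)
      simp
    have bU := b (U y)
    have bV := b (V y)
    rw [e1, e2]
    set A := ((starRingEnd ℂ) (U y) * (nuZero P / (y : ℂ) ^ 2 * Y y)).re
    set B := ((starRingEnd ℂ) (V y) * (nuZero P / (y : ℂ) ^ 2 * Y y)).re
    have hcy : ‖nuZero P‖ / y ^ 2 = c / y ^ 2 * ‖ρ‖ := by
      rw [hc]; field_simp
    have hAB : |A| + |B| ≤ c / y ^ 2 * N y := by
      have hcy0 : 0 ≤ c / y ^ 2 := by positivity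
      have h1 : |A| + |B| ≤ c / y ^ 2 * ((‖U y‖ + ‖V y‖) * (‖ρ‖ * ‖Y y‖)) := by
        rw [hcy] at bU bV
        linarith
      refine h1.trans (mul_le_mul_of_nonneg_left ?_ hcy0)
      simp only [hN]
      nlinarith [sq_nonneg (‖U y‖ - ‖V y‖), norm_nonneg (U y), norm_nonneg (V y)]
    have hA := abs_le.1 (le_refl |A|)
    have hB := abs_le.1 (le_refl |B|)
    have hu : 0 ≤ ρ.im * ‖U y‖ ^ 2 := by positivity
    have hv : 0 ≤ ρ.im * ‖V y‖ ^ 2 := by positivity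
    have hNy : N y = ‖U y‖ ^ 2 + ‖V y‖ ^ 2 := rfl
    have hexp : (2 * ρ.im + 2 * c / y ^ 2) * N y =
        2 * (ρ.im * ‖U y‖ ^ 2) + 2 * (ρ.im * ‖V y‖ ^ 2) + 2 * (c / y ^ 2 * N y) := by
      rw [hNy]; ring
    rw [hexp, abs_le]
    constructor <;> nlinarith
  choose! N' hN' hN'b using hd
  -- A primitive of the bound for the logarithmic derivative of `N`. Thus `N exp(-ψ)` decreases and
  -- `N exp(ψ)` increases, which compares `N` at two points in either order.
  set ψ : ℝ → ℝ := fun y => 2 * ρ.im * y - 2 * c / y with hψ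
  have dψ : ∀ y, 0 < y → HasDerivAt ψ (2 * ρ.im + 2 * c / y ^ 2) y := by
    intro y hy
    have := ((hasDerivAt_id y).const_mul (2 * ρ.im)).sub
      ((hasDerivAt_inv hy.ne').const_mul (2 * c))
    refine (this.congr_deriv ?_)
    field_simp
    ring
  have anti : AntitoneOn (fun y => N y * Real.exp (-ψ y)) (Set.Ioi 0) := by
    have hder : ∀ y, 0 < y → HasDerivAt (fun y => N y * Real.exp (-ψ y))
        (N' y * Real.exp (-ψ y) + N y * (Real.exp (-ψ y) * -(2 * ρ.im + 2 * c / y ^ 2))) y :=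
      fun y hy => (hN' y hy).mul ((dψ y hy).neg.exp)
    refine antitoneOn_of_deriv_nonpos (convex_Ioi 0)
      (fun y hy => (hder y hy).continuousAt.continuousWithinAt)
      (fun y hy => ?_) (fun y hy => ?_)
    · rw [interior_Ioi] at hy
      exact (hder y hy).differentiableAt.differentiableWithinAt
    · rw [interior_Ioi] at hy
      rw [(hder y hy).deriv]
      have := (abs_le.1 (hN'b y hy)).2
      nlinarith [Real.exp_pos (-ψ y)]
  have mono : MonotoneOn (fun y => N y * Real.exp (ψ y)) (Set.Ioi 0) := by
    have hder : ∀ y, 0 < y → HasDerivAt (fun y => N y * Real.exp (ψ y))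
        (N' y * Real.exp (ψ y) + N y * (Real.exp (ψ y) * (2 * ρ.im + 2 * c / y ^ 2))) y :=
      fun y hy => (hN' y hy).mul ((dψ y hy).exp)
    refine monotoneOn_of_deriv_nonneg (convex_Ioi 0)
      (fun y hy => (hder y hy).continuousAt.continuousWithinAt)
      (fun y hy => ?_) (fun y hy => ?_)
    · rw [interior_Ioi] at hy
      exact (hder y hy).differentiableAt.differentiableWithinAt
    · rw [interior_Ioi] at hy
      rw [(hder y hy).deriv]
      have := (abs_le.1 (hN'b y hy)).1
      nlinarith [Real.exp_pos (ψ y)]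
  have pos : ∀ t, 1 ≤ ‖ρ‖ * t → 0 < t := fun t ht => by
    by_contra h
    push Not at h
    nlinarith
  have hr0 := pos r hr
  have hy0 := pos y hy
  have inv_le : ∀ t, 1 ≤ ‖ρ‖ * t → 2 * c / t ≤ 2 * ‖nuZero P‖ := by
    intro t ht
    have ht0 := pos t ht
    rw [div_le_iff₀ ht0, hc]
    calc 2 * (‖nuZero P‖ / ‖ρ‖) = 2 * ‖nuZero P‖ * (1 / ‖ρ‖) := by ring
      _ ≤ 2 * ‖nuZero P‖ * t := by
        refine mul_le_mul_of_nonneg_left ?_ (by positivity)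
        rw [div_le_iff₀ hρ0]
        linarith
  have hfin : ∀ s t, 0 < s → 0 < t → N s ≤ N t * Real.exp (|ψ s - ψ t|) := by
    intro s t hs ht
    rcases le_total t s with h | h
    · have := anti (Set.mem_Ioi.2 ht) (Set.mem_Ioi.2 hs) h
      simp only at this
      have h2 : N s ≤ N t * Real.exp (ψ s - ψ t) := by
        rw [Real.exp_sub]
        rw [Real.exp_neg, Real.exp_neg, ← div_eq_mul_inv, ← div_eq_mul_inv,
          div_le_div_iff₀ (Real.exp_pos _) (Real.exp_pos _)] at this
        rw [← mul_div_assoc, le_div_iff₀ (Real.exp_pos _)]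
        exact this
      refine h2.trans (mul_le_mul_of_nonneg_left ?_ (hN0 t))
      exact Real.exp_le_exp.2 (le_abs_self _)
    · have := mono (Set.mem_Ioi.2 hs) (Set.mem_Ioi.2 ht) h
      simp only at this
      have h2 : N s ≤ N t * Real.exp (-(ψ s - ψ t)) := by
        rw [neg_sub, Real.exp_sub, ← mul_div_assoc, le_div_iff₀ (Real.exp_pos _)]
        exact this
      refine h2.trans (mul_le_mul_of_nonneg_left ?_ (hN0 t))
      exact Real.exp_le_exp.2 (neg_le_abs _)
  have h1 := hfin y r hy0 hr0
  have h2 : |ψ y - ψ r| ≤ 2 * ‖nuZero P‖ + 2 * ρ.im * |y - r| := by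
    have e : ψ y - ψ r = 2 * ρ.im * (y - r) + (2 * c / r - 2 * c / y) := by simp only [hψ]; ring
    rw [e]
    refine (abs_add_le _ _).trans ?_
    rw [abs_mul, abs_of_nonneg (by positivity : 0 ≤ 2 * ρ.im)]
    have i1 := inv_le r hr
    have i2 := inv_le y hy
    have i3 : 0 ≤ 2 * c / r := by positivity
    have i4 : 0 ≤ 2 * c / y := by positivity
    have : |2 * c / r - 2 * c / y| ≤ 2 * ‖nuZero P‖ := by
      rw [abs_le]; constructor <;> linarith
    linarith
  have h3 : N y ≤ N r * (Real.exp (2 * ‖nuZero P‖) * Real.exp (2 * ρ.im * |y - r|)) := by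
    rw [← Real.exp_add]
    exact h1.trans (mul_le_mul_of_nonneg_left (Real.exp_le_exp.2 h2) (hN0 r))
  rw [hNE, hNE] at h3
  linarith

/-- The constant in the growth estimates. -/
def growthC (P : Params) : ℝ := 2 * Real.exp ‖nuZero P‖

theorem growthC_pos (P : Params) : 0 < growthC P := by
  unfold growthC
  positivity

theorem IsModel.growth {P : Params} {ρ : ℂ} (hρ : ρ ≠ 0) (him : 0 ≤ ρ.im) {Y Y1 : ℝ → ℂ}
    (hY : IsModel P (ρ ^ 2) Y Y1) {r y B : ℝ} (hr : 1 ≤ ‖ρ‖ * r) (hy : 1 ≤ ‖ρ‖ * y)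
    (h1 : ‖Y1 r‖ ≤ B) (h0 : ‖ρ‖ * ‖Y r‖ ≤ B) :
    ‖Y1 y‖ ≤ growthC P * Real.exp (ρ.im * |y - r|) * B ∧
      ‖ρ‖ * ‖Y y‖ ≤ growthC P * Real.exp (ρ.im * |y - r|) * B := by
  have hB : 0 ≤ B := (norm_nonneg _).trans h1
  have key := hY.energy_bound hρ him hr hy
  -- The factor 2 would suffice; 4 makes the resulting right-hand side the square of an expression
  -- with constant `growthC`.
  have hr2 : ‖Y1 r‖ ^ 2 + (‖ρ‖ * ‖Y r‖) ^ 2 ≤ 4 * B ^ 2 := by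
    have a1 : ‖Y1 r‖ ^ 2 ≤ B ^ 2 := by gcongr
    have a2 : (‖ρ‖ * ‖Y r‖) ^ 2 ≤ B ^ 2 := by gcongr
    nlinarith [sq_nonneg B]
  have e : Real.exp (2 * ‖nuZero P‖) * Real.exp (2 * ρ.im * |y - r|) * (4 * B ^ 2) =
      (growthC P * Real.exp (ρ.im * |y - r|) * B) ^ 2 := by
    unfold growthC
    rw [show 2 * ‖nuZero P‖ = ‖nuZero P‖ + ‖nuZero P‖ by ring,
      show 2 * ρ.im * |y - r| = ρ.im * |y - r| + ρ.im * |y - r| by ring, Real.exp_add, Real.exp_add]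
    ring
  have hfin : ‖Y1 y‖ ^ 2 + (‖ρ‖ * ‖Y y‖) ^ 2 ≤ (growthC P * Real.exp (ρ.im * |y - r|) * B) ^ 2 := by
    rw [← e]
    exact key.trans (mul_le_mul_of_nonneg_left hr2 (by positivity))
  have hpos : 0 ≤ growthC P * Real.exp (ρ.im * |y - r|) * B := by
    have := growthC_pos P
    positivity
  constructor
  · refine abs_le_of_sq_le_sq' ?_ hpos |>.2
    nlinarith [sq_nonneg (‖ρ‖ * ‖Y y‖)]
  · refine abs_le_of_sq_le_sq' ?_ hpos |>.2
    nlinarith [sq_nonneg (‖Y1 y‖)]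

/-! ### The Green kernel -/

/-- `C₁(r) C₂(y) - C₁(y) C₂(r)`. -/
def green (P : Params) (lam : ℂ) (y r : ℝ) : ℂ :=
  bes P 0 lam r * bes P 1 lam y - bes P 0 lam y * bes P 1 lam r

/-- The derivative of `green` in `y`. -/
def green' (P : Params) (lam : ℂ) (y r : ℝ) : ℂ :=
  bes P 0 lam r * bes' P 1 lam y - bes' P 0 lam y * bes P 1 lam r

theorem green_self (P : Params) (lam : ℂ) (y : ℝ) : green P lam y y = 0 := by
  unfold green
  ring

theorem Admissible.green'_self {P : Params} (hP : Admissible P) (lam : ℂ) {y : ℝ} (hy : 0 < y) :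
    green' P lam y y = 1 := by
  rw [← hP.bes_wronskian lam hy]
  rfl

theorem Admissible.green_isModel {P : Params} (hP : Admissible P) (lam : ℂ) (r : ℝ) :
    IsModel P lam (fun y => green P lam y r) (fun y => green' P lam y r) := by
  have := hP.isModel lam (-bes P 1 lam r) (bes P 0 lam r)
  convert this using 2 <;> simp only [green, green'] <;> ring

theorem pos_of_one_le_mul {a b : ℝ} (ha : 0 < a) (h : 1 ≤ a * b) : 0 < b := by
  by_contra hb
  push Not at hb
  nlinarith

/-- As a function of `y` the Green kernel is the model solution with data `0, 1` at `r`, so the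
growth estimate applies directly. Bounding its two products separately would miss their cancellation
and replace `|y - r|` by `y + r` in the exponent. -/
theorem Admissible.green_far {P : Params} (hP : Admissible P) {ρ : ℂ} (hρ : ρ ≠ 0)
    (him : 0 ≤ ρ.im) {r y : ℝ} (hr : 1 ≤ ‖ρ‖ * r) (hy : 1 ≤ ‖ρ‖ * y) :
    ‖green' P (ρ ^ 2) y r‖ ≤ growthC P * Real.exp (ρ.im * |y - r|) ∧
      ‖ρ‖ * ‖green P (ρ ^ 2) y r‖ ≤ growthC P * Real.exp (ρ.im * |y - r|) := by
  have := (hP.green_isModel (ρ ^ 2) r).growth hρ him (B := 1) hr hy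
    (by rw [hP.green'_self _ (pos_of_one_le_mul (norm_pos_iff.2 hρ) hr)]; simp)
    (by rw [green_self]; simp)
  simpa using this

/-- `min(1, z)^{Re μ_j}`. -/
def om (P : Params) (j : Fin 2) (z : ℝ) : ℝ := (min 1 z) ^ (expo P j).re

theorem om_eq_one (P : Params) (j : Fin 2) {z : ℝ} (hz : 1 ≤ z) : om P j z = 1 := by
  rw [om, min_eq_left hz, Real.one_rpow]

theorem om_pos (P : Params) (j : Fin 2) {z : ℝ} (hz : 0 < z) : 0 < om P j z :=
  Real.rpow_pos_of_pos (lt_min one_pos hz) _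

theorem om_of_le (P : Params) (j : Fin 2) {z : ℝ} (hz : z ≤ 1) : om P j z = z ^ (expo P j).re := by
  rw [om, min_eq_right hz]

/-- The quotient of the two weights is `min(1, ·)^{2 Re ν}`, which increases. Hence one of the two
products in the Green kernel dominates the other. -/
theorem Admissible.om_mul_le {P : Params} (hP : Admissible P) {z w : ℝ} (hz : 0 < z) (hzw : z ≤ w) :
    om P 0 w * om P 1 z ≤ om P 0 z * om P 1 w := by
  have h1 : ∀ t, 0 < t → om P 1 t = om P 0 t * (min 1 t) ^ (2 * P.ν.re) := by
    intro t ht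
    unfold om
    rw [← Real.rpow_add (lt_min one_pos ht), re_expo_zero, re_expo_one]
    congr 1
    ring
  have hw := hz.trans_le hzw
  rw [h1 z hz, h1 w hw]
  have h2 : (min 1 z) ^ (2 * P.ν.re) ≤ (min 1 w) ^ (2 * P.ν.re) :=
    Real.rpow_le_rpow (lt_min one_pos hz).le (min_le_min_left 1 hzw) (by linarith [hP.nu_re])
  have := (om_pos P 0 hz).le
  have := (om_pos P 0 hw).le
  calc om P 0 w * (om P 0 z * (min 1 z) ^ (2 * P.ν.re)) =
      (om P 0 w * om P 0 z) * (min 1 z) ^ (2 * P.ν.re) := by ring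
    _ ≤ (om P 0 w * om P 0 z) * (min 1 w) ^ (2 * P.ν.re) := by gcongr
    _ = _ := by ring

/-- Uniform bounds for the model solutions on the half-line. -/
theorem Admissible.exists_bes_bound {P : Params} (hP : Admissible P) :
    ∃ K : ℝ, 0 < K ∧ ∀ (j : Fin 2) (ρ : ℂ) (y : ℝ), ρ ≠ 0 → 0 ≤ ρ.im → 0 < y →
      ‖bes P j (ρ ^ 2) y‖ ≤ K * ‖ρ‖ ^ (-(expo P j).re) * om P j (‖ρ‖ * y) * Real.exp (ρ.im * y) ∧
      (1 ≤ ‖ρ‖ * y →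
        ‖bes' P j (ρ ^ 2) y‖ ≤ K * ‖ρ‖ ^ (1 - (expo P j).re) * Real.exp (ρ.im * y)) := by
  obtain ⟨K, hK, hb⟩ := hP.exists_near_bound 1
  have hG := growthC_pos P
  refine ⟨K + growthC P * K, by positivity, fun j ρ y hρ him hy => ?_⟩
  have hρ0 : 0 < ‖ρ‖ := norm_pos_iff.2 hρ
  have hexp : 1 ≤ Real.exp (ρ.im * y) := Real.one_le_exp (by positivity)
  have far : 1 ≤ ‖ρ‖ * y →
      ‖bes' P j (ρ ^ 2) y‖ ≤ growthC P * Real.exp (ρ.im * y) * (K * ‖ρ‖ ^ (1 - (expo P j).re)) ∧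
      ‖ρ‖ * ‖bes P j (ρ ^ 2) y‖ ≤
        growthC P * Real.exp (ρ.im * y) * (K * ‖ρ‖ ^ (1 - (expo P j).re)) := by
    intro h1
    -- The point `1/|ρ|` is where the regimes meet: up to it the power series bound holds uniformly,
    -- and beyond it the energy estimate does.
    have hr : (0 : ℝ) < ‖ρ‖⁻¹ := by positivity
    have hnear := hb j (ρ ^ 2) (‖ρ‖⁻¹) hr (by rw [norm_pow]; field_simp; rfl)
    have e1 : (‖ρ‖⁻¹) ^ ((expo P j).re - 1) = ‖ρ‖ ^ (1 - (expo P j).re) := by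
      rw [Real.inv_rpow hρ0.le, ← Real.rpow_neg hρ0.le, neg_sub]
    have e2 : ‖ρ‖ * (‖ρ‖⁻¹) ^ ((expo P j).re) = ‖ρ‖ ^ (1 - (expo P j).re) := by
      rw [Real.inv_rpow hρ0.le, ← Real.rpow_neg hρ0.le, sub_eq_add_neg, Real.rpow_add hρ0,
        Real.rpow_one]
    have hmod : IsModel P (ρ ^ 2) (bes P j (ρ ^ 2)) (bes' P j (ρ ^ 2)) :=
      ⟨fun y hy => hP.hasDerivAt_bes j _ hy, fun y hy => hP.hasDerivAt_bes' j _ hy⟩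
    have := hmod.growth hρ him (r := ‖ρ‖⁻¹) (y := y) (B := K * ‖ρ‖ ^ (1 - (expo P j).re))
      (by rw [mul_inv_cancel₀ hρ0.ne']) h1 (by rw [← e1]; exact hnear.2)
      (by
        rw [← e2]
        calc _ ≤ ‖ρ‖ * (K * ‖ρ‖⁻¹ ^ (expo P j).re) := by gcongr; exact hnear.1
          _ = _ := by ring)
    have habs : |y - ‖ρ‖⁻¹| ≤ y := by
      have : ‖ρ‖⁻¹ ≤ y := by rw [inv_le_iff_one_le_mul₀ hρ0]; linarith
      rw [abs_of_nonneg (by linarith)]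
      linarith
    have hmono : growthC P * Real.exp (ρ.im * |y - ‖ρ‖⁻¹|) * (K * ‖ρ‖ ^ (1 - (expo P j).re)) ≤
        growthC P * Real.exp (ρ.im * y) * (K * ‖ρ‖ ^ (1 - (expo P j).re)) := by gcongr
    exact ⟨this.1.trans hmono, this.2.trans hmono⟩
  constructor
  · rcases le_total (‖ρ‖ * y) 1 with h | h
    · rw [om_of_le P j h, Real.mul_rpow hρ0.le hy.le]
      have hn := (hb j (ρ ^ 2) y hy (by
        rw [norm_pow, ← mul_pow]
        exact pow_le_one₀ (by positivity) h)).1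
      have e : (K + growthC P * K) * ‖ρ‖ ^ (-(expo P j).re) *
          (‖ρ‖ ^ (expo P j).re * y ^ (expo P j).re) = (K + growthC P * K) * y ^ (expo P j).re := by
        rw [Real.rpow_neg hρ0.le]
        have : ‖ρ‖ ^ (expo P j).re ≠ 0 := (Real.rpow_pos_of_pos hρ0 _).ne'
        field_simp
      rw [e]
      have hyp : 0 < y ^ (expo P j).re := Real.rpow_pos_of_pos hy _
      calc _ ≤ K * y ^ (expo P j).re := hn
        _ ≤ (K + growthC P * K) * y ^ (expo P j).re := by
          gcongr
          have : 0 < growthC P * K := by positivity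
          linarith
        _ ≤ _ := le_mul_of_one_le_right (by positivity) hexp
    · rw [om_eq_one P j h, mul_one]
      have := (far h).2
      have e : ‖ρ‖ ^ (1 - (expo P j).re) = ‖ρ‖ * ‖ρ‖ ^ (-(expo P j).re) := by
        rw [sub_eq_add_neg, Real.rpow_add hρ0, Real.rpow_one]
      rw [e] at this
      have h2 : ‖bes P j (ρ ^ 2) y‖ ≤
          growthC P * K * ‖ρ‖ ^ (-(expo P j).re) * Real.exp (ρ.im * y) := by
        refine le_of_mul_le_mul_left ?_ hρ0
        calc _ ≤ _ := this
          _ = _ := by ring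
      refine h2.trans ?_
      have : 0 < ‖ρ‖ ^ (-(expo P j).re) := Real.rpow_pos_of_pos hρ0 _
      gcongr
      linarith
  · intro h
    have : 0 < ‖ρ‖ ^ (1 - (expo P j).re) := Real.rpow_pos_of_pos hρ0 _
    calc _ ≤ _ := (far h).1
      _ = growthC P * K * ‖ρ‖ ^ (1 - (expo P j).re) * Real.exp (ρ.im * y) := by ring
      _ ≤ _ := by gcongr; linarith

theorem Admissible.rpow_expo_mul {P : Params} (ρ : ℂ) (hρ0 : 0 < ‖ρ‖) :
    ‖ρ‖ ^ (-(expo P 0).re) * ‖ρ‖ ^ (-(expo P 1).re) = ‖ρ‖⁻¹ := by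
  rw [← Real.rpow_add hρ0, ← Real.rpow_neg_one, re_expo_zero, re_expo_one]
  congr 1
  ring

/-- Uniform bounds for the Green kernel for `0 < r ≤ y`. -/
theorem Admissible.exists_green_bound {P : Params} (hP : Admissible P) :
    ∃ K : ℝ, 0 < K ∧ ∀ (ρ : ℂ) (r y : ℝ), ρ ≠ 0 → 0 ≤ ρ.im → 0 < r → r ≤ y →
      ‖green P (ρ ^ 2) y r‖ ≤ K / ‖ρ‖ * om P 0 (‖ρ‖ * r) * om P 1 (‖ρ‖ * y) *
        Real.exp (ρ.im * (y - r)) ∧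
      (1 ≤ ‖ρ‖ * y →
        ‖green' P (ρ ^ 2) y r‖ ≤ K * om P 0 (‖ρ‖ * r) * Real.exp (ρ.im * (y - r))) := by
  obtain ⟨K, hK, hb⟩ := hP.exists_bes_bound
  have hG := growthC_pos P
  refine ⟨growthC P + 2 * K ^ 2 * Real.exp 2, by positivity, fun ρ r y hρ him hr hry => ?_⟩
  have hρ0 : 0 < ‖ρ‖ := norm_pos_iff.2 hρ
  have hy := hr.trans_le hry
  -- If `r ≥ 1/|ρ|`, both points are in the energy regime. Otherwise `Im ρ · r ≤ 1`, so the two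
  -- products may be bounded separately at the cost of the factor `exp 2`.
  rcases le_total 1 (‖ρ‖ * r) with h | h
  · have h' : 1 ≤ ‖ρ‖ * y := h.trans (by gcongr)
    have := hP.green_far hρ him h h'
    rw [abs_of_nonneg (by linarith)] at this
    rw [om_eq_one P 0 h, om_eq_one P 1 h', mul_one, mul_one]
    have hE := Real.exp_pos (ρ.im * (y - r))
    constructor
    · rw [div_mul_eq_mul_div, le_div_iff₀ hρ0, mul_comm]
      refine this.2.trans ?_
      gcongr
      have : 0 < 2 * K ^ 2 * Real.exp 2 := by positivity
      linarith
    · intro _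
      rw [mul_one]
      refine this.1.trans ?_
      gcongr
      have : 0 < 2 * K ^ 2 * Real.exp 2 := by positivity
      linarith
  · have hτ : ρ.im ≤ ‖ρ‖ := (le_abs_self _).trans (Complex.abs_im_le_norm ρ)
    have hexp : Real.exp (ρ.im * r) * Real.exp (ρ.im * y) ≤
        Real.exp 2 * Real.exp (ρ.im * (y - r)) := by
      rw [← Real.exp_add, ← Real.exp_add]
      refine Real.exp_le_exp.2 ?_
      have : ρ.im * r ≤ 1 := (mul_le_mul_of_nonneg_right hτ hr.le).trans h
      linarith
    have b0r := (hb 0 ρ r hρ him hr).1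
    have b1r := (hb 1 ρ r hρ him hr).1
    have b0y := hb 0 ρ y hρ him hy
    have b1y := hb 1 ρ y hρ him hy
    have hom := hP.om_mul_le (z := ‖ρ‖ * r) (w := ‖ρ‖ * y) (by positivity) (by gcongr)
    have o0r := om_pos P 0 (z := ‖ρ‖ * r) (by positivity)
    have o1r := om_pos P 1 (z := ‖ρ‖ * r) (by positivity)
    have o0y := om_pos P 0 (z := ‖ρ‖ * y) (by positivity)
    have o1y := om_pos P 1 (z := ‖ρ‖ * y) (by positivity)
    have hR := Admissible.rpow_expo_mul (P := P) ρ hρ0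
    have hE := Real.exp_pos (ρ.im * (y - r))
    constructor
    · have t1 : ‖bes P 0 (ρ ^ 2) r * bes P 1 (ρ ^ 2) y‖ ≤
          K ^ 2 * ‖ρ‖⁻¹ * (om P 0 (‖ρ‖ * r) * om P 1 (‖ρ‖ * y)) *
            (Real.exp 2 * Real.exp (ρ.im * (y - r))) := by
        rw [norm_mul]
        calc _ ≤ _ := mul_le_mul b0r b1y.1 (norm_nonneg _) ((norm_nonneg _).trans b0r)
          _ = K ^ 2 * (‖ρ‖ ^ (-(expo P 0).re) * ‖ρ‖ ^ (-(expo P 1).re)) *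
            (om P 0 (‖ρ‖ * r) * om P 1 (‖ρ‖ * y)) *
            (Real.exp (ρ.im * r) * Real.exp (ρ.im * y)) := by ring
          _ ≤ _ := by rw [hR]; gcongr
      have t2 : ‖bes P 0 (ρ ^ 2) y * bes P 1 (ρ ^ 2) r‖ ≤
          K ^ 2 * ‖ρ‖⁻¹ * (om P 0 (‖ρ‖ * r) * om P 1 (‖ρ‖ * y)) *
            (Real.exp 2 * Real.exp (ρ.im * (y - r))) := by
        rw [norm_mul]
        calc _ ≤ _ := mul_le_mul b0y.1 b1r (norm_nonneg _) ((norm_nonneg _).trans b0y.1)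
          _ = K ^ 2 * (‖ρ‖ ^ (-(expo P 0).re) * ‖ρ‖ ^ (-(expo P 1).re)) *
            (om P 0 (‖ρ‖ * y) * om P 1 (‖ρ‖ * r)) *
            (Real.exp (ρ.im * r) * Real.exp (ρ.im * y)) := by ring
          _ ≤ _ := by rw [hR]; gcongr
      refine (norm_sub_le _ _).trans ((add_le_add t1 t2).trans ?_)
      have : 0 ≤ growthC P / ‖ρ‖ * om P 0 (‖ρ‖ * r) * om P 1 (‖ρ‖ * y) *
        Real.exp (ρ.im * (y - r)) := by positivity
      calc _ = 2 * K ^ 2 * Real.exp 2 / ‖ρ‖ * om P 0 (‖ρ‖ * r) * om P 1 (‖ρ‖ * y) *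
            Real.exp (ρ.im * (y - r)) := by ring
        _ ≤ 2 * K ^ 2 * Real.exp 2 / ‖ρ‖ * om P 0 (‖ρ‖ * r) * om P 1 (‖ρ‖ * y) *
            Real.exp (ρ.im * (y - r)) + growthC P / ‖ρ‖ * om P 0 (‖ρ‖ * r) * om P 1 (‖ρ‖ * y) *
            Real.exp (ρ.im * (y - r)) := by linarith
        _ = _ := by ring
    · intro hy1
      have p0 : ‖ρ‖ ^ (-(expo P 0).re) * ‖ρ‖ ^ (1 - (expo P 1).re) = 1 := by
        rw [sub_eq_add_neg, Real.rpow_add hρ0, Real.rpow_one, mul_left_comm, hR,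
          mul_inv_cancel₀ hρ0.ne']
      have p1 : ‖ρ‖ ^ (1 - (expo P 0).re) * ‖ρ‖ ^ (-(expo P 1).re) = 1 := by
        rw [sub_eq_add_neg, Real.rpow_add hρ0, Real.rpow_one, mul_assoc, hR,
          mul_inv_cancel₀ hρ0.ne']
      have hom' : om P 1 (‖ρ‖ * r) ≤ om P 0 (‖ρ‖ * r) := by
        rw [om_eq_one P 0 hy1, om_eq_one P 1 hy1] at hom
        linarith
      have t1 : ‖bes P 0 (ρ ^ 2) r * bes' P 1 (ρ ^ 2) y‖ ≤
          K ^ 2 * om P 0 (‖ρ‖ * r) * (Real.exp 2 * Real.exp (ρ.im * (y - r))) := by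
        rw [norm_mul]
        calc _ ≤ _ := mul_le_mul b0r (b1y.2 hy1) (norm_nonneg _) ((norm_nonneg _).trans b0r)
          _ = K ^ 2 * (‖ρ‖ ^ (-(expo P 0).re) * ‖ρ‖ ^ (1 - (expo P 1).re)) * om P 0 (‖ρ‖ * r) *
            (Real.exp (ρ.im * r) * Real.exp (ρ.im * y)) := by ring
          _ ≤ _ := by rw [p0, mul_one]; gcongr
      have t2 : ‖bes' P 0 (ρ ^ 2) y * bes P 1 (ρ ^ 2) r‖ ≤
          K ^ 2 * om P 0 (‖ρ‖ * r) * (Real.exp 2 * Real.exp (ρ.im * (y - r))) := by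
        rw [norm_mul]
        calc _ ≤ _ := mul_le_mul (b0y.2 hy1) b1r (norm_nonneg _)
              ((norm_nonneg _).trans (b0y.2 hy1))
          _ = K ^ 2 * (‖ρ‖ ^ (1 - (expo P 0).re) * ‖ρ‖ ^ (-(expo P 1).re)) * om P 1 (‖ρ‖ * r) *
            (Real.exp (ρ.im * r) * Real.exp (ρ.im * y)) := by ring
          _ ≤ _ := by rw [p1, mul_one]; gcongr
      refine (norm_sub_le _ _).trans ((add_le_add t1 t2).trans ?_)
      have : 0 ≤ growthC P * om P 0 (‖ρ‖ * r) * Real.exp (ρ.im * (y - r)) := by positivity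
      calc _ = 2 * K ^ 2 * Real.exp 2 * om P 0 (‖ρ‖ * r) * Real.exp (ρ.im * (y - r)) := by ring
        _ ≤ 2 * K ^ 2 * Real.exp 2 * om P 0 (‖ρ‖ * r) * Real.exp (ρ.im * (y - r)) +
            growthC P * om P 0 (‖ρ‖ * r) * Real.exp (ρ.im * (y - r)) := by linarith
        _ = _ := by ring

/-- Bound for the Green kernel on bounded sets. -/
theorem Admissible.exists_green_near_bound {P : Params} (hP : Admissible P) (L Y : ℝ) :
    ∃ K : ℝ, 0 < K ∧ ∀ (lam : ℂ) (r y : ℝ), ‖lam‖ ≤ L → 0 < r → r ≤ y → y ≤ Y →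
      ‖green P lam y r‖ ≤ K * y ^ (expo P 1).re * r ^ (expo P 0).re := by
  obtain ⟨K, hK, hb⟩ := hP.exists_near_bound (L * Y ^ 2)
  refine ⟨2 * K ^ 2, by positivity, fun lam r y hl hr hry hY => ?_⟩
  have hy := hr.trans_le hry
  have hn : ∀ t, 0 < t → t ≤ Y → ‖lam‖ * t ^ 2 ≤ L * Y ^ 2 := fun t h0 h1 => by
    have := (norm_nonneg lam).trans hl
    gcongr
  have br := fun j => (hb j lam r hr (hn r hr (hry.trans hY))).1
  have bY := fun j => (hb j lam y hy (hn y hy hY)).1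
  have hpos : ∀ t : ℝ, 0 < t → ∀ s : ℝ, 0 < t ^ s := fun t ht s => Real.rpow_pos_of_pos ht s
  have t1 : ‖bes P 0 lam r * bes P 1 lam y‖ ≤ K ^ 2 * y ^ (expo P 1).re * r ^ (expo P 0).re := by
    rw [norm_mul]
    calc _ ≤ _ := mul_le_mul (br 0) (bY 1) (norm_nonneg _) ((norm_nonneg _).trans (br 0))
      _ = _ := by ring
  have hsw : ∀ t : ℝ, 0 < t → t ^ (expo P 1).re = t ^ (expo P 0).re * t ^ (2 * P.ν.re) := by
    intro t ht
    rw [← Real.rpow_add ht, re_expo_zero, re_expo_one]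
    congr 1
    ring
  have h2 : y ^ (expo P 0).re * r ^ (expo P 1).re ≤ y ^ (expo P 1).re * r ^ (expo P 0).re := by
    rw [hsw r hr, hsw y hy]
    have : r ^ (2 * P.ν.re) ≤ y ^ (2 * P.ν.re) :=
      Real.rpow_le_rpow hr.le hry (by linarith [hP.nu_re])
    have := hpos y hy (expo P 0).re
    have := hpos r hr (expo P 0).re
    calc _ = (y ^ (expo P 0).re * r ^ (expo P 0).re) * r ^ (2 * P.ν.re) := by ring
      _ ≤ (y ^ (expo P 0).re * r ^ (expo P 0).re) * y ^ (2 * P.ν.re) := by gcongr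
      _ = _ := by ring
  have t2 : ‖bes P 0 lam y * bes P 1 lam r‖ ≤ K ^ 2 * y ^ (expo P 1).re * r ^ (expo P 0).re := by
    rw [norm_mul]
    calc _ ≤ _ := mul_le_mul (bY 0) (br 1) (norm_nonneg _) ((norm_nonneg _).trans (bY 0))
      _ = K ^ 2 * (y ^ (expo P 0).re * r ^ (expo P 1).re) := by ring
      _ ≤ K ^ 2 * (y ^ (expo P 1).re * r ^ (expo P 0).re) := by gcongr
      _ = _ := by ring
  refine (norm_sub_le _ _).trans ((add_le_add t1 t2).trans (le_of_eq ?_))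
  ring

section

/-! ### Variation of constants -/

/-- Every increment is dominated by the corresponding increment of the real primitive of `‖f‖`. -/
theorem absolutelyContinuous_integral {f : ℝ → ℂ} {a b : ℝ} (h : IntervalIntegrable f volume a b) :
    AbsolutelyContinuousOnInterval (fun x => ∫ v in a..x, f v) a b := by
  have hn := h.norm.absolutelyContinuousOnInterval_intervalIntegral (c := a) Set.left_mem_uIcc
  unfold AbsolutelyContinuousOnInterval at hn ⊢
  refine squeeze_zero' (Eventually.of_forall fun _ => Finset.sum_nonneg fun _ _ => dist_nonneg)
    ?_ hn
  rw [eventually_inf_principal]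
  refine Eventually.of_forall fun E hE => Finset.sum_le_sum fun i hi => ?_
  have hmem := hE.1 i hi
  have sub : ∀ u ∈ Set.uIcc a b, IntervalIntegrable f volume a u := fun u hu =>
    h.mono_set (Set.uIcc_subset_uIcc Set.left_mem_uIcc hu)
  have h1 := sub _ hmem.1
  have h2 := sub _ hmem.2
  rw [dist_comm, dist_eq_norm, dist_comm, Real.dist_eq,
    intervalIntegral.integral_interval_sub_left h2 h1,
    intervalIntegral.integral_interval_sub_left h2.norm h1.norm]
  exact intervalIntegral.norm_integral_le_abs_integral_norm

/-- The function with coefficients `α, β` in the basis of model solutions. -/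
def hval (P : Params) (lam : ℂ) (α β : ℝ → ℂ) (y : ℝ) : ℂ :=
  α y * bes P 0 lam y + β y * bes P 1 lam y

/-- The quasi-derivative of `hval`. -/
def hder (P : Params) (lam : ℂ) (α β : ℝ → ℂ) (y : ℝ) : ℂ :=
  α y * bes' P 0 lam y + β y * bes' P 1 lam y

/-- The coefficients of a solution of `y'' = (ν₀/y² + Q - λ) y` on `(b, ∞)` in the basis of the
model solutions (method of variation of constants). -/
structure HSol (P : Params) (Q : ℝ → ℂ) (lam : ℂ) (b : ℝ) (α β : ℝ → ℂ) : Prop where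
  integrable : ∀ x y, b < x → b < y →
    IntervalIntegrable (fun t => Q t * hval P lam α β t) volume x y
  eqα : ∀ x y, b < x → b < y → α y = α x - ∫ t in x..y, bes P 1 lam t * (Q t * hval P lam α β t)
  eqβ : ∀ x y, b < x → b < y → β y = β x + ∫ t in x..y, bes P 0 lam t * (Q t * hval P lam α β t)

variable {P : Params} {Q : ℝ → ℂ} {lam : ℂ} {b : ℝ} {α β α₂ β₂ : ℝ → ℂ}

theorem Admissible.intervalIntegrable_bes_mul (hP : Admissible P) (j : Fin 2) {f : ℝ → ℂ}
    {x y : ℝ} (hx : 0 < x) (hy : 0 < y) (hf : IntervalIntegrable f volume x y) :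
    IntervalIntegrable (fun t => bes P j lam t * f t) volume x y := by
  refine hf.continuousOn_mul ((hP.continuousOn_bes j lam).mono fun t ht => ?_)
  have := ht.1
  exact lt_of_lt_of_le (lt_min hx hy) this

theorem HSol.int_bes (hP : Admissible P) (hb : 0 ≤ b) (h : HSol P Q lam b α β) (j : Fin 2)
    {x y : ℝ} (hx : b < x) (hy : b < y) :
    IntervalIntegrable (fun t => bes P j lam t * (Q t * hval P lam α β t)) volume x y :=
  hP.intervalIntegrable_bes_mul j (hb.trans_lt hx) (hb.trans_lt hy) (h.integrable x y hx hy)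

theorem HSol.mono (h : HSol P Q lam b α β) {b' : ℝ} (hb : b ≤ b') : HSol P Q lam b' α β :=
  ⟨fun x y hx hy => h.integrable x y (hb.trans_lt hx) (hb.trans_lt hy),
    fun x y hx hy => h.eqα x y (hb.trans_lt hx) (hb.trans_lt hy),
    fun x y hx hy => h.eqβ x y (hb.trans_lt hx) (hb.trans_lt hy)⟩

theorem HSol.linear (hP : Admissible P) (hb : 0 ≤ b) (h₁ : HSol P Q lam b α β)
    (h₂ : HSol P Q lam b α₂ β₂) (c₁ c₂ : ℂ) :
    HSol P Q lam b (fun y => c₁ * α y + c₂ * α₂ y) (fun y => c₁ * β y + c₂ * β₂ y) := by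
  have e : ∀ t, hval P lam (fun y => c₁ * α y + c₂ * α₂ y) (fun y => c₁ * β y + c₂ * β₂ y) t =
      c₁ * hval P lam α β t + c₂ * hval P lam α₂ β₂ t := fun t => by
    unfold hval
    ring
  refine ⟨fun x y hx hy => ?_, fun x y hx hy => ?_, fun x y hx hy => ?_⟩
  · have := ((h₁.integrable x y hx hy).const_mul c₁).add ((h₂.integrable x y hx hy).const_mul c₂)
    refine this.congr fun t _ => ?_
    simp only [e]
    ring
  · have i1 := (h₁.int_bes hP hb 1 hx hy).const_mul c₁
    have i2 := (h₂.int_bes hP hb 1 hx hy).const_mul c₂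
    have : ∫ t in x..y, bes P 1 lam t * (Q t * hval P lam (fun y => c₁ * α y + c₂ * α₂ y)
        (fun y => c₁ * β y + c₂ * β₂ y) t) =
        c₁ * (∫ t in x..y, bes P 1 lam t * (Q t * hval P lam α β t)) +
        c₂ * ∫ t in x..y, bes P 1 lam t * (Q t * hval P lam α₂ β₂ t) := by
      rw [← intervalIntegral.integral_const_mul, ← intervalIntegral.integral_const_mul,
        ← intervalIntegral.integral_add i1 i2]
      refine intervalIntegral.integral_congr fun t _ => ?_
      simp only [e]
      ring
    rw [this, h₁.eqα x y hx hy, h₂.eqα x y hx hy]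
    ring
  · have i1 := (h₁.int_bes hP hb 0 hx hy).const_mul c₁
    have i2 := (h₂.int_bes hP hb 0 hx hy).const_mul c₂
    have : ∫ t in x..y, bes P 0 lam t * (Q t * hval P lam (fun y => c₁ * α y + c₂ * α₂ y)
        (fun y => c₁ * β y + c₂ * β₂ y) t) =
        c₁ * (∫ t in x..y, bes P 0 lam t * (Q t * hval P lam α β t)) +
        c₂ * ∫ t in x..y, bes P 0 lam t * (Q t * hval P lam α₂ β₂ t) := by
      rw [← intervalIntegral.integral_const_mul, ← intervalIntegral.integral_const_mul,
        ← intervalIntegral.integral_add i1 i2]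
      refine intervalIntegral.integral_congr fun t _ => ?_
      simp only [e]
      ring
    rw [this, h₁.eqβ x y hx hy, h₂.eqβ x y hx hy]
    ring

/-- The Wronskian of two solutions is constant. -/
theorem HSol.wronskian_const (hP : Admissible P) (hb : 0 ≤ b) (h₁ : HSol P Q lam b α β)
    (h₂ : HSol P Q lam b α₂ β₂) {x y : ℝ} (hx : b < x) (hy : b < y) :
    α y * β₂ y - β y * α₂ y = α x * β₂ x - β x * α₂ x := by
  set F : ℝ → ℂ := fun z => ∫ t in x..z, bes P 1 lam t * (Q t * hval P lam α β t) with hF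
  set G : ℝ → ℂ := fun z => ∫ t in x..z, bes P 0 lam t * (Q t * hval P lam α β t) with hG
  set F₂ : ℝ → ℂ := fun z => ∫ t in x..z, bes P 1 lam t * (Q t * hval P lam α₂ β₂ t) with hF₂
  set G₂ : ℝ → ℂ := fun z => ∫ t in x..z, bes P 0 lam t * (Q t * hval P lam α₂ β₂ t) with hG₂
  have hmem : ∀ z ∈ Set.uIcc x y, b < z := fun z hz => (lt_min hx hy).trans_le hz.1
  have acF := absolutelyContinuous_integral (h₁.int_bes hP hb 1 hx hy)
  have acG := absolutelyContinuous_integral (h₁.int_bes hP hb 0 hx hy)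
  have acF₂ := absolutelyContinuous_integral (h₂.int_bes hP hb 1 hx hy)
  have acG₂ := absolutelyContinuous_integral (h₂.int_bes hP hb 0 hx hy)
  have acc : ∀ c : ℂ, AbsolutelyContinuousOnInterval (fun _ : ℝ => c) x y := fun c =>
    (LipschitzWith.const c).lipschitzOnWith.absolutelyContinuousOnInterval
  -- As the potential is only integrable, the coefficients have derivatives merely almost
  -- everywhere. Absolute continuity of `W` together with `W' = 0` almost everywhere still gives
  -- constancy.
  set W : ℝ → ℂ := fun z => (α x - F z) * (β₂ x + G₂ z) - (β x + G z) * (α₂ x - F₂ z) with hW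
  have acW : AbsolutelyContinuousOnInterval W x y :=
    (((acc (α x)).sub acF).smul ((acc (β₂ x)).add acG₂)).sub
      (((acc (β x)).add acG).smul ((acc (α₂ x)).sub acF₂))
  have hWd : ∀ᵐ z, z ∈ Set.uIcc x y → HasDerivAt W 0 z := by
    filter_upwards [(h₁.int_bes hP hb 1 hx hy).ae_hasDerivAt_integral,
      (h₁.int_bes hP hb 0 hx hy).ae_hasDerivAt_integral,
      (h₂.int_bes hP hb 1 hx hy).ae_hasDerivAt_integral,
      (h₂.int_bes hP hb 0 hx hy).ae_hasDerivAt_integral] with z d1 d2 d3 d4 hz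
    have hF' := d1 hz x Set.left_mem_uIcc
    have hG' := d2 hz x Set.left_mem_uIcc
    have hF₂' := d3 hz x Set.left_mem_uIcc
    have hG₂' := d4 hz x Set.left_mem_uIcc
    have := ((hF'.const_sub (α x)).mul (hG₂'.const_add (β₂ x))).sub
      ((hG'.const_add (β x)).mul (hF₂'.const_sub (α₂ x)))
    refine this.congr_deriv ?_
    have e1 := h₁.eqα x z hx (hmem z hz)
    have e2 := h₁.eqβ x z hx (hmem z hz)
    have e3 := h₂.eqα x z hx (hmem z hz)
    have e4 := h₂.eqβ x z hx (hmem z hz)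
    rw [← e1, ← e2, ← e3, ← e4]
    unfold hval
    ring
  obtain ⟨C, hC⟩ := acW.const_of_ae_hasDerivAt_zero hWd
  have hxW := hC x Set.left_mem_uIcc
  have hyW := hC y Set.right_mem_uIcc
  have hx0 : W x = α x * β₂ x - β x * α₂ x := by simp [hW, hF, hG, hF₂, hG₂]
  have hy0 : W y = α y * β₂ y - β y * α₂ y := by
    rw [h₁.eqα x y hx hy, h₁.eqβ x y hx hy, h₂.eqα x y hx hy, h₂.eqβ x y hx hy]
  rw [← hx0, ← hy0, hxW, hyW]

/-- The combined integrand carries the factor `v(z)u(t) - u(z)v(t)`, which vanishes at `t = z` and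
is `O(|z - y|)`. Multiplied by `∫‖f‖ → 0`, the expression is `o(|z - y|)`, although neither
primitive alone need be differentiable at `y`. -/
theorem hasDerivAt_integral_mul_sub {f u v : ℝ → ℂ} {u' v' : ℂ} {y : ℝ}
    (hf : ∀ᶠ z in 𝓝 y, IntervalIntegrable f volume y z ∧
      IntervalIntegrable (fun t => u t * f t) volume y z ∧
      IntervalIntegrable (fun t => v t * f t) volume y z)
    (hu : HasDerivAt u u' y) (hv : HasDerivAt v v' y) :
    HasDerivAt (fun z => v z * (∫ t in y..z, u t * f t) - u z * ∫ t in y..z, v t * f t) 0 y := by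
  set N : ℝ → ℝ := fun z => |∫ t in y..z, ‖f t‖| with hN
  have hN0 : Tendsto N (𝓝 y) (𝓝 0) := by
    obtain ⟨δ, hδ, hball⟩ := Metric.eventually_nhds_iff.1 hf
    have h1 : IntervalIntegrable f volume (y - δ / 2) (y + δ / 2) :=
      ((hball (y := y - δ / 2) (by rw [Real.dist_eq]; rw [abs_lt]; constructor <;> linarith)).1.symm).trans
        (hball (y := y + δ / 2) (by rw [Real.dist_eq]; rw [abs_lt]; constructor <;> linarith)).1
    have h2 := intervalIntegral.continuousOn_primitive_interval' (a := y) h1.norm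
      (by rw [Set.uIcc_of_le (by linarith)]; constructor <;> linarith)
    have h3 : ContinuousAt (fun z => ∫ t in y..z, ‖f t‖) y := h2.continuousAt (by
      rw [Set.uIcc_of_le (by linarith)]
      exact Icc_mem_nhds (by linarith) (by linarith))
    have := h3.abs.tendsto
    simpa using this
  have lip : ∀ {w : ℝ → ℂ} {w' : ℂ}, HasDerivAt w w' y → ∃ C : ℝ, 0 < C ∧
      ∀ᶠ z in 𝓝 y, ‖w z - w y‖ ≤ C * |z - y| := by
    intro w w' hw
    obtain ⟨C, hC, h⟩ := hw.isBigO_sub.exists_pos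
    exact ⟨C, hC, by simpa [isBigOWith_iff] using h⟩
  obtain ⟨Cu, hCu, hu1⟩ := lip hu
  obtain ⟨Cv, hCv, hv1⟩ := lip hv
  have bd : ∀ᶠ z in 𝓝 y, ‖v z * (∫ t in y..z, u t * f t) - u z * ∫ t in y..z, v t * f t‖ ≤
      (((Cu * (‖v y‖ + 1) + Cv * (‖u y‖ + 1)) * 2) * N z) * |z - y| := by
    obtain ⟨δ, hδ, hb⟩ := Metric.eventually_nhds_iff.1 (hf.and (hu1.and hv1))
    filter_upwards [Metric.ball_mem_nhds y hδ,
      hu.continuousAt.norm.tendsto.eventually (gt_mem_nhds (lt_add_one ‖u y‖)),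
      hv.continuousAt.norm.tendsto.eventually (gt_mem_nhds (lt_add_one ‖v y‖))] with z hz hzu hzv
    have hzb := hb hz
    obtain ⟨⟨i0, iu, iv⟩, lu, lv⟩ := hzb
    have e : v z * (∫ t in y..z, u t * f t) - u z * ∫ t in y..z, v t * f t =
        ∫ t in y..z, (v z * (u t - u z) - u z * (v t - v z)) * f t := by
      rw [← intervalIntegral.integral_const_mul, ← intervalIntegral.integral_const_mul,
        ← intervalIntegral.integral_sub (iu.const_mul _) (iv.const_mul _)]
      refine intervalIntegral.integral_congr fun t _ => ?_
      ring
    rw [e]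
    have h1 : ∀ t ∈ Set.uIoc y z, ‖(v z * (u t - u z) - u z * (v t - v z)) * f t‖ ≤
        (((Cu * (‖v y‖ + 1) + Cv * (‖u y‖ + 1)) * 2) * |z - y|) * ‖f t‖ := by
      intro t ht
      have hty : |t - y| ≤ |z - y| := by
        have := Set.abs_sub_left_of_mem_uIcc (Set.uIoc_subset_uIcc ht)
        simpa using this
      have htb := hb (y := t) (by
        rw [Real.dist_eq]
        exact hty.trans_lt (by simpa [Real.dist_eq] using hz))
      rw [norm_mul]
      refine mul_le_mul_of_nonneg_right ?_ (norm_nonneg _)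
      have a1 : ‖u t - u z‖ ≤ Cu * (2 * |z - y|) := by
        have := norm_sub_le (u t - u y) (u z - u y)
        rw [sub_sub_sub_cancel_right] at this
        have h3 : Cu * |t - y| ≤ Cu * |z - y| := by gcongr
        linarith [htb.2.1]
      have a2 : ‖v t - v z‖ ≤ Cv * (2 * |z - y|) := by
        have := norm_sub_le (v t - v y) (v z - v y)
        rw [sub_sub_sub_cancel_right] at this
        have h3 : Cv * |t - y| ≤ Cv * |z - y| := by gcongr
        linarith [htb.2.2]
      refine (norm_sub_le _ _).trans ?_
      rw [norm_mul, norm_mul]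
      calc ‖v z‖ * ‖u t - u z‖ + ‖u z‖ * ‖v t - v z‖ ≤
          (‖v y‖ + 1) * (Cu * (2 * |z - y|)) + (‖u y‖ + 1) * (Cv * (2 * |z - y|)) := by gcongr
        _ = _ := by ring
    have h2 := intervalIntegral.norm_integral_le_abs_of_norm_le
      ((ae_restrict_iff' measurableSet_uIoc).2 (Eventually.of_forall h1)) (i0.norm.const_mul _)
    refine h2.trans (le_of_eq ?_)
    rw [intervalIntegral.integral_const_mul, abs_mul, abs_of_nonneg (by positivity)]
    simp only [hN]
    ring
  rw [hasDerivAt_iff_isLittleO]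
  simp only [intervalIntegral.integral_same, mul_zero, sub_zero, smul_zero]
  rw [isLittleO_iff]
  intro ε hε
  have hlim : Tendsto (fun z => ((Cu * (‖v y‖ + 1) + Cv * (‖u y‖ + 1)) * 2) * N z) (𝓝 y)
      (𝓝 (((Cu * (‖v y‖ + 1) + Cv * (‖u y‖ + 1)) * 2) * 0)) := hN0.const_mul _
  rw [mul_zero] at hlim
  filter_upwards [bd, hlim.eventually (gt_mem_nhds hε)] with z hz hzε
  refine hz.trans ?_
  rw [Real.norm_eq_abs]
  gcongr

/-- Variation of the coefficients contributes nothing to the first derivative, by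
`hasDerivAt_integral_mul_sub`. So `hder` is the derivative at every point, not only almost
everywhere. -/
theorem HSol.hasDerivAt (hP : Admissible P) (hb : 0 ≤ b) (h : HSol P Q lam b α β)
    {y : ℝ} (hy : b < y) : HasDerivAt (hval P lam α β) (hder P lam α β y) y := by
  have hy0 := hb.trans_lt hy
  have d0 := hP.hasDerivAt_bes 0 lam hy0
  have d1 := hP.hasDerivAt_bes 1 lam hy0
  have h1 := hasDerivAt_integral_mul_sub (f := fun t => Q t * hval P lam α β t)
    (by
      filter_upwards [Ioi_mem_nhds hy] with z hz
      exact ⟨h.integrable y z hy hz, h.int_bes hP hb 0 hy hz, h.int_bes hP hb 1 hy hz⟩) d0 d1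
  have h2 := ((d0.const_mul (α y)).add (d1.const_mul (β y))).add h1
  refine (h2.congr_deriv (by rw [add_zero]; rfl)).congr_of_eventuallyEq ?_
  filter_upwards [Ioi_mem_nhds hy] with z hz
  rw [hval, h.eqα y z hy hz, h.eqβ y z hy hz]
  simp only [Pi.add_apply]
  ring

theorem wronskian_hval (hP : Admissible P) (lam : ℂ) (α β α₂ β₂ : ℝ → ℂ) {y : ℝ} (hy : 0 < y) :
    hval P lam α β y * hder P lam α₂ β₂ y - hder P lam α β y * hval P lam α₂ β₂ y =
      α y * β₂ y - β y * α₂ y := by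
  have := hP.bes_wronskian lam hy
  unfold hval hder
  linear_combination (α y * β₂ y - β y * α₂ y) * this

/-- Coefficients from the value and the derivative. -/
theorem coeff_of_hval (hP : Admissible P) (lam : ℂ) (α β : ℝ → ℂ) {y : ℝ} (hy : 0 < y) :
    α y = hval P lam α β y * bes' P 1 lam y - hder P lam α β y * bes P 1 lam y ∧
    β y = hder P lam α β y * bes P 0 lam y - hval P lam α β y * bes' P 0 lam y := by
  have := hP.bes_wronskian lam hy
  unfold hval hder
  constructor
  · linear_combination (-α y) * this
  · linear_combination (-β y) * this

end

section

/-! ### Solutions on the half-line -/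

/-- On `(x - δ, x)` the mass of `m` is small uniformly in `x`, by absolute continuity of the
integral. Further left the exponential is at most `exp(-Nδ)`. Such a weight makes a Volterra
operator a contraction without any smallness of the potential. -/
theorem exists_exp_weight {m : ℝ → ℝ} (hm : Integrable m) (hm0 : ∀ t, 0 ≤ m t) {ε : ℝ}
    (hε : 0 < ε) : ∃ N : ℝ, 0 ≤ N ∧ ∀ x,
      Integrable (fun t => if t < x then m t * Real.exp (N * (t - x)) else 0) ∧
      ∫ t, (if t < x then m t * Real.exp (N * (t - x)) else 0) ≤ ε := by
  obtain ⟨δ, hδ, hsmall⟩ : ∃ δ : ℝ, 0 < δ ∧ ∀ x, ∫ t in Set.Ioo (x - δ) x, m t ≤ ε / 2 := by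
    have hfin : ∫⁻ t, ENNReal.ofReal (m t) ≠ ⊤ := by
      rw [← ofReal_integral_eq_lintegral_ofReal hm (Eventually.of_forall hm0)]
      exact ENNReal.ofReal_ne_top
    obtain ⟨δ, hδ, h⟩ := exists_pos_setLIntegral_lt_of_measure_lt hfin
      (ε := ENNReal.ofReal (ε / 2)) (by simpa using (by linarith : (0 : ℝ) < ε / 2))
    obtain ⟨δ', hδ', hlt⟩ := ENNReal.lt_iff_exists_nnreal_btwn.1 hδ
    refine ⟨δ', by exact_mod_cast hδ', fun x => ?_⟩
    have h1 := h (Set.Ioo (x - δ') x) (by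
      rw [Real.volume_Ioo]
      simpa using hlt)
    rw [integral_eq_lintegral_of_nonneg_ae (Eventually.of_forall hm0)
      hm.aestronglyMeasurable.restrict]
    exact ENNReal.toReal_le_of_le_ofReal (by linarith) h1.le
  set T := ∫ t, m t with hT
  have hT0 : 0 ≤ T := integral_nonneg hm0
  obtain ⟨N, hN0, hN⟩ : ∃ N : ℝ, 0 ≤ N ∧ Real.exp (-(N * δ)) * T ≤ ε / 2 := by
    have : Tendsto (fun N : ℝ => Real.exp (-(N * δ)) * T) atTop (𝓝 (0 * T)) :=
      (Real.tendsto_exp_neg_atTop_nhds_zero.comp (tendsto_id.atTop_mul_const hδ)).mul_const T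
    rw [zero_mul] at this
    obtain ⟨N, hN, hN0⟩ := ((this.eventually (gt_mem_nhds (by linarith : 0 < ε / 2))).and
      (eventually_ge_atTop 0)).exists
    exact ⟨N, hN0, hN.le⟩
  refine ⟨N, hN0, fun x => ?_⟩
  have hint : Integrable (fun t => if t < x then m t * Real.exp (N * (t - x)) else 0) := by
    refine hm.mono' ?_ (Eventually.of_forall fun t => ?_)
    · have : (fun t => if t < x then m t * Real.exp (N * (t - x)) else 0) =
          (Set.Iio x).indicator (fun t => m t * Real.exp (N * (t - x))) := by
        funext t
        simp [Set.indicator_apply]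
      rw [this]
      exact (hm.aestronglyMeasurable.mul
        (Continuous.aestronglyMeasurable (by fun_prop))).indicator measurableSet_Iio
    · split_ifs with h
      · rw [norm_mul, Real.norm_of_nonneg (hm0 t), Real.norm_of_nonneg (Real.exp_pos _).le]
        refine mul_le_of_le_one_right (hm0 t) (Real.exp_le_one_iff.2 ?_)
        nlinarith
      · simpa using hm0 t
  refine ⟨hint, ?_⟩
  have hpt : ∀ t, (if t < x then m t * Real.exp (N * (t - x)) else 0) ≤
      Real.exp (-(N * δ)) * m t + (Set.Ioo (x - δ) x).indicator m t := by
    intro t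
    have h0 : 0 ≤ Real.exp (-(N * δ)) * m t := mul_nonneg (Real.exp_pos _).le (hm0 t)
    have h1 : 0 ≤ (Set.Ioo (x - δ) x).indicator m t := Set.indicator_nonneg (fun t _ => hm0 t) t
    split_ifs with h
    · by_cases h2 : x - δ < t
      · rw [Set.indicator_of_mem (show t ∈ Set.Ioo (x - δ) x from ⟨h2, h⟩)]
        have : m t * Real.exp (N * (t - x)) ≤ m t :=
          mul_le_of_le_one_right (hm0 t) (Real.exp_le_one_iff.2 (by nlinarith))
        linarith
      · have : m t * Real.exp (N * (t - x)) ≤ Real.exp (-(N * δ)) * m t := by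
          rw [mul_comm]
          refine mul_le_mul_of_nonneg_right (Real.exp_le_exp.2 ?_) (hm0 t)
          nlinarith
        linarith
    · linarith
  have hind : Integrable ((Set.Ioo (x - δ) x).indicator m) := hm.indicator measurableSet_Ioo
  calc _ ≤ ∫ t, (Real.exp (-(N * δ)) * m t + (Set.Ioo (x - δ) x).indicator m t) :=
        integral_mono hint ((hm.const_mul _).add hind) hpt
    _ = Real.exp (-(N * δ)) * T + ∫ t in Set.Ioo (x - δ) x, m t := by
        rw [integral_add (hm.const_mul _) hind, integral_const_mul,
          integral_indicator measurableSet_Ioo]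
    _ ≤ ε := by linarith [hsmall x]

/-- The weight of the class of potentials in the distance to the singular point. -/
def wt (P : Params) (t : ℝ) : ℝ := t ^ min 0 (1 - 2 * P.ν.re)

theorem wt_pos (P : Params) {t : ℝ} (ht : 0 < t) : 0 < wt P t := Real.rpow_pos_of_pos ht _

theorem rpow_le_wt (P : Params) {s t Y : ℝ} (hs : min 0 (1 - 2 * P.ν.re) ≤ s) (ht : 0 < t)
    (hY : t ≤ Y) : t ^ s ≤ Y ^ (s - min 0 (1 - 2 * P.ν.re)) * wt P t := by
  have h : t ^ s = t ^ (s - min 0 (1 - 2 * P.ν.re)) * wt P t := by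
    rw [wt, ← Real.rpow_add ht]
    congr 1
    ring
  rw [h]
  exact mul_le_mul_of_nonneg_right (Real.rpow_le_rpow ht.le hY (by linarith)) (wt_pos P ht).le

/-- A potential on the half-line, as a function of the distance to the singular point. -/
structure HalfPot (P : Params) (Q : ℝ → ℂ) : Prop where
  meas : Measurable Q
  int : ∀ Y, IntegrableOn (fun t => wt P t * ‖Q t‖) (Set.Ioc 0 Y)

/-- The Volterra kernel of the integral equation of the solutions. -/
def kern (P : Params) (Q : ℝ → ℂ) (lam : ℂ) (x t : ℝ) : ℂ :=
  if 0 < t ∧ t < x then green P lam x t * Q t else 0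

/-- The function `s_j`, up to a constant factor, in the distance to the singular point. -/
def hsol (P : Params) (Q : ℝ → ℂ) (j : Fin 2) (lam : ℂ) (y : ℝ) : ℂ :=
  volterraSol (kern P Q lam) (bes P j lam) y

variable {P : Params} {Q : ℝ → ℂ}

/-- The density `wt · |Q|` cut off to `(0, Y]`. -/
def dens (P : Params) (Q : ℝ → ℂ) (Y t : ℝ) : ℝ :=
  (Set.Ioc 0 Y).indicator (fun t => wt P t * ‖Q t‖) t

theorem dens_nonneg (P : Params) (Q : ℝ → ℂ) (Y t : ℝ) : 0 ≤ dens P Q Y t :=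
  Set.indicator_nonneg (fun _ ht => mul_nonneg (wt_pos P ht.1).le (norm_nonneg _)) t

theorem HalfPot.integrable_dens (hQ : HalfPot P Q) (Y : ℝ) : Integrable (dens P Q Y) :=
  (hQ.int Y).integrable_indicator measurableSet_Ioc

theorem dens_of_mem {Y t : ℝ} (h0 : 0 < t) (h1 : t ≤ Y) : dens P Q Y t = wt P t * ‖Q t‖ :=
  Set.indicator_of_mem (show t ∈ Set.Ioc 0 Y from ⟨h0, h1⟩) _

theorem measurableSet_triangle : MeasurableSet {z : ℝ × ℝ | 0 < z.2 ∧ z.2 < z.1} :=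
  (measurableSet_lt measurable_const measurable_snd).inter
    (measurableSet_lt measurable_snd measurable_fst)

theorem HalfPot.measurable_kern (hP : Admissible P) (hQ : HalfPot P Q) (lam : ℂ) :
    Measurable (Function.uncurry (kern P Q lam)) := by
  have h0 := hP.measurable_bes 0 lam
  have h1 := hP.measurable_bes 1 lam
  have hq := hQ.meas
  have : Measurable (fun z : ℝ × ℝ => green P lam z.1 z.2 * Q z.2) := by
    unfold green
    exact (((h0.comp measurable_snd).mul (h1.comp measurable_fst)).sub
      ((h0.comp measurable_fst).mul (h1.comp measurable_snd))).mul (hq.comp measurable_snd)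
  exact Measurable.ite measurableSet_triangle this measurable_const

/-- Majorant of the kernel with a bound `A` for the Green kernel. -/
def kmaj (Q : ℝ → ℂ) (A : ℝ → ℝ → ℝ) (x t : ℝ) : ℝ := if 0 < t ∧ t < x then A x t * ‖Q t‖ else 0

theorem norm_kern_le {lam : ℂ} {A : ℝ → ℝ → ℝ} {x t : ℝ}
    (hA : 0 < t → t < x → ‖green P lam x t‖ ≤ A x t) : ‖kern P Q lam x t‖ ≤ kmaj Q A x t := by
  unfold kern kmaj
  split_ifs with h
  · rw [norm_mul]
    exact mul_le_mul_of_nonneg_right (hA h.1 h.2) (norm_nonneg _)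
  · simp

theorem aestronglyMeasurable_kmaj_mul (hQ : Measurable Q) {A : ℝ → ℝ → ℝ} {p : ℝ → ℝ} (x : ℝ)
    (hA : Measurable (A x)) (hp : Measurable p) :
    AEStronglyMeasurable (fun t => kmaj Q A x t * p t) := by
  refine Measurable.aestronglyMeasurable (Measurable.mul ?_ hp)
  exact Measurable.ite ((measurableSet_lt measurable_const measurable_id).inter
    (measurableSet_lt measurable_id measurable_const)) (hA.mul hQ.norm) measurable_const

theorem kmaj_support (Q : ℝ → ℂ) (A : ℝ → ℝ → ℝ) (Y : ℝ) :
    ∀ x ∈ Set.Ioc 0 Y, ∀ t, t ∉ Set.Ioc 0 Y → kmaj Q A x t = 0 := by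
  intro x hx t ht
  unfold kmaj
  rw [if_neg]
  rintro ⟨h1, h2⟩
  exact ht ⟨h1, h2.le.trans hx.2⟩

theorem expo_re_ge (hP : Admissible P) (j : Fin 2) : (expo P 0).re ≤ (expo P j).re := by
  have := hP.nu_re
  fin_cases j
  · simp
  · simp only [Fin.mk_one, re_expo_zero, re_expo_one]
    linarith

/-- The most singular product of two model solutions is of order `t^{2 Re μ₁} = t^{1 - 2 Re ν}`. So
the weight in the class `W` makes every product of two model solutions with the potential integrable
at the singular point. -/
theorem min_le_expo_add (hP : Admissible P) (j k : Fin 2) :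
    min 0 (1 - 2 * P.ν.re) ≤ (expo P j).re + (expo P k).re := by
  have h1 := expo_re_ge hP j
  have h2 := expo_re_ge hP k
  rw [re_expo_zero] at h1 h2
  exact (min_le_right _ _).trans (by linarith)

/-- With the Green kernel bounded by `x^{Re μ₂} t^{Re μ₁}` and the weight `x^{Re μ_j}`, what remains
under the integral is a multiple of the density `dens`. The exponential weight then makes the
operator norm at most one half, uniformly for `‖λ‖ ≤ L`. -/
theorem HalfPot.contracts_near (hP : Admissible P) (hQ : HalfPot P Q) {L Y : ℝ} (hY : 0 < Y)
    (j : Fin 2) : ∃ (K N F : ℝ), 0 ≤ N ∧ 0 ≤ F ∧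
      Contracts (kmaj Q fun x t => K * x ^ (expo P 1).re * t ^ (expo P 0).re) (Set.Ioc 0 Y)
        (fun x => x ^ (expo P j).re * Real.exp (N * x)) ∧
      ∀ lam : ℂ, ‖lam‖ ≤ L →
        (∀ x ∈ Set.Ioc 0 Y, ∀ t, ‖kern P Q lam x t‖ ≤
          kmaj Q (fun x t => K * x ^ (expo P 1).re * t ^ (expo P 0).re) x t) ∧
        (∀ x ∈ Set.Ioc 0 Y, ‖bes P j lam x‖ ≤
          F * (x ^ (expo P j).re * Real.exp (N * x))) := by
  obtain ⟨K, hK, hb⟩ := hP.exists_green_near_bound L Y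
  obtain ⟨F, hF, hbF⟩ := hP.exists_near_bound (L * Y ^ 2)
  set m := min 0 (1 - 2 * P.ν.re) with hm
  set s := (expo P 0).re + (expo P j).re with hs
  set C := Y ^ ((expo P 1).re - (expo P j).re) * Y ^ (s - m) with hC
  have hC0 : 0 < C := by positivity
  -- `KC` bounds the kernel relative to the weights, so `1/(2KC)` is the mass for which the
  -- contraction constant is one half.
  obtain ⟨N, hN, hexp⟩ := exists_exp_weight (hQ.integrable_dens Y) (dens_nonneg P Q Y)
    (ε := 1 / (2 * (K * C))) (by positivity)
  have hle1 : (expo P j).re ≤ (expo P 1).re := by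
    have := hP.nu_re
    fin_cases j
    · simp only [Fin.zero_eta, re_expo_zero, re_expo_one]
      linarith
    · simp
  have hpt : ∀ x ∈ Set.Ioc 0 Y, ∀ t, 
      kmaj Q (fun x t => K * x ^ (expo P 1).re * t ^ (expo P 0).re) x t *
        (t ^ (expo P j).re * Real.exp (N * t)) ≤
      K * C * (x ^ (expo P j).re * Real.exp (N * x)) *
        (if t < x then dens P Q Y t * Real.exp (N * (t - x)) else 0) := by
    intro x hx t
    by_cases h : 0 < t ∧ t < x
    · have htY : t ≤ Y := h.2.le.trans hx.2
      have hx0 := hx.1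
      rw [kmaj, if_pos h, if_pos h.2, dens_of_mem h.1 htY]
      have e1 : x ^ (expo P 1).re ≤ Y ^ ((expo P 1).re - (expo P j).re) * x ^ (expo P j).re := by
        have : x ^ (expo P 1).re = x ^ ((expo P 1).re - (expo P j).re) * x ^ (expo P j).re := by
          rw [← Real.rpow_add hx.1]
          congr 1
          ring
        rw [this]
        exact mul_le_mul_of_nonneg_right (Real.rpow_le_rpow hx.1.le hx.2 (by linarith))
          (Real.rpow_pos_of_pos hx.1 _).le
      have e2 : t ^ (expo P 0).re * t ^ (expo P j).re ≤ Y ^ (s - m) * wt P t := by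
        rw [← Real.rpow_add h.1]
        exact rpow_le_wt P (min_le_expo_add hP 0 j) h.1 htY
      have e3 : Real.exp (N * t) = Real.exp (N * x) * Real.exp (N * (t - x)) := by
        rw [← Real.exp_add]
        congr 1
        ring
      rw [e3]
      calc K * x ^ (expo P 1).re * t ^ (expo P 0).re * ‖Q t‖ *
            (t ^ (expo P j).re * (Real.exp (N * x) * Real.exp (N * (t - x)))) =
          (x ^ (expo P 1).re) * (t ^ (expo P 0).re * t ^ (expo P j).re) *
            (K * ‖Q t‖ * (Real.exp (N * x) * Real.exp (N * (t - x)))) := by ring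
        _ ≤ (Y ^ ((expo P 1).re - (expo P j).re) * x ^ (expo P j).re) * (Y ^ (s - m) * wt P t) *
            (K * ‖Q t‖ * (Real.exp (N * x) * Real.exp (N * (t - x)))) := by
              have := Real.rpow_pos_of_pos h.1 (expo P 0).re
              have := Real.rpow_pos_of_pos h.1 (expo P j).re
              have := Real.rpow_pos_of_pos hx.1 (expo P j).re
              gcongr
        _ = _ := by rw [hC]; ring
    · rw [kmaj, if_neg h, zero_mul]
      have h1 : 0 ≤ x ^ (expo P j).re := Real.rpow_nonneg hx.1.le _
      have h2 := dens_nonneg P Q Y t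
      split_ifs <;> positivity
  have hint : ∀ x ∈ Set.Ioc 0 Y, Integrable (fun t => kmaj Q (fun x t => K *
      x ^ (expo P 1).re * t ^ (expo P 0).re) x t *
      (t ^ (expo P j).re * Real.exp (N * t))) := by
    intro x hx
    refine ((hexp x).1.const_mul (K * C * (x ^ (expo P j).re * Real.exp (N * x)))).mono'
      (aestronglyMeasurable_kmaj_mul hQ.meas x (by fun_prop) (by fun_prop))
      (Eventually.of_forall fun t => ?_)
    rw [Real.norm_of_nonneg]
    · exact hpt x hx t
    · unfold kmaj
      split_ifs with h
      · have := Real.rpow_pos_of_pos h.1 (expo P 0).re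
        have := Real.rpow_pos_of_pos h.1 (expo P j).re
        have := Real.rpow_pos_of_pos hx.1 (expo P 1).re
        positivity
      · simp
  refine ⟨K, N, F, hN, hF.le, ⟨fun x hx => ?_, kmaj_support _ _ Y, hint,
    fun x hx => ?_⟩, fun lam hl => ⟨fun x hx t => ?_, fun x hx => ?_⟩⟩
  · have := Real.rpow_nonneg hx.1.le (expo P j).re
    positivity
  · have hx' : 0 ≤ x ^ (expo P j).re * Real.exp (N * x) :=
      mul_nonneg (Real.rpow_nonneg hx.1.le _) (Real.exp_pos _).le
    refine (integral_mono (hint x hx) ((hexp x).1.const_mul _) (hpt x hx)).trans ?_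
    rw [integral_const_mul]
    calc _ ≤ K * C * (x ^ (expo P j).re * Real.exp (N * x)) * (1 / (2 * (K * C))) :=
          mul_le_mul_of_nonneg_left (hexp x).2 (by positivity)
      _ = _ := by field_simp
  · exact norm_kern_le fun h1 h2 => hb lam t x hl h1 h2.le hx.2
  · have h1 := (hbF j lam x hx.1 (by
      have := hx.1
      have := hx.2
      have := (norm_nonneg lam).trans hl
      gcongr)).1
    refine h1.trans (mul_le_mul_of_nonneg_left ?_ hF.le)
    exact le_mul_of_one_le_right (Real.rpow_nonneg hx.1.le _)
      (Real.one_le_exp (mul_nonneg hN hx.1.le))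

theorem HalfPot.norm_hsol_near (hP : Admissible P) (hQ : HalfPot P Q) {L Y : ℝ} (hY : 0 < Y)
    (j : Fin 2) : ∃ C : ℝ, 0 ≤ C ∧ ∀ lam : ℂ, ‖lam‖ ≤ L → ∀ y ∈ Set.Ioc 0 Y,
      ‖hsol P Q j lam y‖ ≤ C * y ^ (expo P j).re := by
  obtain ⟨K, N, F, hN, hF, hc, hb⟩ := hQ.contracts_near hP (L := L) hY j
  refine ⟨2 * F * Real.exp (N * Y), by positivity, fun lam hl y hy => ?_⟩
  refine (hc.norm_sol_le (hb lam hl).1 hF (hb lam hl).2 hy).trans ?_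
  have h1 : Real.exp (N * y) ≤ Real.exp (N * Y) :=
    Real.exp_le_exp.2 (mul_le_mul_of_nonneg_left hy.2 hN)
  have h2 : 0 ≤ y ^ (expo P j).re := Real.rpow_nonneg hy.1.le _
  calc 2 * F * (y ^ (expo P j).re * Real.exp (N * y)) ≤
      2 * F * (y ^ (expo P j).re * Real.exp (N * Y)) := by gcongr
    _ = _ := by ring

theorem HalfPot.measurable_mul_hsol (hP : Admissible P) (hQ : HalfPot P Q) (j : Fin 2) (lam : ℂ)
    {Y : ℝ} (hY : 0 < Y) {g : ℝ → ℂ} (hg : Measurable g) (hg0 : ∀ t, t ∉ Set.Ioc 0 Y → g t = 0) :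
    Measurable (fun t => g t * hsol P Q j lam t) := by
  obtain ⟨K, N, F, hN, hF, hc, hb⟩ := hQ.contracts_near hP (L := ‖lam‖) hY j
  exact hc.measurable_mul_sol (hb lam le_rfl).1 (hQ.measurable_kern hP lam)
    (hP.measurable_bes j lam) hF (hb lam le_rfl).2 hg hg0

/-- Bound for the products occurring in the integral equation. -/
theorem HalfPot.norm_bes_mul_hsol (hP : Admissible P) (hQ : HalfPot P Q) (L : ℝ) {Y : ℝ}
    (hY : 0 < Y) (k j : Fin 2) : ∃ C : ℝ, 0 ≤ C ∧ ∀ lam : ℂ, ‖lam‖ ≤ L → ∀ t ∈ Set.Ioc 0 Y,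
      ‖bes P k lam t * (Q t * hsol P Q j lam t)‖ ≤ C * dens P Q Y t := by
  obtain ⟨C, hC, h1⟩ := hQ.norm_hsol_near hP (L := L) hY j
  obtain ⟨K, hK, h2⟩ := hP.exists_near_bound (L * Y ^ 2)
  refine ⟨K * C * Y ^ ((expo P k).re + (expo P j).re - min 0 (1 - 2 * P.ν.re)), by positivity,
    fun lam hl t ht => ?_⟩
  rw [dens_of_mem ht.1 ht.2, norm_mul, norm_mul]
  have b1 := h1 lam hl t ht
  have b2 := (h2 k lam t ht.1 (by
    have := ht.1
    have := ht.2
    have := (norm_nonneg lam).trans hl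
    gcongr)).1
  have b3 := rpow_le_wt P (min_le_expo_add hP k j) ht.1 ht.2
  rw [Real.rpow_add ht.1] at b3
  have h3 := Real.rpow_nonneg ht.1.le (expo P k).re
  have h4 := Real.rpow_nonneg ht.1.le (expo P j).re
  calc ‖bes P k lam t‖ * (‖Q t‖ * ‖hsol P Q j lam t‖) ≤
      (K * t ^ (expo P k).re) * (‖Q t‖ * (C * t ^ (expo P j).re)) := by gcongr
    _ = (t ^ (expo P k).re * t ^ (expo P j).re) * (K * C * ‖Q t‖) := by ring
    _ ≤ (Y ^ ((expo P k).re + (expo P j).re - min 0 (1 - 2 * P.ν.re)) * wt P t) *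
        (K * C * ‖Q t‖) := by gcongr
    _ = _ := by ring

theorem HalfPot.aesm_bes_mul_hsol (hP : Admissible P) (hQ : HalfPot P Q) (lam : ℂ) {Y : ℝ}
    (hY : 0 < Y) (k j : Fin 2) :
    AEStronglyMeasurable (fun t => bes P k lam t * (Q t * hsol P Q j lam t))
      (volume.restrict (Set.Ioc 0 Y)) := by
  have h := hQ.measurable_mul_hsol hP j lam hY (g := (Set.Ioc 0 Y).indicator
    (fun t => bes P k lam t * Q t))
    (((hP.measurable_bes k lam).mul hQ.meas).indicator measurableSet_Ioc)
    (fun t ht => Set.indicator_of_notMem ht _)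
  refine h.aestronglyMeasurable.congr ?_
  filter_upwards [ae_restrict_mem measurableSet_Ioc] with t ht
  rw [Set.indicator_of_mem ht]
  ring

theorem HalfPot.integrableOn_bes_mul_hsol (hP : Admissible P) (hQ : HalfPot P Q) (lam : ℂ) {Y : ℝ}
    (hY : 0 < Y) (k j : Fin 2) :
    IntegrableOn (fun t => bes P k lam t * (Q t * hsol P Q j lam t)) (Set.Ioc 0 Y) := by
  obtain ⟨C, hC, h⟩ := hQ.norm_bes_mul_hsol hP ‖lam‖ hY k j
  refine ((hQ.integrable_dens Y).const_mul C).integrableOn.mono'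
    (hQ.aesm_bes_mul_hsol hP lam hY k j) ?_
  filter_upwards [ae_restrict_mem measurableSet_Ioc] with t ht
  exact h lam le_rfl t ht

/-- `∫₀^y C_k Q s_j`. -/
def hint (P : Params) (Q : ℝ → ℂ) (k j : Fin 2) (lam : ℂ) (y : ℝ) : ℂ :=
  ∫ t in (0 : ℝ)..y, bes P k lam t * (Q t * hsol P Q j lam t)

theorem HalfPot.intervalIntegrable_bes_mul_hsol (hP : Admissible P) (hQ : HalfPot P Q) (lam : ℂ)
    {x y : ℝ} (hx : 0 ≤ x) (hy : 0 ≤ y) (k j : Fin 2) :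
    IntervalIntegrable (fun t => bes P k lam t * (Q t * hsol P Q j lam t)) volume x y := by
  rw [intervalIntegrable_iff]
  refine (hQ.integrableOn_bes_mul_hsol hP lam (Y := max x y + 1)
    (by linarith [le_max_left x y]) k j).mono_set ?_
  intro t ht
  exact ⟨(le_min hx hy).trans_lt ht.1, ht.2.trans (by linarith)⟩

theorem HalfPot.differentiable_hint (hP : Admissible P) (hQ : HalfPot P Q) (k j : Fin 2)
    {y : ℝ} (hy : 0 < y) : Differentiable ℂ (fun lam => hint P Q k j lam y) := by
  intro l
  set L := ‖l‖ + 1 with hL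
  have hU : IsOpen (Metric.ball (0 : ℂ) L) := Metric.isOpen_ball
  have hlU : ∀ lam ∈ Metric.ball (0 : ℂ) L, ‖lam‖ ≤ L := fun lam h => by
    simpa using (mem_ball_zero_iff.1 h).le
  obtain ⟨K, N, F, hN, hF, hc, hb⟩ := hQ.contracts_near hP (L := L) hy j
  have hsd : ∀ t ∈ Set.Ioc 0 y, DifferentiableOn ℂ (fun lam => hsol P Q j lam t)
      (Metric.ball (0 : ℂ) L) := fun t ht => by
    refine hc.differentiableOn_sol hU (fun lam h => (hb lam (hlU lam h)).1)
      (fun lam _ => hQ.measurable_kern hP lam) (fun lam _ => hP.measurable_bes j lam) hF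
      (fun lam h => (hb lam (hlU lam h)).2) (fun x _ t => ?_)
      (fun x _ => (hP.differentiable_bes j x).differentiableOn) ht
    unfold kern
    split_ifs with h
    · unfold green
      have := hP.differentiable_bes 0 t
      have := hP.differentiable_bes 1 t
      have := hP.differentiable_bes 0 x
      have := hP.differentiable_bes 1 x
      exact Differentiable.differentiableOn (by fun_prop)
    · exact differentiableOn_const _
  obtain ⟨C, hC, hbd⟩ := hQ.norm_bes_mul_hsol hP L hy k j
  have key := differentiableOn_integral_of_dominated hU (μ := volume)
    (F := fun lam t => (Set.Ioc 0 y).indicator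
      (fun t => bes P k lam t * (Q t * hsol P Q j lam t)) t) (b := fun t => C * dens P Q y t)
    (fun lam _ => (aestronglyMeasurable_indicator_iff measurableSet_Ioc).2
      (hQ.aesm_bes_mul_hsol hP lam hy k j))
    (fun t => by
      by_cases ht : t ∈ Set.Ioc 0 y
      · simp only [Set.indicator_of_mem ht]
        exact (hP.differentiable_bes k t).differentiableOn.mul ((hsd t ht).const_mul _)
      · simp only [Set.indicator_of_notMem ht]
        exact differentiableOn_const _)
    (fun lam h t => by
      by_cases ht : t ∈ Set.Ioc 0 y
      · rw [Set.indicator_of_mem ht]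
        exact hbd lam (hlU lam h) t ht
      · rw [Set.indicator_of_notMem ht, norm_zero]
        exact mul_nonneg hC (dens_nonneg P Q y t))
    ((hQ.integrable_dens y).const_mul C)
  have e : (fun lam => hint P Q k j lam y) = fun lam => ∫ t, (Set.Ioc 0 y).indicator
      (fun t => bes P k lam t * (Q t * hsol P Q j lam t)) t := by
    funext lam
    rw [hint, intervalIntegral.integral_of_le hy.le, integral_indicator measurableSet_Ioc]
  rw [e]
  exact key.differentiableAt (hU.mem_nhds (by simp [hL]))

/-- The coefficient of `C₁` in `s_j`. -/
def hal (P : Params) (Q : ℝ → ℂ) (j : Fin 2) (lam : ℂ) (y : ℝ) : ℂ :=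
  (if j = 0 then 1 else 0) - hint P Q 1 j lam y

/-- The coefficient of `C₂` in `s_j`. -/
def hbe (P : Params) (Q : ℝ → ℂ) (j : Fin 2) (lam : ℂ) (y : ℝ) : ℂ :=
  (if j = 1 then 1 else 0) + hint P Q 0 j lam y

theorem integral_kern_mul (s : ℝ → ℂ) (lam : ℂ) {x : ℝ} (hx : 0 < x) :
    ∫ t, kern P Q lam x t * s t = ∫ t in (0 : ℝ)..x, green P lam x t * (Q t * s t) := by
  rw [intervalIntegral.integral_of_le hx.le, integral_Ioc_eq_integral_Ioo,
    ← integral_indicator measurableSet_Ioo]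
  congr 1
  funext t
  unfold kern
  by_cases h : 0 < t ∧ t < x
  · rw [if_pos h, Set.indicator_of_mem (show t ∈ Set.Ioo 0 x from h)]
    ring
  · rw [if_neg h, Set.indicator_of_notMem (show t ∉ Set.Ioo 0 x from h), zero_mul]

theorem integral_green_mul {f : ℝ → ℂ} {lam : ℂ} {x y z : ℝ}
    (h0 : IntervalIntegrable (fun t => bes P 0 lam t * f t) volume x y)
    (h1 : IntervalIntegrable (fun t => bes P 1 lam t * f t) volume x y) :
    ∫ t in x..y, green P lam z t * f t =
      bes P 1 lam z * (∫ t in x..y, bes P 0 lam t * f t) -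
        bes P 0 lam z * ∫ t in x..y, bes P 1 lam t * f t := by
  rw [← intervalIntegral.integral_const_mul, ← intervalIntegral.integral_const_mul,
    ← intervalIntegral.integral_sub (h0.const_mul _) (h1.const_mul _)]
  refine intervalIntegral.integral_congr fun t _ => ?_
  simp only [green]
  ring

theorem integral_green'_mul {f : ℝ → ℂ} {lam : ℂ} {x y z : ℝ}
    (h0 : IntervalIntegrable (fun t => bes P 0 lam t * f t) volume x y)
    (h1 : IntervalIntegrable (fun t => bes P 1 lam t * f t) volume x y) :
    ∫ t in x..y, green' P lam z t * f t =
      bes' P 1 lam z * (∫ t in x..y, bes P 0 lam t * f t) -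
        bes' P 0 lam z * ∫ t in x..y, bes P 1 lam t * f t := by
  rw [← intervalIntegral.integral_const_mul, ← intervalIntegral.integral_const_mul,
    ← intervalIntegral.integral_sub (h0.const_mul _) (h1.const_mul _)]
  refine intervalIntegral.integral_congr fun t _ => ?_
  simp only [green']
  ring

theorem HalfPot.hsol_eq (hP : Admissible P) (hQ : HalfPot P Q) (j : Fin 2) (lam : ℂ) {x : ℝ}
    (hx : 0 < x) : hsol P Q j lam x = bes P j lam x +
      ∫ t in (0 : ℝ)..x, green P lam x t * (Q t * hsol P Q j lam t) := by
  obtain ⟨K, N, F, hN, hF, hc, hb⟩ := hQ.contracts_near hP (L := ‖lam‖) hx j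
  have := hc.sol_eq (hb lam le_rfl).1 (hQ.measurable_kern hP lam)
    (hP.measurable_bes j lam) hF (hb lam le_rfl).2 (x := x) ⟨hx, le_rfl⟩
  rw [← integral_kern_mul _ lam hx]
  exact this

theorem HalfPot.hsol_eq_hval (hP : Admissible P) (hQ : HalfPot P Q) (j : Fin 2) (lam : ℂ) {x : ℝ}
    (hx : 0 < x) : hsol P Q j lam x = hval P lam (hal P Q j lam) (hbe P Q j lam) x := by
  rw [hQ.hsol_eq hP j lam hx, integral_green_mul
    (hQ.intervalIntegrable_bes_mul_hsol hP lam le_rfl hx.le 0 j)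
    (hQ.intervalIntegrable_bes_mul_hsol hP lam le_rfl hx.le 1 j)]
  unfold hval hal hbe hint
  fin_cases j
  · simp
    ring
  · simp
    ring

theorem HalfPot.continuousOn_hint (hP : Admissible P) (hQ : HalfPot P Q) (k j : Fin 2) (lam : ℂ)
    (Y : ℝ) (hY : 0 ≤ Y) : ContinuousOn (hint P Q k j lam) (Set.Icc 0 Y) := by
  have := intervalIntegral.continuousOn_primitive_interval' (a := 0)
    (hQ.intervalIntegrable_bes_mul_hsol hP lam le_rfl hY k j) Set.left_mem_uIcc
  rwa [Set.uIcc_of_le hY] at this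

theorem HalfPot.intervalIntegrable (hQ : HalfPot P Q) {x y : ℝ} (hx : 0 ≤ x) (hy : 0 ≤ y) :
    IntervalIntegrable Q volume x y := by
  rw [intervalIntegrable_iff]
  set Y := max x y + 1 with hYdef
  have hY : 0 < Y := by linarith [le_max_left x y]
  have h1 : IntegrableOn Q (Set.Ioc 0 Y) := by
    refine ((hQ.integrable_dens Y).const_mul
      (Y ^ (0 - min 0 (1 - 2 * P.ν.re)))).integrableOn.mono' hQ.meas.aestronglyMeasurable ?_
    filter_upwards [ae_restrict_mem measurableSet_Ioc] with t ht
    rw [dens_of_mem ht.1 ht.2, ← mul_assoc]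
    have := rpow_le_wt P (min_le_left 0 (1 - 2 * P.ν.re)) ht.1 ht.2
    rw [Real.rpow_zero] at this
    exact le_mul_of_one_le_left (norm_nonneg _) this
  refine h1.mono_set fun t ht => ⟨(le_min hx hy).trans_lt ht.1, ht.2.trans (by linarith)⟩

theorem HalfPot.hSol (hP : Admissible P) (hQ : HalfPot P Q) (j : Fin 2) (lam : ℂ) :
    HSol P Q lam 0 (hal P Q j lam) (hbe P Q j lam) := by
  have hcong : ∀ k : Fin 2, ∀ x y : ℝ, 0 < x → 0 < y →
      ∫ t in x..y, bes P k lam t * (Q t * hval P lam (hal P Q j lam) (hbe P Q j lam) t) =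
        hint P Q k j lam y - hint P Q k j lam x := by
    intro k x y hx hy
    unfold hint
    rw [intervalIntegral.integral_interval_sub_left
      (hQ.intervalIntegrable_bes_mul_hsol hP lam le_rfl hy.le k j)
      (hQ.intervalIntegrable_bes_mul_hsol hP lam le_rfl hx.le k j)]
    refine intervalIntegral.integral_congr fun t ht => ?_
    have ht0 : 0 < t := (lt_min hx hy).trans_le ht.1
    simp only [hQ.hsol_eq_hval hP j lam ht0]
  refine ⟨fun x y hx hy => ?_, fun x y hx hy => ?_, fun x y hx hy => ?_⟩
  · refine (hQ.intervalIntegrable hx.le hy.le).mul_continuousOn ?_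
    have hsub : Set.uIcc x y ⊆ Set.Icc 0 (max x y) := fun t ht =>
      ⟨(le_min hx.le hy.le).trans ht.1, ht.2⟩
    have hpos : Set.uIcc x y ⊆ Set.Ioi 0 := fun t ht => (lt_min hx hy).trans_le ht.1
    have c := fun k => (hQ.continuousOn_hint hP k j lam (max x y)
      (hx.le.trans (le_max_left _ _))).mono hsub
    have b := fun k => (hP.continuousOn_bes k lam).mono hpos
    unfold hval hal hbe
    exact ((continuousOn_const.sub (c 1)).mul (b 0)).add ((continuousOn_const.add (c 0)).mul (b 1))
  · rw [hcong 1 x y hx hy]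
    unfold hal
    ring
  · rw [hcong 0 x y hx hy]
    unfold hbe
    ring

/-- It is constant, and at the singular point the integrals in the coefficients tend to zero,
leaving the Wronskian of the two model solutions. -/
theorem HalfPot.wronskian (hP : Admissible P) (hQ : HalfPot P Q) (lam : ℂ) {y : ℝ} (hy : 0 < y) :
    hal P Q 0 lam y * hbe P Q 1 lam y - hbe P Q 0 lam y * hal P Q 1 lam y = 1 := by
  have lim : ∀ k j, Tendsto (hint P Q k j lam) (𝓝[>] 0) (𝓝 0) := by
    intro k j
    have h := (hQ.continuousOn_hint hP k j lam 1 zero_le_one) 0 ⟨le_rfl, zero_le_one⟩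
    have h0 : hint P Q k j lam 0 = 0 := by simp [hint]
    rw [ContinuousWithinAt, h0] at h
    refine h.mono_left ?_
    rw [← nhdsWithin_Ioc_eq_nhdsGT (zero_lt_one)]
    exact nhdsWithin_mono _ Set.Ioc_subset_Icc_self
  have hlim : Tendsto (fun y => hal P Q 0 lam y * hbe P Q 1 lam y -
      hbe P Q 0 lam y * hal P Q 1 lam y) (𝓝[>] 0) (𝓝 1) := by
    have := (((lim 1 0).const_sub 1).mul ((lim 0 1).const_add 1)).sub
      (((lim 0 0).const_add 0).mul ((lim 1 1).const_sub 0))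
    simpa [hal, hbe] using this
  have hconst : Tendsto (fun y => hal P Q 0 lam y * hbe P Q 1 lam y -
      hbe P Q 0 lam y * hal P Q 1 lam y) (𝓝[>] 0) (𝓝 (hal P Q 0 lam y * hbe P Q 1 lam y -
      hbe P Q 0 lam y * hal P Q 1 lam y)) := by
    refine tendsto_const_nhds.congr' ?_
    filter_upwards [self_mem_nhdsWithin] with z hz
    exact (hQ.hSol hP 0 lam).wronskian_const hP le_rfl (hQ.hSol hP 1 lam) hz hy
  exact tendsto_nhds_unique hconst hlim

theorem HalfPot.differentiable_hal (hP : Admissible P) (hQ : HalfPot P Q) (j : Fin 2)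
    {y : ℝ} (hy : 0 < y) : Differentiable ℂ (fun lam => hal P Q j lam y) :=
  (hQ.differentiable_hint hP 1 j hy).const_sub _

theorem HalfPot.differentiable_hbe (hP : Admissible P) (hQ : HalfPot P Q) (j : Fin 2)
    {y : ℝ} (hy : 0 < y) : Differentiable ℂ (fun lam => hbe P Q j lam y) :=
  (hQ.differentiable_hint hP 0 j hy).const_add _

/-- Uniqueness for the integral equation. -/
theorem HalfPot.hsol_unique (hP : Admissible P) (hQ : HalfPot P Q) (j : Fin 2) (lam : ℂ) {Y : ℝ}
    {s : ℝ → ℂ}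
    (hint : ∀ (k : Fin 2) (x : ℝ), x ∈ Set.Ioc 0 Y →
      IntervalIntegrable (fun t => bes P k lam t * (Q t * s t)) volume 0 x)
    (heq : ∀ x ∈ Set.Ioc 0 Y, s x = bes P j lam x +
      ∫ t in (0 : ℝ)..x, green P lam x t * (Q t * s t)) :
    ∀ x ∈ Set.Ioc 0 Y, s x = hsol P Q j lam x := by
  intro x₀ hx₀
  have hY : 0 < Y := hx₀.1.trans_le hx₀.2
  -- The weight of the more singular exponent is taken whatever `j` is, because the integrability
  -- assumption on `s` yields only that growth. The difference solves the homogeneous equation, so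
  -- `Contracts.norm_le` with `F = 0` makes it vanish.
  obtain ⟨K, N, F, hN, hF, hc, hb⟩ := hQ.contracts_near hP (L := ‖lam‖) hY 0
  obtain ⟨C₁, hC₁, hs⟩ := hQ.norm_hsol_near hP (L := ‖lam‖) hY j
  obtain ⟨B, hB, hbes⟩ := hP.exists_near_bound (‖lam‖ * Y ^ 2)
  set c : Fin 2 → ℝ := fun k => ∫ t in (0 : ℝ)..Y, ‖bes P k lam t * (Q t * s t)‖ with hcdef
  have hYm : Y ∈ Set.Ioc 0 Y := ⟨hY, le_rfl⟩
  have hck : ∀ k, ∀ x ∈ Set.Ioc 0 Y, ‖∫ t in (0 : ℝ)..x, bes P k lam t * (Q t * s t)‖ ≤ c k := by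
    intro k x hx
    refine (intervalIntegral.norm_integral_le_integral_norm hx.1.le).trans ?_
    exact intervalIntegral.integral_mono_interval le_rfl hx.1.le hx.2
      (Eventually.of_forall fun t => norm_nonneg _) (hint k Y hYm).norm
  have hc0 : ∀ k, 0 ≤ c k := fun k => (norm_nonneg _).trans (hck k Y hYm)
  have bes_le : ∀ k, ∀ x ∈ Set.Ioc 0 Y, ‖bes P k lam x‖ ≤
      B * Y ^ ((expo P k).re - (expo P 0).re) * x ^ (expo P 0).re := by
    intro k x hx
    refine (hbes k lam x hx.1 (by have := hx.1; have := hx.2; gcongr)).1.trans ?_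
    have : x ^ (expo P k).re = x ^ ((expo P k).re - (expo P 0).re) * x ^ (expo P 0).re := by
      rw [← Real.rpow_add hx.1]
      congr 1
      ring
    rw [this, mul_assoc]
    refine mul_le_mul_of_nonneg_left (mul_le_mul_of_nonneg_right ?_
      (Real.rpow_nonneg hx.1.le _)) hB.le
    exact Real.rpow_le_rpow hx.1.le hx.2 (by linarith [expo_re_ge hP k])
  set D : Fin 2 → ℝ := fun k => B * Y ^ ((expo P k).re - (expo P 0).re) with hD
  have hD0 : ∀ k, 0 ≤ D k := fun k => by positivity
  set E := C₁ * Y ^ ((expo P j).re - (expo P 0).re) with hE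
  have hdif : ∀ x ∈ Set.Ioc 0 Y, ‖s x - hsol P Q j lam x‖ ≤
      (D j + D 1 * c 0 + D 0 * c 1 + E) * (x ^ (expo P 0).re * Real.exp (N * x)) := by
    intro x hx
    have hxe : 0 ≤ x ^ (expo P 0).re := Real.rpow_nonneg hx.1.le _
    have h1 : ‖s x‖ ≤ (D j + D 1 * c 0 + D 0 * c 1) * x ^ (expo P 0).re := by
      rw [heq x hx, integral_green_mul (hint 0 x hx) (hint 1 x hx)]
      have n1 := norm_add_le (bes P j lam x) (bes P 1 lam x *
        (∫ t in (0 : ℝ)..x, bes P 0 lam t * (Q t * s t)) -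
        bes P 0 lam x * ∫ t in (0 : ℝ)..x, bes P 1 lam t * (Q t * s t))
      have n2 := norm_sub_le (bes P 1 lam x *
        (∫ t in (0 : ℝ)..x, bes P 0 lam t * (Q t * s t)))
        (bes P 0 lam x * ∫ t in (0 : ℝ)..x, bes P 1 lam t * (Q t * s t))
      rw [norm_mul, norm_mul] at n2
      have m1 := mul_le_mul (bes_le 1 x hx) (hck 0 x hx) (norm_nonneg _)
        (mul_nonneg (hD0 1) hxe)
      have m2 := mul_le_mul (bes_le 0 x hx) (hck 1 x hx) (norm_nonneg _)
        (mul_nonneg (hD0 0) hxe)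
      have m3 := bes_le j x hx
      refine n1.trans ((add_le_add m3 (n2.trans (add_le_add m1 m2))).trans (le_of_eq ?_))
      ring
    have h2 : ‖hsol P Q j lam x‖ ≤ E * x ^ (expo P 0).re := by
      refine (hs lam le_rfl x hx).trans ?_
      have : x ^ (expo P j).re = x ^ ((expo P j).re - (expo P 0).re) * x ^ (expo P 0).re := by
        rw [← Real.rpow_add hx.1]
        congr 1
        ring
      rw [this, hE, mul_assoc]
      refine mul_le_mul_of_nonneg_left (mul_le_mul_of_nonneg_right ?_ hxe) hC₁
      exact Real.rpow_le_rpow hx.1.le hx.2 (by linarith [expo_re_ge hP j])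
    have hE0 : 0 ≤ E := by positivity
    have h3 : 0 ≤ D j + D 1 * c 0 + D 0 * c 1 + E := by
      have := mul_nonneg (hD0 1) (hc0 0)
      have := mul_nonneg (hD0 0) (hc0 1)
      have := hD0 j
      linarith
    calc _ ≤ ‖s x‖ + ‖hsol P Q j lam x‖ := norm_sub_le _ _
      _ ≤ (D j + D 1 * c 0 + D 0 * c 1) * x ^ (expo P 0).re + E * x ^ (expo P 0).re :=
        add_le_add h1 h2
      _ = (D j + D 1 * c 0 + D 0 * c 1 + E) * x ^ (expo P 0).re := by ring
      _ ≤ _ := mul_le_mul_of_nonneg_left (le_mul_of_one_le_right hxe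
        (Real.one_le_exp (mul_nonneg hN hx.1.le))) h3
  have hdeq : ∀ x ∈ Set.Ioc 0 Y, s x - hsol P Q j lam x = (0 : ℝ → ℂ) x +
      ∫ t, kern P Q lam x t * (s t - hsol P Q j lam t) := by
    intro x hx
    have i0 := hQ.intervalIntegrable_bes_mul_hsol hP lam le_rfl hx.1.le 0 j
    have i1 := hQ.intervalIntegrable_bes_mul_hsol hP lam le_rfl hx.1.le 1 j
    have e : ∀ k, (fun t => bes P k lam t * (Q t * (s t - hsol P Q j lam t))) = fun t =>
        bes P k lam t * (Q t * s t) - bes P k lam t * (Q t * hsol P Q j lam t) := fun k => by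
      funext t
      ring
    rw [integral_kern_mul _ lam hx.1, integral_green_mul (by rw [e]; exact (hint 0 x hx).sub i0)
      (by rw [e]; exact (hint 1 x hx).sub i1), e, e,
      intervalIntegral.integral_sub (hint 0 x hx) i0,
      intervalIntegral.integral_sub (hint 1 x hx) i1, heq x hx, hQ.hsol_eq hP j lam hx.1,
      integral_green_mul (hint 0 x hx) (hint 1 x hx), integral_green_mul i0 i1]
    simp only [Pi.zero_apply]
    ring
  have := hc.norm_le (F := 0) (hb lam le_rfl).1 le_rfl (f := 0) (fun x hx => by simp) hdif hdeq
    x₀ hx₀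
  rw [mul_zero, zero_mul] at this
  exact sub_eq_zero.1 (norm_le_zero_iff.1 this)

end

section

/-! ### Asymptotics of the solutions for a large spectral parameter -/

variable {P : Params} {Q : ℝ → ℂ}

/-- The derivative of `hsol`. -/
def hsol' (P : Params) (Q : ℝ → ℂ) (j : Fin 2) (lam : ℂ) (y : ℝ) : ℂ :=
  hder P lam (hal P Q j lam) (hbe P Q j lam) y

theorem HalfPot.hasDerivAt_hsol (hP : Admissible P) (hQ : HalfPot P Q) (j : Fin 2) (lam : ℂ)
    {y : ℝ} (hy : 0 < y) : HasDerivAt (hsol P Q j lam) (hsol' P Q j lam y) y := by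
  refine ((hQ.hSol hP j lam).hasDerivAt hP le_rfl hy).congr_of_eventuallyEq ?_
  filter_upwards [lt_mem_nhds hy] with z hz
  exact hQ.hsol_eq_hval hP j lam hz

theorem HalfPot.hsol_wronskian (hP : Admissible P) (hQ : HalfPot P Q) (lam : ℂ) {y : ℝ}
    (hy : 0 < y) :
    hsol P Q 0 lam y * hsol' P Q 1 lam y - hsol' P Q 0 lam y * hsol P Q 1 lam y = 1 := by
  rw [hQ.hsol_eq_hval hP 0 lam hy, hQ.hsol_eq_hval hP 1 lam hy, hsol', hsol',
    wronskian_hval hP lam _ _ _ _ hy, hQ.wronskian hP lam hy]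

theorem HalfPot.differentiable_hsol (hP : Admissible P) (hQ : HalfPot P Q) (j : Fin 2)
    {y : ℝ} (hy : 0 < y) : Differentiable ℂ (fun lam => hsol P Q j lam y) := by
  have : (fun lam => hsol P Q j lam y) =
      fun lam => hval P lam (hal P Q j lam) (hbe P Q j lam) y :=
    funext fun lam => hQ.hsol_eq_hval hP j lam hy
  rw [this]
  exact ((hQ.differentiable_hal hP j hy).mul (hP.differentiable_bes 0 y)).add
    ((hQ.differentiable_hbe hP j hy).mul (hP.differentiable_bes 1 y))

theorem HalfPot.differentiable_hsol' (hP : Admissible P) (hQ : HalfPot P Q) (j : Fin 2)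
    {y : ℝ} (hy : 0 < y) : Differentiable ℂ (fun lam => hsol' P Q j lam y) :=
  ((hQ.differentiable_hal hP j hy).mul (hP.differentiable_bes' 0 y)).add
    ((hQ.differentiable_hbe hP j hy).mul (hP.differentiable_bes' 1 y))

theorem HalfPot.hsol'_eq (hP : Admissible P) (hQ : HalfPot P Q) (j : Fin 2) (lam : ℂ) {y : ℝ}
    (hy : 0 < y) : hsol' P Q j lam y = bes' P j lam y +
      ∫ t in (0 : ℝ)..y, green' P lam y t * (Q t * hsol P Q j lam t) := by
  rw [integral_green'_mul
    (hQ.intervalIntegrable_bes_mul_hsol hP lam le_rfl hy.le 0 j)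
    (hQ.intervalIntegrable_bes_mul_hsol hP lam le_rfl hy.le 1 j)]
  unfold hsol' hder hal hbe hint
  fin_cases j
  · simp
    ring
  · simp
    ring

theorem om_one_le (hP : Admissible P) (j : Fin 2) {z : ℝ} (hz : 0 < z) : om P 1 z ≤ om P j z := by
  have := hP.nu_re
  refine Real.rpow_le_rpow_of_exponent_ge (lt_min one_pos hz) (min_le_left _ _) ?_
  fin_cases j
  · simp only [Fin.zero_eta, re_expo_zero, re_expo_one]
    linarith
  · simp

/-- For `R ≥ 1` and a nonpositive exponent, `(Rt)^m ≤ t^m`. This removes `R = |ρ|` and leaves the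
weight of the class `W`, so the same integrable density works for all large `ρ`. -/
theorem om_mul_om_le (hP : Admissible P) (j : Fin 2) {R t Y : ℝ} (hR : 1 ≤ R) (ht : 0 < t)
    (hY : t ≤ Y) : om P 0 (R * t) * om P j (R * t) ≤
      (1 + Y ^ (-min 0 (1 - 2 * P.ν.re))) * wt P t := by
  have hz : 0 < min 1 (R * t) := lt_min one_pos (by positivity)
  have hm : min 0 (1 - 2 * P.ν.re) ≤ 0 := min_le_left _ _
  have h1 : om P 0 (R * t) * om P j (R * t) ≤ (min 1 (R * t)) ^ min 0 (1 - 2 * P.ν.re) := by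
    unfold om
    rw [← Real.rpow_add hz]
    exact Real.rpow_le_rpow_of_exponent_ge hz (min_le_left _ _) (min_le_expo_add hP 0 j)
  have h2 : (1 : ℝ) ≤ Y ^ (-min 0 (1 - 2 * P.ν.re)) * wt P t := by
    have := rpow_le_wt P hm ht hY
    rwa [Real.rpow_zero, zero_sub] at this
  have h3 : 0 < wt P t := wt_pos P ht
  refine h1.trans ?_
  rcases le_total 1 (R * t) with h | h
  · rw [min_eq_left h, Real.one_rpow]
    linarith
  · rw [min_eq_right h]
    have : (R * t) ^ min 0 (1 - 2 * P.ν.re) ≤ wt P t :=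
      Real.rpow_le_rpow_of_nonpos ht (le_mul_of_one_le_left ht.le hR) hm
    linarith

/-- With the weight `min(1, |ρ|x)^{Re μ_j} exp(x Im ρ)` the Volterra operator has norm `O(1/|ρ|)`,
the small factor coming from the Green kernel. It is a contraction for large `|ρ|`, and one
application of it bounds the deviation from the model solution. -/
theorem HalfPot.exists_large_bound (hP : Admissible P) (hQ : HalfPot P Q) {y : ℝ} (hy : 0 < y) :
    ∃ K R : ℝ, 0 < K ∧ 1 ≤ R ∧ ∀ (j : Fin 2) (ρ : ℂ), R ≤ ‖ρ‖ → 0 ≤ ρ.im →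
      ‖hsol P Q j (ρ ^ 2) y - bes P j (ρ ^ 2) y‖ ≤
        K / ‖ρ‖ * ‖ρ‖ ^ (-(expo P j).re) * Real.exp (ρ.im * y) ∧
      ‖hsol' P Q j (ρ ^ 2) y - bes' P j (ρ ^ 2) y‖ ≤
        K * ‖ρ‖ ^ (-(expo P j).re) * Real.exp (ρ.im * y) := by
  obtain ⟨K₁, hK₁, hbes⟩ := hP.exists_bes_bound
  obtain ⟨K₂, hK₂, hgreen⟩ := hP.exists_green_bound
  set C := 1 + y ^ (-min 0 (1 - 2 * P.ν.re)) with hC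
  have hC0 : 0 < C := by positivity
  set T := ∫ t, dens P Q y t with hT
  have hT0 : 0 ≤ T := integral_nonneg (dens_nonneg P Q y)
  -- The three thresholds for `|ρ|`: 1 for `om_mul_om_le`, `1/y` to have `|ρ|y ≥ 1`, and `2K₂CT` for
  -- the contraction.
  refine ⟨2 * K₁ * K₂ * C * T + 1, max (max 1 y⁻¹) (2 * (K₂ * C * T)), by positivity,
    (le_max_left _ _).trans (le_max_left _ _), fun j ρ hρ him => ?_⟩
  have hρ1 : 1 ≤ ‖ρ‖ := ((le_max_left _ _).trans (le_max_left _ _)).trans hρ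
  have hρ0 : 0 < ‖ρ‖ := by linarith
  have hρne : ρ ≠ 0 := norm_pos_iff.1 hρ0
  have hρy : 1 ≤ ‖ρ‖ * y := by
    have : y⁻¹ ≤ ‖ρ‖ := ((le_max_right _ _).trans (le_max_left _ _)).trans hρ
    calc (1 : ℝ) = y⁻¹ * y := by field_simp
      _ ≤ _ := by gcongr
  have hρT : 2 * (K₂ * C * T) ≤ ‖ρ‖ := (le_max_right _ _).trans hρ
  set p : ℝ → ℝ := fun x => om P j (‖ρ‖ * x) * Real.exp (ρ.im * x) with hp
  set A : ℝ → ℝ → ℝ := fun x t => K₂ / ‖ρ‖ * om P 0 (‖ρ‖ * t) * om P 1 (‖ρ‖ * x) *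
    Real.exp (ρ.im * (x - t)) with hA
  have hmeas : ∀ k, Measurable (fun t : ℝ => om P k (‖ρ‖ * t)) := fun k => by
    unfold om
    fun_prop
  have hompos : ∀ k t, 0 < t → 0 < om P k (‖ρ‖ * t) := fun k t ht => om_pos P k (by positivity)
  -- the basic pointwise estimate
  have hpt : ∀ x ∈ Set.Ioc 0 y, ∀ t, kmaj Q A x t * p t ≤
      K₂ / ‖ρ‖ * C * (om P 1 (‖ρ‖ * x) * Real.exp (ρ.im * x)) * dens P Q y t := by
    intro x hx t
    have hx1 := hompos 1 x hx.1
    unfold kmaj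
    split_ifs with h
    · rw [dens_of_mem h.1 (h.2.le.trans hx.2)]
      have e : Real.exp (ρ.im * x) = Real.exp (ρ.im * (x - t)) * Real.exp (ρ.im * t) := by
        rw [← Real.exp_add]
        congr 1
        ring
      have key := om_mul_om_le hP j hρ1 h.1 (h.2.le.trans hx.2)
      rw [e]
      calc A x t * ‖Q t‖ * p t = (om P 0 (‖ρ‖ * t) * om P j (‖ρ‖ * t)) * (K₂ / ‖ρ‖ *
            (om P 1 (‖ρ‖ * x) * (Real.exp (ρ.im * (x - t)) * Real.exp (ρ.im * t))) * ‖Q t‖) := by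
            simp only [hA, hp]
            ring
        _ ≤ (C * wt P t) * (K₂ / ‖ρ‖ *
            (om P 1 (‖ρ‖ * x) * (Real.exp (ρ.im * (x - t)) * Real.exp (ρ.im * t))) * ‖Q t‖) := by
            gcongr
        _ = _ := by ring
    · rw [zero_mul]
      have := dens_nonneg P Q y t
      positivity
  have hkp0 : ∀ x ∈ Set.Ioc 0 y, ∀ t, 0 ≤ kmaj Q A x t * p t := by
    intro x hx t
    unfold kmaj
    split_ifs with h
    · have := hompos 0 t h.1
      have := hompos j t h.1
      have := hompos 1 x hx.1
      positivity
    · simp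
  have hint : ∀ x ∈ Set.Ioc 0 y, Integrable (fun t => kmaj Q A x t * p t) := by
    intro x hx
    refine ((hQ.integrable_dens y).const_mul (K₂ / ‖ρ‖ * C *
      (om P 1 (‖ρ‖ * x) * Real.exp (ρ.im * x)))).mono'
      (aestronglyMeasurable_kmaj_mul hQ.meas x ?_ ?_) (Eventually.of_forall fun t => ?_)
    · have := hmeas 0
      fun_prop
    · have := hmeas j
      fun_prop
    · rw [Real.norm_of_nonneg (hkp0 x hx t)]
      exact hpt x hx t
  have hintle : ∀ x ∈ Set.Ioc 0 y, ∫ t, kmaj Q A x t * p t ≤ K₂ * C * T / ‖ρ‖ * p x := by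
    intro x hx
    refine (integral_mono (hint x hx) ((hQ.integrable_dens y).const_mul _) (hpt x hx)).trans ?_
    rw [integral_const_mul]
    have := om_one_le hP j (z := ‖ρ‖ * x) (mul_pos hρ0 hx.1)
    calc K₂ / ‖ρ‖ * C * (om P 1 (‖ρ‖ * x) * Real.exp (ρ.im * x)) * T
        ≤ K₂ / ‖ρ‖ * C * (om P j (‖ρ‖ * x) * Real.exp (ρ.im * x)) * T := by gcongr
      _ = _ := by
        simp only [hp]
        ring
  have hp0 : ∀ x ∈ Set.Ioc 0 y, 0 ≤ p x := fun x hx =>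
    mul_nonneg (hompos j x hx.1).le (Real.exp_pos _).le
  have hc : Contracts (kmaj Q A) (Set.Ioc 0 y) p := by
    refine ⟨hp0, kmaj_support _ _ y, hint, fun x hx => (hintle x hx).trans ?_⟩
    have : K₂ * C * T / ‖ρ‖ ≤ 1 / 2 := by
      rw [div_le_iff₀ hρ0]
      linarith
    calc _ ≤ 1 / 2 * p x := mul_le_mul_of_nonneg_right this (hp0 x hx)
      _ = _ := by ring
  have hk : ∀ x ∈ Set.Ioc 0 y, ∀ t, ‖kern P Q (ρ ^ 2) x t‖ ≤ kmaj Q A x t := fun x _ t =>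
    norm_kern_le fun h0 h1 => (hgreen ρ t x hρne him h0 h1.le).1
  set F := K₁ * ‖ρ‖ ^ (-(expo P j).re) with hF
  have hF0 : 0 ≤ F := by positivity
  have hf : ∀ x ∈ Set.Ioc 0 y, ‖bes P j (ρ ^ 2) x‖ ≤ F * p x := fun x hx =>
    (hbes j ρ x hρne him hx.1).1.trans (le_of_eq (by simp only [hp, hF]; ring))
  have hsle : ∀ x ∈ Set.Ioc 0 y, ‖hsol P Q j (ρ ^ 2) x‖ ≤ 2 * F * p x := fun x hx =>
    hc.norm_sol_le hk hF0 hf hx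
  have hym : y ∈ Set.Ioc 0 y := ⟨hy, le_rfl⟩
  have hpy : p y = Real.exp (ρ.im * y) := by
    simp only [hp]
    rw [om_eq_one P j hρy, one_mul]
  have hpow : 0 < ‖ρ‖ ^ (-(expo P j).re) := by positivity
  constructor
  · have e : hsol P Q j (ρ ^ 2) y - bes P j (ρ ^ 2) y =
        ∫ t, kern P Q (ρ ^ 2) y t * hsol P Q j (ρ ^ 2) t := by
      rw [hQ.hsol_eq hP j _ hy, integral_kern_mul _ _ hy]
      ring
    rw [e]
    refine (norm_integral_le_of_norm_le ((hint y hym).const_mul (2 * F)) (Eventually.of_forall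
      fun t => hc.norm_mul_le hk hsle hym t)).trans ?_
    rw [integral_const_mul]
    calc 2 * F * ∫ t, kmaj Q A y t * p t ≤ 2 * F * (K₂ * C * T / ‖ρ‖ * p y) :=
          mul_le_mul_of_nonneg_left (hintle y hym) (by positivity)
      _ = (2 * K₁ * K₂ * C * T) / ‖ρ‖ * ‖ρ‖ ^ (-(expo P j).re) * Real.exp (ρ.im * y) := by
          rw [hpy, hF]
          ring
      _ ≤ _ := by
          gcongr
          linarith
  · rw [hQ.hsol'_eq hP j _ hy, add_sub_cancel_left, intervalIntegral.integral_of_le hy.le]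
    refine (norm_integral_le_of_norm_le (g := fun t => 2 * F * K₂ * C * Real.exp (ρ.im * y) *
      dens P Q y t) ((hQ.integrable_dens y).const_mul _).integrableOn ?_).trans ?_
    · filter_upwards [ae_restrict_mem measurableSet_Ioc] with t ht
      rw [norm_mul, norm_mul, dens_of_mem ht.1 ht.2]
      have b1 := (hgreen ρ t y hρne him ht.1 ht.2).2 hρy
      have b2 := hsle t ht
      have key := om_mul_om_le hP j hρ1 ht.1 ht.2
      have e : Real.exp (ρ.im * y) = Real.exp (ρ.im * (y - t)) * Real.exp (ρ.im * t) := by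
        rw [← Real.exp_add]
        congr 1
        ring
      have := hompos 0 t ht.1
      have := hompos j t ht.1
      rw [e]
      calc ‖green' P (ρ ^ 2) y t‖ * (‖Q t‖ * ‖hsol P Q j (ρ ^ 2) t‖) ≤
          (K₂ * om P 0 (‖ρ‖ * t) * Real.exp (ρ.im * (y - t))) * (‖Q t‖ * (2 * F * p t)) := by
            gcongr
        _ = (om P 0 (‖ρ‖ * t) * om P j (‖ρ‖ * t)) * (2 * F * K₂ *
            (Real.exp (ρ.im * (y - t)) * Real.exp (ρ.im * t)) * ‖Q t‖) := by
            simp only [hp]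
            ring
        _ ≤ (C * wt P t) * (2 * F * K₂ *
            (Real.exp (ρ.im * (y - t)) * Real.exp (ρ.im * t)) * ‖Q t‖) := by gcongr
        _ = _ := by ring
    · rw [integral_const_mul]
      have : ∫ t in Set.Ioc 0 y, dens P Q y t ≤ T :=
        setIntegral_le_integral (hQ.integrable_dens y)
          (Eventually.of_forall (dens_nonneg P Q y))
      calc _ ≤ 2 * F * K₂ * C * Real.exp (ρ.im * y) * T := by gcongr
        _ = (2 * K₁ * K₂ * C * T) * ‖ρ‖ ^ (-(expo P j).re) * Real.exp (ρ.im * y) := by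
          rw [hF]
          ring
        _ ≤ _ := by
          gcongr
          linarith

/-- Growth of the solutions for a large spectral parameter. -/
theorem HalfPot.exists_hsol_bound (hP : Admissible P) (hQ : HalfPot P Q) {y : ℝ} (hy : 0 < y) :
    ∃ K R : ℝ, 0 < K ∧ 1 ≤ R ∧ ∀ (j : Fin 2) (ρ : ℂ), R ≤ ‖ρ‖ → 0 ≤ ρ.im →
      ‖hsol P Q j (ρ ^ 2) y‖ ≤ K * ‖ρ‖ ^ (-(expo P j).re) * Real.exp (ρ.im * y) ∧
      ‖hsol' P Q j (ρ ^ 2) y‖ ≤ K * ‖ρ‖ ^ (1 - (expo P j).re) * Real.exp (ρ.im * y) := by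
  obtain ⟨K₁, hK₁, hbes⟩ := hP.exists_bes_bound
  obtain ⟨K₂, R, hK₂, hR, h⟩ := hQ.exists_large_bound hP hy
  refine ⟨K₁ + K₂, max R y⁻¹, by positivity, hR.trans (le_max_left _ _), fun j ρ hρ him => ?_⟩
  have hρR : R ≤ ‖ρ‖ := (le_max_left _ _).trans hρ
  have hρ1 : 1 ≤ ‖ρ‖ := hR.trans hρR
  have hρ0 : 0 < ‖ρ‖ := by linarith
  have hρne : ρ ≠ 0 := norm_pos_iff.1 hρ0
  have hρy : 1 ≤ ‖ρ‖ * y := by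
    have : y⁻¹ ≤ ‖ρ‖ := (le_max_right _ _).trans hρ
    calc (1 : ℝ) = y⁻¹ * y := by field_simp
      _ ≤ _ := by gcongr
  obtain ⟨b0, b1⟩ := hbes j ρ y hρne him hy
  rw [om_eq_one P j hρy, mul_one] at b0
  have b1 := b1 hρy
  obtain ⟨c0, c1⟩ := h j ρ hρR him
  have e : ‖ρ‖ ^ (1 - (expo P j).re) = ‖ρ‖ * ‖ρ‖ ^ (-(expo P j).re) := by
    rw [sub_eq_add_neg, Real.rpow_add hρ0, Real.rpow_one]
  have hpow : 0 < ‖ρ‖ ^ (-(expo P j).re) := by positivity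
  constructor
  · have := norm_add_le (hsol P Q j (ρ ^ 2) y - bes P j (ρ ^ 2) y) (bes P j (ρ ^ 2) y)
    rw [sub_add_cancel] at this
    refine this.trans ((add_le_add c0 b0).trans ?_)
    have : K₂ / ‖ρ‖ ≤ K₂ := div_le_self hK₂.le hρ1
    calc _ ≤ K₂ * ‖ρ‖ ^ (-(expo P j).re) * Real.exp (ρ.im * y) +
        K₁ * ‖ρ‖ ^ (-(expo P j).re) * Real.exp (ρ.im * y) := by gcongr
      _ = _ := by ring
  · have := norm_add_le (hsol' P Q j (ρ ^ 2) y - bes' P j (ρ ^ 2) y) (bes' P j (ρ ^ 2) y)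
    rw [sub_add_cancel] at this
    refine this.trans ((add_le_add c1 b1).trans ?_)
    rw [e]
    calc _ ≤ K₂ * (‖ρ‖ * ‖ρ‖ ^ (-(expo P j).re)) * Real.exp (ρ.im * y) +
        K₁ * (‖ρ‖ * ‖ρ‖ ^ (-(expo P j).re)) * Real.exp (ρ.im * y) := by
          gcongr
          exact le_mul_of_one_le_left hpow.le hρ1
      _ = _ := by ring

end

section

/-! ### Jost solutions near infinity -/

/-- Integration by parts for primitives of integrable functions, through absolute continuity. It is
used to differentiate products of coefficients with smooth functions. -/
theorem integral_primitive_mul {f g p q : ℝ → ℂ} {x y : ℝ} (hf : IntervalIntegrable f volume x y)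
    (hg : IntervalIntegrable g volume x y) (hp : ∀ z ∈ Set.uIcc x y, p z = p x + ∫ t in x..z, f t)
    (hq : ∀ z ∈ Set.uIcc x y, q z = q x + ∫ t in x..z, g t) :
    IntervalIntegrable (fun t => f t * q t + p t * g t) volume x y ∧
    p y * q y - p x * q x = ∫ t in x..y, (f t * q t + p t * g t) := by
  have cp : ContinuousOn p (Set.uIcc x y) :=
    (continuousOn_const.add (intervalIntegral.continuousOn_primitive_interval' hf
      Set.left_mem_uIcc)).congr hp
  have cq : ContinuousOn q (Set.uIcc x y) :=
    (continuousOn_const.add (intervalIntegral.continuousOn_primitive_interval' hg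
      Set.left_mem_uIcc)).congr hq
  have hi : IntervalIntegrable (fun t => f t * q t + p t * g t) volume x y :=
    (hf.mul_continuousOn cq).add (hg.continuousOn_mul cp)
  refine ⟨hi, ?_⟩
  have acc : ∀ c : ℂ, AbsolutelyContinuousOnInterval (fun _ : ℝ => c) x y := fun c =>
    (LipschitzWith.const c).lipschitzOnWith.absolutelyContinuousOnInterval
  set W : ℝ → ℂ := fun z => (p x + ∫ t in x..z, f t) * (q x + ∫ t in x..z, g t) -
    ∫ t in x..z, (f t * q t + p t * g t) with hW
  have acW : AbsolutelyContinuousOnInterval W x y :=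
    (((acc (p x)).add (absolutelyContinuous_integral hf)).smul
      ((acc (q x)).add (absolutelyContinuous_integral hg))).sub (absolutelyContinuous_integral hi)
  have hWd : ∀ᵐ z, z ∈ Set.uIcc x y → HasDerivAt W 0 z := by
    filter_upwards [hf.ae_hasDerivAt_integral, hg.ae_hasDerivAt_integral,
      hi.ae_hasDerivAt_integral] with z d1 d2 d3 hz
    have := (((d1 hz x Set.left_mem_uIcc).const_add (p x)).mul
      ((d2 hz x Set.left_mem_uIcc).const_add (q x))).sub (d3 hz x Set.left_mem_uIcc)
    refine this.congr_deriv ?_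
    rw [← hp z hz, ← hq z hz]
    ring
  obtain ⟨C, hC⟩ := acW.const_of_ae_hasDerivAt_zero hWd
  have hxW := hC x Set.left_mem_uIcc
  have hyW := hC y Set.right_mem_uIcc
  have h1 := hp y Set.right_mem_uIcc
  have h2 := hq y Set.right_mem_uIcc
  simp only [hW] at hxW hyW
  rw [← h1, ← h2] at hyW
  simp only [intervalIntegral.integral_same, add_zero, sub_zero] at hxW
  rw [hxW, ← hyW]
  ring

/-- The exponential `exp(iρt)`. -/
def expI (ρ : ℂ) (t : ℝ) : ℂ := Complex.exp (Complex.I * ρ * t)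

theorem expI_neg_mul (ρ : ℂ) (t : ℝ) : expI (-ρ) t * expI ρ t = 1 := by
  rw [expI, expI, ← Complex.exp_add]
  simp

theorem expI_add (ρ σ : ℂ) (t : ℝ) : expI (ρ + σ) t = expI ρ t * expI σ t := by
  rw [expI, expI, expI, ← Complex.exp_add]
  congr 1
  ring

theorem expI_time_add (ρ : ℂ) (t s : ℝ) : expI ρ (t + s) = expI ρ t * expI ρ s := by
  rw [expI, expI, expI, ← Complex.exp_add]
  congr 1
  push_cast
  ring

theorem norm_expI (ρ : ℂ) (t : ℝ) : ‖expI ρ t‖ = Real.exp (-(ρ.im * t)) := by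
  rw [expI, Complex.norm_exp]
  congr 1
  simp

theorem norm_expI_le_one {ρ : ℂ} {t : ℝ} (hρ : 0 ≤ ρ.im) (ht : 0 ≤ t) : ‖expI ρ t‖ ≤ 1 := by
  rw [norm_expI, Real.exp_le_one_iff]
  nlinarith

theorem hasDerivAt_expI (ρ : ℂ) (t : ℝ) :
    HasDerivAt (expI ρ) (Complex.I * ρ * expI ρ t) t := by
  have h := ((Complex.ofRealCLM.hasDerivAt (x := t)).const_mul (Complex.I * ρ)).cexp
  refine h.congr_deriv ?_
  simp [expI]
  ring

theorem continuous_expI (ρ : ℂ) : Continuous (expI ρ) := by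
  unfold expI
  fun_prop

theorem differentiable_expI (t : ℝ) : Differentiable ℂ (fun ρ => expI ρ t) := by
  unfold expI
  fun_prop

/-- The Volterra kernel of the Jost solution of `-y'' + V y = ρ² y`, divided by the exponential. -/
def jker (V : ℝ → ℂ) (ρ : ℂ) (x t : ℝ) : ℂ :=
  if x < t then (expI (2 * ρ) (t - x) - 1) / (2 * Complex.I * ρ) * V t else 0

/-- The quotient of the Jost solution by the exponential. -/
def jquot (V : ℝ → ℂ) (ρ : ℂ) : ℝ → ℂ := volterraSol (jker V ρ) (fun _ => 1)

/-- Smallness of the potential `V` beyond `Y` relative to the size `r` of spectral parameters. -/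
structure FarPot (V : ℝ → ℂ) (r Y : ℝ) : Prop where
  meas : Measurable V
  int : IntegrableOn V (Set.Ioi Y)
  pos : 0 < r
  nonneg : 0 ≤ Y
  small : ∫ t in Set.Ioi Y, ‖V t‖ ≤ r / 2

/-- Majorant of `jker`. -/
def jmaj (V : ℝ → ℂ) (r x t : ℝ) : ℝ := (Set.Ioi x).indicator (fun t => ‖V t‖ / r) t

variable {V : ℝ → ℂ} {r Y : ℝ} {ρ : ℂ}

theorem norm_jker_le (hr : 0 < r) (hρ : r ≤ ‖ρ‖) (him : 0 ≤ ρ.im) (x t : ℝ) :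
    ‖jker V ρ x t‖ ≤ jmaj V r x t := by
  unfold jker jmaj
  by_cases h : x < t
  · rw [if_pos h, Set.indicator_of_mem (show t ∈ Set.Ioi x from h), norm_mul, norm_div]
    have h1 : ‖expI (2 * ρ) (t - x) - 1‖ ≤ 2 := by
      refine (norm_sub_le _ _).trans ?_
      have := norm_expI_le_one (ρ := 2 * ρ) (t := t - x) (by simpa using him) (by linarith)
      rw [norm_one]
      linarith
    have h2 : ‖2 * Complex.I * ρ‖ = 2 * ‖ρ‖ := by simp
    rw [h2]
    have hρ0 : 0 < ‖ρ‖ := hr.trans_le hρ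
    calc ‖expI (2 * ρ) (t - x) - 1‖ / (2 * ‖ρ‖) * ‖V t‖ ≤ 2 / (2 * r) * ‖V t‖ := by gcongr
      _ = ‖V t‖ / r := by
        field_simp
  · rw [if_neg h, Set.indicator_of_notMem (show t ∉ Set.Ioi x from h), norm_zero]

/-- After division by the exponential the kernel involves only `exp(2iρ(t - x)) - 1` with `t > x`,
of modulus at most 2 in the closed upper half-plane. A constant weight therefore suffices once `∫‖V‖
≤ r/2`. -/
theorem FarPot.contracts (hV : FarPot V r Y) : Contracts (jmaj V r) (Set.Ioi Y) (fun _ => 1) := by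
  have hr := hV.pos
  refine ⟨fun _ _ => zero_le_one, fun x hx t ht => ?_, fun x hx => ?_, fun x hx => ?_⟩
  · exact Set.indicator_of_notMem (fun h => ht (lt_trans hx h)) _
  · simp only [mul_one]
    exact IntegrableOn.integrable_indicator
      ((hV.int.mono_set (Set.Ioi_subset_Ioi (le_of_lt hx))).norm.div_const r) measurableSet_Ioi
  · simp only [mul_one]
    have e : ∫ t, jmaj V r x t = (∫ t in Set.Ioi x, ‖V t‖) / r := by
      unfold jmaj
      rw [integral_indicator measurableSet_Ioi, integral_div]
    rw [e, div_le_iff₀ hr]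
    have : ∫ t in Set.Ioi x, ‖V t‖ ≤ ∫ t in Set.Ioi Y, ‖V t‖ :=
      setIntegral_mono_set hV.int.norm (Eventually.of_forall fun _ => norm_nonneg _)
        (Set.Ioi_subset_Ioi hx.le).eventuallyLE
    have := hV.small
    linarith

theorem FarPot.measurable_jker (hV : FarPot V r Y) (ρ : ℂ) :
    Measurable (Function.uncurry (jker V ρ)) := by
  have := hV.meas
  refine Measurable.ite (measurableSet_lt measurable_fst measurable_snd) ?_ measurable_const
  unfold expI
  fun_prop

theorem FarPot.norm_jquot_le (hV : FarPot V r Y) (hρ : r ≤ ‖ρ‖) (him : 0 ≤ ρ.im) {y : ℝ}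
    (hy : Y < y) : ‖jquot V ρ y‖ ≤ 2 := by
  have := hV.contracts.norm_sol_le (k := jker V ρ) (f := fun _ => 1) (F := 1)
    (fun x _ t => norm_jker_le hV.pos hρ him x t) zero_le_one (by simp) (x := y) hy
  simpa [jquot] using this

theorem FarPot.jquot_eq (hV : FarPot V r Y) (hρ : r ≤ ‖ρ‖) (him : 0 ≤ ρ.im) {y : ℝ}
    (hy : Y < y) : jquot V ρ y = 1 + ∫ t, jker V ρ y t * jquot V ρ t :=
  hV.contracts.sol_eq (k := jker V ρ) (f := fun _ => 1) (F := 1)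
    (fun x _ t => norm_jker_le hV.pos hρ him x t) (hV.measurable_jker ρ) measurable_const
    zero_le_one (by simp) (x := y) hy

theorem FarPot.integrableOn_mul_jquot (hV : FarPot V r Y) (hρ : r ≤ ‖ρ‖) (him : 0 ≤ ρ.im) :
    IntegrableOn (fun t => V t * jquot V ρ t) (Set.Ioi Y) := by
  have h := hV.contracts.measurable_mul_sol (k := jker V ρ) (f := fun _ => 1) (F := 1)
    (fun x _ t => norm_jker_le hV.pos hρ him x t) (hV.measurable_jker ρ) measurable_const
    zero_le_one (by simp) (hV.meas.indicator (measurableSet_Ioi (a := Y)))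
    (fun t ht => Set.indicator_of_notMem ht _)
  refine (hV.int.norm.mul_const 2).mono' (h.aestronglyMeasurable.congr ?_) ?_
  · filter_upwards [ae_restrict_mem measurableSet_Ioi] with t ht
    rw [Set.indicator_of_mem ht]
    rfl
  · filter_upwards [ae_restrict_mem measurableSet_Ioi] with t ht
    rw [norm_mul]
    exact mul_le_mul_of_nonneg_left (hV.norm_jquot_le hρ him ht) (norm_nonneg _)

theorem FarPot.integrableOn_exp_mul_jquot (hV : FarPot V r Y) (hρ : r ≤ ‖ρ‖) (him : 0 ≤ ρ.im) :
    IntegrableOn (fun t => expI (2 * ρ) t * (V t * jquot V ρ t)) (Set.Ioi Y) := by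
  refine (hV.integrableOn_mul_jquot hρ him).norm.mono'
    ((continuous_expI _).aestronglyMeasurable.mul
      (hV.integrableOn_mul_jquot hρ him).aestronglyMeasurable) ?_
  filter_upwards [ae_restrict_mem measurableSet_Ioi] with t ht
  rw [norm_mul]
  exact mul_le_of_le_one_left (norm_nonneg _) (norm_expI_le_one (by simpa using him)
    (hV.nonneg.trans (le_of_lt ht)))

/-- Coefficient of `exp(iρy)` in the Jost solution. -/
def jcP (V : ℝ → ℂ) (ρ : ℂ) (y : ℝ) : ℂ :=
  1 - (∫ t in Set.Ioi y, V t * jquot V ρ t) / (2 * Complex.I * ρ)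

/-- Coefficient of `exp(-iρy)` in the Jost solution. -/
def jcR (V : ℝ → ℂ) (ρ : ℂ) (y : ℝ) : ℂ :=
  (∫ t in Set.Ioi y, expI (2 * ρ) t * (V t * jquot V ρ t)) / (2 * Complex.I * ρ)

/-- The Jost solution of `-y'' + V y = ρ² y`. -/
def je (V : ℝ → ℂ) (ρ : ℂ) (y : ℝ) : ℂ := expI ρ y * jcP V ρ y + expI (-ρ) y * jcR V ρ y

/-- The derivative of the Jost solution. -/
def je' (V : ℝ → ℂ) (ρ : ℂ) (y : ℝ) : ℂ :=
  Complex.I * ρ * (expI ρ y * jcP V ρ y - expI (-ρ) y * jcR V ρ y)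

theorem FarPot.ne_zero (hV : FarPot V r Y) (hρ : r ≤ ‖ρ‖) : ρ ≠ 0 :=
  norm_pos_iff.1 (hV.pos.trans_le hρ)

theorem FarPot.jquot_eq_add (hV : FarPot V r Y) (hρ : r ≤ ‖ρ‖) (him : 0 ≤ ρ.im) {y : ℝ}
    (hy : Y < y) : jquot V ρ y = jcP V ρ y + expI (-(2 * ρ)) y * jcR V ρ y := by
  have i1 := (hV.integrableOn_mul_jquot hρ him).mono_set (Set.Ioi_subset_Ioi hy.le)
  have i2 := (hV.integrableOn_exp_mul_jquot hρ him).mono_set (Set.Ioi_subset_Ioi hy.le)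
  have e : ∫ t, jker V ρ y t * jquot V ρ t = ∫ t in Set.Ioi y,
      (expI (-(2 * ρ)) y / (2 * Complex.I * ρ) * (expI (2 * ρ) t * (V t * jquot V ρ t)) -
        1 / (2 * Complex.I * ρ) * (V t * jquot V ρ t)) := by
    rw [← integral_indicator measurableSet_Ioi]
    congr 1
    funext t
    unfold jker
    by_cases h : y < t
    · rw [if_pos h, Set.indicator_of_mem (show t ∈ Set.Ioi y from h)]
      have : expI (2 * ρ) (t - y) = expI (-(2 * ρ)) y * expI (2 * ρ) t := by
        rw [expI, expI, expI, ← Complex.exp_add]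
        congr 1
        push_cast
        ring
      rw [this]
      ring
    · rw [if_neg h, Set.indicator_of_notMem (show t ∉ Set.Ioi y from h), zero_mul]
  rw [hV.jquot_eq hρ him hy, e, integral_sub (i2.const_mul _) (i1.const_mul _),
    integral_const_mul, integral_const_mul]
  unfold jcP jcR
  ring

theorem FarPot.je_eq (hV : FarPot V r Y) (hρ : r ≤ ‖ρ‖) (him : 0 ≤ ρ.im) {y : ℝ}
    (hy : Y < y) : je V ρ y = expI ρ y * jquot V ρ y := by
  rw [hV.jquot_eq_add hρ him hy, je, mul_add, ← mul_assoc, ← expI_add]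
  congr 4
  ring

theorem FarPot.norm_jcP_sub_le (hV : FarPot V r Y) (hρ : r ≤ ‖ρ‖) (him : 0 ≤ ρ.im) {y : ℝ}
    (hy : Y < y) : ‖jcP V ρ y - 1‖ ≤ (∫ t in Set.Ioi y, ‖V t‖) / ‖ρ‖ := by
  have h : ‖∫ t in Set.Ioi y, V t * jquot V ρ t‖ ≤ ∫ t in Set.Ioi y, ‖V t‖ * 2 := by
    refine norm_integral_le_of_norm_le ((hV.int.mono_set
      (Set.Ioi_subset_Ioi hy.le)).norm.mul_const 2) ?_
    filter_upwards [ae_restrict_mem measurableSet_Ioi] with t ht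
    rw [norm_mul]
    exact mul_le_mul_of_nonneg_left (hV.norm_jquot_le hρ him (hy.trans ht)) (norm_nonneg _)
  rw [integral_mul_const] at h
  have hρ0 : 0 < ‖ρ‖ := hV.pos.trans_le hρ
  have h2 : ‖2 * Complex.I * ρ‖ = 2 * ‖ρ‖ := by simp
  rw [jcP, sub_sub_cancel_left, norm_neg, norm_div, h2, div_le_div_iff₀ (by positivity) hρ0]
  nlinarith

theorem FarPot.norm_exp_mul_jcR_le (hV : FarPot V r Y) (hρ : r ≤ ‖ρ‖) (him : 0 ≤ ρ.im) {y : ℝ}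
    (hy : Y < y) : ‖expI (-(2 * ρ)) y * jcR V ρ y‖ ≤ (∫ t in Set.Ioi y, ‖V t‖) / ‖ρ‖ := by
  have h : ‖expI (-(2 * ρ)) y * ∫ t in Set.Ioi y, expI (2 * ρ) t * (V t * jquot V ρ t)‖ ≤
      ∫ t in Set.Ioi y, ‖V t‖ * 2 := by
    rw [← integral_const_mul]
    refine norm_integral_le_of_norm_le ((hV.int.mono_set
      (Set.Ioi_subset_Ioi hy.le)).norm.mul_const 2) ?_
    filter_upwards [ae_restrict_mem measurableSet_Ioi] with t ht
    have ht' : y < t := ht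
    have e : expI (-(2 * ρ)) y * expI (2 * ρ) t = expI (2 * ρ) (t - y) := by
      rw [expI, expI, expI, ← Complex.exp_add]
      congr 1
      push_cast
      ring
    rw [← mul_assoc, e, norm_mul, norm_mul]
    have h1 := norm_expI_le_one (ρ := 2 * ρ) (t := t - y) (by simpa using him) (by linarith)
    have h2 := hV.norm_jquot_le hρ him (hy.trans ht)
    calc _ ≤ 1 * (‖V t‖ * 2) := by gcongr
      _ = _ := one_mul _
  rw [integral_mul_const] at h
  have hρ0 : 0 < ‖ρ‖ := hV.pos.trans_le hρ
  have h2 : ‖2 * Complex.I * ρ‖ = 2 * ‖ρ‖ := by simp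
  rw [jcR, ← mul_div_assoc, norm_div, h2, div_le_div_iff₀ (by positivity) hρ0]
  nlinarith

/-- The Jost solution and its derivative are close to those of the exponential. -/
theorem FarPot.norm_je_sub_le (hV : FarPot V r Y) (hρ : r ≤ ‖ρ‖) (him : 0 ≤ ρ.im) {y : ℝ}
    (hy : Y < y) :
    ‖je V ρ y - expI ρ y‖ ≤ 2 * (∫ t in Set.Ioi y, ‖V t‖) / ‖ρ‖ * Real.exp (-(ρ.im * y)) ∧
    ‖je' V ρ y - Complex.I * ρ * expI ρ y‖ ≤
      2 * (∫ t in Set.Ioi y, ‖V t‖) * Real.exp (-(ρ.im * y)) := by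
  have hρ0 : 0 < ‖ρ‖ := hV.pos.trans_le hρ
  have e : expI (-ρ) y = expI ρ y * expI (-(2 * ρ)) y := by
    rw [← expI_add]
    congr 1
    ring
  have h1 := hV.norm_jcP_sub_le hρ him hy
  have h2 := hV.norm_exp_mul_jcR_le hρ him hy
  have hE := norm_expI ρ y
  constructor
  · have : je V ρ y - expI ρ y =
        expI ρ y * ((jcP V ρ y - 1) + expI (-(2 * ρ)) y * jcR V ρ y) := by
      rw [je, e]
      ring
    rw [this, norm_mul, hE]
    calc _ ≤ Real.exp (-(ρ.im * y)) * ((∫ t in Set.Ioi y, ‖V t‖) / ‖ρ‖ +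
          (∫ t in Set.Ioi y, ‖V t‖) / ‖ρ‖) := by
          gcongr
          exact (norm_add_le _ _).trans (add_le_add h1 h2)
      _ = _ := by ring
  · have : je' V ρ y - Complex.I * ρ * expI ρ y =
        Complex.I * ρ * expI ρ y * ((jcP V ρ y - 1) - expI (-(2 * ρ)) y * jcR V ρ y) := by
      rw [je', e]
      ring
    rw [this, norm_mul, norm_mul, hE, norm_mul, Complex.norm_I, one_mul]
    calc _ ≤ ‖ρ‖ * Real.exp (-(ρ.im * y)) * ((∫ t in Set.Ioi y, ‖V t‖) / ‖ρ‖ +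
          (∫ t in Set.Ioi y, ‖V t‖) / ‖ρ‖) := by
          gcongr
          exact (norm_sub_le _ _).trans (add_le_add h1 h2)
      _ = _ := by
        field_simp
        ring

theorem FarPot.tendsto_je (hV : FarPot V r Y) (hρ : r ≤ ‖ρ‖) (him : 0 ≤ ρ.im) :
    Tendsto (fun y => je V ρ y * expI (-ρ) y) atTop (𝓝 1) ∧
    Tendsto (fun y => je' V ρ y * expI (-ρ) y) atTop (𝓝 (Complex.I * ρ)) := by
  have hT : Tendsto (fun y => ∫ t in Set.Ioi y, ‖V t‖) atTop (𝓝 0) := by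
    have h1 := intervalIntegral_tendsto_integral_Ioi Y hV.int.norm tendsto_id
    have h2 := h1.const_sub (∫ t in Set.Ioi Y, ‖V t‖)
    rw [sub_self] at h2
    refine h2.congr' ?_
    filter_upwards [eventually_gt_atTop Y] with y hy
    rw [id, intervalIntegral.integral_of_le hy.le, sub_eq_iff_eq_add,
      add_comm, ← setIntegral_union Set.Ioc_disjoint_Ioi_same measurableSet_Ioi
      (hV.int.mono_set Set.Ioc_subset_Ioi_self).norm
      (hV.int.mono_set (Set.Ioi_subset_Ioi hy.le)).norm, Set.Ioc_union_Ioi_eq_Ioi hy.le]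
  have hn : ∀ y, ‖expI (-ρ) y‖ * Real.exp (-(ρ.im * y)) = 1 := fun y => by
    rw [norm_expI, ← Real.exp_add]
    simp
  constructor
  · rw [tendsto_iff_norm_sub_tendsto_zero]
    have hlim := (hT.const_mul (2 / ‖ρ‖))
    rw [mul_zero] at hlim
    refine squeeze_zero' (Eventually.of_forall fun _ => norm_nonneg _) ?_ hlim
    filter_upwards [eventually_gt_atTop Y] with y hy
    have e : je V ρ y * expI (-ρ) y - 1 = (je V ρ y - expI ρ y) * expI (-ρ) y := by
      linear_combination expI_neg_mul ρ y
    rw [e, norm_mul]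
    refine (mul_le_mul_of_nonneg_right (hV.norm_je_sub_le hρ him hy).1 (norm_nonneg _)).trans
      (le_of_eq ?_)
    linear_combination (2 / ‖ρ‖ * ∫ t in Set.Ioi y, ‖V t‖) * hn y
  · rw [tendsto_iff_norm_sub_tendsto_zero]
    have hlim := (hT.const_mul 2)
    rw [mul_zero] at hlim
    refine squeeze_zero' (Eventually.of_forall fun _ => norm_nonneg _) ?_ hlim
    filter_upwards [eventually_gt_atTop Y] with y hy
    have e : je' V ρ y * expI (-ρ) y - Complex.I * ρ =
        (je' V ρ y - Complex.I * ρ * expI ρ y) * expI (-ρ) y := by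
      linear_combination (Complex.I * ρ) * expI_neg_mul ρ y
    rw [e, norm_mul]
    refine (mul_le_mul_of_nonneg_right (hV.norm_je_sub_le hρ him hy).2 (norm_nonneg _)).trans
      (le_of_eq ?_)
    linear_combination (2 * ∫ t in Set.Ioi y, ‖V t‖) * hn y

/-! ### Dependence on the spectral parameter -/

theorem FarPot.differentiableOn_jquot (hV : FarPot V r Y) {y : ℝ} (hy : Y < y) :
    DifferentiableOn ℂ (fun ρ => jquot V ρ y) {ρ | 0 < ρ.im ∧ r < ‖ρ‖} := by
  have hU : IsOpen {ρ : ℂ | 0 < ρ.im ∧ r < ‖ρ‖} :=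
    (isOpen_lt continuous_const Complex.continuous_im).inter (isOpen_lt continuous_const
      continuous_norm)
  refine hV.contracts.differentiableOn_sol (F := 1) hU
    (fun ρ hρ x _ t => norm_jker_le hV.pos hρ.2.le hρ.1.le x t) (fun ρ _ => hV.measurable_jker ρ)
    (fun _ _ => measurable_const) zero_le_one (by simp) (fun x _ t ρ hρ => ?_)
    (fun x _ => differentiableOn_const _) (x := y) hy
  have hne := hV.ne_zero hρ.2.le
  unfold jker expI
  split_ifs
  · refine DifferentiableAt.differentiableWithinAt ?_
    have : 2 * Complex.I * ρ ≠ 0 := by simp [hne]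
    fun_prop (disch := assumption)
  · exact differentiableWithinAt_const _

theorem FarPot.continuousOn_jquot (hV : FarPot V r Y) {y : ℝ} (hy : Y < y) :
    ContinuousOn (fun ρ => jquot V ρ y) {ρ | 0 ≤ ρ.im ∧ r ≤ ‖ρ‖} := by
  refine hV.contracts.continuousOn_sol (F := 1)
    (fun ρ hρ x _ t => norm_jker_le hV.pos hρ.2 hρ.1 x t) (fun ρ _ => hV.measurable_jker ρ)
    (fun _ _ => measurable_const) zero_le_one (by simp) (fun x _ t ρ hρ => ?_)
    (fun x _ => continuousOn_const) (x := y) hy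
  have hne := hV.ne_zero hρ.2
  unfold jker expI
  split_ifs
  · refine ContinuousAt.continuousWithinAt ?_
    have : 2 * Complex.I * ρ ≠ 0 := by simp [hne]
    fun_prop (disch := assumption)
  · exact continuousWithinAt_const

theorem FarPot.norm_indicator_le (hV : FarPot V r Y) (hρ : r ≤ ‖ρ‖) (him : 0 ≤ ρ.im) {y : ℝ}
    (hy : Y < y) (t : ℝ) :
    ‖(Set.Ioi y).indicator (fun t => V t * jquot V ρ t) t‖ ≤
      (Set.Ioi y).indicator (fun t => ‖V t‖ * 2) t ∧
    ‖(Set.Ioi y).indicator (fun t => expI (2 * ρ) t * (V t * jquot V ρ t)) t‖ ≤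
      (Set.Ioi y).indicator (fun t => ‖V t‖ * 2) t := by
  by_cases ht : t ∈ Set.Ioi y
  · simp only [Set.indicator_of_mem ht, norm_mul]
    have h1 : ‖V t‖ * ‖jquot V ρ t‖ ≤ ‖V t‖ * 2 :=
      mul_le_mul_of_nonneg_left (hV.norm_jquot_le hρ him (hy.trans ht)) (norm_nonneg _)
    refine ⟨h1, (mul_le_of_le_one_left (by positivity) (norm_expI_le_one (by simpa using him)
      (hV.nonneg.trans (hy.trans ht).le))).trans h1⟩
  · simp only [Set.indicator_of_notMem ht, norm_zero]
    exact ⟨le_rfl, le_rfl⟩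

theorem FarPot.aesm_indicator (hV : FarPot V r Y) (hρ : r ≤ ‖ρ‖) (him : 0 ≤ ρ.im) {y : ℝ}
    (hy : Y < y) :
    AEStronglyMeasurable (fun t => (Set.Ioi y).indicator (fun t => V t * jquot V ρ t) t) ∧
    AEStronglyMeasurable (fun t => (Set.Ioi y).indicator
      (fun t => expI (2 * ρ) t * (V t * jquot V ρ t)) t) :=
  ⟨(aestronglyMeasurable_indicator_iff measurableSet_Ioi).2 ((hV.integrableOn_mul_jquot hρ
      him).mono_set (Set.Ioi_subset_Ioi hy.le)).aestronglyMeasurable,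
    (aestronglyMeasurable_indicator_iff measurableSet_Ioi).2 ((hV.integrableOn_exp_mul_jquot hρ
      him).mono_set (Set.Ioi_subset_Ioi hy.le)).aestronglyMeasurable⟩

theorem FarPot.integrable_bound (hV : FarPot V r Y) {y : ℝ} (hy : Y < y) :
    Integrable ((Set.Ioi y).indicator (fun t => ‖V t‖ * 2)) :=
  IntegrableOn.integrable_indicator
    ((hV.int.mono_set (Set.Ioi_subset_Ioi hy.le)).norm.mul_const 2) measurableSet_Ioi

theorem FarPot.differentiableOn_je (hV : FarPot V r Y) {y : ℝ} (hy : Y < y) :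
    DifferentiableOn ℂ (fun ρ => je V ρ y) {ρ | 0 < ρ.im ∧ r < ‖ρ‖} ∧
    DifferentiableOn ℂ (fun ρ => je' V ρ y) {ρ | 0 < ρ.im ∧ r < ‖ρ‖} := by
  have hU : IsOpen {ρ : ℂ | 0 < ρ.im ∧ r < ‖ρ‖} :=
    (isOpen_lt continuous_const Complex.continuous_im).inter (isOpen_lt continuous_const
      continuous_norm)
  have d1 := differentiableOn_integral_of_dominated hU (μ := volume)
    (F := fun ρ t => (Set.Ioi y).indicator (fun t => V t * jquot V ρ t) t)
    (fun ρ hρ => (hV.aesm_indicator hρ.2.le hρ.1.le hy).1) (fun t => by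
      by_cases ht : t ∈ Set.Ioi y
      · simp only [Set.indicator_of_mem ht]
        exact (hV.differentiableOn_jquot (hy.trans ht)).const_mul _
      · simp only [Set.indicator_of_notMem ht]
        exact differentiableOn_const _)
    (fun ρ hρ t => (hV.norm_indicator_le hρ.2.le hρ.1.le hy t).1) (hV.integrable_bound hy)
  have d2 := differentiableOn_integral_of_dominated hU (μ := volume)
    (F := fun ρ t => (Set.Ioi y).indicator (fun t => expI (2 * ρ) t * (V t * jquot V ρ t)) t)
    (fun ρ hρ => (hV.aesm_indicator hρ.2.le hρ.1.le hy).2) (fun t => by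
      by_cases ht : t ∈ Set.Ioi y
      · simp only [Set.indicator_of_mem ht]
        refine DifferentiableOn.mul ?_ ((hV.differentiableOn_jquot (hy.trans ht)).const_mul _)
        unfold expI
        fun_prop
      · simp only [Set.indicator_of_notMem ht]
        exact differentiableOn_const _)
    (fun ρ hρ t => (hV.norm_indicator_le hρ.2.le hρ.1.le hy t).2) (hV.integrable_bound hy)
  simp only [integral_indicator measurableSet_Ioi] at d1 d2
  have hlin : DifferentiableOn ℂ (fun ρ : ℂ => 2 * Complex.I * ρ) {ρ | 0 < ρ.im ∧ r < ‖ρ‖} := by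
    fun_prop
  have hne : ∀ ρ ∈ {ρ : ℂ | 0 < ρ.im ∧ r < ‖ρ‖}, 2 * Complex.I * ρ ≠ 0 := fun ρ hρ => by
    simp [hV.ne_zero hρ.2.le]
  have e1 := (differentiable_expI y).differentiableOn (s := {ρ : ℂ | 0 < ρ.im ∧ r < ‖ρ‖})
  have e2 : DifferentiableOn ℂ (fun ρ => expI (-ρ) y) {ρ : ℂ | 0 < ρ.im ∧ r < ‖ρ‖} := by
    unfold expI
    fun_prop
  have dP : DifferentiableOn ℂ (fun ρ => jcP V ρ y) {ρ | 0 < ρ.im ∧ r < ‖ρ‖} :=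
    (d1.div hlin hne).const_sub 1
  have dR : DifferentiableOn ℂ (fun ρ => jcR V ρ y) {ρ | 0 < ρ.im ∧ r < ‖ρ‖} := d2.div hlin hne
  refine ⟨(e1.mul dP).add (e2.mul dR), DifferentiableOn.mul ?_ ((e1.mul dP).sub (e2.mul dR))⟩
  fun_prop

theorem FarPot.continuousOn_je (hV : FarPot V r Y) {y : ℝ} (hy : Y < y) :
    ContinuousOn (fun ρ => je V ρ y) {ρ | 0 ≤ ρ.im ∧ r ≤ ‖ρ‖} ∧
    ContinuousOn (fun ρ => je' V ρ y) {ρ | 0 ≤ ρ.im ∧ r ≤ ‖ρ‖} := by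
  have d1 := continuousOn_of_dominated (μ := volume) (s := {ρ : ℂ | 0 ≤ ρ.im ∧ r ≤ ‖ρ‖})
    (F := fun ρ t => (Set.Ioi y).indicator (fun t => V t * jquot V ρ t) t)
    (fun ρ hρ => (hV.aesm_indicator hρ.2 hρ.1 hy).1)
    (fun ρ hρ => Eventually.of_forall fun t => (hV.norm_indicator_le hρ.2 hρ.1 hy t).1)
    (hV.integrable_bound hy) (Eventually.of_forall fun t => by
      by_cases ht : t ∈ Set.Ioi y
      · simp only [Set.indicator_of_mem ht]
        exact continuousOn_const.mul (hV.continuousOn_jquot (hy.trans ht))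
      · simp only [Set.indicator_of_notMem ht]
        exact continuousOn_const)
  have d2 := continuousOn_of_dominated (μ := volume) (s := {ρ : ℂ | 0 ≤ ρ.im ∧ r ≤ ‖ρ‖})
    (F := fun ρ t => (Set.Ioi y).indicator (fun t => expI (2 * ρ) t * (V t * jquot V ρ t)) t)
    (fun ρ hρ => (hV.aesm_indicator hρ.2 hρ.1 hy).2)
    (fun ρ hρ => Eventually.of_forall fun t => (hV.norm_indicator_le hρ.2 hρ.1 hy t).2)
    (hV.integrable_bound hy) (Eventually.of_forall fun t => by
      by_cases ht : t ∈ Set.Ioi y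
      · simp only [Set.indicator_of_mem ht]
        refine ContinuousOn.mul ?_ (continuousOn_const.mul (hV.continuousOn_jquot (hy.trans ht)))
        unfold expI
        fun_prop
      · simp only [Set.indicator_of_notMem ht]
        exact continuousOn_const)
  simp only [integral_indicator measurableSet_Ioi] at d1 d2
  have hlin : ContinuousOn (fun ρ : ℂ => 2 * Complex.I * ρ) {ρ | 0 ≤ ρ.im ∧ r ≤ ‖ρ‖} := by
    fun_prop
  have hne : ∀ ρ ∈ {ρ : ℂ | 0 ≤ ρ.im ∧ r ≤ ‖ρ‖}, 2 * Complex.I * ρ ≠ 0 := fun ρ hρ => by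
    simp [hV.ne_zero hρ.2]
  have e1 : ContinuousOn (fun ρ => expI ρ y) {ρ : ℂ | 0 ≤ ρ.im ∧ r ≤ ‖ρ‖} := by
    unfold expI
    fun_prop
  have e2 : ContinuousOn (fun ρ => expI (-ρ) y) {ρ : ℂ | 0 ≤ ρ.im ∧ r ≤ ‖ρ‖} := by
    unfold expI
    fun_prop
  have dP : ContinuousOn (fun ρ => jcP V ρ y) {ρ | 0 ≤ ρ.im ∧ r ≤ ‖ρ‖} :=
    continuousOn_const.sub (d1.div hlin hne)
  have dR : ContinuousOn (fun ρ => jcR V ρ y) {ρ | 0 ≤ ρ.im ∧ r ≤ ‖ρ‖} := d2.div hlin hne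
  refine ⟨(e1.mul dP).add (e2.mul dR), ContinuousOn.mul ?_ ((e1.mul dP).sub (e2.mul dR))⟩
  fun_prop

/-! ### The Jost solution in the basis of model solutions -/

variable {P : Params} {Q : ℝ → ℂ}

/-- The Wronskian of the Jost solution and a model solution. -/
def jwr (P : Params) (V : ℝ → ℂ) (j : Fin 2) (ρ : ℂ) (y : ℝ) : ℂ :=
  je V ρ y * bes' P j (ρ ^ 2) y - je' V ρ y * bes P j (ρ ^ 2) y

theorem setIntegral_Ioi_sub {f : ℝ → ℂ} (hf : IntegrableOn f (Set.Ioi Y)) {x y : ℝ} (hx : Y < x)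
    (hy : Y < y) : (∫ t in Set.Ioi x, f t) - ∫ t in Set.Ioi y, f t = ∫ t in x..y, f t :=
  intervalIntegral.integral_Ioi_sub_Ioi' (hf.mono_set (Set.Ioi_subset_Ioi hx.le))
    (hf.mono_set (Set.Ioi_subset_Ioi hy.le))

/-- The two functions solve equations whose potentials differ by `Q`, so their Wronskian has
derivative `-Q` times their product. This supplies the variation-of-constants coefficients of the
Jost solution. -/
theorem FarPot.jwr_sub (hP : Admissible P) (hV : FarPot V r Y)
    (hVQ : ∀ t, Y < t → V t = Q t + nuZero P / (t : ℂ) ^ 2) (hρ : r ≤ ‖ρ‖) (him : 0 ≤ ρ.im)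
    (j : Fin 2) {x y : ℝ} (hx : Y < x) (hy : Y < y) :
    jwr P V j ρ y - jwr P V j ρ x = -∫ t in x..y, bes P j (ρ ^ 2) t * (Q t * je V ρ t) := by
  have hne := hV.ne_zero hρ
  have hmem : ∀ z ∈ Set.uIcc x y, Y < z := fun z hz => (lt_min hx hy).trans_le hz.1
  have hpos : ∀ z ∈ Set.uIcc x y, 0 < z := fun z hz => hV.nonneg.trans_lt (hmem z hz)
  have i1 := hV.integrableOn_mul_jquot hρ him
  have i2 := hV.integrableOn_exp_mul_jquot hρ him
  have hsub : Set.uIoc x y ⊆ Set.Ioi Y := fun t ht => hmem t (Set.uIoc_subset_uIcc ht)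
  have ii1 : IntervalIntegrable (fun t => V t * jquot V ρ t / (2 * Complex.I * ρ)) volume x y :=
    (intervalIntegrable_iff.2 (i1.mono_set hsub)).div_const _
  have ii2 : IntervalIntegrable (fun t => -(expI (2 * ρ) t * (V t * jquot V ρ t) /
      (2 * Complex.I * ρ))) volume x y :=
    ((intervalIntegrable_iff.2 (i2.mono_set hsub)).div_const _).neg
  -- The Wronskian of `exp(iσt)` with the model solution. The Jost Wronskian is `jcP · w ρ + jcR · w
  -- (-ρ)`, two products of primitives.
  set w : ℂ → ℝ → ℂ := fun σ t => expI σ t * (bes' P j (ρ ^ 2) t - Complex.I * σ *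
    bes P j (ρ ^ 2) t) with hw
  set g : ℂ → ℝ → ℂ := fun σ t => expI σ t * (nuZero P / (t : ℂ) ^ 2 * bes P j (ρ ^ 2) t) with hg
  have hwd : ∀ σ : ℂ, σ ^ 2 = ρ ^ 2 → ∀ t, 0 < t → HasDerivAt (w σ) (g σ t) t := by
    intro σ hσ t ht
    have h := (hasDerivAt_expI σ t).mul ((hP.hasDerivAt_bes' j (ρ ^ 2) ht).sub
      ((hP.hasDerivAt_bes j (ρ ^ 2) ht).const_mul (Complex.I * σ)))
    refine h.congr_deriv ?_
    simp only [hg, Pi.sub_apply]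
    linear_combination (-expI σ t * bes P j (ρ ^ 2) t * σ ^ 2) * Complex.I_sq +
      (expI σ t * bes P j (ρ ^ 2) t) * hσ
  have hgc : ∀ σ : ℂ, ContinuousOn (g σ) (Set.uIcc x y) := fun σ => by
    have hb : ContinuousOn (bes P j (ρ ^ 2)) (Set.uIcc x y) :=
      (hP.continuousOn_bes j (ρ ^ 2)).mono fun t ht => hpos t ht
    refine (continuous_expI σ).continuousOn.mul (ContinuousOn.mul (ContinuousOn.div
      continuousOn_const (by fun_prop) fun t ht => ?_) hb)
    have := (hpos t ht).ne'
    exact pow_ne_zero 2 (by exact_mod_cast this)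
  have hwi : ∀ σ : ℂ, σ ^ 2 = ρ ^ 2 → ∀ z ∈ Set.uIcc x y,
      w σ z = w σ x + ∫ t in x..z, g σ t := by
    intro σ hσ z hz
    have hsub : Set.uIcc x z ⊆ Set.uIcc x y := Set.uIcc_subset_uIcc_left hz
    rw [intervalIntegral.integral_eq_sub_of_hasDerivAt (f := w σ)
      (fun t ht => hwd σ hσ t (hpos t (hsub ht)))
      ((hgc σ).mono hsub).intervalIntegrable]
    ring
  have k1 := integral_primitive_mul (p := jcP V ρ) (q := w ρ) ii1
    (hgc ρ).intervalIntegrable (fun z hz => by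
      rw [intervalIntegral.integral_div, ← setIntegral_Ioi_sub i1 hx (hmem z hz)]
      unfold jcP
      ring) (hwi ρ rfl)
  have k2 := integral_primitive_mul (p := jcR V ρ) (q := w (-ρ)) ii2
    (hgc (-ρ)).intervalIntegrable (fun z hz => by
      rw [intervalIntegral.integral_neg, intervalIntegral.integral_div,
        ← setIntegral_Ioi_sub i2 hx (hmem z hz)]
      unfold jcR
      ring) (hwi (-ρ) (neg_sq ρ))
  have hj : ∀ z, jwr P V j ρ z = jcP V ρ z * w ρ z + jcR V ρ z * w (-ρ) z := fun z => by
    simp only [hw]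
    unfold jwr je je'
    ring
  have e : jwr P V j ρ y - jwr P V j ρ x = (jcP V ρ y * w ρ y - jcP V ρ x * w ρ x) +
      (jcR V ρ y * w (-ρ) y - jcR V ρ x * w (-ρ) x) := by
    rw [hj, hj]
    ring
  rw [e, k1.2, k2.2, ← intervalIntegral.integral_add k1.1 k2.1, ← intervalIntegral.integral_neg]
  refine intervalIntegral.integral_congr fun t ht => ?_
  have htY := hmem t ht
  have ht0 := hpos t ht
  have e1 := expI_neg_mul ρ t
  have e2 : expI (2 * ρ) t = expI ρ t * expI ρ t := by
    rw [← expI_add]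
    congr 1
    ring

  have e4 := hVQ t htY
  have h2 : 2 * Complex.I * ρ ≠ 0 := by simp [hne]
  simp only [hw, hg]
  rw [e2]
  have e5 : V t * jquot V ρ t / (2 * Complex.I * ρ) *
      (expI ρ t * (bes' P j (ρ ^ 2) t - Complex.I * ρ * bes P j (ρ ^ 2) t)) +
      -(expI ρ t * expI ρ t * (V t * jquot V ρ t) / (2 * Complex.I * ρ)) *
      (expI (-ρ) t * (bes' P j (ρ ^ 2) t - Complex.I * -ρ * bes P j (ρ ^ 2) t)) =
      -(V t * je V ρ t * bes P j (ρ ^ 2) t) := by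
    rw [hV.je_eq hρ him htY]
    field_simp
    linear_combination (-V t * jquot V ρ t * expI ρ t * (bes' P j (ρ ^ 2) t + Complex.I * ρ * bes P j (ρ ^ 2) t)) * e1
  have e6 : je V ρ t = expI ρ t * jcP V ρ t + expI (-ρ) t * jcR V ρ t := rfl
  rw [e4] at e5
  rw [← e4] at e5
  linear_combination e5 + (-je V ρ t * bes P j (ρ ^ 2) t) * e4 -
    (nuZero P / (t : ℂ) ^ 2 * bes P j (ρ ^ 2) t) * e6

theorem jwr_hval (hP : Admissible P) (V : ℝ → ℂ) (ρ : ℂ) {y : ℝ} (hy : 0 < y) :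
    hval P (ρ ^ 2) (jwr P V 1 ρ) (fun y => -jwr P V 0 ρ y) y = je V ρ y ∧
    hder P (ρ ^ 2) (jwr P V 1 ρ) (fun y => -jwr P V 0 ρ y) y = je' V ρ y := by
  have := hP.bes_wronskian (ρ ^ 2) hy
  unfold hval hder jwr
  constructor
  · linear_combination je V ρ y * this
  · linear_combination je' V ρ y * this

/-- This puts the Jost solution in the same format as the solutions built from the singular point,
so that Wronskians between the two kinds are known to be constant. -/
theorem FarPot.hSol (hP : Admissible P) (hV : FarPot V r Y)
    (hVQ : ∀ t, Y < t → V t = Q t + nuZero P / (t : ℂ) ^ 2) (hρ : r ≤ ‖ρ‖) (him : 0 ≤ ρ.im) :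
    HSol P Q (ρ ^ 2) Y (jwr P V 1 ρ) (fun y => -jwr P V 0 ρ y) := by
  have hc : ∀ x y : ℝ, Y < x → Y < y → Set.EqOn
      (hval P (ρ ^ 2) (jwr P V 1 ρ) (fun y => -jwr P V 0 ρ y)) (je V ρ) (Set.uIcc x y) :=
    fun x y hx hy t ht => (jwr_hval hP V ρ (hV.nonneg.trans_lt ((lt_min hx hy).trans_le ht.1))).1
  refine ⟨fun x y hx hy => ?_, fun x y hx hy => ?_, fun x y hx hy => ?_⟩
  · have hmem : ∀ z ∈ Set.uIcc x y, Y < z := fun z hz => (lt_min hx hy).trans_le hz.1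
    have hsub : Set.uIoc x y ⊆ Set.Ioi Y := fun t ht => hmem t (Set.uIoc_subset_uIcc ht)
    have i1 : IntervalIntegrable (fun t => V t * jquot V ρ t) volume x y :=
      intervalIntegrable_iff.2 ((hV.integrableOn_mul_jquot hρ him).mono_set hsub)
    have i3 : IntervalIntegrable (fun t => V t * jquot V ρ t * expI ρ t) volume x y :=
      i1.mul_continuousOn (continuous_expI ρ).continuousOn
    have cje : ContinuousOn (je V ρ) (Set.uIcc x y) := by
      have prim : ∀ f : ℝ → ℂ, IntegrableOn f (Set.Ioi Y) →
          ContinuousOn (fun z => ∫ t in Set.Ioi z, f t) (Set.uIcc x y) := by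
        intro f hf
        have h := intervalIntegral.continuousOn_primitive_interval' (a := x) (b₁ := x) (b₂ := y)
          (intervalIntegrable_iff.2 (hf.mono_set hsub)) Set.left_mem_uIcc
        refine (continuousOn_const.sub h).congr (f := fun z => (∫ t in Set.Ioi x, f t) -
          ∫ t in x..z, f t) fun z hz => ?_
        simp only
        rw [← setIntegral_Ioi_sub hf hx (hmem z hz)]
        ring
      exact ((continuous_expI ρ).continuousOn.mul (continuousOn_const.sub
        ((prim _ (hV.integrableOn_mul_jquot hρ him)).div_const _))).add
        ((continuous_expI (-ρ)).continuousOn.mul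
          ((prim _ (hV.integrableOn_exp_mul_jquot hρ him)).div_const _))
    have i4 : IntervalIntegrable (fun t => nuZero P / (t : ℂ) ^ 2 * je V ρ t) volume x y := by
      refine ContinuousOn.intervalIntegrable (ContinuousOn.mul (ContinuousOn.div
        continuousOn_const (by fun_prop) fun t ht => ?_) cje)
      have := (hV.nonneg.trans_lt (hmem t ht)).ne'
      exact pow_ne_zero 2 (by exact_mod_cast this)
    refine (i3.sub i4).congr fun t ht => ?_
    have htm := Set.uIoc_subset_uIcc ht
    have htY := hmem t htm
    rw [hc x y hx hy htm, hV.je_eq hρ him htY, hVQ t htY]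
    ring
  · have := hV.jwr_sub hP hVQ hρ him 1 hx hy
    rw [intervalIntegral.integral_congr (g := fun t => bes P 1 (ρ ^ 2) t * (Q t * je V ρ t))
      (fun t ht => by simp only [hc x y hx hy ht])]
    linear_combination this
  · have := hV.jwr_sub hP hVQ hρ him 0 hx hy
    rw [intervalIntegral.integral_congr (g := fun t => bes P 0 (ρ ^ 2) t * (Q t * je V ρ t))
      (fun t ht => by simp only [hc x y hx hy ht])]
    linear_combination -this

end

section

/-! ### The Jost solution of the model equation -/

variable {P : Params} {ρ : ℂ}

/-- The potential of the model equation. -/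
def mpot (P : Params) (t : ℝ) : ℂ := nuZero P / (t : ℂ) ^ 2

theorem integral_mpot (P : Params) {Y : ℝ} (hY : 0 < Y) :
    IntegrableOn (mpot P) (Set.Ioi Y) ∧ ∫ t in Set.Ioi Y, ‖mpot P t‖ = ‖nuZero P‖ / Y := by
  have hn : ∀ t ∈ Set.Ioi Y, ‖mpot P t‖ = ‖nuZero P‖ * t ^ (-2 : ℝ) := by
    intro t ht
    have ht0 : 0 < t := hY.trans ht
    rw [mpot, norm_div, norm_pow, Complex.norm_real, Real.norm_of_nonneg ht0.le,
      Real.rpow_neg ht0.le, div_eq_mul_inv]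
    norm_num
  have hi := (integrableOn_Ioi_rpow_of_lt (by norm_num : (-2 : ℝ) < -1) hY).const_mul ‖nuZero P‖
  constructor
  · refine Integrable.mono' hi ?_ ?_
    · exact (by unfold mpot; fun_prop : Measurable (mpot P)).aestronglyMeasurable
    · filter_upwards [ae_restrict_mem measurableSet_Ioi] with t ht
      rw [hn t ht]
  · rw [setIntegral_congr_fun measurableSet_Ioi hn, integral_const_mul,
      integral_Ioi_rpow_of_lt (by norm_num) hY]
    norm_num
    rw [Real.rpow_neg_one, div_eq_mul_inv]

theorem farPot_mpot (P : Params) {r Y : ℝ} (hr : 0 < r) (hY : 0 < Y)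
    (h : 2 * ‖nuZero P‖ ≤ r * Y) : FarPot (mpot P) r Y := by
  refine ⟨by unfold mpot; fun_prop, (integral_mpot P hY).1, hr, hY.le, ?_⟩
  rw [(integral_mpot P hY).2, div_le_div_iff₀ hY two_pos]
  linarith

theorem jwr_mpot_const (hP : Admissible P) (j : Fin 2) (him : 0 ≤ ρ.im) (hρ : ρ ≠ 0) {x y : ℝ}
    (hx0 : 0 < x) (hy0 : 0 < y) (hx : 2 * ‖nuZero P‖ < ‖ρ‖ * x) (hy : 2 * ‖nuZero P‖ < ‖ρ‖ * y) :
    jwr P (mpot P) j ρ y = jwr P (mpot P) j ρ x := by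
  have hn : 0 < ‖ρ‖ := norm_pos_iff.2 hρ
  have key : ∀ z, 0 < z → 2 * ‖nuZero P‖ < ‖ρ‖ * z → 2 * ‖nuZero P‖ / ‖ρ‖ < z := fun z _ hz => by
    rw [div_lt_iff₀ hn]
    linarith
  obtain ⟨Y, hY1, hY2⟩ := exists_between (max_lt (lt_min hx0 hy0) (lt_min (key x hx0 hx)
    (key y hy0 hy)))
  have hY0 : 0 < Y := (le_max_left _ _).trans_lt hY1
  have hF : FarPot (mpot P) ‖ρ‖ Y := farPot_mpot P hn hY0 (by
    have := (le_max_right _ _).trans_lt hY1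
    rw [div_lt_iff₀ hn] at this
    linarith)
  have := hF.jwr_sub (Q := fun _ => 0) hP (fun t _ => by simp [mpot]) le_rfl him j
    (hY2.trans_le (min_le_left _ _)) (hY2.trans_le (min_le_right _ _))
  simpa [sub_eq_zero] using this

theorem mpot_scale (P : Params) {c : ℝ} (hc : c ≠ 0) (t : ℝ) :
    mpot P t = (c : ℂ) ^ 2 * mpot P (c * t) := by
  have hc' : (c : ℂ) ≠ 0 := by exact_mod_cast hc
  unfold mpot
  push_cast
  by_cases ht : (t : ℂ) = 0
  · simp [ht]
  · field_simp

theorem expI_scale (ρ : ℂ) (c t : ℝ) : expI (c * ρ) t = expI ρ (c * t) := by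
  unfold expI
  congr 1
  push_cast
  ring

theorem jker_scale (P : Params) (ρ : ℂ) {c : ℝ} (hc : 0 < c) (x t : ℝ) :
    jker (mpot P) (c * ρ) x t = c * jker (mpot P) ρ (c * x) (c * t) := by
  unfold jker
  have hc' : (c : ℂ) ≠ 0 := by exact_mod_cast hc.ne'
  by_cases h : x < t
  · rw [if_pos h, if_pos ((mul_lt_mul_iff_right₀ hc).2 h), mpot_scale P hc.ne' t,
      show 2 * ((c : ℂ) * ρ) = c * (2 * ρ) by ring, expI_scale, mul_sub]
    by_cases hρ : ρ = 0
    · simp [hρ]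
    · field_simp
  · rw [if_neg h, if_neg (fun h' => h ((mul_lt_mul_iff_right₀ hc).1 h')), mul_zero]

theorem jquot_scale (P : Params) (ρ : ℂ) {c : ℝ} (hc : 0 < c) (y : ℝ) :
    jquot (mpot P) (c * ρ) y = jquot (mpot P) ρ (c * y) := by
  have h : ∀ n y, volterraIter (jker (mpot P) (c * ρ)) (fun _ => 1) n y =
      volterraIter (jker (mpot P) ρ) (fun _ => 1) n (c * y) := by
    intro n
    induction n with
    | zero => intro y; rfl
    | succ n ih =>
      intro y
      have e : ∀ t, jker (mpot P) (c * ρ) y t * volterraIter (jker (mpot P) (c * ρ))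
          (fun _ => 1) n t = c * ((fun s => jker (mpot P) ρ (c * y) s *
            volterraIter (jker (mpot P) ρ) (fun _ => 1) n s) (c * t)) := fun t => by
        rw [ih, jker_scale P ρ hc]
        ring
      simp only [volterraIter]
      simp only [e]
      rw [integral_const_mul, Measure.integral_comp_mul_left (fun s => jker (mpot P) ρ (c * y) s *
        volterraIter (jker (mpot P) ρ) (fun _ => 1) n s), abs_of_pos (inv_pos.2 hc),
        Complex.real_smul, ← mul_assoc]
      have hc' : (c : ℂ) ≠ 0 := by exact_mod_cast hc.ne'
      push_cast
      rw [mul_inv_cancel₀ hc', one_mul]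
  unfold jquot volterraSol
  exact tsum_congr fun n => h n y

theorem setIntegral_scale {f g : ℝ → ℂ} {c : ℝ} (hc : 0 < c)
    (h : ∀ t, f t = (c : ℂ) ^ 2 * g (c * t)) (y : ℝ) :
    ∫ t in Set.Ioi y, f t = c * ∫ t in Set.Ioi (c * y), g t := by
  have hc' : (c : ℂ) ≠ 0 := by exact_mod_cast hc.ne'
  simp only [h]
  rw [integral_const_mul, integral_comp_mul_left_Ioi g y hc, Complex.real_smul]
  push_cast
  field_simp

theorem jc_scale (P : Params) (ρ : ℂ) {c : ℝ} (hc : 0 < c) (y : ℝ) :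
    jcP (mpot P) (c * ρ) y = jcP (mpot P) ρ (c * y) ∧
    jcR (mpot P) (c * ρ) y = jcR (mpot P) ρ (c * y) := by
  have hc' : (c : ℂ) ≠ 0 := by exact_mod_cast hc.ne'
  constructor
  · unfold jcP
    rw [setIntegral_scale (g := fun t => mpot P t * jquot (mpot P) ρ t) hc fun t => by
      rw [jquot_scale P ρ hc, mpot_scale P hc.ne' t]
      ring]
    congr 1
    by_cases hρ : ρ = 0
    · simp [hρ]
    · field_simp
  · unfold jcR
    rw [setIntegral_scale (g := fun t => expI (2 * ρ) t * (mpot P t * jquot (mpot P) ρ t)) hc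
      fun t => by
      rw [jquot_scale P ρ hc, mpot_scale P hc.ne' t,
        show 2 * ((c : ℂ) * ρ) = c * (2 * ρ) by ring, expI_scale]
      ring]
    by_cases hρ : ρ = 0
    · simp [hρ]
    · field_simp

theorem je_scale (P : Params) (ρ : ℂ) {c : ℝ} (hc : 0 < c) (y : ℝ) :
    je (mpot P) (c * ρ) y = je (mpot P) ρ (c * y) ∧
    je' (mpot P) (c * ρ) y = c * je' (mpot P) ρ (c * y) := by
  obtain ⟨h1, h2⟩ := jc_scale P ρ hc y
  unfold je je'
  rw [h1, h2, show -((c : ℂ) * ρ) = c * (-ρ) by ring, expI_scale, expI_scale]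
  exact ⟨rfl, by ring⟩

theorem bes_scale (P : Params) (j : Fin 2) (lam : ℂ) {c y : ℝ} (hc : 0 < c) (hy : 0 < y) :
    bes P j lam (c * y) = (c : ℂ) ^ expo P j * bes P j ((c : ℂ) ^ 2 * lam) y ∧
    c * bes' P j lam (c * y) = (c : ℂ) ^ expo P j * bes' P j ((c : ℂ) ^ 2 * lam) y := by
  have hc' : (c : ℂ) ≠ 0 := by exact_mod_cast hc.ne'
  have e : lam * ((c * y : ℝ) : ℂ) ^ 2 = (c : ℂ) ^ 2 * lam * (y : ℂ) ^ 2 := by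
    push_cast
    ring
  unfold bes bes'
  rw [e]
  constructor
  · push_cast
    rw [Complex.mul_cpow_ofReal_nonneg hc.le hy.le]
    ring
  · push_cast
    rw [Complex.mul_cpow_ofReal_nonneg hc.le hy.le, Complex.cpow_sub _ _ hc', Complex.cpow_one]
    field_simp

theorem jwr_scale (P : Params) (j : Fin 2) (ρ : ℂ) {c y : ℝ} (hc : 0 < c) (hy : 0 < y) :
    (c : ℂ) ^ expo P j * jwr P (mpot P) j (c * ρ) y = c * jwr P (mpot P) j ρ (c * y) := by
  obtain ⟨h1, h2⟩ := je_scale P ρ hc y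
  obtain ⟨h3, h4⟩ := bes_scale P j (ρ ^ 2) hc hy
  unfold jwr
  rw [h1, h2, mul_pow]
  linear_combination (-je (mpot P) ρ (c * y)) * h4 + c * je' (mpot P) ρ (c * y) * h3

/-- The coefficients of the model Jost solution in the basis of model solutions. -/
def mcoef (P : Params) (j : Fin 2) (ρ : ℂ) : ℂ :=
  ![jwr P (mpot P) 1 ρ ((2 * ‖nuZero P‖ + 1) / ‖ρ‖),
    -jwr P (mpot P) 0 ρ ((2 * ‖nuZero P‖ + 1) / ‖ρ‖)] j

theorem mcoef_eq (hP : Admissible P) (him : 0 ≤ ρ.im) (hρ : ρ ≠ 0) {y : ℝ}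
    (hy0 : 0 < y) (hy : 2 * ‖nuZero P‖ < ‖ρ‖ * y) :
    mcoef P 0 ρ = jwr P (mpot P) 1 ρ y ∧ mcoef P 1 ρ = -jwr P (mpot P) 0 ρ y := by
  have hn : 0 < ‖ρ‖ := norm_pos_iff.2 hρ
  have h1 : 2 * ‖nuZero P‖ < ‖ρ‖ * ((2 * ‖nuZero P‖ + 1) / ‖ρ‖) := by
    rw [mul_div_cancel₀ _ hn.ne']
    linarith
  have h2 : 0 < (2 * ‖nuZero P‖ + 1) / ‖ρ‖ := by positivity
  constructor
  · exact jwr_mpot_const hP 1 him hρ hy0 h2 hy h1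
  · simp only [mcoef, Matrix.cons_val_one, Matrix.cons_val_fin_one]
    rw [jwr_mpot_const hP 0 him hρ hy0 h2 hy h1]

/-- The potential `ν₀/t²` is homogeneous of degree `-2`. Hence the model Jost solution depends on
`ρy` only, while the model solutions pick up `c^{μ_i}`. The index switches because the coefficient
of one model solution is the Wronskian with the other, and `μ₁ + μ₂ = 1`. -/
theorem mcoef_scale (P : Params) (j : Fin 2) (hρ : ρ ≠ 0) {c : ℝ} (hc : 0 < c) :
    mcoef P j (c * ρ) = (c : ℂ) ^ expo P j * mcoef P j ρ := by
  have hn : 0 < ‖ρ‖ := norm_pos_iff.2 hρ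
  have hc' : (c : ℂ) ≠ 0 := by exact_mod_cast hc.ne'
  set y := (2 * ‖nuZero P‖ + 1) / ‖(c : ℂ) * ρ‖ with hydef
  have hcn : ‖(c : ℂ) * ρ‖ = c * ‖ρ‖ := by
    rw [norm_mul, Complex.norm_real, Real.norm_of_nonneg hc.le]
  have hy : 0 < y := by
    rw [hydef, hcn]
    positivity
  have hcy : c * y = (2 * ‖nuZero P‖ + 1) / ‖ρ‖ := by
    rw [hydef, hcn]
    field_simp
  have key : ∀ i, (c : ℂ) ^ expo P i * jwr P (mpot P) i (c * ρ) y =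
      c * jwr P (mpot P) i ρ ((2 * ‖nuZero P‖ + 1) / ‖ρ‖) := fun i => by
    rw [← hcy]
    exact jwr_scale P i ρ hc hy
  have hprod : (c : ℂ) ^ expo P 0 * (c : ℂ) ^ expo P 1 = c := by
    rw [← Complex.cpow_add _ _ hc', expo_add, Complex.cpow_one]
  have hne : ∀ i, (c : ℂ) ^ expo P i ≠ 0 := fun i => by simp [Complex.cpow_eq_zero_iff, hc']
  fin_cases j
  · simp only [mcoef, Fin.zero_eta, Matrix.cons_val_zero]
    rw [← hydef]
    apply mul_left_cancel₀ (hne 1)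
    rw [key 1, ← mul_assoc, mul_comm ((c : ℂ) ^ expo P 1), hprod]
  · simp only [mcoef, Fin.mk_one, Matrix.cons_val_one, Matrix.cons_val_fin_one]
    rw [← hydef]
    apply mul_left_cancel₀ (hne 0)
    rw [mul_neg, key 0, ← mul_assoc, hprod, mul_neg]

theorem mcoef_regular (hP : Admissible P) (j : Fin 2) (him : 0 ≤ ρ.im) (hρ : ρ ≠ 0) :
    ContinuousWithinAt (mcoef P j) {ρ | 0 ≤ ρ.im} ρ ∧
    (0 < ρ.im → DifferentiableAt ℂ (mcoef P j) ρ) := by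
  have hn : 0 < ‖ρ‖ := norm_pos_iff.2 hρ
  set r := ‖ρ‖ / 2 with hr
  have hr0 : 0 < r := by positivity
  set Y := (2 * ‖nuZero P‖ + 1) / r with hY
  have hY0 : 0 < Y := by positivity
  have hF : FarPot (mpot P) r Y := farPot_mpot P hr0 hY0 (by
    rw [hY, mul_div_cancel₀ _ hr0.ne']
    linarith)
  set y := Y + 1 with hydef
  have hyY : Y < y := by linarith
  have hy0 : 0 < y := by linarith
  have hbig : ∀ σ : ℂ, r ≤ ‖σ‖ → 2 * ‖nuZero P‖ < ‖σ‖ * y := fun σ hσ => by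
    have : r * Y = 2 * ‖nuZero P‖ + 1 := mul_div_cancel₀ _ hr0.ne'
    have : r * Y ≤ ‖σ‖ * y := by gcongr
    linarith
  have hopen : IsOpen {σ : ℂ | r < ‖σ‖} := isOpen_lt continuous_const continuous_norm
  have hρr : r < ‖ρ‖ := by linarith
  have sq : ∀ s : Set ℂ, ContinuousOn (fun σ : ℂ => σ ^ 2) s := fun s => by fun_prop
  set G : ℂ → ℂ := fun σ => ![jwr P (mpot P) 1 σ y, -jwr P (mpot P) 0 σ y] j with hG
  have hGeq : ∀ σ : ℂ, 0 ≤ σ.im → r < ‖σ‖ → mcoef P j σ = G σ := fun σ h1 h2 => by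
    have := mcoef_eq hP h1 (norm_pos_iff.1 (hr0.trans h2)) hy0 (hbig σ h2.le)
    fin_cases j
    · exact this.1
    · exact this.2
  constructor
  · have hc : ∀ i, ContinuousOn (fun σ => jwr P (mpot P) i σ y) {σ | 0 ≤ σ.im ∧ r ≤ ‖σ‖} := by
      intro i
      have c1 := (hP.differentiable_bes i y).continuous.comp (continuous_pow 2)
      have c2 := (hP.differentiable_bes' i y).continuous.comp (continuous_pow 2)
      exact ((hF.continuousOn_je hyY).1.mul c2.continuousOn).sub
        ((hF.continuousOn_je hyY).2.mul c1.continuousOn)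
    have hGc : ContinuousOn G {σ | 0 ≤ σ.im ∧ r ≤ ‖σ‖} := by
      fin_cases j
      · exact hc 1
      · exact (hc 0).neg
    have h1 : ContinuousWithinAt G ({σ | 0 ≤ σ.im} ∩ {σ | r < ‖σ‖}) ρ :=
      (hGc ρ ⟨him, hρr.le⟩).mono fun σ h => ⟨h.1, le_of_lt h.2⟩
    have h2 := h1.congr (g := mcoef P j) (fun σ h => hGeq σ h.1 h.2) (hGeq ρ him hρr)
    exact (continuousWithinAt_inter (hopen.mem_nhds hρr)).1 h2
  · intro hpos
    have hU : IsOpen {σ : ℂ | 0 < σ.im ∧ r < ‖σ‖} :=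
      (isOpen_lt continuous_const Complex.continuous_im).inter hopen
    have hd : ∀ i, DifferentiableAt ℂ (fun σ => jwr P (mpot P) i σ y) ρ := by
      intro i
      have c1 := (hP.differentiable_bes i y).comp (differentiable_pow 2)
      have c2 := (hP.differentiable_bes' i y).comp (differentiable_pow 2)
      have hm := hU.mem_nhds (show ρ ∈ {σ : ℂ | 0 < σ.im ∧ r < ‖σ‖} from ⟨hpos, hρr⟩)
      exact (((hF.differentiableOn_je hyY).1.differentiableAt hm).mul (c2 ρ)).sub
        (((hF.differentiableOn_je hyY).2.differentiableAt hm).mul (c1 ρ))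
    have hGd : DifferentiableAt ℂ G ρ := by
      fin_cases j
      · exact hd 1
      · exact (hd 0).neg
    refine hGd.congr_of_eventuallyEq ?_
    filter_upwards [hU.mem_nhds (show ρ ∈ {σ : ℂ | 0 < σ.im ∧ r < ‖σ‖} from ⟨hpos, hρr⟩)]
      with σ hσ
    exact hGeq σ hσ.1.le hσ.2

/-- The logarithm on the closed upper half-plane with imaginary part in `[0, π]`. -/
def ulog (ρ : ℂ) : ℂ := Complex.log (-(Complex.I * ρ)) + Real.pi / 2 * Complex.I

theorem mem_slitPlane_of_im (him : 0 ≤ ρ.im) (hρ : ρ ≠ 0) :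
    -(Complex.I * ρ) ∈ Complex.slitPlane := by
  rw [Complex.mem_slitPlane_iff]
  rcases him.lt_or_eq with h | h
  · left
    simpa using h
  · right
    intro h0
    refine hρ (Complex.ext ?_ h.symm)
    simpa using h0

theorem differentiableAt_ulog (him : 0 ≤ ρ.im) (hρ : ρ ≠ 0) : DifferentiableAt ℂ ulog ρ := by
  have : DifferentiableAt ℂ (fun ρ : ℂ => -(Complex.I * ρ)) ρ := by fun_prop
  exact (this.clog (mem_slitPlane_of_im him hρ)).add_const _

theorem exp_ulog (hρ : ρ ≠ 0) : Complex.exp (ulog ρ) = ρ := by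
  rw [ulog, Complex.exp_add, Complex.exp_log (by simpa using hρ), Complex.exp_pi_div_two_mul_I]
  linear_combination (-ρ) * Complex.I_sq

theorem ulog_scale (hρ : ρ ≠ 0) {c : ℝ} (hc : 0 < c) :
    ulog (c * ρ) = (Real.log c : ℂ) + ulog ρ := by
  rw [ulog, ulog, show -(Complex.I * ((c : ℂ) * ρ)) = c * -(Complex.I * ρ) by ring,
    Complex.log_ofReal_mul hc (by simpa using hρ)]
  ring

theorem ulog_one : ulog 1 = 0 := by
  rw [ulog, mul_one, Complex.log_neg_I]
  ring

/-- Divided by `ρ^{μ_j}` the coefficient is invariant under positive dilations. Its radial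
derivative vanishes, hence so does its complex derivative, and it is constant in the open
half-plane. Continuity extends this to the real axis without the origin. -/
theorem exists_mcoef_eq (hP : Admissible P) (j : Fin 2) : ∃ β : ℂ, ∀ ρ : ℂ, 0 ≤ ρ.im → ρ ≠ 0 →
    mcoef P j ρ = β * Complex.exp (expo P j * ulog ρ) := by
  set G : ℂ → ℂ := fun ρ => mcoef P j ρ * Complex.exp (-(expo P j * ulog ρ)) with hG
  have hGs : ∀ (ρ : ℂ) (c : ℝ), ρ ≠ 0 → 0 < c → G (c * ρ) = G ρ := by
    intro ρ c hρ hc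
    have hc' : (c : ℂ) ≠ 0 := by exact_mod_cast hc.ne'
    simp only [hG]
    rw [mcoef_scale P j hρ hc, ulog_scale hρ hc, Complex.cpow_def_of_ne_zero hc',
      Complex.ofReal_log hc.le]
    have : Complex.exp (-(expo P j * (Complex.log c + ulog ρ))) =
        Complex.exp (-(Complex.log c * expo P j)) * Complex.exp (-(expo P j * ulog ρ)) := by
      rw [← Complex.exp_add]
      congr 1
      ring
    rw [this]
    have h1 : Complex.exp (Complex.log c * expo P j) * Complex.exp (-(Complex.log c * expo P j)) =
        1 := by
      rw [← Complex.exp_add]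
      simp
    linear_combination (mcoef P j ρ * Complex.exp (-(expo P j * ulog ρ))) * h1
  have hne : ∀ ρ : ℂ, 0 < ρ.im → ρ ≠ 0 := fun ρ h h0 => by simp [h0] at h
  have hGd : ∀ ρ : ℂ, 0 < ρ.im → DifferentiableAt ℂ G ρ := fun ρ h =>
    ((mcoef_regular hP j h.le (hne ρ h)).2 h).mul
      ((differentiableAt_ulog h.le (hne ρ h)).const_mul _).neg.cexp
  have hGc : ∀ ρ : ℂ, 0 ≤ ρ.im → ρ ≠ 0 → ContinuousWithinAt G {ρ | 0 ≤ ρ.im} ρ := fun ρ h h0 =>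
    (mcoef_regular hP j h h0).1.mul
      ((differentiableAt_ulog h h0).continuousAt.const_mul _).neg.cexp.continuousWithinAt
  have hU : IsOpen {ρ : ℂ | 0 < ρ.im} := isOpen_lt continuous_const Complex.continuous_im
  have hder : ∀ ρ : ℂ, 0 < ρ.im → deriv G ρ = 0 := by
    intro ρ h
    have h1 : HasDerivAt (fun c : ℝ => (c : ℂ) * ρ) ρ (1 : ℝ) := by
      simpa using (Complex.ofRealCLM.hasDerivAt (x := 1)).mul_const ρ
    have h2 : HasDerivAt (fun c : ℝ => G ((c : ℂ) * ρ)) (deriv G ρ * ρ) (1 : ℝ) := by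
      have := (hGd ρ h).hasDerivAt
      refine HasDerivAt.comp (1 : ℝ) (h₂ := G) (by simpa using this) h1
    have h3 : HasDerivAt (fun c : ℝ => G ((c : ℂ) * ρ)) 0 (1 : ℝ) := by
      refine (hasDerivAt_const (1 : ℝ) (G ρ)).congr_of_eventuallyEq ?_
      filter_upwards [lt_mem_nhds (zero_lt_one (α := ℝ))] with c hc
      exact hGs ρ c (hne ρ h) hc
    exact (mul_eq_zero.1 (h2.unique h3)).resolve_right (hne ρ h)
  have hconv : Convex ℝ {ρ : ℂ | 0 < ρ.im} := convex_halfSpace_im_gt 0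
  have hI : (0 : ℝ) < Complex.I.im := by simp
  have hconst : ∀ ρ : ℂ, 0 < ρ.im → G ρ = G Complex.I := by
    intro ρ h
    exact hU.is_const_of_deriv_eq_zero hconv.isPreconnected
      (fun z hz => (hGd z hz).differentiableWithinAt) (fun z hz => hder z hz) h hI
  refine ⟨G Complex.I, fun ρ h h0 => ?_⟩
  have hGρ : G ρ = G Complex.I := by
    have hlim : Tendsto (fun ε : ℝ => ρ + ε * Complex.I) (𝓝[>] 0) (𝓝[{ρ | 0 ≤ ρ.im}] ρ) := by
      refine tendsto_nhdsWithin_iff.2 ⟨?_, ?_⟩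
      · have : Continuous (fun ε : ℝ => ρ + ε * Complex.I) := by fun_prop
        have h2 := this.tendsto 0
        simp only [Complex.ofReal_zero, zero_mul, add_zero] at h2
        exact h2.mono_left nhdsWithin_le_nhds
      · filter_upwards [self_mem_nhdsWithin] with ε hε
        have : (0 : ℝ) < ε := hε
        simp
        linarith
    have h1 := (hGc ρ h h0).tendsto.comp hlim
    refine tendsto_nhds_unique h1 (tendsto_const_nhds.congr' ?_)
    filter_upwards [self_mem_nhdsWithin] with ε hε
    have : (0 : ℝ) < ε := hε
    exact (hconst _ (by simp; linarith)).symm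
  rw [← hGρ]
  simp only [hG]
  rw [mul_assoc, ← Complex.exp_add]
  simp

theorem je_mpot_eq (hP : Admissible P) (him : 0 ≤ ρ.im) (hρ : ρ ≠ 0) {y : ℝ}
    (hy0 : 0 < y) (hy : 2 * ‖nuZero P‖ < ‖ρ‖ * y) :
    je (mpot P) ρ y = mcoef P 0 ρ * bes P 0 (ρ ^ 2) y + mcoef P 1 ρ * bes P 1 (ρ ^ 2) y ∧
    je' (mpot P) ρ y = mcoef P 0 ρ * bes' P 0 (ρ ^ 2) y + mcoef P 1 ρ * bes' P 1 (ρ ^ 2) y := by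
  obtain ⟨h1, h2⟩ := mcoef_eq hP him hρ hy0 hy
  obtain ⟨h3, h4⟩ := jwr_hval hP (mpot P) ρ hy0
  rw [h1, h2]
  exact ⟨h3.symm, h4.symm⟩

/-- The model Jost solutions for `ρ = 1` and `ρ = -1` belong to the same `λ = 1`. Their Wronskian is
computed at infinity from the exponentials and at finite points from the coefficients. -/
theorem mcoef_wronskian (hP : Admissible P) :
    mcoef P 0 1 * mcoef P 1 (-1) - mcoef P 1 1 * mcoef P 0 (-1) = -2 * Complex.I := by
  have hF : FarPot (mpot P) 1 (2 * ‖nuZero P‖ + 1) :=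
    farPot_mpot P one_pos (by positivity) (by linarith)
  obtain ⟨a1, a2⟩ := hF.tendsto_je (ρ := 1) (by simp) (by simp)
  obtain ⟨b1, b2⟩ := hF.tendsto_je (ρ := -1) (by simp) (by simp)
  have hlim := (a1.mul b2).sub (a2.mul b1)
  have hval : 1 * (Complex.I * -1) - Complex.I * 1 * 1 = -2 * Complex.I := by ring
  rw [hval] at hlim
  refine tendsto_nhds_unique (tendsto_const_nhds.congr' ?_) hlim
  filter_upwards [eventually_gt_atTop (2 * ‖nuZero P‖ + 1)] with y hy
  have hy0 : 0 < y := lt_trans (by positivity) hy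
  obtain ⟨c1, c2⟩ := je_mpot_eq hP (ρ := 1) (by simp) one_ne_zero hy0 (by simp; linarith)
  obtain ⟨d1, d2⟩ := je_mpot_eq hP (ρ := -1) (by simp) (by simp) hy0 (by simp; linarith)
  have e := expI_neg_mul 1 y
  have w := hP.bes_wronskian 1 hy0
  rw [neg_one_sq] at d1 d2
  rw [one_pow] at c1 c2
  rw [c1, c2, d1, d2, neg_neg]
  linear_combination (-(mcoef P 0 1 * mcoef P 1 (-1) - mcoef P 1 1 * mcoef P 0 (-1))) * w -
    ((mcoef P 0 1 * mcoef P 1 (-1) - mcoef P 1 1 * mcoef P 0 (-1)) *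
      (bes P 0 1 y * bes' P 1 1 y - bes' P 0 1 y * bes P 1 1 y)) * e

/-- Size of the coefficients of the model Jost solution. -/
theorem exists_mcoef_bound (hP : Admissible P) : ∃ (β : ℂ) (K : ℝ), β ≠ 0 ∧ 0 < K ∧
    ∀ ρ : ℂ, 0 ≤ ρ.im → ρ ≠ 0 → mcoef P 0 ρ * mcoef P 1 ρ = β * ρ ∧
      ∀ j, ‖mcoef P j ρ‖ ≤ K * ‖ρ‖ ^ (expo P j).re := by
  choose β hβ using exists_mcoef_eq hP
  have hw := mcoef_wronskian hP
  have e1 : ∀ j, mcoef P j 1 = β j := fun j => by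
    rw [hβ j 1 (by simp) one_ne_zero, ulog_one]
    simp
  -- Both terms of `mcoef_wronskian` contain the factor `β 0 * β 1`, and that Wronskian is not zero.
  have hne : β 0 * β 1 ≠ 0 := by
    intro h
    rw [e1, e1, hβ 1 (-1) (by simp) (by simp), hβ 0 (-1) (by simp) (by simp)] at hw
    have : -2 * Complex.I = 0 := by
      rw [← hw]
      linear_combination (Complex.exp (expo P 1 * ulog (-1)) -
        Complex.exp (expo P 0 * ulog (-1))) * h
    simp at this
  refine ⟨β 0 * β 1, (‖β 0‖ + ‖β 1‖ + 1) * Real.exp (2 * Real.pi * (‖expo P 0‖ + ‖expo P 1‖)),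
    hne, by positivity, fun ρ him h0 => ⟨?_, fun j => ?_⟩⟩
  · rw [hβ 0 ρ him h0, hβ 1 ρ him h0]
    have : Complex.exp (expo P 0 * ulog ρ) * Complex.exp (expo P 1 * ulog ρ) = ρ := by
      rw [← Complex.exp_add, ← add_mul, expo_add, one_mul, exp_ulog h0]
    linear_combination (β 0 * β 1) * this
  · have hn : 0 < ‖ρ‖ := norm_pos_iff.2 h0
    rw [hβ j ρ him h0, norm_mul, Complex.norm_exp]
    have hre : (ulog ρ).re = Real.log ‖ρ‖ := by
      simp [ulog, Complex.log_re]
    have him2 : |(ulog ρ).im| ≤ 2 * Real.pi := by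
      have h1 : (ulog ρ).im = Complex.arg (-(Complex.I * ρ)) + Real.pi / 2 := by
        have : ((Real.pi : ℂ) / 2 * Complex.I).im = Real.pi / 2 := by
          have : ((Real.pi : ℂ) / 2 * Complex.I) = ((Real.pi / 2 : ℝ) : ℂ) * Complex.I := by
            push_cast; ring
          rw [this, Complex.mul_I_im, Complex.ofReal_re]
        rw [ulog, Complex.add_im, Complex.log_im, this]
      rw [h1]
      have := Complex.abs_arg_le_pi (-(Complex.I * ρ))
      have hpi := Real.pi_pos
      rw [abs_le] at this ⊢
      constructor <;> linarith
    have h1 : (expo P j * ulog ρ).re ≤ Real.log ‖ρ‖ * (expo P j).re +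
        2 * Real.pi * (‖expo P 0‖ + ‖expo P 1‖) := by
      rw [Complex.mul_re, hre]
      have h2 : |(expo P j).im * (ulog ρ).im| ≤ ‖expo P j‖ * (2 * Real.pi) := by
        rw [abs_mul]
        exact mul_le_mul (Complex.abs_im_le_norm _) him2 (abs_nonneg _) (norm_nonneg _)
      have h3 : ‖expo P j‖ ≤ ‖expo P 0‖ + ‖expo P 1‖ := by
        have := norm_nonneg (expo P 0)
        have := norm_nonneg (expo P 1)
        fin_cases j
        · simp
        · simp
      have h4 := neg_abs_le ((expo P j).im * (ulog ρ).im)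
      have h5 : ‖expo P j‖ * (2 * Real.pi) ≤ (‖expo P 0‖ + ‖expo P 1‖) * (2 * Real.pi) := by
        gcongr
      linarith
    have h2 : ‖β j‖ ≤ ‖β 0‖ + ‖β 1‖ + 1 := by
      have := norm_nonneg (β 0)
      have := norm_nonneg (β 1)
      fin_cases j
      · simp only [Fin.zero_eta]; linarith
      · simp only [Fin.mk_one]; linarith
    calc ‖β j‖ * Real.exp (expo P j * ulog ρ).re ≤ (‖β 0‖ + ‖β 1‖ + 1) *
          Real.exp (Real.log ‖ρ‖ * (expo P j).re + 2 * Real.pi * (‖expo P 0‖ + ‖expo P 1‖)) := by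
          gcongr
      _ = _ := by
          rw [Real.exp_add, Real.rpow_def_of_pos hn]
          ring

end

section

/-! ### Asymptotics of combinations of the model solutions -/

variable {P : Params} {Q : ℝ → ℂ} {ρ : ℂ} {r Y : ℝ}

theorem rpow_neg_mul_rpow {x : ℝ} (hx : 0 < x) (s : ℝ) : x ^ (-s) * x ^ s = 1 := by
  rw [← Real.rpow_add hx]
  simp

theorem exists_combination_bound (hP : Admissible P) : ∃ K : ℝ, 0 < K ∧
    ∀ (ρ b0 b1 : ℂ) (B s : ℝ), 0 ≤ ρ.im → ρ ≠ 0 → 1 ≤ ‖ρ‖ * s →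
      ‖b0‖ ≤ B * ‖ρ‖ ^ (expo P 0).re → ‖b1‖ ≤ B * ‖ρ‖ ^ (expo P 1).re →
      ‖b0 * bes P 0 (ρ ^ 2) s + b1 * bes P 1 (ρ ^ 2) s‖ ≤ K * B * Real.exp (ρ.im * s) ∧
      ‖b0 * bes' P 0 (ρ ^ 2) s + b1 * bes' P 1 (ρ ^ 2) s‖ ≤
        K * B * ‖ρ‖ * Real.exp (ρ.im * s) := by
  obtain ⟨K, hK, h⟩ := hP.exists_bes_bound
  refine ⟨2 * K, by positivity, fun ρ b0 b1 B s him hρ hs h0 h1 => ?_⟩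
  have hn : 0 < ‖ρ‖ := norm_pos_iff.2 hρ
  have hs0 : 0 < s := pos_of_one_le_mul hn hs
  have key : ∀ (j : Fin 2) (b : ℂ), ‖b‖ ≤ B * ‖ρ‖ ^ (expo P j).re →
      ‖b * bes P j (ρ ^ 2) s‖ ≤ K * B * Real.exp (ρ.im * s) ∧
      ‖b * bes' P j (ρ ^ 2) s‖ ≤ K * B * ‖ρ‖ * Real.exp (ρ.im * s) := by
    intro j b hb
    obtain ⟨c0, c1⟩ := h j ρ s hρ him hs0
    have c1 := c1 hs
    rw [om_eq_one P j hs, mul_one] at c0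
    have e := rpow_neg_mul_rpow hn (expo P j).re
    have e2 : ‖ρ‖ ^ (1 - (expo P j).re) * ‖ρ‖ ^ (expo P j).re = ‖ρ‖ := by
      rw [← Real.rpow_add hn]
      simp
    have hb0 : 0 ≤ B * ‖ρ‖ ^ (expo P j).re := (norm_nonneg b).trans hb
    constructor
    · rw [norm_mul]
      calc _ ≤ (B * ‖ρ‖ ^ (expo P j).re) *
            (K * ‖ρ‖ ^ (-(expo P j).re) * Real.exp (ρ.im * s)) :=
            mul_le_mul hb c0 (norm_nonneg _) hb0
        _ = _ := by linear_combination (B * K * Real.exp (ρ.im * s)) * e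
    · rw [norm_mul]
      calc _ ≤ (B * ‖ρ‖ ^ (expo P j).re) *
            (K * ‖ρ‖ ^ (1 - (expo P j).re) * Real.exp (ρ.im * s)) :=
            mul_le_mul hb c1 (norm_nonneg _) hb0
        _ = _ := by linear_combination (B * K * Real.exp (ρ.im * s)) * e2
  constructor
  · refine (norm_add_le _ _).trans ((add_le_add (key 0 b0 h0).1 (key 1 b1 h1).1).trans
      (le_of_eq (by ring)))
  · refine (norm_add_le _ _).trans ((add_le_add (key 0 b0 h0).2 (key 1 b1 h1).2).trans
      (le_of_eq (by ring)))

/-- A combination of the model solutions is governed by its Wronskian with the model Jost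
solution. -/
theorem exists_combination_asymptotics (hP : Admissible P) {y : ℝ} (hy : 0 < y) :
    ∃ K R : ℝ, 0 < K ∧ 1 ≤ R ∧ ∀ (ρ b0 b1 : ℂ) (B : ℝ), 0 ≤ ρ.im → R ≤ ‖ρ‖ → 0 ≤ B →
      ‖b0‖ ≤ B * ‖ρ‖ ^ (expo P 0).re → ‖b1‖ ≤ B * ‖ρ‖ ^ (expo P 1).re →
      ‖2 * Complex.I * ρ * (b0 * bes P 0 (ρ ^ 2) y + b1 * bes P 1 (ρ ^ 2) y) +
        expI (-ρ) y * (mcoef P 0 ρ * b1 - mcoef P 1 ρ * b0)‖ ≤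
        K * B * (‖ρ‖ + Real.exp (ρ.im * y)) := by
  obtain ⟨K, hK, hbd⟩ := exists_combination_bound hP
  set N := ‖nuZero P‖ with hN
  have hN0 : 0 ≤ N := norm_nonneg _
  -- `|ρ| ≥ 2/y` puts the whole interval `[y/2, y]` in the range `|ρ|s ≥ 1`, and `|ρ| > 4N/y` makes
  -- the model potential small beyond `y/2`.
  refine ⟨K * (2 + 8 * (N / y)), max 1 (max (2 / y) (4 * N / y + 1)), by positivity,
    le_max_left _ _, fun ρ b0 b1 B him hR hB h0 h1 => ?_⟩
  have hρ1 : 1 ≤ ‖ρ‖ := (le_max_left _ _).trans hR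
  have hn : 0 < ‖ρ‖ := by linarith
  have hρ : ρ ≠ 0 := norm_pos_iff.1 hn
  have hρy : 2 ≤ ‖ρ‖ * y := by
    have := ((le_max_left _ _).trans (le_max_right _ _)).trans hR
    rwa [div_le_iff₀ hy] at this
  have hρN : 4 * N < ‖ρ‖ * y := by
    have := ((le_max_right _ _).trans (le_max_right _ _)).trans hR
    have h2 : 4 * N / y < ‖ρ‖ := by linarith
    rwa [div_lt_iff₀ hy] at h2
  set f : ℝ → ℂ := fun s => b0 * bes P 0 (ρ ^ 2) s + b1 * bes P 1 (ρ ^ 2) s with hf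
  set f' : ℝ → ℂ := fun s => b0 * bes' P 0 (ρ ^ 2) s + b1 * bes' P 1 (ρ ^ 2) s with hf'
  have hM : IsModel P (ρ ^ 2) f f' := hP.isModel (ρ ^ 2) b0 b1
  have hfb : ∀ s, y / 2 ≤ s → ‖f s‖ ≤ K * B * Real.exp (ρ.im * s) ∧
      ‖f' s‖ ≤ K * B * ‖ρ‖ * Real.exp (ρ.im * s) := fun s hs =>
    hbd ρ b0 b1 B s him hρ (by
      have : ‖ρ‖ * (y / 2) ≤ ‖ρ‖ * s := by gcongr
      linarith) h0 h1
  -- the Wronskian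
  have hF : FarPot (mpot P) ‖ρ‖ (y / 2) := farPot_mpot P hn (by positivity) (by linarith)
  obtain ⟨d0, d1⟩ := hF.norm_je_sub_le le_rfl him (y := y) (by linarith)
  rw [(integral_mpot P hy).2, ← hN] at d0 d1
  obtain ⟨j0, j1⟩ := je_mpot_eq hP him hρ hy (by linarith)
  have hW : mcoef P 0 ρ * b1 - mcoef P 1 ρ * b0 = je (mpot P) ρ y * f' y -
      je' (mpot P) ρ y * f y := by
    rw [j0, j1]
    simp only [hf, hf']
    linear_combination (-(mcoef P 0 ρ * b1 - mcoef P 1 ρ * b0)) * hP.bes_wronskian (ρ ^ 2) hy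
  -- the outgoing part
  have hU : ∀ s, 0 < s → HasDerivAt (fun s => expI (-ρ) s * (f' s + Complex.I * ρ * f s))
      (expI (-ρ) s * (mpot P s * f s)) s := by
    intro s hs
    refine ((hasDerivAt_expI (-ρ) s).mul ((hM.d1 s hs).add
      ((hM.d0 s hs).const_mul (Complex.I * ρ)))).congr_deriv ?_
    simp only [Pi.add_apply]
    unfold mpot
    linear_combination (-expI (-ρ) s * ρ ^ 2 * f s) * Complex.I_sq
  have hyy : y / 2 ≤ y := by linarith
  have hposI : ∀ s ∈ Set.uIcc (y / 2) y, y / 2 ≤ s ∧ s ≤ y := fun s hs => by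
    rwa [Set.uIcc_of_le hyy] at hs
  have hcont : ContinuousOn (fun s => expI (-ρ) s * (mpot P s * f s)) (Set.uIcc (y / 2) y) := by
    refine (continuous_expI _).continuousOn.mul (ContinuousOn.mul ?_ fun s hs => ?_)
    · unfold mpot
      refine ContinuousOn.div continuousOn_const (by fun_prop) fun s hs => ?_
      have := (hposI s hs).1
      have h3 : s ≠ 0 := by
        intro h
        rw [h] at this
        linarith
      exact pow_ne_zero 2 (by exact_mod_cast h3)
    · exact (hM.d0 s (by linarith [(hposI s hs).1])).continuousAt.continuousWithinAt
  have hint := intervalIntegral.integral_eq_sub_of_hasDerivAt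
    (fun s hs => hU s (by linarith [(hposI s hs).1])) hcont.intervalIntegrable
  have hintb : ‖∫ s in (y / 2)..y, expI (-ρ) s * (mpot P s * f s)‖ ≤
      (Real.exp (ρ.im * y) * (4 * N / y ^ 2 * (K * B * Real.exp (ρ.im * y)))) *
        |y - y / 2| := by
    refine intervalIntegral.norm_integral_le_of_norm_le_const fun s hs => ?_
    obtain ⟨s1, s2⟩ := hposI s (Set.uIoc_subset_uIcc hs)
    have hs0 : 0 < s := by linarith
    rw [norm_mul, norm_mul, norm_expI]
    have e1 : -((-ρ).im * s) = ρ.im * s := by simp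
    rw [e1]
    have e2 : ‖mpot P s‖ ≤ 4 * N / y ^ 2 := by
      rw [mpot, norm_div, norm_pow, Complex.norm_real, Real.norm_of_nonneg hs0.le, ← hN,
        div_le_div_iff₀ (by positivity) (by positivity)]
      have : y ^ 2 ≤ 4 * s ^ 2 := by nlinarith
      nlinarith
    have e3 : Real.exp (ρ.im * s) ≤ Real.exp (ρ.im * y) := by gcongr
    have e4 := (hfb s s1).1
    have e5 : ‖f s‖ ≤ K * B * Real.exp (ρ.im * y) := e4.trans (by gcongr)
    gcongr
  have habs : |y - y / 2| = y / 2 := by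
    rw [abs_of_pos (by linarith)]
    ring
  rw [habs] at hintb
  set I := ∫ s in (y / 2)..y, expI (-ρ) s * (mpot P s * f s) with hI
  set G := Real.exp (ρ.im * y) with hG
  have hG0 : 0 < G := Real.exp_pos _
  have hGinv : Real.exp (-(ρ.im * y)) * G = 1 := by
    rw [hG, ← Real.exp_add]
    simp
  have ee := expI_neg_mul ρ y
  -- Here `2iρf = (f' + iρf) - (f' - iρf)`. The second combination is `exp(-iρy)` times the
  -- Wronskian, up to the deviation of the Jost solution from the exponential. The first is
  -- propagated from `y/2`, where it is exponentially smaller than at `y`.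
  have hmain : 2 * Complex.I * ρ * f y + expI (-ρ) y * (mcoef P 0 ρ * b1 - mcoef P 1 ρ * b0) =
      expI ρ y * I + expI ρ y * (expI (-ρ) (y / 2) * (f' (y / 2) + Complex.I * ρ * f (y / 2))) +
      expI (-ρ) y * ((je (mpot P) ρ y - expI ρ y) * f' y -
        (je' (mpot P) ρ y - Complex.I * ρ * expI ρ y) * f y) := by
    rw [hW, hint]
    linear_combination (-2 * Complex.I * ρ * f y) * ee
  rw [hmain]
  have n1 : ‖expI ρ y * I‖ ≤ 2 * (N / y) * (K * B * G) := by
    rw [norm_mul, norm_expI]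
    calc _ ≤ Real.exp (-(ρ.im * y)) * ((G * (4 * N / y ^ 2 * (K * B * G))) * (y / 2)) := by
          gcongr
      _ = (Real.exp (-(ρ.im * y)) * G) * (2 * (N / y) * (K * B * G)) := by
          field_simp
          ring
      _ = _ := by rw [hGinv, one_mul]
  have n2 : ‖expI ρ y * (expI (-ρ) (y / 2) * (f' (y / 2) + Complex.I * ρ * f (y / 2)))‖ ≤
      2 * (K * B * ‖ρ‖) := by
    obtain ⟨g0, g1⟩ := hfb (y / 2) le_rfl
    have hs : ‖f' (y / 2) + Complex.I * ρ * f (y / 2)‖ ≤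
        2 * (K * B * ‖ρ‖ * Real.exp (ρ.im * (y / 2))) := by
      refine (norm_add_le _ _).trans ?_
      rw [norm_mul, norm_mul, Complex.norm_I, one_mul]
      have : ‖ρ‖ * ‖f (y / 2)‖ ≤ ‖ρ‖ * (K * B * Real.exp (ρ.im * (y / 2))) := by gcongr
      linarith
    rw [norm_mul, norm_mul, norm_expI, norm_expI]
    have e : Real.exp (-(ρ.im * y)) * (Real.exp (-((-ρ).im * (y / 2))) *
        Real.exp (ρ.im * (y / 2))) = 1 := by
      rw [← Real.exp_add, ← Real.exp_add, Real.exp_eq_one_iff, Complex.neg_im]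
      ring
    calc _ ≤ Real.exp (-(ρ.im * y)) * (Real.exp (-((-ρ).im * (y / 2))) *
          (2 * (K * B * ‖ρ‖ * Real.exp (ρ.im * (y / 2))))) := by gcongr
      _ = _ := by linear_combination (2 * (K * B * ‖ρ‖)) * e
  have n3 : ‖expI (-ρ) y * ((je (mpot P) ρ y - expI ρ y) * f' y -
        (je' (mpot P) ρ y - Complex.I * ρ * expI ρ y) * f y)‖ ≤ 4 * (N / y) * (K * B * G) := by
    obtain ⟨g0, g1⟩ := hfb y hyy
    rw [norm_mul, norm_expI]
    have e1 : -((-ρ).im * y) = ρ.im * y := by simp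
    rw [e1, ← hG]
    have hs : ‖(je (mpot P) ρ y - expI ρ y) * f' y -
        (je' (mpot P) ρ y - Complex.I * ρ * expI ρ y) * f y‖ ≤
        (2 * (N / y) / ‖ρ‖ * Real.exp (-(ρ.im * y))) * (K * B * ‖ρ‖ * G) +
        (2 * (N / y) * Real.exp (-(ρ.im * y))) * (K * B * G) := by
      refine (norm_sub_le _ _).trans ?_
      rw [norm_mul, norm_mul]
      gcongr
    calc _ ≤ G * ((2 * (N / y) / ‖ρ‖ * Real.exp (-(ρ.im * y))) * (K * B * ‖ρ‖ * G) +
        (2 * (N / y) * Real.exp (-(ρ.im * y))) * (K * B * G)) := by gcongr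
      _ = 4 * (N / y) * (K * B * G) * (Real.exp (-(ρ.im * y)) * G) := by
        field_simp
        ring
      _ = _ := by rw [hGinv, mul_one]
  refine (norm_add₃_le).trans ((add_le_add (add_le_add n1 n2) n3).trans ?_)
  have hNy : 0 ≤ N / y := by positivity
  have hKB : 0 ≤ K * B := by positivity
  have t1 : 0 ≤ N / y * (K * B * ‖ρ‖) := by positivity
  have t2 : 0 ≤ N / y * (K * B * G) := by positivity
  have t3 : 0 ≤ K * B * G := by positivity
  have : K * (2 + 8 * (N / y)) * B * (‖ρ‖ + G) = 2 * (K * B * ‖ρ‖) + 2 * (K * B * G) +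
      8 * (N / y * (K * B * ‖ρ‖)) + 8 * (N / y * (K * B * G)) := by ring
  rw [this]
  linarith

/-! ### The Jost solution in the basis of solutions -/

/-- A potential on the half-line that is integrable at infinity. -/
structure TailPot (P : Params) (Q : ℝ → ℂ) : Prop extends HalfPot P Q where
  tail : ∃ T, 0 < T ∧ IntegrableOn Q (Set.Ioi T)

/-- The full potential. -/
def vpot (P : Params) (Q : ℝ → ℂ) (t : ℝ) : ℂ := Q t + mpot P t

theorem TailPot.integrableOn_vpot (hQ : TailPot P Q) (hY : 0 < Y) :
    IntegrableOn (vpot P Q) (Set.Ioi Y) := by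
  refine IntegrableOn.add ?_ (integral_mpot P hY).1
  obtain ⟨T, hT, h⟩ := hQ.tail
  have h1 := (intervalIntegrable_iff.1 (hQ.intervalIntegrable hY.le
    (hY.le.trans (le_max_left Y T))))
  rw [Set.uIoc_of_le (le_max_left Y T)] at h1
  rw [← Set.Ioc_union_Ioi_eq_Ioi (le_max_left Y T)]
  exact h1.union (h.mono_set (Set.Ioi_subset_Ioi (le_max_right _ _)))

theorem TailPot.farPot (hQ : TailPot P Q) (hr : 0 < r) (hY : 0 < Y)
    (h : ∫ t in Set.Ioi Y, ‖vpot P Q t‖ ≤ r / 2) : FarPot (vpot P Q) r Y := by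
  refine ⟨?_, hQ.integrableOn_vpot hY, hr, hY.le, h⟩
  have := hQ.meas
  unfold vpot mpot
  fun_prop

/-- For any `ρ ≠ 0` the smallness condition holds far enough out, which defines the Jost solution
near infinity. `exists_farPot` exchanges the roles: the point is fixed and `|ρ|` is taken large. -/
theorem TailPot.exists_farPot_of_pos (hQ : TailPot P Q) (hr : 0 < r) :
    ∃ Y, 0 < Y ∧ FarPot (vpot P Q) r Y := by
  have hi := (hQ.integrableOn_vpot one_pos).norm
  have h1 := intervalIntegral_tendsto_integral_Ioi 1 hi tendsto_id
  have h2 := h1.const_sub (∫ t in Set.Ioi 1, ‖vpot P Q t‖)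
  rw [sub_self] at h2
  obtain ⟨Y, hY, hY1⟩ := ((h2.eventually (gt_mem_nhds (by positivity : 0 < r / 2))).and
    (eventually_gt_atTop 1)).exists
  refine ⟨Y, by linarith, hQ.farPot hr (by linarith) ?_⟩
  rw [id, intervalIntegral.integral_of_le hY1.le, ← Set.Ioc_union_Ioi_eq_Ioi hY1.le,
    setIntegral_union Set.Ioc_disjoint_Ioi_same measurableSet_Ioi
      ((hQ.integrableOn_vpot one_pos).mono_set Set.Ioc_subset_Ioi_self).norm
      (hQ.integrableOn_vpot (by linarith)).norm] at hY
  linarith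

theorem TailPot.exists_farPot (hQ : TailPot P Q) (hY : 0 < Y) :
    ∃ R, 1 ≤ R ∧ ∀ r, R ≤ r → FarPot (vpot P Q) r Y := by
  have h0 : 0 ≤ ∫ t in Set.Ioi Y, ‖vpot P Q t‖ := integral_nonneg fun _ => norm_nonneg _
  exact ⟨1 + 2 * ∫ t in Set.Ioi Y, ‖vpot P Q t‖, by linarith, fun r hr =>
    hQ.farPot (by linarith) hY (by linarith)⟩

/-- The Wronskian of the Jost solution and the solution `hsol`. -/
def pwr (P : Params) (Q : ℝ → ℂ) (j : Fin 2) (ρ : ℂ) (y : ℝ) : ℂ :=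
  je (vpot P Q) ρ y * hsol' P Q j (ρ ^ 2) y - je' (vpot P Q) ρ y * hsol P Q j (ρ ^ 2) y

theorem TailPot.pwr_const (hP : Admissible P) (hQ : TailPot P Q) (hV : FarPot (vpot P Q) r Y)
    (hρ : r ≤ ‖ρ‖) (him : 0 ≤ ρ.im) (j : Fin 2) {x y : ℝ} (hx : Y < x) (hy : Y < y) :
    pwr P Q j ρ y = pwr P Q j ρ x := by
  have h1 := hV.hSol hP (Q := Q) (fun t _ => rfl) hρ him
  have h2 := (hQ.hSol hP j (ρ ^ 2)).mono hV.nonneg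
  have hw := h1.wronskian_const hP hV.nonneg h2 hx hy
  have key : ∀ z, Y < z → pwr P Q j ρ z = jwr P (vpot P Q) 1 ρ z * hbe P Q j (ρ ^ 2) z -
      (-jwr P (vpot P Q) 0 ρ z) * hal P Q j (ρ ^ 2) z := by
    intro z hz
    have hz0 := hV.nonneg.trans_lt hz
    rw [← wronskian_hval hP (ρ ^ 2) (jwr P (vpot P Q) 1 ρ) (fun y => -jwr P (vpot P Q) 0 ρ y)
      _ _ hz0, (jwr_hval hP (vpot P Q) ρ hz0).1, (jwr_hval hP (vpot P Q) ρ hz0).2,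
      ← hQ.hsol_eq_hval hP j _ hz0]
    rfl
  rw [key y hy, key x hx, hw]

/-- The coefficients of the Jost solution. -/
def jB (P : Params) (Q : ℝ → ℂ) (j : Fin 2) (ρ : ℂ) (y : ℝ) : ℂ :=
  ![pwr P Q 1 ρ y, -pwr P Q 0 ρ y] j

theorem TailPot.jB_const (hP : Admissible P) (hQ : TailPot P Q) (hV : FarPot (vpot P Q) r Y)
    (hρ : r ≤ ‖ρ‖) (him : 0 ≤ ρ.im) (j : Fin 2) {x y : ℝ} (hx : Y < x) (hy : Y < y) :
    jB P Q j ρ y = jB P Q j ρ x := by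
  unfold jB
  rw [hQ.pwr_const hP hV hρ him 1 hx hy, hQ.pwr_const hP hV hρ him 0 hx hy]

theorem HalfPot.je_eq_jB (hP : Admissible P) (hQ : HalfPot P Q) (ρ : ℂ) {y : ℝ} (hy : 0 < y) :
    je (vpot P Q) ρ y =
      jB P Q 0 ρ y * hsol P Q 0 (ρ ^ 2) y + jB P Q 1 ρ y * hsol P Q 1 (ρ ^ 2) y ∧
    je' (vpot P Q) ρ y =
      jB P Q 0 ρ y * hsol' P Q 0 (ρ ^ 2) y + jB P Q 1 ρ y * hsol' P Q 1 (ρ ^ 2) y := by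
  have := hQ.hsol_wronskian hP (ρ ^ 2) hy
  simp only [jB, pwr, Matrix.cons_val_zero, Matrix.cons_val_one, Matrix.cons_val_fin_one]
  constructor
  · linear_combination (-je (vpot P Q) ρ y) * this
  · linear_combination (-je' (vpot P Q) ρ y) * this

theorem TailPot.differentiableOn_jB (hP : Admissible P) (hQ : TailPot P Q)
    (hV : FarPot (vpot P Q) r Y) (j : Fin 2) {y : ℝ} (hy : Y < y) :
    DifferentiableOn ℂ (fun ρ => jB P Q j ρ y) {ρ | 0 < ρ.im ∧ r < ‖ρ‖} := by
  have hy0 := hV.nonneg.trans_lt hy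
  have key : ∀ i, DifferentiableOn ℂ (fun ρ => pwr P Q i ρ y) {ρ | 0 < ρ.im ∧ r < ‖ρ‖} := by
    intro i
    have c1 := (hQ.differentiable_hsol hP i hy0).comp (differentiable_pow 2)
    have c2 := (hQ.differentiable_hsol' hP i hy0).comp (differentiable_pow 2)
    exact ((hV.differentiableOn_je hy).1.mul c2.differentiableOn).sub
      ((hV.differentiableOn_je hy).2.mul c1.differentiableOn)
  fin_cases j
  · exact key 1
  · exact (key 0).neg

/-- Asymptotics of the Jost solution at a fixed point. -/
theorem TailPot.exists_je_bound (hQ : TailPot P Q) {y : ℝ} (hy : 0 < y) :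
    ∃ K R : ℝ, 0 < K ∧ 1 ≤ R ∧ ∀ ρ : ℂ, R ≤ ‖ρ‖ → 0 ≤ ρ.im →
      ‖je (vpot P Q) ρ y - expI ρ y‖ ≤ K / ‖ρ‖ * Real.exp (-(ρ.im * y)) ∧
      ‖je' (vpot P Q) ρ y - Complex.I * ρ * expI ρ y‖ ≤ K * Real.exp (-(ρ.im * y)) := by
  obtain ⟨R, hR, h⟩ := hQ.exists_farPot (half_pos hy)
  have h0 : 0 ≤ ∫ t in Set.Ioi y, ‖vpot P Q t‖ := integral_nonneg fun _ => norm_nonneg _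
  refine ⟨2 * (∫ t in Set.Ioi y, ‖vpot P Q t‖) + 1, R, by positivity, hR, fun ρ hρ him => ?_⟩
  have hn : 0 < ‖ρ‖ := by linarith
  obtain ⟨h1, h2⟩ := (h ‖ρ‖ hρ).norm_je_sub_le le_rfl him (y := y) (by linarith)
  constructor
  · refine h1.trans ?_
    gcongr
    linarith
  · refine h2.trans ?_
    gcongr
    linarith

theorem tailPot_zero (P : Params) : TailPot P (fun _ => 0) :=
  ⟨⟨measurable_const, fun _ => by simp⟩, 1, one_pos, by simp⟩

theorem vpot_zero (P : Params) : vpot P (fun _ => 0) = mpot P := by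
  funext t
  simp [vpot]

/-- The coefficients are Wronskians at `y` of a factor of size `exp(-y Im ρ)` and one of size `exp(y
Im ρ)`. Each factor differs from its model by the relative order `1/|ρ|`, and the exponentials
cancel. -/
theorem TailPot.exists_jB_sub_bound (hP : Admissible P) (hQ : TailPot P Q) {y : ℝ} (hy : 0 < y) :
    ∃ K R : ℝ, 0 < K ∧ 1 ≤ R ∧ ∀ (j : Fin 2) (ρ : ℂ), R ≤ ‖ρ‖ → 0 ≤ ρ.im →
      ‖jB P Q j ρ y - mcoef P j ρ‖ ≤ K / ‖ρ‖ * ‖ρ‖ ^ (expo P j).re := by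
  obtain ⟨K₁, R₁, hK₁, hR₁, h₁⟩ := hQ.exists_je_bound hy
  obtain ⟨K₂, R₂, hK₂, hR₂, h₂⟩ := (tailPot_zero P).exists_je_bound hy
  obtain ⟨K₃, R₃, hK₃, hR₃, h₃⟩ := hQ.exists_large_bound hP hy
  obtain ⟨K₄, R₄, hK₄, hR₄, h₄⟩ := hQ.exists_hsol_bound hP hy
  rw [vpot_zero] at h₂
  refine ⟨2 * (K₁ + K₂) * K₄ + 2 * (K₂ + 1) * K₃, max (max R₁ R₂) (max (max R₃ R₄)
    ((2 * ‖nuZero P‖ + 1) / y)), by positivity,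
    hR₁.trans ((le_max_left _ _).trans (le_max_left _ _)), fun j ρ hρ him => ?_⟩
  have hρ12 := (le_max_left _ _).trans hρ
  have hρ34 := (le_max_right _ _).trans hρ
  have hρ1 := (le_max_left _ _).trans hρ12
  have hρ2 := (le_max_right _ _).trans hρ12
  have hρ3 := (le_max_left _ _).trans ((le_max_left _ _).trans hρ34)
  have hρ4 := (le_max_right _ _).trans ((le_max_left _ _).trans hρ34)
  have hρ5 := (le_max_right _ _).trans hρ34
  have hone : 1 ≤ ‖ρ‖ := hR₁.trans hρ1
  have hn : 0 < ‖ρ‖ := by linarith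
  have hne : ρ ≠ 0 := norm_pos_iff.1 hn
  rw [div_le_iff₀ hy] at hρ5
  obtain ⟨a0, a1⟩ := h₁ ρ hρ1 him
  obtain ⟨b0, b1⟩ := h₂ ρ hρ2 him
  set E := Real.exp (ρ.im * y) with hE
  set E' := Real.exp (-(ρ.im * y)) with hE'
  have hEE : E' * E = 1 := by
    rw [hE, hE', ← Real.exp_add]
    simp
  have hE0 : 0 < E := Real.exp_pos _
  have hE0' : 0 < E' := Real.exp_pos _
  have nexp : ‖expI ρ y‖ = E' := norm_expI ρ y
  set e0 := je (mpot P) ρ y with he0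
  set e1 := je' (mpot P) ρ y with he1
  have d0 : ‖je (vpot P Q) ρ y - e0‖ ≤ (K₁ + K₂) / ‖ρ‖ * E' := by
    have := norm_sub_le (je (vpot P Q) ρ y - expI ρ y) (e0 - expI ρ y)
    rw [sub_sub_sub_cancel_right] at this
    refine this.trans ((add_le_add a0 b0).trans (le_of_eq (by ring)))
  have d1 : ‖je' (vpot P Q) ρ y - e1‖ ≤ (K₁ + K₂) * E' := by
    have := norm_sub_le (je' (vpot P Q) ρ y - Complex.I * ρ * expI ρ y)
      (e1 - Complex.I * ρ * expI ρ y)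
    rw [sub_sub_sub_cancel_right] at this
    refine this.trans ((add_le_add a1 b1).trans (le_of_eq (by ring)))
  have c0 : ‖e0‖ ≤ (K₂ + 1) * E' := by
    have := norm_add_le (e0 - expI ρ y) (expI ρ y)
    rw [sub_add_cancel, nexp] at this
    have h6 : K₂ / ‖ρ‖ * E' ≤ K₂ * E' := by
      gcongr
      exact div_le_self hK₂.le hone
    linarith
  have c1 : ‖e1‖ ≤ (K₂ + 1) * ‖ρ‖ * E' := by
    have := norm_add_le (e1 - Complex.I * ρ * expI ρ y) (Complex.I * ρ * expI ρ y)
    rw [sub_add_cancel, norm_mul, norm_mul, Complex.norm_I, one_mul, nexp] at this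
    have h6 : K₂ * E' ≤ K₂ * ‖ρ‖ * E' := by
      gcongr
      exact le_mul_of_one_le_right hK₂.le hone
    linarith
  have key : ∀ i, ‖pwr P Q i ρ y - jwr P (mpot P) i ρ y‖ ≤
      (2 * (K₁ + K₂) * K₄ + 2 * (K₂ + 1) * K₃) * ‖ρ‖ ^ (-(expo P i).re) := by
    intro i
    obtain ⟨p0, p1⟩ := h₃ i ρ hρ3 him
    obtain ⟨q0, q1⟩ := h₄ i ρ hρ4 him
    set s := ‖ρ‖ ^ (-(expo P i).re) with hs
    have hs0 : 0 < s := by positivity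
    have hs1 : ‖ρ‖ ^ (1 - (expo P i).re) = ‖ρ‖ * s := by
      rw [sub_eq_add_neg, Real.rpow_add hn, Real.rpow_one]
    rw [hs1] at q1
    have e : pwr P Q i ρ y - jwr P (mpot P) i ρ y =
        (je (vpot P Q) ρ y - e0) * hsol' P Q i (ρ ^ 2) y +
        e0 * (hsol' P Q i (ρ ^ 2) y - bes' P i (ρ ^ 2) y) -
        ((je' (vpot P Q) ρ y - e1) * hsol P Q i (ρ ^ 2) y +
        e1 * (hsol P Q i (ρ ^ 2) y - bes P i (ρ ^ 2) y)) := by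
      unfold pwr jwr
      ring
    rw [e]
    have m1 : ‖(je (vpot P Q) ρ y - e0) * hsol' P Q i (ρ ^ 2) y‖ ≤
        ((K₁ + K₂) / ‖ρ‖ * E') * (K₄ * (‖ρ‖ * s) * E) := by
      rw [norm_mul]
      gcongr
    have m2 : ‖e0 * (hsol' P Q i (ρ ^ 2) y - bes' P i (ρ ^ 2) y)‖ ≤
        ((K₂ + 1) * E') * (K₃ * s * E) := by
      rw [norm_mul]
      gcongr
    have m3 : ‖(je' (vpot P Q) ρ y - e1) * hsol P Q i (ρ ^ 2) y‖ ≤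
        ((K₁ + K₂) * E') * (K₄ * s * E) := by
      rw [norm_mul]
      gcongr
    have m4 : ‖e1 * (hsol P Q i (ρ ^ 2) y - bes P i (ρ ^ 2) y)‖ ≤
        ((K₂ + 1) * ‖ρ‖ * E') * (K₃ / ‖ρ‖ * s * E) := by
      rw [norm_mul]
      gcongr
    refine (norm_sub_le _ _).trans ((add_le_add ((norm_add_le _ _).trans (add_le_add m1 m2))
      ((norm_add_le _ _).trans (add_le_add m3 m4))).trans (le_of_eq ?_))
    calc _ = (2 * (K₁ + K₂) * K₄ + 2 * (K₂ + 1) * K₃) * s * (E' * E) := by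
          field_simp
          ring
      _ = _ := by rw [hEE, mul_one]
  have hr : ∀ i k : Fin 2, (expo P i).re + (expo P k).re = 1 →
      ‖ρ‖ ^ (-(expo P i).re) = ‖ρ‖⁻¹ * ‖ρ‖ ^ (expo P k).re := by
    intro i k h
    rw [← Real.rpow_neg_one, ← Real.rpow_add hn]
    congr 1
    linarith
  have hsum : (expo P 0).re + (expo P 1).re = 1 := by
    rw [re_expo_zero, re_expo_one]
    ring
  obtain ⟨mc0, mc1⟩ := mcoef_eq hP him hne hy (by linarith)
  fin_cases j
  · simp only [jB, Fin.zero_eta, Matrix.cons_val_zero, mc0]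
    refine (key 1).trans (le_of_eq ?_)
    rw [hr 1 0 (by linarith)]
    ring
  · simp only [jB, Fin.mk_one, Matrix.cons_val_one, Matrix.cons_val_fin_one, mc1]
    have h6 := key 0
    rw [← norm_neg] at h6
    refine (le_of_eq (by congr 1; ring)).trans (h6.trans (le_of_eq ?_))
    rw [hr 0 1 hsum]
    ring

/-! ### Uniqueness of the decaying solution -/

/-- The differential equation in integrated form. It is needed to bound the derivative of a solution
when only the solution itself is known to decay. -/
theorem HSol.hder_sub (hP : Admissible P) {lam : ℂ} {b : ℝ} {α β : ℝ → ℂ} (hb : 0 ≤ b)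
    (h : HSol P Q lam b α β) {x y : ℝ} (hx : b < x) (hy : b < y) :
    hder P lam α β y - hder P lam α β x =
      ∫ t in x..y, (vpot P Q t - lam) * hval P lam α β t := by
  have hmem : ∀ z ∈ Set.uIcc x y, b < z := fun z hz => (lt_min hx hy).trans_le hz.1
  have hpos : ∀ z ∈ Set.uIcc x y, 0 < z := fun z hz => hb.trans_lt (hmem z hz)
  have hgc : ∀ i, ContinuousOn (fun t : ℝ => (nuZero P / (t : ℂ) ^ 2 - lam) * bes P i lam t)
      (Set.uIcc x y) := by
    intro i
    refine ContinuousOn.mul (ContinuousOn.sub (ContinuousOn.div continuousOn_const (by fun_prop)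
      fun t ht => ?_) continuousOn_const) ((hP.continuousOn_bes i lam).mono fun t ht => hpos t ht)
    have := (hpos t ht).ne'
    exact pow_ne_zero 2 (by exact_mod_cast this)
  have hbi : ∀ i, ∀ z ∈ Set.uIcc x y, bes' P i lam z = bes' P i lam x +
      ∫ t in x..z, (nuZero P / (t : ℂ) ^ 2 - lam) * bes P i lam t := by
    intro i z hz
    have hsub : Set.uIcc x z ⊆ Set.uIcc x y := Set.uIcc_subset_uIcc_left hz
    rw [intervalIntegral.integral_eq_sub_of_hasDerivAt
      (fun t ht => hP.hasDerivAt_bes' i lam (hpos t (hsub ht)))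
      ((hgc i).mono hsub).intervalIntegrable]
    ring
  have k1 := integral_primitive_mul (p := α) (q := bes' P 0 lam)
    (h.int_bes hP hb 1 hx hy).neg (hgc 0).intervalIntegrable (fun z hz => by
      simp only [Pi.neg_apply, intervalIntegral.integral_neg]
      rw [h.eqα x z hx (hmem z hz)]
      ring) (hbi 0)
  have k2 := integral_primitive_mul (p := β) (q := bes' P 1 lam)
    (h.int_bes hP hb 0 hx hy) (hgc 1).intervalIntegrable
    (fun z hz => h.eqβ x z hx (hmem z hz)) (hbi 1)
  have e : hder P lam α β y - hder P lam α β x =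
      (α y * bes' P 0 lam y - α x * bes' P 0 lam x) +
      (β y * bes' P 1 lam y - β x * bes' P 1 lam x) := by
    unfold hder
    ring
  rw [e, k1.2, k2.2, ← intervalIntegral.integral_add k1.1 k2.1]
  refine intervalIntegral.integral_congr fun t ht => ?_
  have w := hP.bes_wronskian lam (hpos t ht)
  simp only [Pi.neg_apply]
  unfold vpot mpot
  have : hval P lam α β t = α t * bes P 0 lam t + β t * bes P 1 lam t := rfl
  linear_combination (Q t * hval P lam α β t) * w -
    (nuZero P / (t : ℂ) ^ 2 - lam) * this

/-- The solution decays and its derivative stays bounded, so its constant Wronskian with the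
decaying Jost solution is zero. It is then a multiple of the Jost solution, and the normalised
limits 0 and 1 force the multiple to vanish. -/
theorem TailPot.eq_zero_of_tendsto (hP : Admissible P) (hQ : TailPot P Q) (him : 0 < ρ.im)
    {d0 d1 : ℂ} (hlim : Tendsto (fun y => (d0 * hsol P Q 0 (ρ ^ 2) y + d1 * hsol P Q 1 (ρ ^ 2) y) *
      expI (-ρ) y) atTop (𝓝 0)) : d0 = 0 ∧ d1 = 0 := by
  have hρ : ρ ≠ 0 := fun h => by simp [h] at him
  obtain ⟨Y, hY0, hV⟩ := hQ.exists_farPot_of_pos (norm_pos_iff.2 hρ)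
  set α : ℝ → ℂ := fun y => d0 * hal P Q 0 (ρ ^ 2) y + d1 * hal P Q 1 (ρ ^ 2) y with hα
  set β : ℝ → ℂ := fun y => d0 * hbe P Q 0 (ρ ^ 2) y + d1 * hbe P Q 1 (ρ ^ 2) y with hβ
  have hS : HSol P Q (ρ ^ 2) 0 α β :=
    (hQ.hSol hP 0 (ρ ^ 2)).linear hP le_rfl (hQ.hSol hP 1 (ρ ^ 2)) d0 d1
  set z : ℝ → ℂ := fun y => d0 * hsol P Q 0 (ρ ^ 2) y + d1 * hsol P Q 1 (ρ ^ 2) y with hz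
  set z' : ℝ → ℂ := fun y => d0 * hsol' P Q 0 (ρ ^ 2) y + d1 * hsol' P Q 1 (ρ ^ 2) y with hz'
  have hzv : ∀ y, 0 < y → hval P (ρ ^ 2) α β y = z y := fun y hy => by
    simp only [hz, hQ.hsol_eq_hval hP _ _ hy]
    unfold hval
    simp only [hα, hβ]
    ring
  have hzd : ∀ y, hder P (ρ ^ 2) α β y = z' y := fun y => by
    simp only [hz', hsol']
    unfold hder
    simp only [hα, hβ]
    ring
  obtain ⟨e1, e2⟩ := hV.tendsto_je le_rfl him.le
  have hexp0 : Tendsto (fun y => expI ρ y) atTop (𝓝 0) := by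
    rw [tendsto_zero_iff_norm_tendsto_zero]
    simp only [norm_expI]
    exact Real.tendsto_exp_neg_atTop_nhds_zero.comp (tendsto_id.const_mul_atTop him)
  have hcancel : ∀ (f : ℝ → ℂ) (l : ℂ), Tendsto (fun y => f y * expI (-ρ) y) atTop (𝓝 l) →
      Tendsto f atTop (𝓝 0) := by
    intro f l h
    have := h.mul hexp0
    rw [mul_zero] at this
    refine this.congr fun y => ?_
    linear_combination f y * expI_neg_mul ρ y
  have hz0 := hcancel z 0 hlim
  have he0 := hcancel _ _ e1
  have he0' := hcancel _ _ e2
  -- the derivative is bounded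
  obtain ⟨y₀, hy₀⟩ := eventually_atTop.1 ((hlim.norm.eventually
    (gt_mem_nhds (by simp : ‖(0 : ℂ)‖ < 1))).and (eventually_gt_atTop 0))
  have hy₀Y := (hy₀ y₀ le_rfl).2
  have hzb : ∀ y, y₀ ≤ y → ‖z y‖ ≤ Real.exp (-(ρ.im * y)) := by
    intro y hy
    have h1 := (hy₀ y hy).1
    have e : z y = (z y * expI (-ρ) y) * expI ρ y := by
      linear_combination (-z y) * expI_neg_mul ρ y
    rw [e, norm_mul, norm_expI]
    exact mul_le_of_le_one_left (Real.exp_pos _).le h1.le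
  have hexpi : IntegrableOn (fun t : ℝ => Real.exp (-(ρ.im * t))) (Set.Ioi y₀) := by
    have := exp_neg_integrableOn_Ioi y₀ him
    simpa only [neg_mul] using this
  have hbi : IntegrableOn (fun t => ‖vpot P Q t‖ + ‖ρ ^ 2‖ * Real.exp (-(ρ.im * t)))
      (Set.Ioi y₀) := (hQ.integrableOn_vpot hy₀Y).norm.add (hexpi.const_mul _)
  set D := ‖z' y₀‖ + ∫ t in Set.Ioi y₀, (‖vpot P Q t‖ + ‖ρ ^ 2‖ * Real.exp (-(ρ.im * t)))
  have hz'b : ∀ y, y₀ ≤ y → ‖z' y‖ ≤ D := by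
    intro y hy
    have h1 := hS.hder_sub hP le_rfl hy₀Y (hy₀Y.trans_le hy)
    rw [hzd, hzd, sub_eq_iff_eq_add] at h1
    rw [h1, add_comm]
    refine (norm_add_le _ _).trans (add_le_add le_rfl ?_)
    rw [intervalIntegral.integral_of_le hy]
    refine (norm_integral_le_of_norm_le (hbi.mono_set Set.Ioc_subset_Ioi_self) ?_).trans
      (setIntegral_mono_set hbi (Eventually.of_forall fun t => by positivity)
        Set.Ioc_subset_Ioi_self.eventuallyLE)
    filter_upwards [ae_restrict_mem measurableSet_Ioc] with t ht
    rw [hzv t (hy₀Y.trans ht.1), norm_mul]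
    have b1 := hzb t ht.1.le
    have b2 : Real.exp (-(ρ.im * t)) ≤ 1 := Real.exp_le_one_iff.2 (by
      have := hy₀Y.trans ht.1
      nlinarith)
    calc _ ≤ (‖vpot P Q t‖ + ‖ρ ^ 2‖) * Real.exp (-(ρ.im * t)) := by
          gcongr
          exact norm_sub_le _ _
      _ = ‖vpot P Q t‖ * Real.exp (-(ρ.im * t)) + ‖ρ ^ 2‖ * Real.exp (-(ρ.im * t)) := by ring
      _ ≤ _ := by
          gcongr
          exact mul_le_of_le_one_right (norm_nonneg _) b2
  -- the Wronskian with the Jost solution vanishes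
  have hwlim : Tendsto (fun y => z y * je' (vpot P Q) ρ y - z' y * je (vpot P Q) ρ y) atTop
      (𝓝 0) := by
    have h1 := hz0.mul he0'
    have h2 : Tendsto (fun y => z' y * je (vpot P Q) ρ y) atTop (𝓝 0) := by
      refine squeeze_zero_norm' ?_ (by simpa using he0.norm.const_mul D)
      filter_upwards [eventually_ge_atTop y₀] with y hy
      rw [norm_mul]
      exact mul_le_mul_of_nonneg_right (hz'b y hy) (norm_nonneg _)
    simpa using h1.sub h2
  set y₁ := Y + 1
  have hw : d0 * pwr P Q 0 ρ y₁ + d1 * pwr P Q 1 ρ y₁ = 0 := by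
    refine tendsto_nhds_unique (tendsto_const_nhds.congr' ?_) (by simpa using hwlim.neg)
    filter_upwards [eventually_gt_atTop Y] with y hy
    rw [← hQ.pwr_const hP hV le_rfl him.le 0 (lt_add_one Y) hy,
      ← hQ.pwr_const hP hV le_rfl him.le 1 (lt_add_one Y) hy]
    simp only [hz, hz', pwr]
    ring
  have hej : ∀ y, Y < y → je (vpot P Q) ρ y = pwr P Q 1 ρ y₁ * hsol P Q 0 (ρ ^ 2) y -
      pwr P Q 0 ρ y₁ * hsol P Q 1 (ρ ^ 2) y := by
    intro y hy
    rw [(hQ.je_eq_jB hP ρ (hV.nonneg.trans_lt hy)).1,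
      hQ.jB_const hP hV le_rfl him.le 0 (lt_add_one Y) hy,
      hQ.jB_const hP hV le_rfl him.le 1 (lt_add_one Y) hy]
    simp [jB]
    ring
  have hcase : ∀ t : ℂ, (∀ y, Y < y → z y = t * je (vpot P Q) ρ y) → t = 0 := by
    intro t ht
    have h1 := e1.const_mul t
    refine (mul_one t).symm.trans (tendsto_nhds_unique h1 (hlim.congr' ?_))
    filter_upwards [eventually_gt_atTop Y] with y hy
    have := ht y hy
    simp only [hz] at this
    linear_combination expI (-ρ) y * this
  by_cases hp : pwr P Q 1 ρ y₁ = 0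
  · by_cases hq : pwr P Q 0 ρ y₁ = 0
    · exfalso
      refine one_ne_zero (tendsto_nhds_unique e1 (tendsto_const_nhds.congr' ?_) : (1 : ℂ) = 0)
      filter_upwards [eventually_gt_atTop Y] with y hy
      rw [hej y hy, hp, hq]
      ring
    · rw [hp, mul_zero, add_zero] at hw
      have hd0 := (mul_eq_zero.1 hw).resolve_right hq
      have := hcase (-d1 / pwr P Q 0 ρ y₁) fun y hy => by
        rw [hej y hy, hp]
        simp only [hz, hd0]
        field_simp
        ring
      rw [div_eq_zero_iff, neg_eq_zero] at this
      exact ⟨hd0, this.resolve_right hq⟩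
  · have hd1 : d1 = -(d0 * pwr P Q 0 ρ y₁) / pwr P Q 1 ρ y₁ := by
      rw [eq_div_iff hp]
      linear_combination hw
    have := hcase (d0 / pwr P Q 1 ρ y₁) fun y hy => by
      rw [hej y hy]
      simp only [hz]
      rw [hd1]
      field_simp
      ring
    rw [div_eq_zero_iff] at this
    have hd0 := this.resolve_right hp
    exact ⟨hd0, by rw [hd1, hd0]; simp⟩

end

section

/-! ### Reduction to the half-lines on both sides of the singular point -/

variable {P : Params} {q Qp Qm : ℝ → ℂ}

/-- `Qp` and `Qm` represent `q` to the right and to the left of the singular point, as functions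
of the distance. -/
structure SplitPot (P : Params) (q Qp Qm : ℝ → ℂ) : Prop where
  right : TailPot P Qp
  left : HalfPot P Qm
  ae_right : ∀ᵐ t, 0 < t → q (P.a + t) = Qp t
  ae_left : ∀ᵐ t, 0 < t → t < P.a → q (P.a - t) = Qm t

theorem ClassW.exists_rep (hq : ClassW P q) (ha : 0 < P.a) :
    ∃ q' : ℝ → ℂ, Measurable q' ∧ ∀ᵐ x, 0 < x → q x = q' x := by
  obtain ⟨T, hT, h1, h2⟩ := hq
  have m1 : AEMeasurable q (volume.restrict (Set.Ioo 0 T)) := by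
    have hw : Measurable (fun x : ℝ =>
        (((|x - P.a| ^ min 0 (1 - 2 * P.ν.re) : ℝ) : ℂ))⁻¹) := by fun_prop
    refine (h1.aestronglyMeasurable.aemeasurable.mul hw.aemeasurable).congr ?_
    have : ∀ᵐ x : ℝ ∂(volume.restrict (Set.Ioo 0 T)), x ≠ P.a :=
      ae_restrict_of_ae (by simp [ae_iff, measure_singleton])
    filter_upwards [this] with x hx
    have h0 : ((|x - P.a| ^ min 0 (1 - 2 * P.ν.re) : ℝ) : ℂ) ≠ 0 := by
      have : 0 < |x - P.a| := abs_pos.2 (sub_ne_zero.2 hx)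
      exact_mod_cast (Real.rpow_pos_of_pos this _).ne'
    simp only [Pi.mul_apply]
    rw [mul_assoc, mul_inv_cancel₀ h0, mul_one]
  have m2 : AEMeasurable q (volume.restrict (Set.Ici T)) := by
    rw [← restrict_Ioi_eq_restrict_Ici]
    exact h2.aestronglyMeasurable.aemeasurable
  have m3 : AEMeasurable q (volume.restrict (Set.Ioi 0)) := by
    rw [← Set.Ioo_union_Ici_eq_Ioi (ha.trans hT)]
    exact aemeasurable_union_iff.2 ⟨m1, m2⟩
  refine ⟨m3.mk q, m3.measurable_mk, ?_⟩
  exact (ae_restrict_iff' measurableSet_Ioi).1 m3.ae_eq_mk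

theorem ClassW.exists_splitPot (hq : ClassW P q) (ha : 0 < P.a) :
    ∃ Qp Qm, SplitPot P q Qp Qm := by
  obtain ⟨q', hm, hae⟩ := hq.exists_rep ha
  obtain ⟨T, hT, h1, h2⟩ := hq
  set m := min 0 (1 - 2 * P.ν.re) with hmdef
  have hm0 : m ≤ 0 := min_le_left _ _
  set G : ℝ → ℝ := (Set.Ioo 0 T).indicator (fun x => ‖q' x‖ * |x - P.a| ^ m) with hG
  have hGi : Integrable G := by
    refine IntegrableOn.integrable_indicator (h1.norm.congr ?_) measurableSet_Ioo
    filter_upwards [ae_restrict_of_ae hae, ae_restrict_mem measurableSet_Ioo] with x hx hx1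
    rw [hx hx1.1, norm_mul, Complex.norm_real, Real.norm_of_nonneg (by positivity)]
  set F : ℝ → ℂ := (Set.Ioi T).indicator q' with hF
  have hFi : Integrable F := by
    refine IntegrableOn.integrable_indicator (Integrable.congr h2 ?_) measurableSet_Ioi
    filter_upwards [ae_restrict_of_ae hae, ae_restrict_mem measurableSet_Ioi] with x hx hx1
    exact hx ((ha.trans hT).trans hx1)
  -- On the left the potential is cut off at distance `a`, which corresponds to the origin. Larger
  -- distances do not occur on `[0, a)`.
  refine ⟨fun t => q' (P.a + t), fun t => (Set.Iio P.a).indicator (fun t => q' (P.a - t)) t,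
    ⟨⟨by fun_prop, fun Y => ?_⟩, T - P.a, by linarith, ?_⟩, ⟨?_, fun Y => ?_⟩, ?_, ?_⟩
  · have hb : Integrable (fun t => G (P.a + t) + (T - P.a) ^ m * ‖F (P.a + t)‖) :=
      (hGi.comp_add_left P.a).add ((hFi.comp_add_left P.a).norm.const_mul _)
    refine hb.integrableOn.mono' ?_ ?_
    · refine Measurable.aestronglyMeasurable ?_
      unfold wt
      fun_prop
    · have hne : ∀ᵐ t : ℝ ∂(volume.restrict (Set.Ioc 0 Y)), t ≠ T - P.a :=
        ae_restrict_of_ae (by simp [ae_iff, measure_singleton])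
      filter_upwards [ae_restrict_mem measurableSet_Ioc, hne] with t ht htT
      have hw : 0 ≤ wt P t := (wt_pos P ht.1).le
      rw [Real.norm_of_nonneg (mul_nonneg hw (norm_nonneg _))]
      rcases lt_or_gt_of_ne htT with h | h
      · have : G (P.a + t) = ‖q' (P.a + t)‖ * wt P t := by
          rw [hG, Set.indicator_of_mem (show P.a + t ∈ Set.Ioo 0 T from
            ⟨by linarith [ht.1], by linarith⟩), add_sub_cancel_left, abs_of_pos ht.1]
          rfl
        rw [this]
        have : 0 ≤ (T - P.a) ^ m * ‖F (P.a + t)‖ :=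
          mul_nonneg (Real.rpow_nonneg (by linarith) _) (norm_nonneg _)
        linarith
      · have e1 : F (P.a + t) = q' (P.a + t) :=
          Set.indicator_of_mem (show P.a + t ∈ Set.Ioi T by
            simp only [Set.mem_Ioi]; linarith) _
        have e2 : 0 ≤ G (P.a + t) := Set.indicator_nonneg (fun x _ => by positivity) _
        have e3 : wt P t ≤ (T - P.a) ^ m :=
          Real.rpow_le_rpow_of_nonpos (by linarith) h.le hm0
        rw [e1]
        have := mul_le_mul_of_nonneg_right e3 (norm_nonneg (q' (P.a + t)))
        linarith
  · have := (hFi.comp_add_left P.a).integrableOn (s := Set.Ioi (T - P.a))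
    refine Integrable.congr this ?_
    filter_upwards [ae_restrict_mem measurableSet_Ioi] with t ht
    have : T - P.a < t := ht
    exact Set.indicator_of_mem (show P.a + t ∈ Set.Ioi T by
      simp only [Set.mem_Ioi]; linarith) _
  · exact Measurable.indicator (by fun_prop) measurableSet_Iio
  · refine (hGi.comp_sub_left P.a).integrableOn.mono' ?_ ?_
    · refine Measurable.aestronglyMeasurable (Measurable.mul (by unfold wt; fun_prop) ?_)
      exact (Measurable.indicator (by fun_prop) measurableSet_Iio).norm
    · filter_upwards [ae_restrict_mem measurableSet_Ioc] with t ht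
      have hw : 0 ≤ wt P t := (wt_pos P ht.1).le
      rw [Real.norm_of_nonneg (mul_nonneg hw (norm_nonneg _))]
      by_cases h : t < P.a
      · rw [Set.indicator_of_mem (show t ∈ Set.Iio P.a from h), hG,
          Set.indicator_of_mem (show P.a - t ∈ Set.Ioo 0 T from
            ⟨by linarith, by linarith [ht.1]⟩), sub_sub_cancel_left, abs_neg, abs_of_pos ht.1,
          mul_comm]
        rfl
      · rw [Set.indicator_of_notMem (show t ∉ Set.Iio P.a from h), norm_zero, mul_zero]
        exact Set.indicator_nonneg (fun x _ => by positivity) _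
  · have := (measurePreserving_add_left volume P.a).quasiMeasurePreserving.ae hae
    filter_upwards [this] with t ht h0
    exact ht (by linarith)
  · have := (Measure.measurePreserving_sub_left volume P.a).quasiMeasurePreserving.ae hae
    filter_upwards [this] with t ht h0 h1
    rw [Set.indicator_of_mem (show t ∈ Set.Iio P.a from h1)]
    exact ht (by linarith)

theorem turn_ne_zero (P : Params) (j : Fin 2) : turn P j ≠ 0 := Complex.exp_ne_zero _

theorem SplitPot.right_iff (hS : SplitPot P q Qp Qm) (lam : ℂ) (s : ℝ → ℂ) (k : Fin 2) {x : ℝ}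
    (hx : P.a < x) :
    IntervalIntegrable (fun t => modelSol P k t lam * (q t * s t)) volume P.a x ↔
    IntervalIntegrable (fun t => bes P k lam t * (Qp t * s (P.a + t))) volume 0 (x - P.a) := by
  rw [← IntervalIntegrable.comp_add_left_iff (c := P.a), sub_self]
  refine intervalIntegrable_congr_ae ?_
  rw [Set.uIoc_of_le (by linarith)]
  filter_upwards [ae_restrict_of_ae hS.ae_right, ae_restrict_mem measurableSet_Ioc] with t ht hm
  rw [ht hm.1, modelSol_eq_bes, add_sub_cancel_left]

theorem SplitPot.right_integral (hS : SplitPot P q Qp Qm) (lam : ℂ) (s : ℝ → ℂ) {x : ℝ}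
    (hx : P.a < x) :
    ∫ t in P.a..x, greenKernel P x t lam * q t * s t =
      ∫ t in (0 : ℝ)..(x - P.a), green P lam (x - P.a) t * (Qp t * s (P.a + t)) := by
  have h := intervalIntegral.integral_comp_add_left (a := 0) (b := x - P.a)
    (fun t => greenKernel P x t lam * q t * s t) P.a
  rw [add_zero, add_sub_cancel] at h
  rw [← h]
  refine intervalIntegral.integral_congr_ae ?_
  rw [Set.uIoc_of_le (by linarith)]
  filter_upwards [hS.ae_right] with t ht hm
  rw [ht hm.1]
  unfold greenKernel green
  simp only [modelSol_eq_bes, add_sub_cancel_left]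
  ring

theorem SplitPot.left_iff (hS : SplitPot P q Qp Qm) (lam : ℂ) (s : ℝ → ℂ) (k : Fin 2) {x : ℝ}
    (hx0 : 0 ≤ x) (hx : x < P.a) :
    IntervalIntegrable (fun t => modelSol P k t lam * (q t * s t)) volume P.a x ↔
    IntervalIntegrable (fun t => turn P k * (bes P k lam t * (Qm t * s (P.a - t)))) volume 0
      (P.a - x) := by
  rw [← IntervalIntegrable.comp_sub_left_iff P.a, sub_self]
  refine intervalIntegrable_congr_ae ?_
  rw [Set.uIoc_of_le (by linarith)]
  have hne : ∀ᵐ t : ℝ ∂(volume.restrict (Set.Ioc 0 (P.a - x))), t ≠ P.a :=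
    ae_restrict_of_ae (by simp [ae_iff, measure_singleton])
  filter_upwards [ae_restrict_of_ae hS.ae_left, ae_restrict_mem measurableSet_Ioc, hne]
    with t ht hm hta
  rw [ht hm.1 (lt_of_le_of_ne (by linarith [hm.2]) hta), modelSol_eq_bes, sub_sub_cancel_left,
    bes_neg P k lam hm.1]
  ring

/-- Each product in the kernel picks up `turn P 0 * turn P 1 = -1`, which cancels the sign from
reversing the direction of integration. In the distance to `a` the equation is therefore the same as
on the right. -/
theorem SplitPot.left_integral (hS : SplitPot P q Qp Qm) (lam : ℂ) (s : ℝ → ℂ) {x : ℝ}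
    (hx0 : 0 ≤ x) (hx : x < P.a) :
    ∫ t in P.a..x, greenKernel P x t lam * q t * s t =
      ∫ t in (0 : ℝ)..(P.a - x), green P lam (P.a - x) t * (Qm t * s (P.a - t)) := by
  have h := intervalIntegral.integral_comp_sub_left (a := 0) (b := P.a - x)
    (fun t => greenKernel P x t lam * q t * s t) P.a
  rw [sub_zero, sub_sub_cancel] at h
  rw [intervalIntegral.integral_symm, ← h, ← intervalIntegral.integral_neg]
  refine intervalIntegral.integral_congr_ae ?_
  rw [Set.uIoc_of_le (by linarith)]
  have hne : ∀ᵐ t : ℝ, t ≠ P.a := by simp [ae_iff, measure_singleton]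
  filter_upwards [hS.ae_left, hne] with t ht hta hm
  rw [ht hm.1 (lt_of_le_of_ne (by linarith [hm.2]) hta)]
  have hy : 0 < P.a - x := by linarith
  have e : x - P.a = -(P.a - x) := by ring
  unfold greenKernel green
  simp only [modelSol_eq_bes, sub_sub_cancel_left]
  rw [e, bes_neg P 0 lam hm.1, bes_neg P 1 lam hm.1, bes_neg P 0 lam hy, bes_neg P 1 lam hy]
  linear_combination (-(bes P 0 lam t * bes P 1 lam (P.a - x) - bes P 0 lam (P.a - x) *
    bes P 1 lam t) * (Qm t * s (P.a - t))) * turn_mul P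

/-- The solutions `s_j` are given by `hsol` on both sides of the singular point. -/
theorem SplitPot.sSol_eq (hP : Admissible P) (ha : 0 < P.a) (hS : SplitPot P q Qp Qm) (j : Fin 2)
    (lam : ℂ) :
    (∀ x, P.a < x → sSol P q j lam x = hsol P Qp j lam (x - P.a)) ∧
    (∀ x, 0 ≤ x → x < P.a → sSol P q j lam x = turn P j * hsol P Qm j lam (P.a - x)) := by
  have hr := hS.right.toHalfPot
  have hl := hS.left
  set s₀ : ℝ → ℂ := fun x => if P.a < x then hsol P Qp j lam (x - P.a) else
    turn P j * hsol P Qm j lam (P.a - x) with hs₀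
  have hs₀r : ∀ t, 0 < t → s₀ (P.a + t) = hsol P Qp j lam t := fun t ht => by
    simp only [hs₀]
    rw [if_pos (by linarith), add_sub_cancel_left]
  have hs₀l : ∀ t, 0 < t → s₀ (P.a - t) = turn P j * hsol P Qm j lam t := fun t ht => by
    simp only [hs₀]
    rw [if_neg (by linarith), sub_sub_cancel]
  have hex : SolvesIntegralEq P q j lam s₀ := by
    intro x hx0 hxa
    rcases lt_or_gt_of_ne hxa with h | h
    · have hy : 0 < P.a - x := by linarith
      have hcong : ∀ g : ℝ → ℂ, ∀ t ∈ Set.uIoc 0 (P.a - x),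
          g t * (Qm t * s₀ (P.a - t)) = turn P j * (g t * (Qm t * hsol P Qm j lam t)) := by
        intro g t ht
        rw [Set.uIoc_of_le hy.le] at ht
        rw [hs₀l t ht.1]
        ring
      constructor
      · intro k
        rw [hS.left_iff lam s₀ k hx0 h]
        refine (IntervalIntegrable.const_mul ?_ _)
        refine ((hl.intervalIntegrable_bes_mul_hsol hP lam le_rfl hy.le k j).const_mul
          (turn P j)).congr fun t ht => ?_
        exact (hcong _ t ht).symm
      · rw [hS.left_integral lam s₀ hx0 h, intervalIntegral.integral_congr_ae (Eventually.of_forall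
          fun t ht => hcong _ t ht), intervalIntegral.integral_const_mul, modelSol_eq_bes,
          show x - P.a = -(P.a - x) by ring, bes_neg P j lam hy, ← mul_add, ← hl.hsol_eq hP j lam hy]
        simp only [hs₀]
        rw [if_neg (by linarith)]
    · have hy : 0 < x - P.a := by linarith
      have hcong : ∀ g : ℝ → ℂ, ∀ t ∈ Set.uIoc 0 (x - P.a),
          g t * (Qp t * s₀ (P.a + t)) = g t * (Qp t * hsol P Qp j lam t) := by
        intro g t ht
        rw [Set.uIoc_of_le hy.le] at ht
        rw [hs₀r t ht.1]
      constructor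
      · intro k
        rw [hS.right_iff lam s₀ k h]
        refine (hr.intervalIntegrable_bes_mul_hsol hP lam le_rfl hy.le k j).congr fun t ht => ?_
        exact (hcong _ t ht).symm
      · rw [hS.right_integral lam s₀ h, intervalIntegral.integral_congr_ae (Eventually.of_forall
          fun t ht => hcong _ t ht), modelSol_eq_bes, ← hr.hsol_eq hP j lam hy]
        simp only [hs₀]
        rw [if_pos h]
  -- The explicit candidate `s₀` is needed only here, to know that the chosen function solves the
  -- equation. Its values are then identified by uniqueness on each side.
  have hs : SolvesIntegralEq P q j lam (sSol P q j lam) := Classical.epsilon_spec ⟨s₀, hex⟩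
  set s := sSol P q j lam with hsdef
  constructor
  · intro x hx
    have hy : 0 < x - P.a := by linarith
    have := hr.hsol_unique hP j lam (Y := x - P.a) (s := fun t => s (P.a + t))
      (fun k y hy => by
        have h := (hs (P.a + y) (by linarith [hy.1]) (by linarith [hy.1])).1 k
        rwa [hS.right_iff lam s k (by linarith [hy.1]), add_sub_cancel_left] at h)
      (fun y hy => by
        have h := (hs (P.a + y) (by linarith [hy.1]) (by linarith [hy.1])).2
        rwa [hS.right_integral lam s (by linarith [hy.1]), modelSol_eq_bes,
          add_sub_cancel_left] at h) (x - P.a) ⟨hy, le_rfl⟩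
    simpa using this
  · intro x hx0 hx
    have hy : 0 < P.a - x := by linarith
    have ht := turn_ne_zero P j
    have := hl.hsol_unique hP j lam (Y := P.a - x) (s := fun t => (turn P j)⁻¹ * s (P.a - t))
      (fun k y hy => by
        have h := (hs (P.a - y) (by linarith [hy.2]) (by linarith [hy.1])).1 k
        rw [hS.left_iff lam s k (by linarith [hy.2]) (by linarith [hy.1]), sub_sub_cancel] at h
        have h2 := h.const_mul ((turn P k)⁻¹ * (turn P j)⁻¹)
        refine h2.congr fun t _ => ?_
        have := turn_ne_zero P k
        field_simp)
      (fun y hy => by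
        have h := (hs (P.a - y) (by linarith [hy.2]) (by linarith [hy.1])).2
        rw [hS.left_integral lam s (by linarith [hy.2]) (by linarith [hy.1]), modelSol_eq_bes,
          sub_sub_cancel, sub_sub_cancel_left, bes_neg P j lam hy.1] at h
        rw [h, mul_add, inv_mul_cancel_left₀ ht, ← intervalIntegral.integral_const_mul]
        congr 1
        refine intervalIntegral.integral_congr fun t _ => ?_
        ring) (P.a - x) ⟨hy, le_rfl⟩
    simp only [sub_sub_cancel] at this
    rw [← this, mul_inv_cancel_left₀ ht]

end

section

/-! ### Solutions with the matching conditions, the Jost solution and the Weyl solution -/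

/-- The standing assumptions, together with a representation of the potential on both sides of the
singular point. -/
structure Setting (P : Params) (q Qp Qm : ℝ → ℂ) : Prop where
  adm : Admissible P
  a_pos : 0 < P.a
  split : SplitPot P q Qp Qm
  A01 : P.A 0 1 = 0
  det_ne : P.A.det ≠ 0

variable {P : Params} {q Qp Qm : ℝ → ℂ}

theorem Setting.det_eq (h : Setting P q Qp Qm) : P.A.det = P.A 0 0 * P.A 1 1 := by
  rw [Matrix.det_fin_two, h.A01, zero_mul, sub_zero]

theorem Setting.A00_ne (h : Setting P q Qp Qm) : P.A 0 0 ≠ 0 :=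
  left_ne_zero_of_mul (h.det_eq ▸ h.det_ne)

theorem Setting.A11_ne (h : Setting P q Qp Qm) : P.A 1 1 ≠ 0 :=
  right_ne_zero_of_mul (h.det_eq ▸ h.det_ne)

/-- The solutions `σ_j` in terms of the solutions on the half-lines. -/
def sg (P : Params) (Qp Qm : ℝ → ℂ) (j : Fin 2) (lam : ℂ) (x : ℝ) : ℂ :=
  if x < P.a then turn P j * hsol P Qm j lam (P.a - x)
  else P.A 0 j * hsol P Qp 0 lam (x - P.a) + P.A 1 j * hsol P Qp 1 lam (x - P.a)

/-- The derivative of `sg`. -/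
def sg' (P : Params) (Qp Qm : ℝ → ℂ) (j : Fin 2) (lam : ℂ) (x : ℝ) : ℂ :=
  if x < P.a then -(turn P j * hsol' P Qm j lam (P.a - x))
  else P.A 0 j * hsol' P Qp 0 lam (x - P.a) + P.A 1 j * hsol' P Qp 1 lam (x - P.a)

theorem Setting.sigma_eq (h : Setting P q Qp Qm) (j : Fin 2) (lam : ℂ) {x : ℝ} (hx : 0 ≤ x)
    (hxa : x ≠ P.a) : sigma P q j lam x = sg P Qp Qm j lam x := by
  unfold sigma sg
  split_ifs with hlt
  · exact (h.split.sSol_eq h.adm h.a_pos j lam).2 x hx hlt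
  · have hgt : P.a < x := lt_of_le_of_ne (not_lt.1 hlt) hxa.symm
    rw [Fin.sum_univ_two, (h.split.sSol_eq h.adm h.a_pos 0 lam).1 x hgt,
      (h.split.sSol_eq h.adm h.a_pos 1 lam).1 x hgt]

theorem Setting.hasDerivAt_sg (h : Setting P q Qp Qm) (j : Fin 2) (lam : ℂ) {x : ℝ}
    (hxa : x ≠ P.a) : HasDerivAt (sg P Qp Qm j lam) (sg' P Qp Qm j lam x) x := by
  rcases lt_or_gt_of_ne hxa with hlt | hgt
  · have h1 := h.split.left.hasDerivAt_hsol h.adm j lam (y := P.a - x) (by linarith)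
    have h2 : HasDerivAt (fun x => turn P j * hsol P Qm j lam (P.a - x))
        (sg' P Qp Qm j lam x) x := by
      refine ((h1.comp_const_sub P.a x).const_mul (turn P j)).congr_deriv ?_
      rw [sg', if_pos hlt, mul_neg]
    refine h2.congr_of_eventuallyEq ?_
    filter_upwards [gt_mem_nhds hlt] with z hz
    rw [sg, if_pos hz]
  · have h1 := fun k => (h.split.right.toHalfPot.hasDerivAt_hsol h.adm k lam (y := x - P.a)
      (by linarith)).comp_sub_const x P.a
    have h2 : HasDerivAt (fun x => P.A 0 j * hsol P Qp 0 lam (x - P.a) +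
        P.A 1 j * hsol P Qp 1 lam (x - P.a)) (sg' P Qp Qm j lam x) x := by
      refine (((h1 0).const_mul (P.A 0 j)).add ((h1 1).const_mul (P.A 1 j))).congr_deriv ?_
      rw [sg', if_neg hgt.not_gt]
    refine h2.congr_of_eventuallyEq ?_
    filter_upwards [lt_mem_nhds hgt] with z hz
    rw [sg, if_neg (not_lt.2 (le_of_lt hz))]

/-- The derivative of a combination of `σ₁, σ₂`. -/
theorem Setting.dx_combination (h : Setting P q Qp Qm) (lam c0 c1 : ℂ) {f : ℝ → ℂ}
    (hf : ∀ x, f x = c0 * sigma P q 0 lam x + c1 * sigma P q 1 lam x) {x : ℝ} (hx : 0 ≤ x)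
    (hxa : x ≠ P.a) : dx f x = c0 * sg' P Qp Qm 0 lam x + c1 * sg' P Qp Qm 1 lam x := by
  have h1 := ((h.hasDerivAt_sg 0 lam hxa).const_mul c0).add
    ((h.hasDerivAt_sg 1 lam hxa).const_mul c1)
  have heq : ∀ y, 0 ≤ y → y ≠ P.a →
      f y = c0 * sg P Qp Qm 0 lam y + c1 * sg P Qp Qm 1 lam y := fun y hy hya => by
    rw [hf, h.sigma_eq 0 lam hy hya, h.sigma_eq 1 lam hy hya]
  refine HasDerivWithinAt.derivWithin ?_ (uniqueDiffOn_Ici 0 x hx)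
  refine h1.hasDerivWithinAt.congr_of_eventuallyEq ?_ (heq x hx hxa)
  filter_upwards [self_mem_nhdsWithin, mem_nhdsWithin_of_mem_nhds (isOpen_ne.mem_nhds hxa)]
    with y hy hya
  exact heq y hy hya

theorem Setting.sg_wronskian (h : Setting P q Qp Qm) (lam : ℂ) {x : ℝ} (hxa : x ≠ P.a) :
    sg P Qp Qm 0 lam x * sg' P Qp Qm 1 lam x - sg' P Qp Qm 0 lam x * sg P Qp Qm 1 lam x =
      eta P x := by
  unfold sg sg' eta
  rcases lt_or_gt_of_ne hxa with hlt | hgt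
  · have := h.split.left.hsol_wronskian h.adm lam (y := P.a - x) (by linarith)
    simp only [if_pos hlt]
    linear_combination (-(turn P 0 * turn P 1)) * this - turn_mul P
  · have := h.split.right.toHalfPot.hsol_wronskian h.adm lam (y := x - P.a) (by linarith)
    simp only [if_neg hgt.not_gt, Matrix.det_fin_two]
    linear_combination (P.A 0 0 * P.A 1 1 - P.A 0 1 * P.A 1 0) * this

theorem Setting.differentiable_sg (h : Setting P q Qp Qm) (j : Fin 2) {x : ℝ} (hxa : x ≠ P.a) :
    Differentiable ℂ (fun lam => sg P Qp Qm j lam x) ∧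
    Differentiable ℂ (fun lam => sg' P Qp Qm j lam x) := by
  unfold sg sg'
  have hr := h.split.right.toHalfPot
  rcases lt_or_gt_of_ne hxa with hlt | hgt
  · have hy : 0 < P.a - x := by linarith
    simp only [if_pos hlt]
    exact ⟨(h.split.left.differentiable_hsol h.adm j hy).const_mul _,
      ((h.split.left.differentiable_hsol' h.adm j hy).const_mul _).neg⟩
  · have hy : 0 < x - P.a := by linarith
    simp only [if_neg hgt.not_gt]
    exact ⟨((hr.differentiable_hsol h.adm 0 hy).const_mul _).add
        ((hr.differentiable_hsol h.adm 1 hy).const_mul _),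
      ((hr.differentiable_hsol' h.adm 0 hy).const_mul _).add
        ((hr.differentiable_hsol' h.adm 1 hy).const_mul _)⟩

/-- The values of `φ`. -/
def phv (P : Params) (Qp Qm : ℝ → ℂ) (x : ℝ) (lam : ℂ) : ℂ :=
  sg P Qp Qm 0 lam 0 * sg P Qp Qm 1 lam x - sg P Qp Qm 1 lam 0 * sg P Qp Qm 0 lam x

/-- The derivative of `phv` in `x`. -/
def phd (P : Params) (Qp Qm : ℝ → ℂ) (x : ℝ) (lam : ℂ) : ℂ :=
  sg P Qp Qm 0 lam 0 * sg' P Qp Qm 1 lam x - sg P Qp Qm 1 lam 0 * sg' P Qp Qm 0 lam x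

/-- The solution `S` with `S(0) = 1`, `S'(0) = 0`. -/
def cov (P : Params) (Qp Qm : ℝ → ℂ) (x : ℝ) (lam : ℂ) : ℂ :=
  sg' P Qp Qm 1 lam 0 * sg P Qp Qm 0 lam x - sg' P Qp Qm 0 lam 0 * sg P Qp Qm 1 lam x

/-- The derivative of `cov` in `x`. -/
def cod (P : Params) (Qp Qm : ℝ → ℂ) (x : ℝ) (lam : ℂ) : ℂ :=
  sg' P Qp Qm 1 lam 0 * sg' P Qp Qm 0 lam x - sg' P Qp Qm 0 lam 0 * sg' P Qp Qm 1 lam x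

/-- The values of the Jost solution. -/
def jov (P : Params) (q Qp Qm : ℝ → ℂ) (x : ℝ) (ρ : ℂ) : ℂ :=
  jostCoeff P q ρ 0 * sg P Qp Qm 0 (ρ ^ 2) x + jostCoeff P q ρ 1 * sg P Qp Qm 1 (ρ ^ 2) x

/-- The derivative of `jov` in `x`. -/
def jod (P : Params) (q Qp Qm : ℝ → ℂ) (x : ℝ) (ρ : ℂ) : ℂ :=
  jostCoeff P q ρ 0 * sg' P Qp Qm 0 (ρ ^ 2) x + jostCoeff P q ρ 1 * sg' P Qp Qm 1 (ρ ^ 2) x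

theorem Setting.phi_eq (h : Setting P q Qp Qm) {x : ℝ} (hx : 0 ≤ x) (hxa : x ≠ P.a) (lam : ℂ) :
    phi P q lam x = phv P Qp Qm x lam ∧ dx (phi P q lam) x = phd P Qp Qm x lam := by
  have h0 := h.a_pos.ne
  refine ⟨?_, ?_⟩
  · rw [phi, h.sigma_eq 0 lam le_rfl h0, h.sigma_eq 1 lam le_rfl h0, h.sigma_eq 0 lam hx hxa,
      h.sigma_eq 1 lam hx hxa, phv]
  · rw [h.dx_combination lam (-sigma P q 1 lam 0) (sigma P q 0 lam 0)
      (fun x => by rw [phi]; ring) hx hxa, h.sigma_eq 0 lam le_rfl h0,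
      h.sigma_eq 1 lam le_rfl h0, phd]
    ring

theorem Setting.jost_eq (h : Setting P q Qp Qm) {x : ℝ} (hx : 0 ≤ x) (hxa : x ≠ P.a) (ρ : ℂ) :
    jost P q ρ x = jov P q Qp Qm x ρ ∧ charFun P q ρ = jov P q Qp Qm 0 ρ := by
  have h0 := h.a_pos.ne
  rw [charFun, jost, jost, Fin.sum_univ_two, Fin.sum_univ_two, h.sigma_eq 0 _ le_rfl h0,
    h.sigma_eq 1 _ le_rfl h0, h.sigma_eq 0 _ hx hxa, h.sigma_eq 1 _ hx hxa]
  exact ⟨rfl, rfl⟩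

theorem Setting.weylSol_eq (h : Setting P q Qp Qm) {x : ℝ} (hx : 0 ≤ x) (hxa : x ≠ P.a) (ρ : ℂ) :
    weylSol P q ρ x = jov P q Qp Qm x ρ / jov P q Qp Qm 0 ρ ∧
    dx (weylSol P q ρ) x = jod P q Qp Qm x ρ / jov P q Qp Qm 0 ρ := by
  obtain ⟨h1, h2⟩ := h.jost_eq hx hxa ρ
  refine ⟨by rw [weylSol, h1, h2], ?_⟩
  rw [h.dx_combination (ρ ^ 2) (jostCoeff P q ρ 0 / charFun P q ρ)
    (jostCoeff P q ρ 1 / charFun P q ρ)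
    (fun x => by rw [weylSol, jost, Fin.sum_univ_two]; ring) hx hxa, h2, jod]
  ring

theorem Setting.weylFun_eq (h : Setting P q Qp Qm) (ρ : ℂ) :
    weylFun P q ρ = jod P q Qp Qm 0 ρ / jov P q Qp Qm 0 ρ :=
  (h.weylSol_eq le_rfl h.a_pos.ne ρ).2

theorem Setting.initial_wronskian (h : Setting P q Qp Qm) (lam : ℂ) :
    sg P Qp Qm 0 lam 0 * sg' P Qp Qm 1 lam 0 - sg' P Qp Qm 0 lam 0 * sg P Qp Qm 1 lam 0 = 1 := by
  rw [h.sg_wronskian lam h.a_pos.ne, eta, if_pos h.a_pos]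

theorem Setting.phi_cos_wronskian (h : Setting P q Qp Qm) {x : ℝ} (hxa : x ≠ P.a) (lam : ℂ) :
    phd P Qp Qm x lam * cov P Qp Qm x lam - phv P Qp Qm x lam * cod P Qp Qm x lam = eta P x := by
  have h1 := h.initial_wronskian lam
  have h2 := h.sg_wronskian lam hxa
  unfold phv phd cov cod
  linear_combination (sg P Qp Qm 0 lam x * sg' P Qp Qm 1 lam x -
    sg' P Qp Qm 0 lam x * sg P Qp Qm 1 lam x) * h1 + h2

theorem Setting.jost_eq_add (h : Setting P q Qp Qm) (x : ℝ) (ρ : ℂ) :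
    jov P q Qp Qm x ρ = jov P q Qp Qm 0 ρ * cov P Qp Qm x (ρ ^ 2) +
      jod P q Qp Qm 0 ρ * phv P Qp Qm x (ρ ^ 2) ∧
    jod P q Qp Qm x ρ = jov P q Qp Qm 0 ρ * cod P Qp Qm x (ρ ^ 2) +
      jod P q Qp Qm 0 ρ * phd P Qp Qm x (ρ ^ 2) := by
  have h1 := h.initial_wronskian (ρ ^ 2)
  constructor
  · unfold jov jod cov phv
    linear_combination (-(jostCoeff P q ρ 0 * sg P Qp Qm 0 (ρ ^ 2) x +
      jostCoeff P q ρ 1 * sg P Qp Qm 1 (ρ ^ 2) x)) * h1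
  · unfold jov jod cod phd
    linear_combination (-(jostCoeff P q ρ 0 * sg' P Qp Qm 0 (ρ ^ 2) x +
      jostCoeff P q ρ 1 * sg' P Qp Qm 1 (ρ ^ 2) x)) * h1

theorem Setting.weylSol_eq_add (h : Setting P q Qp Qm) {x : ℝ} (hx : 0 ≤ x) (hxa : x ≠ P.a)
    {ρ : ℂ} (hρ : charFun P q ρ ≠ 0) :
    weylSol P q ρ x = cov P Qp Qm x (ρ ^ 2) + weylFun P q ρ * phv P Qp Qm x (ρ ^ 2) ∧
    dx (weylSol P q ρ) x = cod P Qp Qm x (ρ ^ 2) + weylFun P q ρ * phd P Qp Qm x (ρ ^ 2) := by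
  rw [(h.jost_eq hx hxa ρ).2] at hρ
  rw [h.weylFun_eq, (h.weylSol_eq hx hxa ρ).1, (h.weylSol_eq hx hxa ρ).2, (h.jost_eq_add x ρ).1,
    (h.jost_eq_add x ρ).2]
  constructor <;> field_simp

theorem Setting.differentiable_values (h : Setting P q Qp Qm) {x : ℝ} (hxa : x ≠ P.a) :
    Differentiable ℂ (phv P Qp Qm x) ∧ Differentiable ℂ (phd P Qp Qm x) ∧
    Differentiable ℂ (cov P Qp Qm x) ∧ Differentiable ℂ (cod P Qp Qm x) := by
  have h0 := h.a_pos.ne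
  have a := fun j => h.differentiable_sg j h0
  have b := fun j => h.differentiable_sg j hxa
  exact ⟨((a 0).1.mul (b 1).1).sub ((a 1).1.mul (b 0).1),
    ((a 0).1.mul (b 1).2).sub ((a 1).1.mul (b 0).2),
    ((a 1).2.mul (b 0).1).sub ((a 0).2.mul (b 1).1),
    ((a 1).2.mul (b 0).2).sub ((a 0).2.mul (b 1).2)⟩

/-- Passing to the distance `y = x - a` moves the factor `exp(iρa)` into the limit; the coefficients
to the right of `a` are `A B`, with `A` triangular. -/
theorem Setting.isJostCoeff_iff (h : Setting P q Qp Qm) (ρ : ℂ) (B : Fin 2 → ℂ) :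
    IsJostCoeff P q ρ B ↔ Tendsto (fun y => (P.A 0 0 * B 0 * hsol P Qp 0 (ρ ^ 2) y +
      (P.A 1 0 * B 0 + P.A 1 1 * B 1) * hsol P Qp 1 (ρ ^ 2) y) * expI (-ρ) y) atTop
        (𝓝 (expI ρ P.a)) := by
  have key : ∀ᶠ y : ℝ in atTop, (∑ k : Fin 2, B k * sigma P q k (ρ ^ 2) (y + P.a)) *
      Complex.exp (-Complex.I * ρ * (y + P.a : ℝ)) =
      expI (-ρ) P.a * ((P.A 0 0 * B 0 * hsol P Qp 0 (ρ ^ 2) y +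
        (P.A 1 0 * B 0 + P.A 1 1 * B 1) * hsol P Qp 1 (ρ ^ 2) y) * expI (-ρ) y) := by
    filter_upwards [eventually_gt_atTop 0] with y hy
    have h1 : Complex.exp (-Complex.I * ρ * (y + P.a : ℝ)) = expI (-ρ) P.a * expI (-ρ) y := by
      rw [mul_comm, ← expI_time_add]
      unfold expI
      congr 1
      push_cast
      ring
    have hp : 0 < P.a := h.a_pos
    rw [h1, Fin.sum_univ_two, h.sigma_eq 0 _ (by linarith) (by linarith),
      h.sigma_eq 1 _ (by linarith) (by linarith), sg, sg, if_neg (by linarith),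
      if_neg (by linarith), add_sub_cancel_right, h.A01]
    ring
  have e1 : expI (-ρ) P.a * expI ρ P.a = 1 := expI_neg_mul ρ P.a
  unfold IsJostCoeff
  have hshift : ∀ (f : ℝ → ℂ) (l : Filter ℂ),
      Tendsto f atTop l ↔ Tendsto (fun y => f (y + P.a)) atTop l := fun f l => by
    conv_lhs => rw [← (OrderIso.addRight P.a).map_atTop, tendsto_map'_iff]
    rfl
  rw [hshift, tendsto_congr' key, ← e1]
  have hne : expI (-ρ) P.a ≠ 0 := left_ne_zero_of_mul (e1 ▸ one_ne_zero)
  exact tendsto_const_smul_iff₀ hne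

/-- The triangular system is solved with the Jost solution built from infinity, so the defining
condition can be satisfied. `TailPot.eq_zero_of_tendsto` shows that the chosen coefficients are
these. -/
theorem Setting.jostCoeff_eq (h : Setting P q Qp Qm) {ρ : ℂ} {r Y y : ℝ} (him : 0 < ρ.im)
    (hV : FarPot (vpot P Qp) r Y) (hρ : r ≤ ‖ρ‖) (hy : Y < y) :
    P.A 0 0 * jostCoeff P q ρ 0 = expI ρ P.a * jB P Qp 0 ρ y ∧
    P.A 1 0 * jostCoeff P q ρ 0 + P.A 1 1 * jostCoeff P q ρ 1 = expI ρ P.a * jB P Qp 1 ρ y := by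
  have hQ := h.split.right
  have a0 := h.A00_ne
  have a1 := h.A11_ne
  set B : Fin 2 → ℂ := ![expI ρ P.a * jB P Qp 0 ρ y / P.A 0 0,
    (expI ρ P.a * jB P Qp 1 ρ y - P.A 1 0 * (expI ρ P.a * jB P Qp 0 ρ y / P.A 0 0)) / P.A 1 1]
    with hB
  have hB0 : P.A 0 0 * B 0 = expI ρ P.a * jB P Qp 0 ρ y := by
    simp only [hB, Matrix.cons_val_zero]
    field_simp
  have hB1 : P.A 1 0 * B 0 + P.A 1 1 * B 1 = expI ρ P.a * jB P Qp 1 ρ y := by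
    simp only [hB, Matrix.cons_val_zero, Matrix.cons_val_one]
    field_simp
    ring
  have hJ : IsJostCoeff P q ρ B := by
    rw [h.isJostCoeff_iff, hB0, hB1]
    have h1 := ((hV.tendsto_je hρ him.le).1).const_mul (expI ρ P.a)
    rw [mul_one] at h1
    refine h1.congr' ?_
    filter_upwards [eventually_gt_atTop Y, eventually_gt_atTop 0] with t ht ht0
    rw [(hQ.toHalfPot.je_eq_jB h.adm ρ ht0).1, hQ.jB_const h.adm hV hρ him.le 0 hy ht,
      hQ.jB_const h.adm hV hρ him.le 1 hy ht]
    ring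
  have hC : IsJostCoeff P q ρ (jostCoeff P q ρ) := Classical.epsilon_spec ⟨B, hJ⟩
  rw [h.isJostCoeff_iff] at hJ hC
  have h2 := hC.sub hJ
  rw [sub_self] at h2
  have h3 := hQ.eq_zero_of_tendsto h.adm him
    (d0 := P.A 0 0 * jostCoeff P q ρ 0 - P.A 0 0 * B 0)
    (d1 := P.A 1 0 * jostCoeff P q ρ 0 + P.A 1 1 * jostCoeff P q ρ 1 -
      (P.A 1 0 * B 0 + P.A 1 1 * B 1)) (h2.congr fun t => by ring)
  exact ⟨by rw [← hB0]; exact sub_eq_zero.1 h3.1, by rw [← hB1]; exact sub_eq_zero.1 h3.2⟩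

theorem Setting.differentiableAt_jostCoeff (h : Setting P q Qp Qm) {ρ : ℂ} (him : 0 < ρ.im)
    (j : Fin 2) : DifferentiableAt ℂ (fun ρ => jostCoeff P q ρ j) ρ := by
  have hQ := h.split.right
  have a0 := h.A00_ne
  have a1 := h.A11_ne
  have hρ : 0 < ‖ρ‖ := norm_pos_iff.2 fun h => by simp [h] at him
  obtain ⟨Y, hY, hV⟩ := hQ.exists_farPot_of_pos (r := ‖ρ‖ / 2) (by positivity)
  have hopen : IsOpen {z : ℂ | 0 < z.im ∧ ‖ρ‖ / 2 < ‖z‖} :=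
    (isOpen_lt continuous_const Complex.continuous_im).inter
      (isOpen_lt continuous_const continuous_norm)
  have hmem : {z : ℂ | 0 < z.im ∧ ‖ρ‖ / 2 < ‖z‖} ∈ 𝓝 ρ := hopen.mem_nhds ⟨him, by linarith⟩
  have hd := fun k => (hQ.differentiableOn_jB h.adm hV k (lt_add_one Y)).differentiableAt hmem
  have he := (differentiable_expI P.a).differentiableAt (x := ρ)
  have heq : ∀ᶠ z in 𝓝 ρ, jostCoeff P q z 0 = expI z P.a * jB P Qp 0 z (Y + 1) / P.A 0 0 ∧
      jostCoeff P q z 1 = (expI z P.a * jB P Qp 1 z (Y + 1) -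
        P.A 1 0 * (expI z P.a * jB P Qp 0 z (Y + 1) / P.A 0 0)) / P.A 1 1 := by
    filter_upwards [hmem] with z hz
    obtain ⟨e0, e1⟩ := h.jostCoeff_eq hz.1 hV hz.2.le (lt_add_one Y)
    have e2 : jostCoeff P q z 0 = expI z P.a * jB P Qp 0 z (Y + 1) / P.A 0 0 := by
      rw [← e0]
      field_simp
    refine ⟨e2, ?_⟩
    rw [← e2, ← e1]
    field_simp
    ring
  have d0 := (he.mul (hd 0)).div_const (P.A 0 0)
  fin_cases j
  · exact d0.congr_of_eventuallyEq (heq.mono fun z hz => hz.1)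
  · exact (((he.mul (hd 1)).sub (d0.const_mul (P.A 1 0))).div_const
      (P.A 1 1)).congr_of_eventuallyEq (heq.mono fun z hz => hz.2)

theorem Setting.differentiableAt_jost (h : Setting P q Qp Qm) {ρ : ℂ} (him : 0 < ρ.im) {x : ℝ}
    (hxa : x ≠ P.a) : DifferentiableAt ℂ (jov P q Qp Qm x) ρ ∧
      DifferentiableAt ℂ (jod P q Qp Qm x) ρ := by
  have hs := fun j => h.differentiable_sg j hxa
  have hc := h.differentiableAt_jostCoeff him
  have hsq : DifferentiableAt ℂ (fun z : ℂ => z ^ 2) ρ := by fun_prop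
  have c1 := fun j => DifferentiableAt.comp ρ ((hs j).1 (ρ ^ 2)) hsq
  have c2 := fun j => DifferentiableAt.comp ρ ((hs j).2 (ρ ^ 2)) hsq
  exact ⟨((hc 0).mul (c1 0)).add ((hc 1).mul (c1 1)),
    ((hc 0).mul (c2 0)).add ((hc 1).mul (c2 1))⟩

theorem Setting.differentiableAt_weylFun (h : Setting P q Qp Qm) {ρ : ℂ} (him : 0 < ρ.im)
    (hρ : charFun P q ρ ≠ 0) : DifferentiableAt ℂ (weylFun P q) ρ := by
  have h0 := h.a_pos.ne
  obtain ⟨d0, d1⟩ := h.differentiableAt_jost him h0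
  rw [(h.jost_eq le_rfl h0 ρ).2] at hρ
  rw [funext h.weylFun_eq]
  exact d1.div d0 hρ

end

section

/-! ### Solutions with given initial values away from the singular point -/

variable {P : Params} {Q : ℝ → ℂ}

theorem HSol.eq_green (hP : Admissible P) {lam : ℂ} {α β : ℝ → ℂ} (h : HSol P Q lam 0 α β)
    {a y : ℝ} (ha : 0 < a) (hy : 0 < y) (h0 : hval P lam α β a = 0) (h1 : hder P lam α β a = -1) :
    hval P lam α β y = -green P lam y a + ∫ t in a..y, green P lam y t * (Q t * hval P lam α β t) ∧
    hder P lam α β y =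
      -green' P lam y a + ∫ t in a..y, green' P lam y t * (Q t * hval P lam α β t) := by
  obtain ⟨cα, cβ⟩ := coeff_of_hval hP lam α β ha
  rw [h0, h1] at cα cβ
  have e0 := h.eqα a y ha hy
  have e1 := h.eqβ a y ha hy
  have i0 := h.int_bes hP le_rfl 0 ha hy
  have i1 := h.int_bes hP le_rfl 1 ha hy
  rw [integral_green_mul i0 i1, integral_green'_mul i0 i1]
  constructor
  · rw [hval, e0, e1, cα, cβ, green]
    ring
  · rw [hder, e0, e1, cα, cβ, green']
    ring

/-- The distance `a` corresponds to the origin, and the slope is `-1` because the distance decreases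
with `x`. The Volterra equation is solved from there towards the singular point, and the growth is
only `exp((a - y) Im ρ)`. Writing the same solution through solutions normalised at the singular
point would give `exp((a + y) Im ρ)`. -/
theorem HalfPot.exists_initial_bound (hP : Admissible P) (hQ : HalfPot P Q) {y a : ℝ}
    (hy : 0 < y) (hya : y ≤ a) : ∃ K R : ℝ, 0 < K ∧ 1 ≤ R ∧ ∀ (ρ : ℂ) (α β : ℝ → ℂ), R ≤ ‖ρ‖ →
      0 ≤ ρ.im → HSol P Q (ρ ^ 2) 0 α β → hval P (ρ ^ 2) α β a = 0 → hder P (ρ ^ 2) α β a = -1 →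
      ‖hval P (ρ ^ 2) α β y‖ ≤ K / ‖ρ‖ * Real.exp (ρ.im * (a - y)) ∧
      ‖hder P (ρ ^ 2) α β y + green' P (ρ ^ 2) y a‖ ≤ K / ‖ρ‖ * Real.exp (ρ.im * (a - y)) := by
  have ha : 0 < a := hy.trans_le hya
  set G := growthC P with hG
  have hG0 : 0 < G := growthC_pos P
  have hQi : IntegrableOn (fun t => ‖Q t‖) (Set.Ioc y a) :=
    ((intervalIntegrable_iff_integrableOn_Ioc_of_le hya).1
      (hQ.intervalIntegrable hy.le ha.le)).norm
  set T := ∫ t in Set.Ioc y a, ‖Q t‖ with hT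
  have hT0 : 0 ≤ T := integral_nonneg fun t => norm_nonneg _
  refine ⟨2 * G + 2 * G ^ 2 * T, max (max 1 y⁻¹) (2 * (G * T)), by positivity,
    (le_max_left _ _).trans (le_max_left _ _), fun ρ α β hρ him hs h0 h1 => ?_⟩
  have hρ1 : 1 ≤ ‖ρ‖ := ((le_max_left _ _).trans (le_max_left _ _)).trans hρ
  have hρ0 : 0 < ‖ρ‖ := by linarith
  have hρne : ρ ≠ 0 := norm_pos_iff.1 hρ0
  have hfar : ∀ s, y ≤ s → 1 ≤ ‖ρ‖ * s := fun s hs => by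
    have : y⁻¹ ≤ ‖ρ‖ := ((le_max_right _ _).trans (le_max_left _ _)).trans hρ
    calc (1 : ℝ) = y⁻¹ * y := by field_simp
      _ ≤ ‖ρ‖ * s := by gcongr
  have hρT : 2 * (G * T) ≤ ‖ρ‖ := (le_max_right _ _).trans hρ
  set lam := ρ ^ 2 with hlam
  set v := hval P lam α β with hv
  set p : ℝ → ℝ := fun s => Real.exp (ρ.im * (a - s)) with hp
  set κ : ℝ → ℝ → ℝ := fun s t => (Set.Ioc (max s y) a).indicator
    (fun t => G / ‖ρ‖ * Real.exp (ρ.im * (t - s)) * ‖Q t‖) t with hκ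
  set k : ℝ → ℝ → ℂ := fun s t => (Set.Ioc (max s y) a).indicator
    (fun t => -(green P lam s t * Q t)) t with hk
  have hg : ∀ s t, y ≤ s → y ≤ t → s ≤ t →
      ‖green P lam s t‖ ≤ G / ‖ρ‖ * Real.exp (ρ.im * (t - s)) ∧
      ‖green' P lam s t‖ ≤ G * Real.exp (ρ.im * (t - s)) := by
    intro s t hs ht hst
    obtain ⟨e1, e2⟩ := hP.green_far hρne him (hfar t ht) (hfar s hs)
    rw [abs_sub_comm, abs_of_nonneg (by linarith)] at e1 e2
    refine ⟨?_, e1⟩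
    rw [div_mul_eq_mul_div, le_div_iff₀ hρ0, mul_comm]
    exact e2
  have hpp : ∀ s t, Real.exp (ρ.im * (t - s)) * p t = p s := fun s t => by
    rw [hp]
    simp only
    rw [← Real.exp_add]
    congr 1
    ring
  have hκp : ∀ s, (fun t => κ s t * p t) =
      fun t => G / ‖ρ‖ * p s * (Set.Ioc (max s y) a).indicator (fun t => ‖Q t‖) t := by
    intro s
    funext t
    simp only [hκ]
    by_cases ht : t ∈ Set.Ioc (max s y) a
    · rw [Set.indicator_of_mem ht, Set.indicator_of_mem ht, ← hpp s t]
      ring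
    · rw [Set.indicator_of_notMem ht, Set.indicator_of_notMem ht]
      ring
  have hsub : ∀ s, Set.Ioc (max s y) a ⊆ Set.Ioc y a := fun s =>
    Set.Ioc_subset_Ioc_left (le_max_right _ _)
  have hC : Contracts κ (Set.Icc y a) p := by
    refine ⟨fun s _ => (Real.exp_pos _).le, fun s hs t ht => ?_, fun s hs => ?_, fun s hs => ?_⟩
    · exact Set.indicator_of_notMem (fun h => ht ⟨(hsub s h).1.le, h.2⟩) _
    · rw [hκp]
      exact ((hQi.mono_set (hsub s)).integrable_indicator measurableSet_Ioc).const_mul _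
    · rw [hκp, integral_const_mul, integral_indicator measurableSet_Ioc]
      have : ∫ t in Set.Ioc (max s y) a, ‖Q t‖ ≤ T :=
        setIntegral_mono_set hQi (ae_of_all _ fun t => norm_nonneg _)
          (ae_of_all _ (hsub s))
      have hps : 0 < p s := Real.exp_pos _
      calc G / ‖ρ‖ * p s * ∫ t in Set.Ioc (max s y) a, ‖Q t‖ ≤ G / ‖ρ‖ * p s * T := by gcongr
        _ = p s * (G * T) / ‖ρ‖ := by ring
        _ ≤ p s / 2 := by
          rw [div_le_div_iff₀ hρ0 two_pos]
          nlinarith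
  have hkκ : ∀ s ∈ Set.Icc y a, ∀ t, ‖k s t‖ ≤ κ s t := by
    intro s hs t
    simp only [hk, hκ]
    by_cases ht : t ∈ Set.Ioc (max s y) a
    · rw [Set.indicator_of_mem ht, Set.indicator_of_mem ht, norm_neg, norm_mul]
      have hst : s < t := (le_max_left _ _).trans_lt ht.1
      have hyt : y < t := (le_max_right _ _).trans_lt ht.1
      gcongr
      exact (hg s t hs.1 hyt.le hst.le).1
    · rw [Set.indicator_of_notMem ht, Set.indicator_of_notMem ht, norm_zero]
  have hcont : ContinuousOn v (Set.Icc y a) := fun s hs' =>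
    (hs.hasDerivAt hP le_rfl (hy.trans_le hs'.1)).continuousAt.continuousWithinAt
  -- `B` may depend on `ρ`: `Contracts.norm_le` only needs some finite bound and returns one without
  -- it.
  obtain ⟨B, hB⟩ := isCompact_Icc.exists_bound_of_continuousOn hcont
  have hp1 : ∀ s ∈ Set.Icc y a, 1 ≤ p s := fun s hs' =>
    Real.one_le_exp (mul_nonneg him (by linarith [hs'.2]))
  have hmain := hC.norm_le (f := fun s => -green P lam s a) (y := v) (F := G / ‖ρ‖) (C := B) hkκ
    (by positivity)
    (fun s hs' => by rw [norm_neg]; exact (hg s a hs'.1 hya hs'.2).1)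
    (fun s hs' => by
      have h2 := hB s hs'
      have h3 := (norm_nonneg _).trans h2
      nlinarith [hp1 s hs'])
    (fun s hs' => by
      rw [hv, (hs.eq_green hP ha (hy.trans_le hs'.1) h0 h1).1, ← hv, intervalIntegral.integral_symm,
        intervalIntegral.integral_of_le hs'.2, ← integral_indicator measurableSet_Ioc,
        ← integral_neg]
      congr 1
      refine integral_congr_ae (ae_of_all _ fun t => ?_)
      simp only [hk, max_eq_left hs'.1]
      by_cases ht : t ∈ Set.Ioc s a
      · rw [Set.indicator_of_mem ht, Set.indicator_of_mem ht]
        ring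
      · rw [Set.indicator_of_notMem ht, Set.indicator_of_notMem ht]
        ring)
  have hp0 : 0 < p y := Real.exp_pos _
  refine ⟨(hmain y ⟨le_rfl, hya⟩).trans ?_, ?_⟩
  · change _ ≤ (2 * G + 2 * G ^ 2 * T) / ‖ρ‖ * p y
    rw [← mul_div_assoc]
    gcongr
    have : 0 ≤ 2 * G ^ 2 * T := by positivity
    linarith
  · rw [(hs.eq_green hP ha hy h0 h1).2, neg_add_cancel_comm, intervalIntegral.integral_symm,
      norm_neg, intervalIntegral.integral_of_le hya]
    have hb : ∀ t ∈ Set.Ioc y a, ‖green' P lam y t * (Q t * v t)‖ ≤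
        2 * G ^ 2 / ‖ρ‖ * p y * ‖Q t‖ := by
      intro t ht
      rw [norm_mul, norm_mul]
      calc ‖green' P lam y t‖ * (‖Q t‖ * ‖v t‖) ≤
          (G * Real.exp (ρ.im * (t - y))) * (‖Q t‖ * (2 * (G / ‖ρ‖) * p t)) := by
            gcongr
            · exact (hg y t le_rfl ht.1.le ht.1.le).2
            · exact hmain t ⟨ht.1.le, ht.2⟩
        _ = 2 * G ^ 2 / ‖ρ‖ * (Real.exp (ρ.im * (t - y)) * p t) * ‖Q t‖ := by ring
        _ = _ := by rw [hpp]
    calc _ ≤ ∫ t in Set.Ioc y a, 2 * G ^ 2 / ‖ρ‖ * p y * ‖Q t‖ :=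
          norm_integral_le_of_norm_le (hQi.const_mul _)
            ((ae_restrict_iff' measurableSet_Ioc).2 (ae_of_all _ hb))
      _ = 2 * G ^ 2 * T / ‖ρ‖ * p y := by rw [integral_const_mul, ← hT]; ring
      _ ≤ _ := by
        gcongr
        linarith

end

section

/-! ### Growth classes in the upper half-plane -/

/-- The filter of neighbourhoods of infinity in the closed upper half-plane. -/
def uhp : Filter ℂ := inftyIn {ρ | 0 ≤ ρ.im}

/-- The weight `|ρ|^s exp(t Im ρ)`. -/
def pw (s t : ℝ) (ρ : ℂ) : ℝ := ‖ρ‖ ^ s * Real.exp (ρ.im * t)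

theorem pw_nonneg (s t : ℝ) (ρ : ℂ) : 0 ≤ pw s t ρ := by unfold pw; positivity

theorem pw_mul (s t s' t' : ℝ) {ρ : ℂ} (hρ : ρ ≠ 0) :
    pw s t ρ * pw s' t' ρ = pw (s + s') (t + t') ρ := by
  unfold pw
  rw [Real.rpow_add (norm_pos_iff.2 hρ), mul_add, Real.exp_add]
  ring

theorem pw_zero_zero : pw 0 0 = fun _ => 1 := by
  funext ρ
  simp [pw]

theorem isBigO_inftyIn {A : Set ℂ} {f : ℂ → ℂ} {s t K R : ℝ}
    (h : ∀ ρ ∈ A, R ≤ ‖ρ‖ → ‖f ρ‖ ≤ K * pw s t ρ) : f =O[inftyIn A] pw s t := by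
  refine IsBigO.of_bound K (eventually_inftyIn.2 ⟨R, fun ρ hρ hR => ?_⟩)
  rw [Real.norm_of_nonneg (pw_nonneg s t ρ)]
  exact h ρ hρ hR

section algebra

variable {l : Filter ℂ} {f g f₂ g₂ : ℂ → ℂ} {s t s' t' s'' t'' : ℝ}

theorem eventually_ne_zero_of_le (hl : l ≤ uhp) : ∀ᶠ ρ : ℂ in l, ρ ≠ 0 ∧ 1 ≤ ‖ρ‖ ∧ 0 ≤ ρ.im := by
  have h1 := hl (norm_mem_inftyIn {ρ : ℂ | 0 ≤ ρ.im} 1)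
  have h2 := hl (mem_inftyIn {ρ : ℂ | 0 ≤ ρ.im})
  filter_upwards [h1, h2] with ρ h h'
  exact ⟨norm_pos_iff.1 (by linarith), h, h'⟩

theorem isBigO_mul_pw (hl : l ≤ uhp) (hf : f =O[l] pw s t) (hg : g =O[l] pw s' t')
    (hs : s + s' = s'') (ht : t + t' = t'') : (fun ρ => f ρ * g ρ) =O[l] pw s'' t'' := by
  subst hs ht
  refine (hf.mul hg).congr' EventuallyEq.rfl ?_
  filter_upwards [eventually_ne_zero_of_le hl] with ρ hρ
  exact pw_mul s t s' t' hρ.1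

theorem isBigO_pw_of_le (hl : l ≤ uhp) (hs : s ≤ s') (ht : t ≤ t') (hf : f =O[l] pw s t) :
    f =O[l] pw s' t' := by
  refine hf.trans (IsBigO.of_bound 1 ?_)
  filter_upwards [eventually_ne_zero_of_le hl] with ρ hρ
  rw [Real.norm_of_nonneg (pw_nonneg s t ρ), Real.norm_of_nonneg (pw_nonneg s' t' ρ), one_mul]
  unfold pw
  have := hρ.2.2
  gcongr
  exact hρ.2.1

/-- From `fg - f₂g₂ = f(g - g₂) + (f - f₂)g₂`, a relative gain of `d` powers in both factors passes
to the product. -/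
theorem isBigO_mul_sub_pw (hl : l ≤ uhp) (hf : f =O[l] pw s t)
    (hg₂ : g₂ =O[l] pw s' t')
    {d : ℝ} (hfd : (fun ρ => f ρ - f₂ ρ) =O[l] pw (s - d) t)
    (hgd : (fun ρ => g ρ - g₂ ρ) =O[l] pw (s' - d) t') (hs : s + s' - d = s'')
    (ht : t + t' = t'') : (fun ρ => f ρ * g ρ - f₂ ρ * g₂ ρ) =O[l] pw s'' t'' := by
  have h1 := isBigO_mul_pw (s'' := s'') (t'' := t'') hl hf hgd (by linarith) ht
  have h2 := isBigO_mul_pw (s'' := s'') (t'' := t'') hl hfd hg₂ (by linarith) ht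
  refine (h1.add h2).congr_left fun ρ => ?_
  ring

theorem tendsto_zero_of_isBigO_pw (hl : l ≤ uhp) (hs : s < 0) (hf : f =O[l] pw s 0) :
    Tendsto f l (𝓝 0) := by
  refine hf.trans_tendsto ?_
  have h1 : Tendsto (fun ρ : ℂ => ‖ρ‖ ^ s) (Bornology.cobounded ℂ) (𝓝 0) := by
    have := (tendsto_rpow_neg_atTop (neg_pos.2 hs)).comp (tendsto_norm_cobounded_atTop (E := ℂ))
    simpa [Function.comp_def] using this
  refine (h1.mono_left (hl.trans inf_le_left)).congr fun ρ => ?_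
  simp [pw]

end algebra

theorem isBigO_expI (t : ℝ) (l : Filter ℂ) : (fun ρ => expI ρ t) =O[l] pw 0 (-t) := by
  refine IsBigO.of_bound 1 (Eventually.of_forall fun ρ => ?_)
  rw [norm_expI, Real.norm_of_nonneg (pw_nonneg _ _ _), pw, Real.rpow_zero]
  simp

theorem isBigO_id_pw {l : Filter ℂ} : (fun ρ : ℂ => ρ) =O[l] pw 1 0 := by
  refine IsBigO.of_bound 1 (Eventually.of_forall fun ρ => ?_)
  rw [Real.norm_of_nonneg (pw_nonneg _ _ _), pw]
  simp

theorem isBigO_const_pw {l : Filter ℂ} (c : ℂ) : (fun _ : ℂ => c) =O[l] pw 0 0 := by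
  rw [pw_zero_zero]
  exact isBigO_const_const c one_ne_zero l

/-! ### Bounds for the solutions near infinity -/

variable {P : Params} {q Qp Qm q₂ Qp₂ Qm₂ Q Q₂ : ℝ → ℂ}

theorem HalfPot.isBigO_hsol (hP : Admissible P) (hQ : HalfPot P Q) (j : Fin 2) {y : ℝ}
    (hy : 0 < y) : (fun ρ => hsol P Q j (ρ ^ 2) y) =O[uhp] pw (-(expo P j).re) y ∧
      (fun ρ => hsol' P Q j (ρ ^ 2) y) =O[uhp] pw (1 - (expo P j).re) y := by
  obtain ⟨K, R, hK, hR, hb⟩ := hQ.exists_hsol_bound hP hy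
  exact ⟨isBigO_inftyIn (K := K) (R := R) fun ρ h1 h2 => by
      rw [pw, ← mul_assoc]; exact (hb j ρ h2 h1).1,
    isBigO_inftyIn (K := K) (R := R) fun ρ h1 h2 => by
      rw [pw, ← mul_assoc]; exact (hb j ρ h2 h1).2⟩

theorem HalfPot.isBigO_hsol_sub_bes (hP : Admissible P) (hQ : HalfPot P Q) (j : Fin 2) {y : ℝ}
    (hy : 0 < y) :
    (fun ρ => hsol P Q j (ρ ^ 2) y - bes P j (ρ ^ 2) y) =O[uhp] pw (-(expo P j).re - 1) y ∧
      (fun ρ => hsol' P Q j (ρ ^ 2) y - bes' P j (ρ ^ 2) y) =O[uhp]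
        pw (1 - (expo P j).re - 1) y := by
  obtain ⟨K, R, hK, hR, hb⟩ := hQ.exists_large_bound hP hy
  refine ⟨isBigO_inftyIn (K := K) (R := R) fun ρ h1 h2 => ?_,
    isBigO_inftyIn (K := K) (R := R) fun ρ h1 h2 => ?_⟩
  · have h0 : 0 < ‖ρ‖ := by linarith
    refine ((hb j ρ h2 h1).1).trans_eq ?_
    rw [pw, Real.rpow_sub_one h0.ne']
    ring
  · refine ((hb j ρ h2 h1).2).trans_eq ?_
    rw [pw, ← mul_assoc]
    congr 3
    ring

theorem expo_re_zero_le (hP : Admissible P) : (expo P 0).re ≤ (expo P 1).re := by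
  have := hP.nu_re
  rw [re_expo_zero, re_expo_one]
  linarith

/-- As the transition matrix is triangular, the first of two growth rates dominates. -/
theorem Setting.isBigO_column (h : Setting P q Qp Qm) (j : Fin 2) {s : Fin 2 → ℝ} {t : ℝ}
    (hs : s 1 ≤ s 0) {F : Fin 2 → ℂ → ℂ} (hF : ∀ k, F k =O[uhp] pw (s k) t) :
    (fun ρ => P.A 0 j * F 0 ρ + P.A 1 j * F 1 ρ) =O[uhp] pw (s j) t := by
  fin_cases j
  · exact ((hF 0).const_mul_left _).add
      (isBigO_pw_of_le le_rfl hs le_rfl ((hF 1).const_mul_left _))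
  · refine ((hF 1).const_mul_left (P.A 1 1)).congr_left fun ρ => ?_
    have := h.A01
    simp [this]

theorem Setting.isBigO_sg (h : Setting P q Qp Qm) (j : Fin 2) {x : ℝ} (hxa : x ≠ P.a) :
    (fun ρ => sg P Qp Qm j (ρ ^ 2) x) =O[uhp] pw (-(expo P j).re) |x - P.a| ∧
    (fun ρ => sg' P Qp Qm j (ρ ^ 2) x) =O[uhp] pw (1 - (expo P j).re) |x - P.a| := by
  have hr := h.split.right.toHalfPot
  have hP := h.adm
  unfold sg sg'
  rcases lt_or_gt_of_ne hxa with hlt | hgt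
  · have hy : 0 < P.a - x := by linarith
    simp only [if_pos hlt]
    rw [abs_of_neg (by linarith), neg_sub]
    obtain ⟨b1, b2⟩ := h.split.left.isBigO_hsol hP j hy
    exact ⟨b1.const_mul_left _, (b2.const_mul_left _).neg_left⟩
  · have hy : 0 < x - P.a := by linarith
    simp only [if_neg hgt.not_gt]
    rw [abs_of_pos hy]
    have b := fun k => hr.isBigO_hsol hP k hy
    have e := expo_re_zero_le hP
    exact ⟨h.isBigO_column j (s := fun k => -(expo P k).re) (by linarith) fun k => (b k).1,
      h.isBigO_column j (s := fun k => 1 - (expo P k).re) (by linarith) fun k => (b k).2⟩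

theorem HalfPot.isBigO_hsol_sub (hP : Admissible P) (hQ : HalfPot P Q) (hQ₂ : HalfPot P Q₂)
    (j : Fin 2) {y : ℝ} (hy : 0 < y) :
    (fun ρ => hsol P Q j (ρ ^ 2) y - hsol P Q₂ j (ρ ^ 2) y) =O[uhp] pw (-(expo P j).re - 1) y ∧
      (fun ρ => hsol' P Q j (ρ ^ 2) y - hsol' P Q₂ j (ρ ^ 2) y) =O[uhp]
        pw (1 - (expo P j).re - 1) y := by
  obtain ⟨a1, a2⟩ := hQ.isBigO_hsol_sub_bes hP j hy
  obtain ⟨b1, b2⟩ := hQ₂.isBigO_hsol_sub_bes hP j hy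
  exact ⟨(a1.sub b1).congr_left fun ρ => by ring, (a2.sub b2).congr_left fun ρ => by ring⟩

theorem Setting.isBigO_sg_sub (h : Setting P q Qp Qm) (h₂ : Setting P q₂ Qp₂ Qm₂) (j : Fin 2)
    {x : ℝ} (hxa : x ≠ P.a) :
    (fun ρ => sg P Qp Qm j (ρ ^ 2) x - sg P Qp₂ Qm₂ j (ρ ^ 2) x) =O[uhp]
      pw (-(expo P j).re - 1) |x - P.a| ∧
    (fun ρ => sg' P Qp Qm j (ρ ^ 2) x - sg' P Qp₂ Qm₂ j (ρ ^ 2) x) =O[uhp]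
      pw (1 - (expo P j).re - 1) |x - P.a| := by
  have hr := h.split.right.toHalfPot
  have hP := h.adm
  unfold sg sg'
  rcases lt_or_gt_of_ne hxa with hlt | hgt
  · have hy : 0 < P.a - x := by linarith
    simp only [if_pos hlt]
    rw [abs_of_neg (by linarith), neg_sub]
    obtain ⟨b1, b2⟩ := h.split.left.isBigO_hsol_sub hP h₂.split.left j hy
    exact ⟨(b1.const_mul_left (turn P j)).congr_left fun ρ => by ring,
      (b2.const_mul_left (-turn P j)).congr_left fun ρ => by ring⟩
  · have hy : 0 < x - P.a := by linarith
    simp only [if_neg hgt.not_gt]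
    rw [abs_of_pos hy]
    have b := fun k => hr.isBigO_hsol_sub hP h₂.split.right.toHalfPot k hy
    have e := expo_re_zero_le hP
    exact ⟨(h.isBigO_column j (s := fun k => -(expo P k).re - 1) (by linarith)
        fun k => (b k).1).congr_left fun ρ => by ring,
      (h.isBigO_column j (s := fun k => 1 - (expo P k).re - 1) (by linarith)
        fun k => (b k).2).congr_left fun ρ => by ring⟩

theorem re_expo_add (P : Params) : (expo P 0).re + (expo P 1).re = 1 := by
  rw [re_expo_zero, re_expo_one]
  ring

/-- Rough bounds in the closed upper half-plane. -/
theorem Setting.isBigO_values (h : Setting P q Qp Qm) {x : ℝ} (hxa : x ≠ P.a) :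
    (fun ρ => phv P Qp Qm x (ρ ^ 2)) =O[uhp] pw (-1) (P.a + |x - P.a|) ∧
    (fun ρ => phd P Qp Qm x (ρ ^ 2)) =O[uhp] pw 0 (P.a + |x - P.a|) ∧
    (fun ρ => cov P Qp Qm x (ρ ^ 2)) =O[uhp] pw 0 (P.a + |x - P.a|) ∧
    (fun ρ => cod P Qp Qm x (ρ ^ 2)) =O[uhp] pw 1 (P.a + |x - P.a|) := by
  have h0 : |0 - P.a| = P.a := by rw [zero_sub, abs_neg, abs_of_pos h.a_pos]
  have a := fun j => h.isBigO_sg j h.a_pos.ne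
  rw [h0] at a
  have b := fun j => h.isBigO_sg j hxa
  have e := re_expo_add P
  exact ⟨(isBigO_mul_pw le_rfl (a 0).1 (b 1).1 (by linarith) rfl).sub
      (isBigO_mul_pw le_rfl (a 1).1 (b 0).1 (by linarith) rfl),
    (isBigO_mul_pw le_rfl (a 0).1 (b 1).2 (by linarith) rfl).sub
      (isBigO_mul_pw le_rfl (a 1).1 (b 0).2 (by linarith) rfl),
    (isBigO_mul_pw le_rfl (a 1).2 (b 0).1 (by linarith) rfl).sub
      (isBigO_mul_pw le_rfl (a 0).2 (b 1).1 (by linarith) rfl),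
    (isBigO_mul_pw le_rfl (a 1).2 (b 0).2 (by linarith) rfl).sub
      (isBigO_mul_pw le_rfl (a 0).2 (b 1).2 (by linarith) rfl)⟩

/-- Bounds for `φ` of the exact exponential type. -/
theorem Setting.isBigO_phi_right (h : Setting P q Qp Qm) (h₂ : Setting P q₂ Qp₂ Qm₂) {x : ℝ}
    (hxa : P.a < x) :
    (fun ρ => phv P Qp Qm x (ρ ^ 2)) =O[uhp] pw (-1) x ∧
    (fun ρ => phd P Qp Qm x (ρ ^ 2)) =O[uhp] pw 0 x ∧
    (fun ρ => phd P Qp Qm x (ρ ^ 2) - phd P Qp₂ Qm₂ x (ρ ^ 2)) =O[uhp] pw (-1) x := by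
  have h0 : |0 - P.a| = P.a := by rw [zero_sub, abs_neg, abs_of_pos h.a_pos]
  have h1 : P.a + |x - P.a| = x := by rw [abs_of_pos (by linarith)]; ring
  obtain ⟨v1, v2, -, -⟩ := h.isBigO_values hxa.ne'
  rw [h1] at v1 v2
  refine ⟨v1, v2, ?_⟩
  have a := fun j => h.isBigO_sg j h.a_pos.ne
  have b₂ := fun j => h₂.isBigO_sg j hxa.ne'
  have c := fun j => h.isBigO_sg_sub h₂ j h.a_pos.ne
  have d := fun j => h.isBigO_sg_sub h₂ j hxa.ne'
  rw [h0] at a c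
  have e := re_expo_add P
  have r1 := isBigO_mul_sub_pw (s'' := -1) (t'' := x) le_rfl (a 0).1 (b₂ 1).2 (c 0).1 (d 1).2
    (by linarith) h1
  have r2 := isBigO_mul_sub_pw (s'' := -1) (t'' := x) le_rfl (a 1).1 (b₂ 0).2 (c 1).1 (d 0).2
    (by linarith) h1
  refine (r1.sub r2).congr_left fun ρ => ?_
  unfold phd
  ring

end

section

variable {P : Params} {q Qp Qm q₂ Qp₂ Qm₂ Q Q₂ : ℝ → ℂ}

/-! ### The solution `φ` to the left of the singular point -/

theorem Setting.initial_values (h : Setting P q Qp Qm) (lam : ℂ) :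
    phv P Qp Qm 0 lam = 0 ∧ phd P Qp Qm 0 lam = 1 := by
  have := h.initial_wronskian lam
  unfold phv phd
  exact ⟨by ring, by linear_combination this⟩

theorem Setting.exists_phi_left_bound (h : Setting P q Qp Qm) {x : ℝ} (hx : 0 ≤ x)
    (hxa : x < P.a) :
    (fun ρ => phv P Qp Qm x (ρ ^ 2)) =O[uhp] pw (-1) x ∧
    (fun ρ => phd P Qp Qm x (ρ ^ 2) - green' P (ρ ^ 2) (P.a - x) P.a) =O[uhp] pw (-1) x := by
  have hP := h.adm
  have hQ := h.split.left
  have ha := h.a_pos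
  have hy : 0 < P.a - x := by linarith
  obtain ⟨K, R, hK, hR, hb⟩ := hQ.exists_initial_bound hP hy (a := P.a) (by linarith)
  have key : ∀ ρ : ℂ, R ≤ ‖ρ‖ → 0 ≤ ρ.im →
      ‖phv P Qp Qm x (ρ ^ 2)‖ ≤ K / ‖ρ‖ * Real.exp (ρ.im * (P.a - (P.a - x))) ∧
      ‖-phd P Qp Qm x (ρ ^ 2) + green' P (ρ ^ 2) (P.a - x) P.a‖ ≤
        K / ‖ρ‖ * Real.exp (ρ.im * (P.a - (P.a - x))) := by
    intro ρ hρ him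
    set c0 := -(sg P Qp Qm 1 (ρ ^ 2) 0 * turn P 0) with hc0
    set c1 := sg P Qp Qm 0 (ρ ^ 2) 0 * turn P 1 with hc1
    have hs := (hQ.hSol hP 0 (ρ ^ 2)).linear hP le_rfl (hQ.hSol hP 1 (ρ ^ 2)) c0 c1
    have e1 : ∀ t, 0 < t → t ≤ P.a → hval P (ρ ^ 2)
        (fun y => c0 * hal P Qm 0 (ρ ^ 2) y + c1 * hal P Qm 1 (ρ ^ 2) y)
        (fun y => c0 * hbe P Qm 0 (ρ ^ 2) y + c1 * hbe P Qm 1 (ρ ^ 2) y) t =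
        phv P Qp Qm (P.a - t) (ρ ^ 2) := by
      intro t ht hta
      have h0 := hQ.hsol_eq_hval hP 0 (ρ ^ 2) ht
      have h1 := hQ.hsol_eq_hval hP 1 (ρ ^ 2) ht
      have h2 : ∀ j, sg P Qp Qm j (ρ ^ 2) (P.a - t) = turn P j * hsol P Qm j (ρ ^ 2) t :=
        fun j => by rw [sg, if_pos (by linarith), sub_sub_cancel]
      rw [phv, h2, h2, h0, h1, hc0, hc1]
      unfold hval
      ring
    have e2 : ∀ t, 0 < t → t ≤ P.a → hder P (ρ ^ 2)
        (fun y => c0 * hal P Qm 0 (ρ ^ 2) y + c1 * hal P Qm 1 (ρ ^ 2) y)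
        (fun y => c0 * hbe P Qm 0 (ρ ^ 2) y + c1 * hbe P Qm 1 (ρ ^ 2) y) t =
        -phd P Qp Qm (P.a - t) (ρ ^ 2) := by
      intro t ht hta
      have h2 : ∀ j, sg' P Qp Qm j (ρ ^ 2) (P.a - t) = -(turn P j * hsol' P Qm j (ρ ^ 2) t) :=
        fun j => by rw [sg', if_pos (by linarith), sub_sub_cancel]
      rw [phd, h2, h2, hc0, hc1]
      unfold hsol' hder
      ring
    obtain ⟨i1, i2⟩ := h.initial_values (ρ ^ 2)
    have := hb ρ _ _ hρ him hs (by rw [e1 P.a ha le_rfl, sub_self, i1])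
      (by rw [e2 P.a ha le_rfl, sub_self, i2])
    rw [e1 _ hy (by linarith), e2 _ hy (by linarith)] at this
    simpa only [sub_sub_cancel] using this
  have hform : ∀ ρ : ℂ, K / ‖ρ‖ * Real.exp (ρ.im * (P.a - (P.a - x))) = K * pw (-1) x ρ := by
    intro ρ
    rw [pw, Real.rpow_neg_one, sub_sub_cancel]
    ring
  refine ⟨isBigO_inftyIn (K := K) (R := R) fun ρ h1 h2 => ?_,
    isBigO_inftyIn (K := K) (R := R) fun ρ h1 h2 => ?_⟩
  · rw [← hform]
    exact (key ρ h2 h1).1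
  · rw [← hform, ← norm_neg, neg_sub, sub_eq_neg_add]
    exact (key ρ h2 h1).2

/-- To the right of `a` the products `σ_j(0)σ_k(x)` have type `a + (x - a) = x` already. To the left
they would give `2a - x`, so the estimate from the initial values at the origin is used, with the
model derivative common to both potentials. -/
theorem Setting.isBigO_phi (h : Setting P q Qp Qm) (h₂ : Setting P q₂ Qp₂ Qm₂) {x : ℝ}
    (hx : 0 ≤ x) (hxa : x ≠ P.a) :
    (fun ρ => phv P Qp Qm x (ρ ^ 2)) =O[uhp] pw (-1) x ∧
    (fun ρ => phd P Qp Qm x (ρ ^ 2)) =O[uhp] pw 0 x ∧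
    (fun ρ => phd P Qp Qm x (ρ ^ 2) - phd P Qp₂ Qm₂ x (ρ ^ 2)) =O[uhp] pw (-1) x := by
  rcases lt_or_gt_of_ne hxa with hlt | hgt
  · obtain ⟨a1, a2⟩ := h.exists_phi_left_bound hx hlt
    obtain ⟨b1, b2⟩ := h₂.exists_phi_left_bound hx hlt
    have hy : 0 < P.a - x := by linarith
    have hg : (fun ρ => green' P (ρ ^ 2) (P.a - x) P.a) =O[uhp] pw 0 x := by
      refine isBigO_inftyIn (K := growthC P) (R := max 1 (P.a - x)⁻¹) fun ρ h1 h2 => ?_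
      have h3 : 1 ≤ ‖ρ‖ := (le_max_left _ _).trans h2
      have h4 : 1 ≤ ‖ρ‖ * (P.a - x) := by
        have : (P.a - x)⁻¹ ≤ ‖ρ‖ := (le_max_right _ _).trans h2
        calc (1 : ℝ) = (P.a - x)⁻¹ * (P.a - x) := by field_simp
          _ ≤ _ := by gcongr
      have h5 : 1 ≤ ‖ρ‖ * P.a := h4.trans (by gcongr; linarith)
      have := (h.adm.green_far (norm_pos_iff.1 (by linarith)) h1 h5 h4).1
      rw [sub_sub_cancel_left, abs_neg, abs_of_nonneg hx] at this
      simpa [pw] using this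
    refine ⟨a1, ?_, (a2.sub b2).congr_left fun ρ => by ring⟩
    refine ((isBigO_pw_of_le le_rfl (by norm_num) le_rfl a2).add hg).congr_left fun ρ => by ring
  · exact h.isBigO_phi_right h₂ hgt

/-! ### The Jost solution near infinity -/

theorem isBigO_mcoef (hP : Admissible P) (j : Fin 2) : mcoef P j =O[uhp] pw (expo P j).re 0 := by
  obtain ⟨β, K, -, -, hb⟩ := exists_mcoef_bound hP
  refine isBigO_inftyIn (K := K) (R := 1) fun ρ h1 h2 => ?_
  have := (hb ρ h1 (norm_pos_iff.1 (by linarith))).2 j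
  simpa [pw] using this

theorem TailPot.isBigO_jB_sub (hP : Admissible P) (hQ : TailPot P Q) (j : Fin 2) {y : ℝ}
    (hy : 0 < y) :
    (fun ρ => jB P Q j ρ y - mcoef P j ρ) =O[uhp] pw ((expo P j).re - 1) 0 := by
  obtain ⟨K, R, -, hR, hb⟩ := hQ.exists_jB_sub_bound hP hy
  refine isBigO_inftyIn (K := K) (R := R) fun ρ h1 h2 => ?_
  refine (hb j ρ h2 h1).trans_eq ?_
  rw [pw, Real.rpow_sub_one (by linarith), mul_zero, Real.exp_zero]
  ring

/-- The relative accuracy of the model solutions to the left of the singular point. -/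
def gap (P : Params) : ℝ := min 1 (2 * P.ν.re)

theorem gap_pos (hP : Admissible P) : 0 < gap P :=
  lt_min one_pos (by linarith [hP.nu_re])

/-- The coefficients of the model of the Jost solution to the left of the singular point. -/
def lcoef (P : Params) (j : Fin 2) (ρ : ℂ) : ℂ := mcoef P j ρ * turn P j / P.A j j

/-- The model of the Jost solution to the left of the singular point. -/
def lmv (P : Params) (s : ℝ) (ρ : ℂ) : ℂ :=
  lcoef P 0 ρ * bes P 0 (ρ ^ 2) s + lcoef P 1 ρ * bes P 1 (ρ ^ 2) s

/-- The derivative of `lmv`. -/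
def lmd (P : Params) (s : ℝ) (ρ : ℂ) : ℂ :=
  lcoef P 0 ρ * bes' P 0 (ρ ^ 2) s + lcoef P 1 ρ * bes' P 1 (ρ ^ 2) s

theorem isBigO_lcoef (hP : Admissible P) (j : Fin 2) : lcoef P j =O[uhp] pw (expo P j).re 0 :=
  ((isBigO_mcoef hP j).const_mul_left (turn P j / P.A j j)).congr_left fun ρ => by
    rw [lcoef]
    ring

theorem isBigO_bes (hP : Admissible P) (j : Fin 2) {y : ℝ} (hy : 0 < y) :
    (fun ρ => bes P j (ρ ^ 2) y) =O[uhp] pw (-(expo P j).re) y ∧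
      (fun ρ => bes' P j (ρ ^ 2) y) =O[uhp] pw (1 - (expo P j).re) y := by
  obtain ⟨a1, a2⟩ := (tailPot_zero P).toHalfPot.isBigO_hsol hP j hy
  obtain ⟨b1, b2⟩ := (tailPot_zero P).toHalfPot.isBigO_hsol_sub_bes hP j hy
  exact ⟨(a1.sub (isBigO_pw_of_le le_rfl (by linarith) le_rfl b1)).congr_left fun ρ => by ring,
    (a2.sub (isBigO_pw_of_le le_rfl (by linarith) le_rfl b2)).congr_left fun ρ => by ring⟩

theorem isBigO_lm (hP : Admissible P) {s : ℝ} (hs : 0 < s) :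
    lmv P s =O[uhp] pw 0 s ∧ lmd P s =O[uhp] pw 1 s :=
  have b := fun j => isBigO_bes hP j hs
  have c := fun j => isBigO_lcoef hP j
  ⟨(isBigO_mul_pw le_rfl (c 0) (b 0).1 (by ring) (by ring)).add
      (isBigO_mul_pw le_rfl (c 1) (b 1).1 (by ring) (by ring)),
    (isBigO_mul_pw le_rfl (c 0) (b 0).2 (by ring) (by ring)).add
      (isBigO_mul_pw le_rfl (c 1) (b 1).2 (by ring) (by ring))⟩

/-- The neighbourhoods of infinity in `Im ρ ≥ H`. -/
def ext (H : ℝ) : Filter ℂ := inftyIn {ρ | H ≤ ρ.im}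

theorem ext_le_uhp {H : ℝ} (hH : 0 < H) : ext H ≤ uhp :=
  inftyIn_mono fun _ hρ => hH.le.trans hρ

theorem Setting.jost_formulas (h : Setting P q Qp Qm) {H : ℝ} (hH : 0 < H) {y : ℝ} (hy : 0 < y) :
    ∀ᶠ ρ in ext H, P.A 0 0 * jostCoeff P q ρ 0 = expI ρ P.a * jB P Qp 0 ρ y ∧
      P.A 1 0 * jostCoeff P q ρ 0 + P.A 1 1 * jostCoeff P q ρ 1 =
        expI ρ P.a * jB P Qp 1 ρ y := by
  obtain ⟨R, hR, hV⟩ := h.split.right.exists_farPot (Y := y / 2) (by linarith)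
  exact eventually_inftyIn.2 ⟨R, fun ρ hρ hn =>
    h.jostCoeff_eq (lt_of_lt_of_le hH hρ) (hV R le_rfl) hn (by linarith)⟩

theorem Setting.isBigO_jost_right (h : Setting P q Qp Qm) {H : ℝ} (hH : 0 < H) {x : ℝ}
    (hxa : P.a < x) :
    (fun ρ => jov P q Qp Qm x ρ - expI ρ x) =O[ext H] pw (-1) (-x) ∧
    (fun ρ => jod P q Qp Qm x ρ - Complex.I * ρ * expI ρ x) =O[ext H] pw 0 (-x) := by
  have hy : 0 < x - P.a := by linarith
  have hP := h.adm
  have hQ := h.split.right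
  have hE := isBigO_expI P.a (ext H)
  have hl := ext_le_uhp hH
  obtain ⟨K, R, hK, hR, hb⟩ := hQ.exists_je_bound hy
  have b1 : (fun ρ => je (vpot P Qp) ρ (x - P.a) - expI ρ (x - P.a)) =O[uhp]
      pw (-1) (-(x - P.a)) := by
    refine isBigO_inftyIn (K := K) (R := R) fun ρ h1 h2 => ((hb ρ h2 h1).1).trans_eq ?_
    rw [pw, Real.rpow_neg_one, mul_neg]
    ring
  have b2 : (fun ρ => je' (vpot P Qp) ρ (x - P.a) - Complex.I * ρ * expI ρ (x - P.a)) =O[uhp]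
      pw 0 (-(x - P.a)) := by
    refine isBigO_inftyIn (K := K) (R := R) fun ρ h1 h2 => ((hb ρ h2 h1).2).trans_eq ?_
    rw [pw, Real.rpow_zero, mul_neg]
    ring
  have e : ∀ ρ, expI ρ x = expI ρ P.a * expI ρ (x - P.a) := fun ρ => by
    rw [← expI_time_add]
    congr 1
    ring
  have hf := h.jost_formulas hH hy
  constructor
  · refine (isBigO_mul_pw (s'' := -1) (t'' := -x) hl hE (b1.mono hl) (by ring)
      (by ring)).congr' ?_ EventuallyEq.rfl
    filter_upwards [hf] with ρ hρ
    rw [jov, sg, sg, if_neg hxa.not_gt, if_neg hxa.not_gt, h.A01, e,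
      (hQ.toHalfPot.je_eq_jB hP ρ hy).1]
    linear_combination (-hsol P Qp 0 (ρ ^ 2) (x - P.a)) * hρ.1 -
      hsol P Qp 1 (ρ ^ 2) (x - P.a) * hρ.2
  · refine (isBigO_mul_pw (s'' := 0) (t'' := -x) hl hE (b2.mono hl) (by ring)
      (by ring)).congr' ?_ EventuallyEq.rfl
    filter_upwards [hf] with ρ hρ
    rw [jod, sg', sg', if_neg hxa.not_gt, if_neg hxa.not_gt, h.A01, e,
      (hQ.toHalfPot.je_eq_jB hP ρ hy).2]
    linear_combination (-hsol' P Qp 0 (ρ ^ 2) (x - P.a)) * hρ.1 -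
      hsol' P Qp 1 (ρ ^ 2) (x - P.a) * hρ.2

/-- Solving the triangular system, the second coefficient contains a multiple of `jB P Qp 0`,
smaller than its leading term by `|ρ|^{-2 Re ν}`. All other errors have relative order `1/|ρ|`, and
the worse of the two is `gap`. The type is right because `-a + (a - x) = -x`. -/
theorem Setting.isBigO_jost_left (h : Setting P q Qp Qm) {H : ℝ} (hH : 0 < H) {x : ℝ}
    (hxa : x < P.a) :
    (fun ρ => jov P q Qp Qm x ρ - expI ρ P.a * lmv P (P.a - x) ρ) =O[ext H] pw (-gap P) (-x) ∧
    (fun ρ => jod P q Qp Qm x ρ + expI ρ P.a * lmd P (P.a - x) ρ) =O[ext H]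
      pw (1 - gap P) (-x) := by
  have hy : 0 < P.a - x := by linarith
  have hP := h.adm
  have hQ := h.split.left
  have hE := isBigO_expI P.a (ext H)
  have hl := ext_le_uhp hH
  have a0 := h.A00_ne
  have a1 := h.A11_ne
  have g1 : gap P ≤ 1 := min_le_left _ _
  have g2 : (expo P 0).re ≤ (expo P 1).re - gap P := by
    have : gap P ≤ 2 * P.ν.re := min_le_right _ _
    rw [re_expo_zero, re_expo_one]
    linarith
  -- For large `|ρ|` the formulas for the coefficients hold with `jB` taken at any fixed point; 1 is
  -- an arbitrary choice.
  have ePos := one_pos (α := ℝ)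
  have hB := fun j => h.split.right.isBigO_jB_sub hP j ePos
  have hm := fun j => isBigO_mcoef hP j
  have hc := fun j => isBigO_lcoef hP j
  have hJ : ∀ j, (fun ρ => jB P Qp j ρ 1) =O[uhp] pw (expo P j).re 0 := fun j =>
    ((isBigO_pw_of_le le_rfl (by linarith) le_rfl (hB j)).add (hm j)).congr_left fun ρ => by ring
  set k0 : ℂ → ℂ := fun ρ => turn P 0 / P.A 0 0 * jB P Qp 0 ρ 1 with hk0
  set k1 : ℂ → ℂ := fun ρ => turn P 1 / P.A 1 1 * (jB P Qp 1 ρ 1 -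
    P.A 1 0 / P.A 0 0 * jB P Qp 0 ρ 1) with hk1
  have hk0b : k0 =O[uhp] pw (expo P 0).re 0 := (hJ 0).const_mul_left _
  have hJ0 : (fun ρ => P.A 1 0 / P.A 0 0 * jB P Qp 0 ρ 1) =O[uhp] pw ((expo P 1).re - gap P) 0 :=
    isBigO_pw_of_le le_rfl g2 le_rfl ((hJ 0).const_mul_left _)
  have g0 := gap_pos hP
  have hk1b : k1 =O[uhp] pw (expo P 1).re 0 :=
    ((hJ 1).sub (isBigO_pw_of_le le_rfl (by linarith) le_rfl hJ0)).const_mul_left _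
  have d0 : (fun ρ => k0 ρ - lcoef P 0 ρ) =O[uhp] pw ((expo P 0).re - gap P) 0 := by
    refine (isBigO_pw_of_le le_rfl (by linarith) le_rfl
      ((hB 0).const_mul_left (turn P 0 / P.A 0 0))).congr_left fun ρ => ?_
    simp only [hk0, lcoef]
    ring
  have d1 : (fun ρ => k1 ρ - lcoef P 1 ρ) =O[uhp] pw ((expo P 1).re - gap P) 0 := by
    refine (((isBigO_pw_of_le le_rfl (by linarith) le_rfl (hB 1)).sub hJ0).const_mul_left
      (turn P 1 / P.A 1 1)).congr_left fun ρ => ?_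
    simp only [hk1, lcoef]
    ring
  have hb := fun j => isBigO_bes hP j hy
  have hs : ∀ j, (fun ρ => hsol P Qm j (ρ ^ 2) (P.a - x) - bes P j (ρ ^ 2) (P.a - x)) =O[uhp]
        pw (-(expo P j).re - gap P) (P.a - x) ∧
      (fun ρ => hsol' P Qm j (ρ ^ 2) (P.a - x) - bes' P j (ρ ^ 2) (P.a - x)) =O[uhp]
        pw (1 - (expo P j).re - gap P) (P.a - x) := fun j =>
    have := hQ.isBigO_hsol_sub_bes hP j hy
    ⟨isBigO_pw_of_le le_rfl (by linarith) le_rfl this.1,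
      isBigO_pw_of_le le_rfl (by linarith) le_rfl this.2⟩
  have v := (isBigO_mul_sub_pw (s'' := -gap P) (t'' := P.a - x) le_rfl hk0b (hb 0).1 d0 (hs 0).1
    (by ring) (by ring)).add (isBigO_mul_sub_pw (s'' := -gap P) (t'' := P.a - x) le_rfl hk1b
      (hb 1).1 d1 (hs 1).1 (by ring) (by ring))
  have w := (isBigO_mul_sub_pw (s'' := 1 - gap P) (t'' := P.a - x) le_rfl hk0b (hb 0).2 d0 (hs 0).2
    (by ring) (by ring)).add (isBigO_mul_sub_pw (s'' := 1 - gap P) (t'' := P.a - x) le_rfl hk1b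
      (hb 1).2 d1 (hs 1).2 (by ring) (by ring))
  have hcoef : ∀ᶠ ρ in ext H, jostCoeff P q ρ 0 * turn P 0 = expI ρ P.a * k0 ρ ∧
      jostCoeff P q ρ 1 * turn P 1 = expI ρ P.a * k1 ρ := by
    filter_upwards [h.jost_formulas hH ePos] with ρ hρ
    have c0 : jostCoeff P q ρ 0 = expI ρ P.a * jB P Qp 0 ρ 1 / P.A 0 0 := by
      rw [← hρ.1]
      field_simp
    have c1 : jostCoeff P q ρ 1 = (expI ρ P.a * jB P Qp 1 ρ 1 -
        P.A 1 0 * jostCoeff P q ρ 0) / P.A 1 1 := by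
      rw [← hρ.2]
      field_simp
      ring
    rw [c1, c0]
    simp only [hk0, hk1]
    constructor <;> ring
  constructor
  · refine (isBigO_mul_pw (s'' := -gap P) (t'' := -x) hl hE (v.mono hl) (by ring)
      (by ring)).congr' ?_ EventuallyEq.rfl
    filter_upwards [hcoef] with ρ hρ
    rw [jov, sg, sg, if_pos hxa, if_pos hxa, lmv]
    linear_combination (-hsol P Qm 0 (ρ ^ 2) (P.a - x)) * hρ.1 -
      hsol P Qm 1 (ρ ^ 2) (P.a - x) * hρ.2
  · refine (isBigO_mul_pw (s'' := 1 - gap P) (t'' := -x) hl hE.neg_left (w.mono hl) (by ring)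
      (by ring)).congr' ?_ EventuallyEq.rfl
    filter_upwards [hcoef] with ρ hρ
    rw [jod, sg', sg', if_pos hxa, if_pos hxa, lmd]
    linear_combination (hsol' P Qm 0 (ρ ^ 2) (P.a - x)) * hρ.1 +
      hsol' P Qm 1 (ρ ^ 2) (P.a - x) * hρ.2

theorem Setting.isBigO_jost (h : Setting P q Qp Qm) (h₂ : Setting P q₂ Qp₂ Qm₂) {H : ℝ}
    (hH : 0 < H) {x : ℝ} (hxa : x ≠ P.a) :
    jov P q Qp Qm x =O[ext H] pw 0 (-x) ∧ jod P q Qp Qm x =O[ext H] pw 1 (-x) ∧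
    (fun ρ => jov P q Qp Qm x ρ - jov P q₂ Qp₂ Qm₂ x ρ) =O[ext H] pw (-gap P) (-x) ∧
    (fun ρ => jod P q Qp Qm x ρ - jod P q₂ Qp₂ Qm₂ x ρ) =O[ext H] pw (1 - gap P) (-x) := by
  have hl := ext_le_uhp hH
  have g0 := gap_pos h.adm
  have g1 : gap P ≤ 1 := min_le_left _ _
  rcases lt_or_gt_of_ne hxa with hlt | hgt
  · have hy : 0 < P.a - x := by linarith
    obtain ⟨a1, a2⟩ := h.isBigO_jost_left hH hlt
    obtain ⟨b1, b2⟩ := h₂.isBigO_jost_left hH hlt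
    obtain ⟨m1, m2⟩ := isBigO_lm h.adm hy
    have hE := isBigO_expI P.a (ext H)
    have c1 := isBigO_mul_pw (s'' := 0) (t'' := -x) hl hE (m1.mono hl) (by ring) (by ring)
    have c2 := isBigO_mul_pw (s'' := 1) (t'' := -x) hl hE (m2.mono hl) (by ring) (by ring)
    exact ⟨((isBigO_pw_of_le hl (by linarith) le_rfl a1).add c1).congr_left fun ρ => by ring,
      ((isBigO_pw_of_le hl (by linarith) le_rfl a2).sub c2).congr_left fun ρ => by ring,
      (a1.sub b1).congr_left fun ρ => by ring, (a2.sub b2).congr_left fun ρ => by ring⟩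
  · obtain ⟨a1, a2⟩ := h.isBigO_jost_right hH hgt
    obtain ⟨b1, b2⟩ := h₂.isBigO_jost_right hH hgt
    have hE := isBigO_expI x (ext H)
    have hE2 := (isBigO_mul_pw (s'' := 1) (t'' := -x) hl isBigO_id_pw hE (by ring)
      (by ring)).const_mul_left Complex.I
    exact ⟨((isBigO_pw_of_le hl (by linarith) le_rfl a1).add hE).congr_left fun ρ => by ring,
      ((isBigO_pw_of_le hl (by linarith) le_rfl a2).add hE2).congr_left fun ρ => by ring,
      isBigO_pw_of_le hl (by linarith) le_rfl ((a1.sub b1).congr_left fun ρ => by ring),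
      isBigO_pw_of_le hl (by linarith) le_rfl ((a2.sub b2).congr_left fun ρ => by ring)⟩

end

section

variable {P : Params} {q Qp Qm q₂ Qp₂ Qm₂ Q Q₂ : ℝ → ℂ}

/-! ### The characteristic function is bounded away from zero -/

theorem turn_eq (P : Params) : turn P 0 = Complex.I * Complex.exp (-(Real.pi * Complex.I * P.ν)) ∧
    turn P 1 = Complex.I * Complex.exp (Real.pi * Complex.I * P.ν) := by
  have e : Complex.I = Complex.exp (Real.pi / 2 * Complex.I) := Complex.exp_pi_div_two_mul_I.symm
  constructor
  · conv_rhs => rw [e]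
    rw [← Complex.exp_add, turn, expo_zero, ← e]
    congr 1
    ring
  · conv_rhs => rw [e]
    rw [← Complex.exp_add, turn, expo_one, ← e]
    congr 1
    ring

/-- Multiplied by `a₁₁a₂₂`, the quantity becomes `i(a₁₁ exp(πiν) - a₂₂ exp(-πiν))`, the negative of
the bracket in the off-diagonal entry of `[ξ_{jk}]`. -/
theorem Setting.kappa_ne_zero (h : Setting P q Qp Qm) (hxi : xi P 0 1 ≠ 0) :
    turn P 1 / P.A 1 1 - turn P 0 / P.A 0 0 ≠ 0 := by
  have a0 := h.A00_ne
  have a1 := h.A11_ne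
  intro h0
  apply hxi
  obtain ⟨e0, e1⟩ := turn_eq P
  have h1 : P.A 0 0 * turn P 1 - P.A 1 1 * turn P 0 = 0 := by
    field_simp at h0
    linear_combination h0
  rw [e0, e1] at h1
  have h2 : -Complex.I * (P.A 0 0 * Complex.exp (Real.pi * Complex.I * P.ν) -
      P.A 1 1 * Complex.exp (-(Real.pi * Complex.I * P.ν))) = 0 := by
    linear_combination -h1
  simp [xi, h2]

/-- By `exists_combination_asymptotics`, the model of `Δ` is governed by its Wronskian `βκρ` with
the model Jost solution, up to `O(exp(-a Im ρ) + 1/|ρ|)`. The first error is small only for large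
`Im ρ`, hence the height `H₀`. With each error at most `c/4` the model is at least `c/4` in modulus,
and the remainder `O(|ρ|^{-gap})` costs at most another `c/8`. -/
theorem Setting.exists_charFun_bound (h : Setting P q Qp Qm) (hxi : xi P 0 1 ≠ 0) :
    ∃ H₀ : ℝ, 0 < H₀ ∧ ∀ H, H₀ ≤ H → (∀ᶠ ρ in ext H, jov P q Qp Qm 0 ρ ≠ 0) ∧
      (fun ρ => (jov P q Qp Qm 0 ρ)⁻¹) =O[ext H] pw 0 0 := by
  have hP := h.adm
  have ha := h.a_pos
  obtain ⟨β, K₀, hβ, hK₀, hmc⟩ := exists_mcoef_bound hP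
  set κ := turn P 1 / P.A 1 1 - turn P 0 / P.A 0 0 with hκ
  have hκ0 : κ ≠ 0 := h.kappa_ne_zero hxi
  obtain ⟨K, R, hK, hR, hcomb⟩ := exists_combination_asymptotics hP ha
  set B := K₀ * (‖turn P 0 / P.A 0 0‖ + ‖turn P 1 / P.A 1 1‖) with hB
  have hB0 : 0 ≤ B := by positivity
  set c := ‖β * κ‖ with hc
  have hc0 : 0 < c := norm_pos_iff.2 (mul_ne_zero hβ hκ0)
  -- the lower bound for the model
  have hmodel : ∀ ρ : ℂ, 0 ≤ ρ.im → R ≤ ‖ρ‖ →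
      c ≤ 2 * ‖expI ρ P.a * lmv P P.a ρ‖ + K * B * (Real.exp (-(ρ.im * P.a)) + 1 / ‖ρ‖) := by
    intro ρ him hρ
    have hρ0 : 0 < ‖ρ‖ := by linarith
    have hne := norm_pos_iff.1 hρ0
    obtain ⟨hm1, hm2⟩ := hmc ρ him hne
    have hl : ∀ j, ‖lcoef P j ρ‖ ≤ B * ‖ρ‖ ^ (expo P j).re := by
      intro j
      have e : lcoef P j ρ = mcoef P j ρ * (turn P j / P.A j j) := by rw [lcoef]; ring
      have hj : ‖turn P j / P.A j j‖ ≤ ‖turn P 0 / P.A 0 0‖ + ‖turn P 1 / P.A 1 1‖ := by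
        fin_cases j
        · exact le_add_of_nonneg_right (norm_nonneg _)
        · exact le_add_of_nonneg_left (norm_nonneg _)
      rw [e, norm_mul]
      calc _ ≤ (K₀ * ‖ρ‖ ^ (expo P j).re) *
            (‖turn P 0 / P.A 0 0‖ + ‖turn P 1 / P.A 1 1‖) := by
              gcongr
              exact hm2 j
        _ = _ := by rw [hB]; ring
    have h1 := hcomb ρ _ _ B him hρ hB0 (hl 0) (hl 1)
    have e1 : expI (-ρ) P.a * expI ρ P.a = 1 := expI_neg_mul ρ P.a
    have e2 : β * κ * ρ + 2 * Complex.I * ρ * (expI ρ P.a * lmv P P.a ρ) =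
        expI ρ P.a * (2 * Complex.I * ρ * (lcoef P 0 ρ * bes P 0 (ρ ^ 2) P.a +
          lcoef P 1 ρ * bes P 1 (ρ ^ 2) P.a) + expI (-ρ) P.a *
          (mcoef P 0 ρ * lcoef P 1 ρ - mcoef P 1 ρ * lcoef P 0 ρ)) := by
      have e3 : mcoef P 0 ρ * lcoef P 1 ρ - mcoef P 1 ρ * lcoef P 0 ρ = β * κ * ρ := by
        rw [lcoef, lcoef, hκ]
        linear_combination (turn P 1 / P.A 1 1 - turn P 0 / P.A 0 0) * hm1
      rw [e3, lmv]
      linear_combination (-(β * κ * ρ)) * e1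
    have h2 : ‖β * κ * ρ + 2 * Complex.I * ρ * (expI ρ P.a * lmv P P.a ρ)‖ ≤
        Real.exp (-(ρ.im * P.a)) * (K * B * (‖ρ‖ + Real.exp (ρ.im * P.a))) := by
      rw [e2, norm_mul, norm_expI]
      gcongr
    have h3 : Real.exp (-(ρ.im * P.a)) * Real.exp (ρ.im * P.a) = 1 := by
      rw [← Real.exp_add, neg_add_cancel, Real.exp_zero]
    have h4 : ‖β * κ * ρ‖ ≤ ‖β * κ * ρ + 2 * Complex.I * ρ * (expI ρ P.a * lmv P P.a ρ)‖ +
        ‖2 * Complex.I * ρ * (expI ρ P.a * lmv P P.a ρ)‖ := by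
      have := norm_sub_le (β * κ * ρ + 2 * Complex.I * ρ * (expI ρ P.a * lmv P P.a ρ))
        (2 * Complex.I * ρ * (expI ρ P.a * lmv P P.a ρ))
      rwa [add_sub_cancel_right] at this
    have h5 : ‖2 * Complex.I * ρ * (expI ρ P.a * lmv P P.a ρ)‖ =
        2 * ‖expI ρ P.a * lmv P P.a ρ‖ * ‖ρ‖ := by
      rw [norm_mul, norm_mul, norm_mul, Complex.norm_I, Complex.norm_ofNat]
      ring
    rw [norm_mul, ← hc] at h4
    refine le_of_mul_le_mul_right ?_ hρ0
    have h6 : (2 * ‖expI ρ P.a * lmv P P.a ρ‖ + K * B * (Real.exp (-(ρ.im * P.a)) + 1 / ‖ρ‖)) *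
        ‖ρ‖ = 2 * ‖expI ρ P.a * lmv P P.a ρ‖ * ‖ρ‖ +
          Real.exp (-(ρ.im * P.a)) * (K * B * (‖ρ‖ + Real.exp (ρ.im * P.a))) := by
      have : 1 / ‖ρ‖ * ‖ρ‖ = 1 := by field_simp
      linear_combination (K * B) * this - K * B * h3
    rw [h6]
    linarith
  -- the height
  have hlim : Tendsto (fun H : ℝ => K * B * Real.exp (-(H * P.a))) atTop (𝓝 0) := by
    have : Tendsto (fun H : ℝ => H * P.a) atTop atTop := tendsto_id.atTop_mul_const ha
    simpa using (Real.tendsto_exp_neg_atTop_nhds_zero.comp this).const_mul (K * B)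
  obtain ⟨H₀, hH₀, hH₀'⟩ := ((hlim.eventually (ge_mem_nhds (show 0 < c / 4 by linarith))).and
    (eventually_gt_atTop 0)).exists
  refine ⟨H₀, hH₀', fun H hH => ?_⟩
  have hHpos : 0 < H := hH₀'.trans_le hH
  have hd := (h.isBigO_jost_left hHpos ha).1
  rw [neg_zero, sub_zero] at hd
  have hd0 := tendsto_zero_of_isBigO_pw (ext_le_uhp hHpos) (neg_lt_zero.2 (gap_pos hP)) hd
  have e1 : ∀ᶠ ρ in ext H, ‖jov P q Qp Qm 0 ρ - expI ρ P.a * lmv P P.a ρ‖ < c / 8 := by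
    have := hd0.norm.eventually (gt_mem_nhds (show ‖(0 : ℂ)‖ < c / 8 by
      rw [norm_zero]; linarith))
    exact this
  have hlow : ∀ᶠ ρ in ext H, c / 8 ≤ ‖jov P q Qp Qm 0 ρ‖ := by
    filter_upwards [e1, norm_mem_inftyIn {ρ : ℂ | H ≤ ρ.im} (max R (4 * (K * B) / c)),
      mem_inftyIn {ρ : ℂ | H ≤ ρ.im}] with ρ h1 h2 h3
    have h3' : H ≤ ρ.im := h3
    have him : 0 ≤ ρ.im := hHpos.le.trans h3'
    have hR' : R ≤ ‖ρ‖ := (le_max_left _ _).trans h2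
    have hρ0 : 0 < ‖ρ‖ := by linarith
    have h4 := hmodel ρ him hR'
    have h5 : K * B * Real.exp (-(ρ.im * P.a)) ≤ c / 4 := by
      refine le_trans ?_ hH₀
      gcongr
      exact hH.trans h3'
    have h6 : K * B * (1 / ‖ρ‖) ≤ c / 4 := by
      have : 4 * (K * B) / c ≤ ‖ρ‖ := (le_max_right _ _).trans h2
      rw [div_le_iff₀ hc0] at this
      rw [mul_one_div, div_le_iff₀ hρ0]
      linarith
    have h7 : ‖expI ρ P.a * lmv P P.a ρ‖ ≤ ‖jov P q Qp Qm 0 ρ‖ +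
        ‖jov P q Qp Qm 0 ρ - expI ρ P.a * lmv P P.a ρ‖ := by
      have := norm_sub_le (jov P q Qp Qm 0 ρ)
        (jov P q Qp Qm 0 ρ - expI ρ P.a * lmv P P.a ρ)
      rwa [sub_sub_cancel] at this
    rw [mul_add] at h4
    linarith
  refine ⟨hlow.mono fun ρ h8 h0 => ?_, IsBigO.of_bound (8 / c) (hlow.mono fun ρ h8 => ?_)⟩
  · rw [h0, norm_zero] at h8
    linarith
  · rw [norm_inv, pw_zero_zero, norm_one, mul_one]
    calc ‖jov P q Qp Qm 0 ρ‖⁻¹ ≤ (c / 8)⁻¹ := inv_anti₀ (by linarith) h8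
      _ = 8 / c := by rw [inv_div]

/-- The values and derivatives of the Weyl solution. -/
def wev (P : Params) (q Qp Qm : ℝ → ℂ) (x : ℝ) (ρ : ℂ) : ℂ :=
  jov P q Qp Qm x ρ / jov P q Qp Qm 0 ρ

/-- The derivative of `wev` in `x`. -/
def wed (P : Params) (q Qp Qm : ℝ → ℂ) (x : ℝ) (ρ : ℂ) : ℂ :=
  jod P q Qp Qm x ρ / jov P q Qp Qm 0 ρ

theorem Setting.isBigO_weyl (h : Setting P q Qp Qm) (h₂ : Setting P q₂ Qp₂ Qm₂)
    (hxi : xi P 0 1 ≠ 0) : ∃ H₀ : ℝ, 0 < H₀ ∧ ∀ H, H₀ ≤ H →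
      (∀ᶠ ρ in ext H, jov P q Qp Qm 0 ρ ≠ 0) ∧ ∀ x : ℝ, x ≠ P.a →
      wev P q Qp Qm x =O[ext H] pw 0 (-x) ∧ wed P q Qp Qm x =O[ext H] pw 1 (-x) ∧
      (fun ρ => wed P q Qp Qm x ρ - wed P q₂ Qp₂ Qm₂ x ρ) =O[ext H] pw (1 - gap P) (-x) := by
  obtain ⟨H₁, hH₁, hb₁⟩ := h.exists_charFun_bound hxi
  obtain ⟨H₂, hH₂, hb₂⟩ := h₂.exists_charFun_bound hxi
  refine ⟨max H₁ H₂, lt_max_of_lt_left hH₁, fun H hH =>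
    ⟨(hb₁ H ((le_max_left _ _).trans hH)).1, fun x hxa => ?_⟩⟩
  have hHpos : 0 < H := hH₁.trans_le ((le_max_left _ _).trans hH)
  have hl := ext_le_uhp hHpos
  obtain ⟨n₁, i₁⟩ := hb₁ H ((le_max_left _ _).trans hH)
  obtain ⟨n₂, i₂⟩ := hb₂ H ((le_max_right _ _).trans hH)
  obtain ⟨j1, j2, j3, j4⟩ := h.isBigO_jost h₂ hHpos hxa
  obtain ⟨k1, k2, -, -⟩ := h₂.isBigO_jost h hHpos hxa
  obtain ⟨-, -, m3, -⟩ := h.isBigO_jost h₂ hHpos h.a_pos.ne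
  rw [neg_zero] at m3
  have hd : (fun ρ => (jov P q Qp Qm 0 ρ)⁻¹ - (jov P q₂ Qp₂ Qm₂ 0 ρ)⁻¹) =O[ext H]
      pw (0 - gap P) 0 := by
    have h1 := isBigO_mul_pw (s'' := 0) (t'' := 0) hl i₁ i₂ (by ring) (by ring)
    have h2 := isBigO_mul_pw (s'' := 0 - gap P) (t'' := 0) hl h1 m3.neg_left (by ring) (by ring)
    refine h2.congr' ?_ EventuallyEq.rfl
    filter_upwards [n₁, n₂] with ρ h₁ h₂
    field_simp
    ring
  refine ⟨?_, ?_, ?_⟩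
  · exact isBigO_mul_pw hl j1 i₁ (by ring) (by ring)
  · exact isBigO_mul_pw hl j2 i₁ (by ring) (by ring)
  · exact isBigO_mul_sub_pw hl j2 i₂ j4 hd (by ring) (by ring)

/-- The mixed Wronskian-like combinations of `φ` and `Φ` for two potentials. -/
theorem Setting.exists_mixed_bounds (h : Setting P q Qp Qm) (h₂ : Setting P q₂ Qp₂ Qm₂)
    (hxi : xi P 0 1 ≠ 0) {x : ℝ} (hx : 0 ≤ x) (hxa : x ≠ P.a) :
    ∃ H₀ : ℝ, 0 < H₀ ∧ ∀ H, H₀ ≤ H →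
      Tendsto (fun ρ => phd P Qp₂ Qm₂ x (ρ ^ 2) * wev P q Qp Qm x ρ -
        wed P q₂ Qp₂ Qm₂ x ρ * phv P Qp Qm x (ρ ^ 2)) (ext H) (𝓝 (eta P x)) ∧
      Tendsto (fun ρ => phv P Qp₂ Qm₂ x (ρ ^ 2) * wev P q Qp Qm x ρ -
        wev P q₂ Qp₂ Qm₂ x ρ * phv P Qp Qm x (ρ ^ 2)) (ext H) (𝓝 0) ∧
      (fun ρ => phd P Qp₂ Qm₂ x (ρ ^ 2) * wed P q Qp Qm x ρ -
        wed P q₂ Qp₂ Qm₂ x ρ * phd P Qp Qm x (ρ ^ 2)) =O[ext H] pw 1 0 ∧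
      (fun ρ => phv P Qp₂ Qm₂ x (ρ ^ 2) * wed P q Qp Qm x ρ -
        wev P q₂ Qp₂ Qm₂ x ρ * phd P Qp Qm x (ρ ^ 2)) =O[ext H] pw 1 0 := by
  obtain ⟨H₁, hH₁, hb₁⟩ := h.isBigO_weyl h₂ hxi
  obtain ⟨H₂, hH₂, hb₂⟩ := h₂.isBigO_weyl h hxi
  refine ⟨max H₁ H₂, lt_max_of_lt_left hH₁, fun H hH => ?_⟩
  have hHpos : 0 < H := hH₁.trans_le ((le_max_left _ _).trans hH)
  have hl := ext_le_uhp hHpos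
  obtain ⟨hn, hb⟩ := hb₁ H ((le_max_left _ _).trans hH)
  obtain ⟨w0, w1, wd⟩ := hb x hxa
  obtain ⟨v0, v1, -⟩ := (hb₂ H ((le_max_right _ _).trans hH)).2 x hxa
  obtain ⟨p0, p1, pd⟩ := h.isBigO_phi h₂ hx hxa
  obtain ⟨r0, r1, -⟩ := h₂.isBigO_phi h hx hxa
  have g0 := gap_pos h.adm
  have g1 : gap P ≤ 1 := min_le_left _ _
  refine ⟨?_, ?_, ?_, ?_⟩
  -- The expression equals `φ'Φ - Φ'φ = η` up to `(φ' - φ̃')Φ` and `(Φ' - Φ̃')φ`. In both products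
  -- the types `x` and `-x` cancel and a negative power remains.
  · have a1 := isBigO_mul_pw (s'' := -1) (t'' := 0) hl (pd.mono hl) w0 (by ring) (by ring)
    have a2 := isBigO_mul_pw (s'' := -gap P) (t'' := 0) hl wd (p0.mono hl) (by ring) (by ring)
    have a3 := (isBigO_pw_of_le (s' := -gap P) hl (by linarith) le_rfl a1).sub a2
    have a4 := (tendsto_zero_of_isBigO_pw hl (neg_lt_zero.2 g0) a3).const_sub (eta P x)
    rw [sub_zero] at a4
    refine a4.congr' ?_
    filter_upwards [hn] with ρ hρ
    have e := h.phi_cos_wronskian hxa (ρ ^ 2)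
    obtain ⟨j1, j2⟩ := h.jost_eq_add x ρ
    have e1 : wev P q Qp Qm x ρ = cov P Qp Qm x (ρ ^ 2) +
        jod P q Qp Qm 0 ρ / jov P q Qp Qm 0 ρ * phv P Qp Qm x (ρ ^ 2) := by
      rw [wev, j1]
      field_simp
    have e2 : wed P q Qp Qm x ρ = cod P Qp Qm x (ρ ^ 2) +
        jod P q Qp Qm 0 ρ / jov P q Qp Qm 0 ρ * phd P Qp Qm x (ρ ^ 2) := by
      rw [wed, j2]
      field_simp
    have e3 : phd P Qp Qm x (ρ ^ 2) * wev P q Qp Qm x ρ -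
        wed P q Qp Qm x ρ * phv P Qp Qm x (ρ ^ 2) = eta P x := by
      rw [e1, e2]
      linear_combination e
    linear_combination -e3
  · have a1 := isBigO_mul_pw (s'' := -1) (t'' := 0) hl (r0.mono hl) w0 (by ring) (by ring)
    have a2 := isBigO_mul_pw (s'' := -1) (t'' := 0) hl v0 (p0.mono hl) (by ring) (by ring)
    exact tendsto_zero_of_isBigO_pw hl (by norm_num) (a1.sub a2)
  · exact (isBigO_mul_pw hl (r1.mono hl) w1 (by ring) (by ring)).sub
      (isBigO_mul_pw hl v1 (p1.mono hl) (by ring) (by ring))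
  · have a1 := isBigO_mul_pw (s'' := 0) (t'' := 0) hl (r0.mono hl) w1 (by ring) (by ring)
    have a2 := isBigO_mul_pw (s'' := 0) (t'' := 0) hl v0 (p1.mono hl) (by ring) (by ring)
    exact isBigO_pw_of_le hl zero_le_one le_rfl (a1.sub a2)

/-- The neighbourhoods of infinity in the strip `0 ≤ Im ρ ≤ H`. -/
def strip (H : ℝ) : Filter ℂ := inftyIn {ρ | 0 ≤ ρ.im ∧ ρ.im ≤ H}

theorem strip_le_uhp (H : ℝ) : strip H ≤ uhp := inftyIn_mono fun _ hρ => hρ.1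

/-- Exponential weights are bounded in a strip, so there the rough bounds of non-optimal type are as
good as the exact ones. -/
theorem isBigO_strip {f : ℂ → ℂ} {s t : ℝ} (ht : 0 ≤ t) (hf : f =O[uhp] pw s t) (H : ℝ) :
    f =O[strip H] pw s 0 := by
  refine (hf.mono (strip_le_uhp H)).trans (IsBigO.of_bound (Real.exp (H * t)) ?_)
  filter_upwards [mem_inftyIn {ρ : ℂ | 0 ≤ ρ.im ∧ ρ.im ≤ H}] with ρ hρ
  rw [Real.norm_of_nonneg (pw_nonneg _ _ _), Real.norm_of_nonneg (pw_nonneg _ _ _), pw, pw,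
    mul_zero, Real.exp_zero, mul_one, mul_comm]
  have := hρ.2
  gcongr

end

section

/-! ### The contour argument -/

theorem isBigO_inv_sq_sub {l : Filter ℂ} (hl : l ≤ uhp) (m : ℂ) :
    (fun z => (z ^ 2 - m)⁻¹) =O[l] pw (-2) 0 := by
  refine IsBigO.of_bound 2 ?_
  filter_upwards [hl (norm_mem_inftyIn {ρ : ℂ | 0 ≤ ρ.im} (1 + 2 * ‖m‖))] with z hz
  have h1 : 1 ≤ ‖z‖ := by linarith [norm_nonneg m]
  have h0 : 0 < ‖z‖ := by linarith
  have h2 : ‖z‖ ^ 2 ≤ ‖z ^ 2 - m‖ + ‖m‖ := by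
    rw [← norm_pow]
    exact norm_le_norm_sub_add _ _
  have h3 : ‖z‖ ^ 2 / 2 ≤ ‖z ^ 2 - m‖ := by nlinarith [norm_nonneg m]
  rw [norm_inv, Real.norm_of_nonneg (pw_nonneg _ _ _), pw, mul_zero, Real.exp_zero, mul_one,
    Real.rpow_neg h0.le, Real.rpow_two]
  calc ‖z ^ 2 - m‖⁻¹ ≤ (‖z‖ ^ 2 / 2)⁻¹ := inv_anti₀ (by positivity) h3
    _ = 2 * (‖z‖ ^ 2)⁻¹ := by rw [inv_div]; ring

theorem eventually_sq_ne {l : Filter ℂ} (hl : l ≤ uhp) (m : ℂ) : ∀ᶠ z in l, z ^ 2 ≠ m := by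
  filter_upwards [hl (norm_mem_inftyIn {ρ : ℂ | 0 ≤ ρ.im} (1 + ‖m‖))] with z hz h
  have h1 : ‖z‖ ^ 2 = ‖m‖ := by rw [← norm_pow, h]
  nlinarith [norm_nonneg m]

theorem isBigO_cker {l : Filter ℂ} (hl : l ≤ uhp) (m : ℂ) : cker m =O[l] pw (-1) 0 := by
  refine ((isBigO_mul_pw (s'' := -1) (t'' := 0) hl isBigO_id_pw (isBigO_inv_sq_sub hl m)
    (by ring) (by ring)).const_mul_left (-2)).congr_left fun z => ?_
  rw [cker, ← neg_sub (z ^ 2) m, div_neg, div_eq_mul_inv]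
  ring

theorem dslope_eq_div {g : ℂ → ℂ} {m w : ℂ} (h : w ≠ m) :
    dslope g m w = (g w - g m) / (w - m) := by
  rw [dslope_of_ne _ h, slope_def_field]

/-- The divided difference gains `|z|^{-2}`. The condition `0 ≤ s` absorbs the constant `g m`. -/
theorem isBigO_dslope {l : Filter ℂ} (hl : l ≤ uhp) (m : ℂ) {g : ℂ → ℂ} {s : ℝ} (hs : 0 ≤ s)
    (hg : (fun z => g (z ^ 2)) =O[l] pw s 0) :
    (fun z => dslope g m (z ^ 2)) =O[l] pw (s - 2) 0 := by
  have h1 := hg.sub (isBigO_pw_of_le hl hs le_rfl (isBigO_const_pw (g m)))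
  refine (isBigO_mul_pw (s'' := s - 2) (t'' := 0) hl h1 (isBigO_inv_sq_sub hl m) (by ring)
    (by ring)).congr' ?_ EventuallyEq.rfl
  filter_upwards [eventually_sq_ne hl m] with z hz
  rw [dslope_eq_div hz, div_eq_mul_inv]

theorem differentiable_dslope {g : ℂ → ℂ} (hg : Differentiable ℂ g) (m : ℂ) :
    Differentiable ℂ (dslope g m) :=
  differentiableOn_univ.1 ((Complex.differentiableOn_dslope univ_mem).2 hg.differentiableOn)

theorem lineInt_sub {f g : ℂ → ℂ} {H : ℝ} (S : ℝ)
    (hf : ∀ z : ℂ, z.im = H → DifferentiableAt ℂ f z)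
    (hg : ∀ z : ℂ, z.im = H → DifferentiableAt ℂ g z) :
    lineInt (fun z => f z - g z) H S = lineInt f H S - lineInt g H S := by
  have h := lineInt_add S hf (fun z hz => (hg z hz).const_mul (-1))
  rw [lineInt_const_mul] at h
  rw [sub_eq_add_neg, ← neg_one_mul, ← h]
  exact lineInt_congr S fun z _ => by ring

/-- The limits of the integrals over `Im z = H` of an even entire function times `2z`. -/
theorem tendsto_lineInt_even {g : ℂ → ℂ} (hg : Differentiable ℂ g) {H s : ℝ} (hH : 0 ≤ H)
    (hs : s < -1) (hb : (fun z => g (z ^ 2)) =O[strip H] pw s 0) :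
    Tendsto (fun S => lineInt (fun z => g (z ^ 2) * (2 * z)) H S) atTop (𝓝 0) := by
  refine tendsto_lineInt_odd hH (by fun_prop) (fun z => by rw [neg_sq]; ring) ?_
  have h1 := isBigO_mul_pw (s'' := s + 1) (t'' := 0) (strip_le_uhp H) hb
    (isBigO_id_pw.const_mul_left 2) rfl (by ring)
  exact tendsto_zero_of_isBigO_pw (strip_le_uhp H) (by linarith) h1

/-- The integrand is `g(m)` times the Cauchy kernel minus `2z` times the divided difference at `z²`.
The latter is an odd entire function and integrates to zero in the limit; `s < 1` is what makes it
decay in the strip. -/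
theorem tendsto_lineInt_entire_cker {g : ℂ → ℂ} (hg : Differentiable ℂ g) {H s : ℝ} {m : ℂ}
    (hH : 0 < H) (hm : ‖m‖ < H ^ 2) (hs0 : 0 ≤ s) (hs : s < 1)
    (hb : (fun z => g (z ^ 2)) =O[strip H] pw s 0) :
    Tendsto (fun S => lineInt (fun z => g (z ^ 2) * cker m z) H S) atTop
      (𝓝 (2 * Real.pi * Complex.I * g m)) := by
  have h1 := tendsto_lineInt_even (differentiable_dslope hg m) hH.le (by linarith)
    (isBigO_dslope (strip_le_uhp H) m hs0 hb)
  have h2 := (tendsto_lineInt_cker hm hH).const_mul (g m)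
  have h3 := h2.sub h1
  rw [sub_zero, mul_comm] at h3
  have hne : ∀ z : ℂ, z.im = H → m - z ^ 2 ≠ 0 := fun z hz => sq_ne_of_im hm hH hz.ge
  have hd := differentiable_dslope hg m
  refine h3.congr fun S => ?_
  rw [← lineInt_const_mul, ← lineInt_sub S
    (fun z hz => (differentiableAt_cker (hne z hz)).const_mul _) (fun z _ => by fun_prop)]
  refine lineInt_congr S fun z hz => ?_
  have h4 := hne z hz
  have h5 : z ^ 2 ≠ m := fun h => h4 (by rw [h, sub_self])
  have h6 : z ^ 2 - m ≠ 0 := sub_ne_zero.2 h5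
  rw [dslope_eq_div h5, cker, ← neg_sub (z ^ 2) m]
  field_simp
  ring

theorem tendsto_lineInt_halfPlane_cker {X : ℂ → ℂ} {H : ℝ} {m L : ℂ}
    (hH : 0 < H) (hm : ‖m‖ < H ^ 2) (hX : ∀ z : ℂ, H ≤ z.im → DifferentiableAt ℂ X z)
    (hlim : Tendsto X (ext H) (𝓝 L)) :
    Tendsto (fun S => lineInt (fun z => X z * cker m z) H S) atTop
      (𝓝 (2 * Real.pi * Complex.I * L)) := by
  have h1 : Tendsto (fun z => z * (X z * cker m z)) (inftyIn {z | H ≤ z.im}) (𝓝 (L * (-2))) :=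
    (hlim.mul (tendsto_mul_cker m {z | H ≤ z.im})).congr fun z => by ring
  have h2 := tendsto_lineInt_halfPlane (f := fun z => X z * cker m z) hH (fun z hz => (hX z hz).mul
    (differentiableAt_cker (sq_ne_of_im hm hH hz))) h1
  convert h2 using 2
  ring

/-- A holomorphic integrand on the line `Im z = h` gives a principal value integral. -/
theorem hasPVIntegral_of_lineInt {F g : ℂ → ℂ} {h : ℝ} {L : ℂ}
    (hg : ∀ z : ℂ, z.im = h → F z * (2 * z) = g z)
    (hd : ∀ z : ℂ, z.im = h → DifferentiableAt ℂ g z)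
    (ht : Tendsto (fun S => lineInt g h S) atTop (𝓝 L)) : HasPVIntegral h F (-L) := by
  have him : ∀ s : ℝ, ((s : ℂ) + h * Complex.I).im = h := fun s => by simp
  have heq : (fun s : ℝ => F (s + h * Complex.I) * (2 * (s + h * Complex.I))) =
      fun s : ℝ => g (s + h * Complex.I) := funext fun s => hg _ (him s)
  unfold HasPVIntegral
  simp only
  rw [heq]
  refine ⟨fun S => (lineInt_integrable S hd).symm, ?_⟩
  refine ht.neg.congr fun S => ?_
  -- The contour runs from right to left in `θ`, opposite to `lineInt`, hence the minus sign of the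
  -- limit.
  rw [lineInt, intervalIntegral.integral_symm, neg_neg]

/-- Moving the line of integration. -/
theorem tendsto_lineInt_shift {f : ℂ → ℂ} {h H : ℝ} {L : ℂ} (hh : 0 < h) (hH : h ≤ H)
    (hf : ∀ z : ℂ, h ≤ z.im → DifferentiableAt ℂ f z) {s : ℝ} (hs : s < 0)
    (hb : f =O[inftyIn {z | h ≤ z.im ∧ z.im ≤ H}] pw s 0)
    (ht : Tendsto (fun S => lineInt f H S) atTop (𝓝 L)) :
    Tendsto (fun S => lineInt f h S) atTop (𝓝 L) := by
  have hl : inftyIn {z : ℂ | h ≤ z.im ∧ z.im ≤ H} ≤ uhp :=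
    inftyIn_mono fun z hz => hh.le.trans hz.1
  have h1 := (tendsto_lineInt_sub hH (fun z hz _ => hf z hz)
    (tendsto_zero_of_isBigO_pw hl hs hb)).add ht
  rw [zero_add] at h1
  exact h1.congr fun S => by ring

/-- The values and derivatives at a point of `φ` and of the solution `S` as functions of `λ`, and
the Weyl function. -/
structure PhiData where
  f0 : ℂ → ℂ
  f1 : ℂ → ℂ
  s0 : ℂ → ℂ
  s1 : ℂ → ℂ
  M : ℂ → ℂ

/-- The Weyl solution. -/
def PhiData.p0 (D : PhiData) (z : ℂ) : ℂ := D.s0 (z ^ 2) + D.M z * D.f0 (z ^ 2)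

/-- The derivative of the Weyl solution. -/
def PhiData.p1 (D : PhiData) (z : ℂ) : ℂ := D.s1 (z ^ 2) + D.M z * D.f1 (z ^ 2)

/-- What the contour argument needs about one problem at a fixed point: entire dependence on `λ`,
the Wronskian of `φ` and `S`, and power bounds in strips. -/
structure PhiData.Regular (D : PhiData) (h : ℝ) (η : ℂ) : Prop where
  df0 : Differentiable ℂ D.f0
  df1 : Differentiable ℂ D.f1
  ds0 : Differentiable ℂ D.s0
  ds1 : Differentiable ℂ D.s1
  wr : ∀ l, D.f1 l * D.s0 l - D.f0 l * D.s1 l = η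
  dM : ∀ z : ℂ, h ≤ z.im → DifferentiableAt ℂ D.M z
  bf0 : ∀ H, (fun z => D.f0 (z ^ 2)) =O[strip H] pw (-1) 0
  bf1 : ∀ H, (fun z => D.f1 (z ^ 2)) =O[strip H] pw 0 0
  bs0 : ∀ H, (fun z => D.s0 (z ^ 2)) =O[strip H] pw 0 0
  bs1 : ∀ H, (fun z => D.s1 (z ^ 2)) =O[strip H] pw 1 0

/-- The relations between the data of two problems. -/
structure PhiData.Paired (D E : PhiData) (h : ℝ) (η : ℂ) : Prop where
  regD : D.Regular h η
  regE : E.Regular h η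
  pos : 0 < h
  bM : (fun z => D.M z - E.M z) =O[ext h] pw 0 0
  mixed : ∃ H₀ : ℝ, ∀ H, H₀ ≤ H →
    Tendsto (fun z => E.f1 (z ^ 2) * D.p0 z - E.p1 z * D.f0 (z ^ 2)) (ext H) (𝓝 η) ∧
    Tendsto (fun z => E.f0 (z ^ 2) * D.p0 z - E.p0 z * D.f0 (z ^ 2)) (ext H) (𝓝 0) ∧
    (fun z => E.f1 (z ^ 2) * D.p1 z - E.p1 z * D.f1 (z ^ 2)) =O[ext H] pw 1 0 ∧
    (fun z => E.f0 (z ^ 2) * D.p1 z - E.p0 z * D.f1 (z ^ 2)) =O[ext H] pw 1 0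

variable {D E : PhiData} {h : ℝ} {η : ℂ}

/-- The Wronskian of the solution with the values `y0, y1` and of the function `φ`. -/
def PhiData.wf (E : PhiData) (y0 y1 l : ℂ) : ℂ := y0 * E.f1 l - y1 * E.f0 l

/-- The same with the solution `S`. -/
def PhiData.ws (E : PhiData) (y0 y1 l : ℂ) : ℂ := y0 * E.s1 l - y1 * E.s0 l

theorem PhiData.Regular.differentiable_w (hE : E.Regular h η) (y0 y1 : ℂ) :
    Differentiable ℂ (E.wf y0 y1) ∧ Differentiable ℂ (E.ws y0 y1) :=
  ⟨(hE.df1.const_mul y0).sub (hE.df0.const_mul y1),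
    (hE.ds1.const_mul y0).sub (hE.ds0.const_mul y1)⟩

theorem PhiData.Regular.isBigO_w (hE : E.Regular h η) (y0 y1 : ℂ) (H : ℝ) :
    (fun z => E.wf y0 y1 (z ^ 2)) =O[strip H] pw 0 0 ∧
    (fun z => E.ws y0 y1 (z ^ 2)) =O[strip H] pw 1 0 :=
  ⟨((hE.bf1 H).const_mul_left y0).sub (isBigO_pw_of_le (strip_le_uhp H) (by norm_num) le_rfl
      ((hE.bf0 H).const_mul_left y1)),
    ((hE.bs1 H).const_mul_left y0).sub (isBigO_pw_of_le (strip_le_uhp H) (by norm_num) le_rfl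
      ((hE.bs0 H).const_mul_left y1))⟩

/-- The entire part in the decomposition of the integrand. -/
def entirePart (D E : PhiData) (y0 y1 l : ℂ) : ℂ :=
  E.wf y0 y1 l * D.s0 l - E.ws y0 y1 l * D.f0 l

/-- The integrand without the Cauchy kernel. -/
def mainPart (D E : PhiData) (y0 y1 z : ℂ) : ℂ :=
  E.wf y0 y1 (z ^ 2) * (D.M z - E.M z) * D.f0 (z ^ 2)

theorem PhiData.Paired.differentiable_entirePart (hp : D.Paired E h η) (y0 y1 : ℂ) :
    Differentiable ℂ (entirePart D E y0 y1) :=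
  ((hp.regE.differentiable_w y0 y1).1.mul hp.regD.ds0).sub
    ((hp.regE.differentiable_w y0 y1).2.mul hp.regD.df0)

theorem PhiData.Paired.isBigO_entirePart (hp : D.Paired E h η) (y0 y1 : ℂ) (H : ℝ) :
    (fun z => entirePart D E y0 y1 (z ^ 2)) =O[strip H] pw 0 0 := by
  obtain ⟨a, b⟩ := hp.regE.isBigO_w y0 y1 H
  exact (isBigO_mul_pw (strip_le_uhp H) a (hp.regD.bs0 H) (by ring) (by ring)).sub
    (isBigO_mul_pw (strip_le_uhp H) b (hp.regD.bf0 H) (by ring) (by ring))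

theorem PhiData.Paired.differentiableAt_mainPart (hp : D.Paired E h η) (y0 y1 : ℂ) {z : ℂ}
    (hz : h ≤ z.im) : DifferentiableAt ℂ (mainPart D E y0 y1) z := by
  have h1 := (hp.regE.differentiable_w y0 y1).1
  have h2 := hp.regD.df0
  have h3 := hp.regD.dM z hz
  have h4 := hp.regE.dM z hz
  unfold mainPart
  fun_prop

/-- The core of the contour argument. The integrand differs by an entire function of `z²` from a
combination of mixed Wronskians that tends to `η y0`, and each part is integrated against the Cauchy
kernel by its own lemma. -/
theorem PhiData.Paired.tendsto_lineInt_high (hp : D.Paired E h η) (y0 y1 m : ℂ) :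
    ∃ H : ℝ, h ≤ H ∧ ‖m‖ < H ^ 2 ∧
      Tendsto (fun S => lineInt (fun z => mainPart D E y0 y1 z * cker m z) H S) atTop
        (𝓝 (2 * Real.pi * Complex.I * (η * y0 - entirePart D E y0 y1 m))) := by
  obtain ⟨H₀, hH₀⟩ := hp.mixed
  -- The line must lie above `h`, in the half-plane of the asymptotics, and above both square roots
  -- of `m`.
  set H := max (max H₀ h) (1 + ‖m‖) with hH
  have hhH : h ≤ H := (le_max_right _ _).trans (le_max_left _ _)
  have hpos : 0 < H := hp.pos.trans_le hhH
  have hm : ‖m‖ < H ^ 2 := by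
    have : 1 + ‖m‖ ≤ H := le_max_right _ _
    nlinarith [norm_nonneg m]
  refine ⟨H, hhH, hm, ?_⟩
  obtain ⟨m1, m2, -, -⟩ := hH₀ H ((le_max_left _ _).trans (le_max_left _ _))
  have hX := (m1.const_mul y0).sub (m2.const_mul y1)
  rw [mul_zero, sub_zero, mul_comm] at hX
  have hd := hp.differentiable_entirePart y0 y1
  -- Insert `Φ = S + Mφ` for both problems: the terms with `M` or `M̃` collect into the factor `M -
  -- M̃`, and the rest is entire in `z²`.
  have hXe : ∀ z, y0 * (E.f1 (z ^ 2) * D.p0 z - E.p1 z * D.f0 (z ^ 2)) -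
      y1 * (E.f0 (z ^ 2) * D.p0 z - E.p0 z * D.f0 (z ^ 2)) =
      mainPart D E y0 y1 z + entirePart D E y0 y1 (z ^ 2) := fun z => by
    unfold mainPart entirePart PhiData.p0 PhiData.p1 PhiData.wf PhiData.ws
    ring
  have t1 := tendsto_lineInt_halfPlane_cker hpos hm (X := fun z => mainPart D E y0 y1 z +
    entirePart D E y0 y1 (z ^ 2)) (fun z hz => (hp.differentiableAt_mainPart y0 y1
      (hhH.trans hz)).add (by fun_prop)) (hX.congr hXe)
  have t2 := tendsto_lineInt_entire_cker hd hpos hm le_rfl zero_lt_one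
    (hp.isBigO_entirePart y0 y1 H)
  have t3 := t1.sub t2
  rw [← mul_sub] at t3
  refine t3.congr fun S => ?_
  have hc : ∀ z : ℂ, z.im = H → DifferentiableAt ℂ (cker m) z := fun z hz =>
    differentiableAt_cker (sq_ne_of_im hm hpos hz.ge)
  rw [← lineInt_sub S]
  · exact lineInt_congr S fun z _ => by ring
  · intro z hz
    exact ((hp.differentiableAt_mainPart y0 y1 (hhH.trans hz.ge)).add (by fun_prop)).mul (hc z hz)
  · intro z hz
    exact DifferentiableAt.mul (by fun_prop) (hc z hz)

/-- The strip between the contour and a higher line. -/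
theorem midstrip_le (h H : ℝ) : inftyIn {z : ℂ | h ≤ z.im ∧ z.im ≤ H} ≤ ext h :=
  inftyIn_mono fun _ hz => hz.1

theorem midstrip_le_strip (hh : 0 < h) (H : ℝ) :
    inftyIn {z : ℂ | h ≤ z.im ∧ z.im ≤ H} ≤ strip H :=
  inftyIn_mono fun _ hz => ⟨hh.le.trans hz.1, hz.2⟩

theorem PhiData.Paired.isBigO_mainPart (hp : D.Paired E h η) (y0 y1 : ℂ) (H : ℝ) :
    mainPart D E y0 y1 =O[inftyIn {z : ℂ | h ≤ z.im ∧ z.im ≤ H}] pw (-1) 0 := by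
  have l1 := midstrip_le h H
  have l2 := midstrip_le_strip hp.pos H
  have hl := l2.trans (strip_le_uhp H)
  have a := isBigO_mul_pw (s'' := 0) (t'' := 0) hl ((hp.regE.isBigO_w y0 y1 H).1.mono l2)
    (hp.bM.mono l1) (by ring) (by ring)
  exact isBigO_mul_pw hl a ((hp.regD.bf0 H).mono l2) (by ring) (by ring)

/-- The main equation for `φ`. -/
theorem PhiData.Paired.tendsto_phi (hp : D.Paired E h η) (m : ℂ) :
    Tendsto (fun S => lineInt (fun z => -dslope (E.wf (E.f0 m) (E.f1 m)) m (z ^ 2) *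
      (D.M z - E.M z) * D.f0 (z ^ 2) * (2 * z)) h S) atTop
      (𝓝 (2 * Real.pi * Complex.I * (η * (E.f0 m - D.f0 m)))) := by
  set y0 := E.f0 m
  set y1 := E.f1 m
  obtain ⟨H, hhH, hm, ht⟩ := hp.tendsto_lineInt_high y0 y1 m
  have hE : entirePart D E y0 y1 m = η * D.f0 m := by
    rw [← hp.regE.wr m]
    simp only [entirePart, PhiData.wf, PhiData.ws, y0, y1]
    ring
  -- This zero cancels the pole of the Cauchy kernel, so the integrand is holomorphic above the
  -- contour wherever `m` lies, and the line can be lowered to `h` without a residue.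
  have hw0 : E.wf y0 y1 m = 0 := by
    simp only [PhiData.wf, y0, y1]
    ring
  rw [hE, ← mul_sub] at ht
  have hw := (hp.regE.differentiable_w y0 y1).1
  have hds := differentiable_dslope hw m
  have hpos := hp.pos
  have l2 := midstrip_le_strip hpos H
  have hl := l2.trans (strip_le_uhp H)
  refine tendsto_lineInt_shift hpos hhH (s := -2) (fun z hz => ?_) (by norm_num) ?_ ?_
  · have h2 := hp.regD.df0
    have h3 := hp.regD.dM z hz
    have h4 := hp.regE.dM z hz
    fun_prop
  · have b1 := (isBigO_dslope hl m le_rfl ((hp.regE.isBigO_w y0 y1 H).1.mono l2)).neg_left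
    have b2 := isBigO_mul_pw (s'' := -2) (t'' := 0) hl b1 (hp.bM.mono (midstrip_le h H))
      (by ring) (by ring)
    have b3 := isBigO_mul_pw (s'' := -3) (t'' := 0) hl b2 ((hp.regD.bf0 H).mono l2)
      (by ring) (by ring)
    exact isBigO_mul_pw hl b3 (isBigO_id_pw.const_mul_left 2) (by ring) (by ring)
  · refine ht.congr fun S => lineInt_congr S fun z hz => ?_
    have h4 := sq_ne_of_im hm (hpos.trans_le hhH) hz.ge
    have h5 : z ^ 2 ≠ m := fun h => h4 (by rw [h, sub_self])
    have h6 : z ^ 2 - m ≠ 0 := sub_ne_zero.2 h5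
    rw [dslope_eq_div h5, hw0, mainPart, cker, ← neg_sub (z ^ 2) m]
    field_simp
    ring

/-- The main equation for the Weyl solution. -/
theorem PhiData.Paired.tendsto_weyl (hp : D.Paired E h η) {r : ℂ} (hr : h < r.im) :
    Tendsto (fun S => lineInt (fun z => mainPart D E (E.p0 r) (E.p1 r) z * cker (r ^ 2) z) h S)
      atTop (𝓝 (2 * Real.pi * Complex.I * (η * (E.p0 r - D.p0 r)))) := by
  set y0 := E.p0 r
  set y1 := E.p1 r
  set N := mainPart D E y0 y1 with hN
  obtain ⟨H, hhH, hm, ht⟩ := hp.tendsto_lineInt_high y0 y1 (r ^ 2)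
  have hpos := hp.pos
  have hHpos := hpos.trans_le hhH
  -- With the data of `Φ̃` at `r`, the main and entire parts at `r` add up to `(φ̃'Φ̃ - φ̃Φ̃')Φ =
  -- ηΦ`.
  have hval : η * y0 - entirePart D E y0 y1 (r ^ 2) - N r = η * (y0 - D.p0 r) := by
    rw [← hp.regE.wr (r ^ 2)]
    simp only [hN, mainPart, entirePart, PhiData.wf, PhiData.ws, y0, y1, PhiData.p0, PhiData.p1]
    ring
  have hdN : ∀ z : ℂ, h ≤ z.im → DifferentiableAt ℂ N z := fun z hz =>
    hp.differentiableAt_mainPart y0 y1 hz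
  -- Now there is a genuine pole at `r` between the contour and the high line. `F` is the integrand
  -- minus `N r` times the Cauchy kernel, written so that it is visibly holomorphic at `r`.
  set F : ℂ → ℂ := fun z => -dslope N r z * (2 * z / (r + z)) with hF
  have hopen : IsOpen {z : ℂ | h < z.im} := isOpen_lt continuous_const Complex.continuous_im
  have hdd : ∀ z : ℂ, h ≤ z.im → DifferentiableAt ℂ (dslope N r) z := by
    intro z hz
    by_cases hzr : z = r
    · rw [hzr]
      exact ((Complex.differentiableOn_dslope (hopen.mem_nhds hr)).2 fun w hw =>
        (hdN w (le_of_lt hw)).differentiableWithinAt).differentiableAt (hopen.mem_nhds hr)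
    · exact (differentiableAt_dslope_of_ne hzr).2 (hdN z hz)
  have hplus : ∀ z : ℂ, h ≤ z.im → r + z ≠ 0 := by
    intro z hz h0
    have := congrArg Complex.im h0
    simp only [Complex.add_im, Complex.zero_im] at this
    linarith
  have hFd : ∀ z : ℂ, h ≤ z.im → DifferentiableAt ℂ F z := fun z hz =>
    (hdd z hz).neg.mul (DifferentiableAt.div (by fun_prop) (by fun_prop) (hplus z hz))
  have hFe : ∀ z : ℂ, h ≤ z.im → z ≠ r → F z = N z * cker (r ^ 2) z - N r * cker (r ^ 2) z := by
    intro z hz hzr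
    have h1 := hplus z hz
    have h2 : r - z ≠ 0 := sub_ne_zero.2 (Ne.symm hzr)
    have h4 : z - r ≠ 0 := sub_ne_zero.2 hzr
    have h3 : r ^ 2 - z ^ 2 ≠ 0 := by
      rw [sq_sub_sq]
      exact mul_ne_zero h1 h2
    have h5 : -(N z - N r) * 2 * z * (r ^ 2 - z ^ 2) =
        (N z - N r) * 2 * z * ((z - r) * (r + z)) := by ring
    simp only [hF]
    rw [dslope_eq_div hzr, cker, ← sub_mul, ← neg_div, div_mul_div_comm, ← mul_div_assoc,
      div_eq_div_iff (mul_ne_zero h4 h1) h3]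
    linear_combination h5
  -- on the high line
  have hrH : ∀ z : ℂ, z.im = H → z ≠ r := by
    intro z hz hzr
    exact sq_ne_of_im hm hHpos hz.ge (by rw [hzr, sub_self])
  have hcH : ∀ z : ℂ, z.im = H → DifferentiableAt ℂ (cker (r ^ 2)) z := fun z hz =>
    differentiableAt_cker (sq_ne_of_im hm hHpos hz.ge)
  have t1 := ht.sub ((tendsto_lineInt_cker hm hHpos).const_mul (N r))
  have t2 : Tendsto (fun S => lineInt F H S) atTop
      (𝓝 (2 * Real.pi * Complex.I * (η * (y0 - D.p0 r)))) := by
    rw [← hval]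
    rw [mul_comm (N r), ← mul_sub] at t1
    refine t1.congr fun S => ?_
    rw [← lineInt_const_mul, ← lineInt_sub (f := fun z => N z * cker (r ^ 2) z) _
      (fun z hz => (hdN z (hhH.trans hz.ge)).mul (hcH z hz)) (fun z hz => (hcH z hz).const_mul _)]
    exact (lineInt_congr _ fun z hz => hFe z (hhH.trans hz.ge) (hrH z hz)).symm
  have l2 := midstrip_le_strip hpos H
  have hl := l2.trans (strip_le_uhp H)
  have hne : ∀ᶠ z in inftyIn {z : ℂ | h ≤ z.im ∧ z.im ≤ H}, z ≠ r :=
    (eventually_sq_ne hl (r ^ 2)).mono fun z hz hzr => hz (by rw [hzr])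
  have t3 := tendsto_lineInt_shift hpos hhH hFd (s := -1) (by norm_num) (by
    have b1 := isBigO_mul_pw (s'' := -2) (t'' := 0) hl (hp.isBigO_mainPart y0 y1 H)
      (isBigO_cker hl (r ^ 2)) (by ring) (by ring)
    have b2 := (isBigO_cker hl (r ^ 2)).const_mul_left (N r)
    refine ((isBigO_pw_of_le hl (by norm_num) le_rfl b1).sub b2).congr' ?_ EventuallyEq.rfl
    filter_upwards [hne, mem_inftyIn {z : ℂ | h ≤ z.im ∧ z.im ≤ H}] with z hz hz2
    exact (hFe z hz2.1 hz).symm) t2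
  -- on the contour
  have hrh : ∀ z : ℂ, z.im = h → z ≠ r := fun z hz hzr => by
    rw [hzr] at hz
    linarith
  have hch : ∀ z : ℂ, z.im = h → DifferentiableAt ℂ (cker (r ^ 2)) z := fun z hz =>
    differentiableAt_cker (by
      rw [sq_sub_sq]
      exact mul_ne_zero (hplus z hz.ge) (sub_ne_zero.2 (hrh z hz).symm))
  -- On the contour the subtracted kernel integrates to zero because `r²` lies outside the parabola,
  -- whereas on the high line it contributed `2πi N r`.
  have t4 := t3.add ((tendsto_lineInt_cker_outside hpos.le hr).const_mul (N r))
  rw [mul_zero, add_zero] at t4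
  refine t4.congr fun S => ?_
  rw [← lineInt_const_mul, ← lineInt_add _ (fun z hz => hFd z hz.ge)
    (fun z hz => (hch z hz).const_mul _)]
  refine lineInt_congr _ fun z hz => ?_
  rw [hFe z hz.ge (hrh z hz)]
  ring

end

/-! ### The equation for the kernels, and the data of the boundary value problem at a point. -/

section

variable {D E : PhiData} {h : ℝ} {η : ℂ}

/-- The entire part in the decomposition of the integrand for the kernels. -/
def entirePart₂ (D E : PhiData) (y0 y1 z0 z1 l : ℂ) : ℂ :=
  E.wf y0 y1 l * D.ws z0 z1 l - E.ws y0 y1 l * D.wf z0 z1 l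

/-- At `m` the form `wf` of the tilde problem vanishes and its `ws` equals `-η`; the same holds for
the other problem at `n`. So at each end only one term of `entirePart₂` survives. The diagonal case
follows by differentiating the product. -/
theorem PhiData.Paired.dslope_entirePart₂ (hp : D.Paired E h η) (m n : ℂ) :
    dslope (entirePart₂ D E (E.f0 m) (E.f1 m) (D.f0 n) (D.f1 n)) m n =
      η * (dslope (D.wf (D.f0 n) (D.f1 n)) n m - dslope (E.wf (E.f0 m) (E.f1 m)) m n) := by
  have hw : E.wf (E.f0 m) (E.f1 m) m = 0 := by unfold PhiData.wf; ring
  have hw₂ : D.wf (D.f0 n) (D.f1 n) n = 0 := by unfold PhiData.wf; ring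
  have hs : E.ws (E.f0 m) (E.f1 m) m = -η := by
    rw [← hp.regE.wr m]
    unfold PhiData.ws
    ring
  have hs₂ : D.ws (D.f0 n) (D.f1 n) n = -η := by
    rw [← hp.regD.wr n]
    unfold PhiData.ws
    ring
  by_cases hmn : m = n
  · subst hmn
    obtain ⟨dw, ds⟩ := hp.regE.differentiable_w (E.f0 m) (E.f1 m)
    obtain ⟨dw₂, ds₂⟩ := hp.regD.differentiable_w (D.f0 m) (D.f1 m)
    have h1 := ((dw m).hasDerivAt.mul (ds₂ m).hasDerivAt).sub
      ((ds m).hasDerivAt.mul (dw₂ m).hasDerivAt)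
    have h2 : HasDerivAt (entirePart₂ D E (E.f0 m) (E.f1 m) (D.f0 m) (D.f1 m)) _ m := h1
    rw [dslope_same, dslope_same, dslope_same, h2.deriv, hw, hw₂, hs, hs₂]
    ring
  · have hnm : n - m ≠ 0 := sub_ne_zero.2 (Ne.symm hmn)
    have hmn' : m - n ≠ 0 := sub_ne_zero.2 hmn
    rw [dslope_eq_div hmn, dslope_eq_div (Ne.symm hmn), dslope_eq_div (Ne.symm hmn), hw, hw₂,
      entirePart₂, entirePart₂, hw, hw₂, hs, hs₂]
    field_simp
    ring

/-- The argument for `φ` with a Wronskian form on both sides. All four mixed Wronskians now enter,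
and their combination is only `O(|z|)`, but two denominators `z² - m` and `z² - n` are available.
The value comes from the divided difference of the entire part. -/
theorem PhiData.Paired.tendsto_kernel (hp : D.Paired E h η) (m n : ℂ) :
    Tendsto (fun S => lineInt (fun z => dslope (E.wf (E.f0 m) (E.f1 m)) m (z ^ 2) *
      (D.M z - E.M z) * dslope (D.wf (D.f0 n) (D.f1 n)) n (z ^ 2) * (2 * z)) h S) atTop
      (𝓝 (2 * Real.pi * Complex.I * (η * (dslope (D.wf (D.f0 n) (D.f1 n)) n m -
        dslope (E.wf (E.f0 m) (E.f1 m)) m n)))) := by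
  rw [← hp.dslope_entirePart₂ m n]
  have hw0 : E.wf (E.f0 m) (E.f1 m) m = 0 := by unfold PhiData.wf; ring
  have hw₂0 : D.wf (D.f0 n) (D.f1 n) n = 0 := by unfold PhiData.wf; ring
  generalize E.f0 m = y0 at *
  generalize E.f1 m = y1 at *
  generalize D.f0 n = z0 at *
  generalize D.f1 n = z1 at *
  set w := E.wf y0 y1 with hw
  set w₂ := D.wf z0 z1 with hw₂
  set e := entirePart₂ D E y0 y1 z0 z1 with he
  have hpos := hp.pos
  obtain ⟨H₀, hH₀⟩ := hp.mixed
  set H := max (max H₀ h) (1 + ‖m‖ + ‖n‖) with hH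
  have hhH : h ≤ H := (le_max_right _ _).trans (le_max_left _ _)
  have hHpos : 0 < H := hpos.trans_le hhH
  have hH1 : 1 + ‖m‖ + ‖n‖ ≤ H := le_max_right _ _
  have hm : ‖m‖ < H ^ 2 := by nlinarith [norm_nonneg m, norm_nonneg n]
  have hn : ‖n‖ < H ^ 2 := by nlinarith [norm_nonneg m, norm_nonneg n]
  obtain ⟨m1, m2, m3, m4⟩ := hH₀ H ((le_max_left _ _).trans (le_max_left _ _))
  obtain ⟨dw, ds⟩ := hp.regE.differentiable_w y0 y1
  obtain ⟨dw₂, ds₂⟩ := hp.regD.differentiable_w z0 z1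
  have de : Differentiable ℂ e := (dw.mul ds₂).sub (ds.mul dw₂)
  have hM : ∀ z : ℂ, h ≤ z.im → DifferentiableAt ℂ (fun z => D.M z - E.M z) z := fun z hz =>
    (hp.regD.dM z hz).sub (hp.regE.dM z hz)
  have le := ext_le_uhp hHpos
  have l2 := midstrip_le_strip hpos H
  have hl := l2.trans (strip_le_uhp H)
  have bw := fun H => hp.regE.isBigO_w y0 y1 H
  have bw₂ := fun H => hp.regD.isBigO_w z0 z1 H
  have ds1 := differentiable_dslope dw m
  have ds2 := differentiable_dslope dw₂ n
  refine tendsto_lineInt_shift hpos hhH (s := -3) (fun z hz => ?_) (by norm_num) ?_ ?_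
  · have := hM z hz
    fun_prop
  · have b1 := isBigO_dslope hl m le_rfl ((bw H).1.mono l2)
    have b2 := isBigO_dslope hl n le_rfl ((bw₂ H).1.mono l2)
    have b3 := isBigO_mul_pw (s'' := -2) (t'' := 0) hl b1 (hp.bM.mono (midstrip_le h H))
      (by ring) (by ring)
    have b4 := isBigO_mul_pw (s'' := -4) (t'' := 0) hl b3 b2 (by ring) (by ring)
    exact isBigO_mul_pw hl b4 (isBigO_id_pw.const_mul_left 2) (by ring) (by ring)
  · -- the part that is holomorphic in the half-plane
    set X : ℂ → ℂ := fun z => w (z ^ 2) * (D.M z - E.M z) * w₂ (z ^ 2) + e (z ^ 2) with hX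
    have bX : X =O[ext H] pw 1 0 := by
      have o : ∀ {f : ℂ → ℂ} {c : ℂ}, Tendsto f (ext H) (𝓝 c) → f =O[ext H] pw 1 0 := by
        intro f c hf
        refine isBigO_pw_of_le le zero_le_one le_rfl ?_
        rw [pw_zero_zero]
        exact hf.isBigO_one ℝ
      have := (((o m2).const_mul_left (y1 * z1)).sub ((o m1).const_mul_left (y0 * z1))).add
        ((m3.const_mul_left (y0 * z0)).sub (m4.const_mul_left (y1 * z0)))
      refine this.congr_left fun z => ?_
      simp only [hX, he, hw, hw₂, entirePart₂, PhiData.p0, PhiData.p1, PhiData.wf, PhiData.ws]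
      ring
    have hXd : ∀ z : ℂ, H ≤ z.im → DifferentiableAt ℂ X z := fun z hz => by
      have := hM z (hhH.trans hz)
      fun_prop
    have hnz : ∀ {k z : ℂ}, ‖k‖ < H ^ 2 → H ≤ z.im → z ^ 2 - k ≠ 0 := fun {k z} hk hz => by
      rw [← neg_sub]
      exact neg_ne_zero.2 (sq_ne_of_im hk hHpos hz)
    set k : ℂ → ℂ := fun z => 2 * z * (z ^ 2 - m)⁻¹ * (z ^ 2 - n)⁻¹ with hk
    have hkd : ∀ z : ℂ, H ≤ z.im → DifferentiableAt ℂ k z := fun z hz =>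
      ((by fun_prop : DifferentiableAt ℂ (fun z : ℂ => 2 * z) z).mul
        ((by fun_prop : DifferentiableAt ℂ (fun z : ℂ => z ^ 2 - m) z).inv (hnz hm hz))).mul
        ((by fun_prop : DifferentiableAt ℂ (fun z : ℂ => z ^ 2 - n) z).inv (hnz hn hz))
    have bk : k =O[ext H] pw (-3) 0 :=
      isBigO_mul_pw le (isBigO_mul_pw (s'' := -1) (t'' := 0) le (isBigO_id_pw.const_mul_left 2)
        (isBigO_inv_sq_sub le m) (by ring) (by ring)) (isBigO_inv_sq_sub le n) (by ring) (by ring)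
    have bY : (fun z => X z - e m) =O[ext H] pw 1 0 :=
      bX.sub (isBigO_pw_of_le le zero_le_one le_rfl (isBigO_const_pw (e m)))
    -- The integrand is `O(|z|^{-2})` in the upper half-plane and has no poles above the line. The
    -- constant `e m` is subtracted so that the complementary entire part becomes a divided
    -- difference at `m`.
    have t1 : Tendsto (fun S => lineInt (fun z => (X z - e m) * k z) H S) atTop (𝓝 0) := by
      refine tendsto_lineInt_halfPlane_zero hHpos
        (fun z hz => ((hXd z hz).sub_const _).mul (hkd z hz)) ?_
      have b1 := isBigO_mul_pw (s'' := -2) (t'' := 0) le bY bk (by ring) (by ring)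
      have b2 := isBigO_mul_pw (s'' := -1) (t'' := 0) le isBigO_id_pw b1 (by ring) (by ring)
      exact tendsto_zero_of_isBigO_pw le (by norm_num) b2
    have be : (fun z => e (z ^ 2)) =O[strip H] pw 1 0 :=
      (isBigO_mul_pw (strip_le_uhp H) (bw H).1 (bw₂ H).2 (by ring) (by ring)).sub
        (isBigO_mul_pw (strip_le_uhp H) (bw H).2 (bw₂ H).1 (by ring) (by ring))
    -- `(e(z²) - e(m))/(z² - m)` is again entire in `z²`, so only the Cauchy kernel at `n` remains
    -- and it evaluates this function at `n`.
    have dg := differentiable_dslope de m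
    have t2 := tendsto_lineInt_entire_cker dg hHpos hn le_rfl zero_lt_one
      (isBigO_pw_of_le (strip_le_uhp H) (by norm_num) le_rfl
        (isBigO_dslope (strip_le_uhp H) m zero_le_one be))
    have t3 := t1.add t2
    rw [zero_add] at t3
    refine t3.congr fun S => ?_
    rw [← lineInt_add (f := fun z => (X z - e m) * k z)
      (g := fun z => dslope e m (z ^ 2) * cker n z) S
      (fun z hz => ((hXd z hz.ge).sub_const _).mul (hkd z hz.ge))
      (fun z hz => DifferentiableAt.mul (by fun_prop)
        (differentiableAt_cker (sq_ne_of_im hn hHpos hz.ge)))]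
    refine lineInt_congr S fun z hz => ?_
    have n1 := hnz hm hz.ge
    have n2 := hnz hn hz.ge
    rw [dslope_eq_div (sub_ne_zero.1 n1), dslope_eq_div (sub_ne_zero.1 n1),
      dslope_eq_div (sub_ne_zero.1 n2), hw0, hw₂0, cker, ← neg_sub (z ^ 2) n]
    simp only [hX, hk]
    field_simp
    ring

/-! ### The data of the boundary value problem at a fixed point -/

variable {P : Params} {q Qp Qm q₂ Qp₂ Qm₂ : ℝ → ℂ}

/-- The functions of the spectral parameter at the point `x`. -/
def phiData (P : Params) (q Qp Qm : ℝ → ℂ) (x : ℝ) : PhiData :=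
  ⟨phv P Qp Qm x, phd P Qp Qm x, cov P Qp Qm x, cod P Qp Qm x, weylFun P q⟩

theorem charFun_ne_zero (hh : 0 < h)
    (hzero : ∀ ρ : ℂ, 0 ≤ ρ.im → ρ ≠ 0 → charFun P q ρ = 0 → ρ.im < h) {z : ℂ} (hz : h ≤ z.im) :
    charFun P q z ≠ 0 := fun h0 =>
  absurd (hzero z (hh.le.trans hz) (ne_zero_of_im_ge hh hz) h0) (not_lt.2 hz)

theorem Setting.regular (hS : Setting P q Qp Qm) (hh : 0 < h)
    (hzero : ∀ ρ : ℂ, 0 ≤ ρ.im → ρ ≠ 0 → charFun P q ρ = 0 → ρ.im < h) {x : ℝ} (hxa : x ≠ P.a) :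
    (phiData P q Qp Qm x).Regular h (eta P x) := by
  obtain ⟨d1, d2, d3, d4⟩ := hS.differentiable_values hxa
  obtain ⟨b1, b2, b3, b4⟩ := hS.isBigO_values hxa
  have ht : 0 ≤ P.a + |x - P.a| := add_nonneg hS.a_pos.le (abs_nonneg _)
  exact ⟨d1, d2, d3, d4, fun l => hS.phi_cos_wronskian hxa l,
    fun z hz => hS.differentiableAt_weylFun (hh.trans_le hz) (charFun_ne_zero hh hzero hz),
    isBigO_strip ht b1, isBigO_strip ht b2, isBigO_strip ht b3, isBigO_strip ht b4⟩

theorem Setting.weyl_eq_phiData (hS : Setting P q Qp Qm) {x : ℝ} (hx : 0 ≤ x) (hxa : x ≠ P.a)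
    {z : ℂ} (hz : charFun P q z ≠ 0) :
    weylSol P q z x = (phiData P q Qp Qm x).p0 z ∧
    dx (weylSol P q z) x = (phiData P q Qp Qm x).p1 z :=
  hS.weylSol_eq_add hx hxa hz

theorem Setting.paired (hS : Setting P q Qp Qm) (hS₂ : Setting P q₂ Qp₂ Qm₂) (hh : 0 < h)
    (hzero : ∀ ρ : ℂ, 0 ≤ ρ.im → ρ ≠ 0 → charFun P q ρ = 0 → ρ.im < h)
    (hzero₂ : ∀ ρ : ℂ, 0 ≤ ρ.im → ρ ≠ 0 → charFun P q₂ ρ = 0 → ρ.im < h)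
    (hM : weylDiff P q q₂ =O[Bornology.cobounded ℂ ⊓ 𝓟 {ρ : ℂ | h ≤ ρ.im}] fun _ => (1 : ℝ))
    (hxi : xi P 0 1 ≠ 0) {x : ℝ} (hx : 0 ≤ x) (hxa : x ≠ P.a) :
    (phiData P q Qp Qm x).Paired (phiData P q₂ Qp₂ Qm₂ x) h (eta P x) := by
  refine ⟨hS.regular hh hzero hxa, hS₂.regular hh hzero₂ hxa, hh, ?_, ?_⟩
  · rw [pw_zero_zero]
    exact hM
  · obtain ⟨H₀, -, hb⟩ := hS.exists_mixed_bounds hS₂ hxi hx hxa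
    refine ⟨max H₀ h, fun H hH => ?_⟩
    obtain ⟨b1, b2, b3, b4⟩ := hb H ((le_max_left _ _).trans hH)
    have hHh : h ≤ H := (le_max_right _ _).trans hH
    have e : ∀ᶠ z in ext H, wev P q Qp Qm x z = (phiData P q Qp Qm x).p0 z ∧
        wed P q Qp Qm x z = (phiData P q Qp Qm x).p1 z ∧
        wev P q₂ Qp₂ Qm₂ x z = (phiData P q₂ Qp₂ Qm₂ x).p0 z ∧
        wed P q₂ Qp₂ Qm₂ x z = (phiData P q₂ Qp₂ Qm₂ x).p1 z := by
      filter_upwards [mem_inftyIn {ρ : ℂ | H ≤ ρ.im}] with z hz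
      have hz' : h ≤ z.im := hHh.trans hz
      obtain ⟨a1, a2⟩ := hS.weyl_eq_phiData hx hxa (charFun_ne_zero hh hzero hz')
      obtain ⟨c1, c2⟩ := hS₂.weyl_eq_phiData hx hxa (charFun_ne_zero hh hzero₂ hz')
      rw [← a1, ← a2, ← c1, ← c2]
      exact ⟨(hS.weylSol_eq hx hxa z).1.symm, (hS.weylSol_eq hx hxa z).2.symm,
        (hS₂.weylSol_eq hx hxa z).1.symm, (hS₂.weylSol_eq hx hxa z).2.symm⟩
    refine ⟨b1.congr' ?_, b2.congr' ?_, b3.congr' ?_ EventuallyEq.rfl,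
      b4.congr' ?_ EventuallyEq.rfl⟩ <;>
    · filter_upwards [e] with z hz
      simp only [hz.1, hz.2.1, hz.2.2.1, hz.2.2.2]
      rfl

/-- The Wronskian vanishes on the diagonal, so the kernel is a divided difference, and its extension
by the limit is the diagonal value of `dslope`. No case distinction is needed afterwards. -/
theorem Setting.kernelD_eq (hS : Setting P q Qp Qm) {x : ℝ} (hx : 0 ≤ x) (hxa : x ≠ P.a)
    (m n : ℂ) : kernelD P q x m n = -((eta P x)⁻¹ * dslope ((phiData P q Qp Qm x).wf
      (phv P Qp Qm x n) (phd P Qp Qm x n)) n m) := by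
  have hw : ∀ l, wronskian (phi P q l) (phi P q n) x =
      -(phiData P q Qp Qm x).wf (phv P Qp Qm x n) (phd P Qp Qm x n) l := fun l => by
    rw [wronskian, (hS.phi_eq hx hxa l).1, (hS.phi_eq hx hxa l).2, (hS.phi_eq hx hxa n).1,
      (hS.phi_eq hx hxa n).2, PhiData.wf, phiData]
    ring
  rw [kernelD]
  split_ifs with hmn
  · rw [hmn, dslope_same, funext hw, deriv.fun_neg, mul_neg]
  · have h0 : (phiData P q Qp Qm x).wf (phv P Qp Qm x n) (phd P Qp Qm x n) n = 0 := by
      simp only [PhiData.wf, phiData]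
      ring
    rw [hw, dslope_eq_div hmn, h0, sub_zero]
    ring

/-- The divided difference may be taken in either variable, since the Wronskian and the denominator
both change sign. This form is used when the contour variable is the second argument. -/
theorem Setting.kernelD_eq' (hS : Setting P q Qp Qm) {x : ℝ} (hx : 0 ≤ x) (hxa : x ≠ P.a)
    (m n : ℂ) : kernelD P q x m n = -((eta P x)⁻¹ * dslope ((phiData P q Qp Qm x).wf
      (phv P Qp Qm x m) (phd P Qp Qm x m)) m n) := by
  rw [hS.kernelD_eq hx hxa]
  by_cases hmn : m = n
  · rw [hmn]
  · have hnm : n - m ≠ 0 := sub_ne_zero.2 (Ne.symm hmn)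
    have hmn' : m - n ≠ 0 := sub_ne_zero.2 hmn
    rw [dslope_eq_div hmn, dslope_eq_div (Ne.symm hmn)]
    simp only [PhiData.wf, phiData]
    field_simp
    ring

theorem eta_ne_zero (hdet : P.A.det ≠ 0) (x : ℝ) : eta P x ≠ 0 := by
  unfold eta
  split_ifs
  · exact one_ne_zero
  · exact hdet

end

end BesselSL

end

/-! ### The three equations from the contour integrals at a fixed point. -/

theorem theorem5 (P : Params) (q qt : ℝ → ℂ) (h : ℝ)
    (ha : 0 < P.a)
    (hnu : 0 < P.ν.re) (hnu_nat : ∀ n : ℕ, 1 ≤ n → P.ν ≠ n)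
    (hc : P.c 0 * P.c 1 = (2 * P.ν)⁻¹)
    (hdet : P.A.det ≠ 0) (hA : P.A 0 1 = 0)
    (hxi : 0 < ‖xi P 0 1‖) (hxi_diag : ∀ j : Fin 2, ‖xi P 0 1‖ < ‖xi P j j‖)
    (hq : ClassW P q) (hqt : ClassW P qt)
    (hh : 0 < h)
    (hzero : ∀ ρ : ℂ, 0 ≤ ρ.im → ρ ≠ 0 → charFun P q ρ = 0 → ρ.im < h)
    (hzero_t : ∀ ρ : ℂ, 0 ≤ ρ.im → ρ ≠ 0 → charFun P qt ρ = 0 → ρ.im < h)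
    (hM : weylDiff P q qt =O[Bornology.cobounded ℂ ⊓ 𝓟 {ρ : ℂ | h ≤ ρ.im}] fun _ => (1 : ℝ)) :
    ∀ x : ℝ, 0 ≤ x → x ≠ P.a →
      (∀ lam : ℂ, ∃ J : ℂ,
        HasPVIntegral h (fun θ => kernelRt P q qt x lam θ * phi P q (θ ^ 2) x) J ∧
        phi P qt lam x = phi P q lam x - 1 / (2 * Real.pi * Complex.I) * J) ∧
      (∀ lam θ : ℂ, 0 ≤ θ.im → θ ≠ 0 → charFun P q θ ≠ 0 → charFun P qt θ ≠ 0 → ∃ J : ℂ,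
        HasPVIntegral h (fun ζ => kernelRt P q qt x lam ζ * kernelR P q qt x (ζ ^ 2) θ) J ∧
        kernelR P q qt x lam θ - kernelRt P q qt x lam θ
          - 1 / (2 * Real.pi * Complex.I) * J = 0) ∧
      (∀ ρ : ℂ, h < ρ.im → ∃ J : ℂ,
        HasPVIntegral h
          (fun θ => wronskian (weylSol P qt ρ) (phi P qt (θ ^ 2)) x / (ρ ^ 2 - θ ^ 2)
            * weylDiff P q qt θ * phi P q (θ ^ 2) x) J ∧
        weylSol P qt ρ x = weylSol P q ρ x
          - 1 / (2 * Real.pi * Complex.I) * (1 / eta P x) * J) := by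
  intro x hx hxa
  have hP : Admissible P := ⟨hnu, hnu_nat, hc⟩
  obtain ⟨Qp, Qm, hsp⟩ := hq.exists_splitPot ha
  obtain ⟨Rp, Rm, hsp_t⟩ := hqt.exists_splitPot ha
  have hS : Setting P q Qp Qm := ⟨hP, ha, hsp, hA, hdet⟩
  have hT : Setting P qt Rp Rm := ⟨hP, ha, hsp_t, hA, hdet⟩
  have hxi0 : xi P 0 1 ≠ 0 := norm_pos_iff.1 hxi
  have hp := hS.paired hT hh hzero hzero_t hM hxi0 hx hxa
  set D := phiData P q Qp Qm x with hD
  set E := phiData P qt Rp Rm x with hE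
  have hη : eta P x ≠ 0 := eta_ne_zero hdet x
  have hpi : (2 * Real.pi * Complex.I : ℂ) ≠ 0 := by
    simp [Real.pi_ne_zero, Complex.I_ne_zero]
  have hphi : ∀ l, phi P q l x = D.f0 l := fun l => (hS.phi_eq hx hxa l).1
  have hphi_t : ∀ l, phi P qt l x = E.f0 l := fun l => (hT.phi_eq hx hxa l).1
  have hMd : ∀ z, weylDiff P q qt z = D.M z - E.M z := fun z => rfl
  have hdiff : ∀ z : ℂ, z.im = h → DifferentiableAt ℂ (fun z => D.M z - E.M z) z := fun z hz =>
    (hp.regD.dM z hz.ge).sub (hp.regE.dM z hz.ge)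
  have hw := fun m => (hp.regE.differentiable_w (E.f0 m) (E.f1 m)).1
  have hw₂ := fun n => (hp.regD.differentiable_w (D.f0 n) (D.f1 n)).1
  refine ⟨fun m => ?_, fun m θ _ _ _ _ => ?_, fun r hr => ?_⟩
  · have ht := (hp.tendsto_phi m).const_mul (eta P x)⁻¹
    refine ⟨_, hasPVIntegral_of_lineInt (g := fun z => (eta P x)⁻¹ *
      (-dslope (E.wf (E.f0 m) (E.f1 m)) m (z ^ 2) * (D.M z - E.M z) * D.f0 (z ^ 2) * (2 * z)))
      (fun z _ => ?_) (fun z hz => ?_) (ht.congr fun S => (lineInt_const_mul _ _ _ _).symm), ?_⟩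
    · rw [kernelRt, hT.kernelD_eq' hx hxa, hphi, hMd]
      change -((eta P x)⁻¹ * dslope (E.wf (E.f0 m) (E.f1 m)) m (z ^ 2)) * _ * _ * _ = _
      ring
    · have h1 := hdiff z hz
      have h2 := differentiable_dslope (hw m) m
      have h3 := hp.regD.df0
      fun_prop
    · rw [hphi, hphi_t]
      field_simp
      ring
  · set n := θ ^ 2 with hn
    -- The value of `M - M̃` at `θ` is a constant factor in all three terms, so no regularity of the
    -- Weyl functions at `θ` is involved, even for real `θ`.
    have ht := (hp.tendsto_kernel m n).const_mul ((eta P x)⁻¹ ^ 2 * weylDiff P q qt θ)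
    refine ⟨_, hasPVIntegral_of_lineInt (g := fun z => (eta P x)⁻¹ ^ 2 * weylDiff P q qt θ *
      (dslope (E.wf (E.f0 m) (E.f1 m)) m (z ^ 2) * (D.M z - E.M z) *
        dslope (D.wf (D.f0 n) (D.f1 n)) n (z ^ 2) * (2 * z)))
      (fun z _ => ?_) (fun z hz => ?_) (ht.congr fun S => (lineInt_const_mul _ _ _ _).symm), ?_⟩
    · rw [kernelRt, kernelR, ← hn, hT.kernelD_eq' hx hxa, hS.kernelD_eq hx hxa, hMd z]
      change -((eta P x)⁻¹ * dslope (E.wf (E.f0 m) (E.f1 m)) m (z ^ 2)) * _ *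
        (-((eta P x)⁻¹ * dslope (D.wf (D.f0 n) (D.f1 n)) n (z ^ 2)) * _) * _ = _
      ring
    · have h1 := hdiff z hz
      have h2 := differentiable_dslope (hw m) m
      have h3 := differentiable_dslope (hw₂ n) n
      fun_prop
    · rw [kernelRt, kernelR, ← hn, hT.kernelD_eq' hx hxa, hS.kernelD_eq hx hxa]
      change -((eta P x)⁻¹ * dslope (D.wf (D.f0 n) (D.f1 n)) n m) * _ -
        -((eta P x)⁻¹ * dslope (E.wf (E.f0 m) (E.f1 m)) m n) * _ - _ = 0
      field_simp
      ring
  · have hr0 : h ≤ r.im := hr.le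
    obtain ⟨w0, -⟩ := hS.weyl_eq_phiData hx hxa (charFun_ne_zero hh hzero hr0)
    obtain ⟨v0, v1⟩ := hT.weyl_eq_phiData hx hxa (charFun_ne_zero hh hzero_t hr0)
    have hne : ∀ z : ℂ, z.im = h → r ^ 2 - z ^ 2 ≠ 0 := by
      intro z hz h0
      rw [sq_sub_sq, mul_eq_zero] at h0
      rcases h0 with h0 | h0
      · have := congrArg Complex.im h0
        simp only [Complex.add_im, Complex.zero_im] at this
        linarith
      · have := congrArg Complex.im h0
        simp only [Complex.sub_im, Complex.zero_im] at this
        linarith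
    refine ⟨_, hasPVIntegral_of_lineInt (fun z hz => ?_) (fun z hz =>
      (hp.differentiableAt_mainPart _ _ hz.ge).mul (differentiableAt_cker (hne z hz)))
      (hp.tendsto_weyl hr), ?_⟩
    · have := hne z hz
      rw [wronskian, v0, v1, (hT.phi_eq hx hxa _).1, (hT.phi_eq hx hxa _).2, hphi, hMd]
      change (E.p0 r * E.f1 (z ^ 2) - E.p1 r * E.f0 (z ^ 2)) / _ * _ * _ * _ =
        (E.p0 r * E.f1 (z ^ 2) - E.p1 r * E.f0 (z ^ 2)) * _ * _ * (2 * z / (r ^ 2 - z ^ 2))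
      ring
    · rw [w0, v0]
      change E.p0 r = D.p0 r - _
      field_simp
      ring
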